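/- Let $k$ be an algebraically closed field of characteristic $0$. Let $m,d$ be positive integers and let $\underline m=(m_1,\dots,m_\theta)$ be positive integers; for each $i$ let $e_i$ be the least positive integer with $m\mid e_im_i$. Assume that $\underline m$ is a fraction of $m$, that is: (i) $\gcd(e_i,m_i)=1$ for all $i$; (ii) $m\mid m_im_j$ for all $i\ne j$; (iii) $m=e_1\cdots e_\theta$; (iv) if $0\le a_i,b_i<e_i$ for all $i$ and $\sum_i a_im_i\equiv\sum_i b_im_i \pmod m$, then $a_i=b_i$ for all $i$. Hence every $j\in\mathbb Z/m$ has unique coordinates $(j_1,\dots,j_\theta)$ with $0\le j_i<e_i$ and $j\equiv\sum_i j_im_i\pmod m$. Put $N=\sum_{i}(e_i-1)m_i$ and assume moreover $$2\mid \sum_{i}(m_i-1)(e_i-1),\qquad 2\mid Nd .$$ Let $\gamma\in k$ be a primitive $m$-th root of unity and, for each $i$, let $\xi_{m_i}\in k$ be a primitive $2e_i$-th root of unity with $\xi_{m_i}^2=\gamma^{m_i}$. For $j\in\mathbb Z/m$ let $$\phi_{m_i,j}=1-\gamma^{-m_i^2(1+j_i)}x^{m_id},$$ a polynomial in $x$ that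 depends on $j$ only through $j_i$; for $0\le a<e_i$ the element $am_i$ has $i$-th coordinate $a$. For integers $s,t$ with residues $\bar s,\bar t\in\{0,\dots,e_i-1\}$ modulo $e_i$ let $]s,t[_{m_i}$ be $$\prod_{a=\bar t+1}^{e_i-1}\phi_{m_i,am_i}\prod_{a=0}^{\bar s-1}\phi_{m_i,am_i}\ \text{ if }\bar t\ge\bar s,\qquad \prod_{a=\bar t+1}^{\bar s-1}\phi_{m_i,am_i}\ \text{ if }\bar s>\bar t$$ (empty products are $1$). Let $D=D(\underline m,d,\gamma)$ be the $k$-algebra generated by $x^{\pm1},g^{\pm1},y_{m_1},\dots,y_{m_\theta},u_0,\dots,u_{m-1}$ (indices of the $u_j$ are read modulo $m$) with the relations, for all $i,l$ and all $j,r\in\mathbb Z/m$, $$xx^{-1}=x^{-1}x=1,\quad gg^{-1}=g^{-1}g=1,\quad xg=gx,\quad xy_{m_i}=y_{m_i}x,\quad y_{m_i}y_{m_l}=y_{m_l}y_{m_i},$$ $$y_{m_i}g=\gamma^{m_i}gy_{m_i},\quad y_{m_i}^{e_i}=1-x^{e_im_id},\quad g^m=x^{md},\quad xu_j=u_jx^{-1},$$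 $$y_{m_i}u_j=\phi_{m_i,j}u_{j+m_i}=\xi_{m_i}x^{m_id}u_jy_{m_i},\quad u_jg=\gamma^jx^{-2d}gu_j,$$ $$u_ju_r=\frac1m\,x^{-\frac{2+N}2d}\prod_{i=1}^\theta(-1)^{r_i}\xi_{m_i}^{-r_i}\gamma^{m_i^2\frac{r_i(r_i+1)}2}\;]{-1-r_i},\,j_i-1[_{m_i}\; y_{j+r}\,g,\qquad y_j:=y_{m_1}^{j_1}\cdots y_{m_\theta}^{j_\theta}.$$ Then $D$ is a Hopf algebra, with bijective antipode, whose comultiplication, counit and antipode are given by $$\Delta(x)=x\otimes x,\quad \Delta(g)=g\otimes g,\quad \Delta(y_{m_i})=y_{m_i}\otimes g^{m_i}+1\otimes y_{m_i},\quad \Delta(u_j)=\sum_{l=0}^{m-1}\gamma^{l(j-l)}u_l\otimes x^{-ld}g^lu_{j-l},$$ $$\epsilon(x)=\epsilon(g)=\epsilon(u_0)=1,\quad \epsilon(y_{m_i})=0,\quad \epsilon(u_j)=0\ (j\neq0),$$ $$S(x)=x^{-1},\quad S(g)=g^{-1},\quad S(y_{m_i})=-y_{m_i}g^{-m_i},$$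 $$S(u_j)=\prod_{i}(-1)^{j_i}\xi_{m_i}^{-j_i}\gamma^{-m_i^2\frac{j_i(j_i+1)}2}\;x^{b+\sum_i j_im_id}\,g^{m-1-\sum_ij_im_i}\,u_j,\qquad b=(1-m)d-\tfrac{N}{2}d,$$ and this Hopf algebra has the following properties. (1) $D$ is a prime ring, and its PI-degree, i.e. the least $n$ such that $D$ embeds as a ring into $M_n(C)$ for some commutative ring $C$, is $2m$. (2) $D$ has a $1$-dimensional representation $\pi:D\to k$ of order $2m$, i.e. the left winding automorphism $a\mapsto\sum\pi(a_1)a_2$ generates a group of order $2m$. (3) If $m>1$, then $D$ is not pointed (some simple subcoalgebra is not one-dimensional), and its coradical (the sum of all simple subcoalgebras) is not a Hopf subalgebra. (4) $D$ is pivotal: the category of its finite-dimensional representations is a pivotal tensor category, i.e. every object has left and right duals, and there is an isomorphism of tensor functors from the identity functor to the double dual functor $V\mapsto V^{**}$. -/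

import Mathlib

open scoped TensorProduct

universe u

/-! ### Fractions of a natural number -/

/-- The exponent of `a` with respect to `m`: the least positive `n` with `m ∣ n * a`. -/
noncomputable def fracExponent (m a : ℕ) : ℕ := sInf {n : ℕ | 0 < n ∧ m ∣ n * a}

/-- The positive integers `M 0, …, M (θ - 1)` form a fraction of `m` (of length `θ`). -/
structure IsFraction (m : ℕ) {θ : ℕ} (M : Fin θ → ℕ) : Prop where
  pos : ∀ i, 0 < M i
  coprime : ∀ i, Nat.Coprime (fracExponent m (M i)) (M i)
  dvd_mul : ∀ i j, i ≠ j → m ∣ M i * M j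
  prod_eq : m = ∏ i, fracExponent m (M i)
  unique : ∀ a b : Fin θ → ℕ, (∀ i, a i < fracExponent m (M i)) →
    (∀ i, b i < fracExponent m (M i)) →
    (∑ i, a i * M i) ≡ (∑ i, b i * M i) [MOD m] → a = b

open Classical in
/-- The coordinates `(j_i)` of a residue `j` modulo `m` with respect to `M`: the tuple with
`0 ≤ j_i < e_i` and `j ≡ ∑ i, j_i * M i` modulo `m`.  (It is the zero tuple if there is no such
tuple; for a fraction of `m` the tuple exists and is unique, see `IsFraction.coord_spec`.) -/
noncomputable def fracCoord (m : ℕ) {θ : ℕ} (M : Fin θ → ℕ) (j : ZMod m) : Fin θ → ℕ :=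
  if h : ∃ a : Fin θ → ℕ, (∀ i, a i < fracExponent m (M i)) ∧
      ((∑ i, a i * M i : ℕ) : ZMod m) = j
  then h.choose else 0

theorem IsFraction.coord_spec {m θ : ℕ} {M : Fin θ → ℕ} (hm : 0 < m) (h : IsFraction m M)
    (j : ZMod m) : (∀ i, fracCoord m M j i < fracExponent m (M i)) ∧
      ((∑ i, fracCoord m M j i * M i : ℕ) : ZMod m) = j := by
  have : NeZero m := ⟨hm.ne'⟩
  let f : (∀ i, Fin (fracExponent m (M i))) → ZMod m :=
    fun a => ((∑ i, (a i : ℕ) * M i : ℕ) : ZMod m)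
  have hf : Function.Injective f := by
    intro a b hab
    have := h.unique (fun i => (a i : ℕ)) (fun i => (b i : ℕ)) (fun i => (a i).2)
      (fun i => (b i).2) ((ZMod.natCast_eq_natCast_iff _ _ _).1 hab)
    funext i
    exact Fin.ext (congrFun this i)
  have hb : Function.Bijective f := by
    rw [Fintype.bijective_iff_injective_and_card]
    refine ⟨hf, ?_⟩
    rw [Fintype.card_pi, ZMod.card]
    simp only [Fintype.card_fin]
    exact h.prod_eq.symm
  obtain ⟨a, ha⟩ := hb.2 j
  have hex : ∃ a : Fin θ → ℕ, (∀ i, a i < fracExponent m (M i)) ∧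
      ((∑ i, a i * M i : ℕ) : ZMod m) = j := ⟨fun i => (a i : ℕ), fun i => (a i).2, ha⟩
  unfold fracCoord
  rw [dif_pos hex]
  exact hex.choose_spec

/-! ### The algebra `D(m̲, d, γ)` -/

/-- The data `m`, `d`, `m̲ = (m_1, …, m_θ)`, `γ`, `(ξ_{m_1}, …, ξ_{m_θ})`. -/
structure DData (k : Type u) where
  m : ℕ
  d : ℕ
  θ : ℕ
  M : Fin θ → ℕ
  γ : k
  ξ : Fin θ → k

/-- The symbols for the generators `x^{±1}, g^{±1}, y_{m_i}, u_j`; the index `j` of `u_j` is read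
modulo `m`. -/
inductive DGen (m θ : ℕ) : Type
  | x
  | xinv
  | g
  | ginv
  | y (i : Fin θ)
  | u (j : ZMod m)

namespace DData

noncomputable section

variable {k : Type u} [Field k] (P : DData k)

/-- The exponent `e_i` of `m_i` with respect to `m`. -/
def e (i : Fin P.θ) : ℕ := fracExponent P.m (P.M i)

/-- The coordinates of `j` with respect to `m_1, …, m_θ`. -/
def coord (j : ZMod P.m) : Fin P.θ → ℕ := fracCoord P.m P.M j

/-- `N = ∑ i, (e_i - 1) m_i`. -/
def N : ℕ := ∑ i, (P.e i - 1) * P.M i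

/-- `γ_i = γ^{-m_i^2}`. -/
def γi (i : Fin P.θ) : k := P.γ ^ (-((P.M i : ℤ) ^ 2))

/-- The polynomial `φ_{m_i, j} = 1 - γ_i^{1 + a} X^{m_i d}`, where `a = j_i` is the `i`-th
coordinate of `j`. -/
def phi (i : Fin P.θ) (a : ℕ) : Polynomial k :=
  1 - Polynomial.C (P.γi i ^ (1 + a)) * Polynomial.X ^ (P.M i * P.d)

/-- The polynomial `]s, t[_{m_i}`: with `s', t'` the residues of `s, t` modulo `e_i`, the product
`φ_{m_i, 0} φ_{m_i, m_i} ⋯ φ_{m_i, (e_i - 1) m_i}` with the factors cyclically from the one of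
index `s'` to the one of index `t'` omitted; it is `1` if `s' = t' + 1`. -/
def omitted (i : Fin P.θ) (s t : ℤ) : Polynomial k :=
  let s' : ℕ := (s % (P.e i : ℤ)).toNat
  let t' : ℕ := (t % (P.e i : ℤ)).toNat
  if s' ≤ t' then
    (∏ a ∈ Finset.Ico (t' + 1) (P.e i), P.phi i a) * ∏ a ∈ Finset.range s', P.phi i a
  else ∏ a ∈ Finset.Ico (t' + 1) s', P.phi i a

/-- The free algebra on the generators. -/
abbrev Free : Type u := FreeAlgebra k (DGen P.m P.θ)

/-- The words `x^n`, `n ∈ ℤ`. -/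
def fx : ℤ → P.Free
  | Int.ofNat n => FreeAlgebra.ι k DGen.x ^ n
  | Int.negSucc n => FreeAlgebra.ι k DGen.xinv ^ (n + 1)

/-- The words `g^n`, `n ∈ ℤ`. -/
def fg : ℤ → P.Free
  | Int.ofNat n => FreeAlgebra.ι k DGen.g ^ n
  | Int.negSucc n => FreeAlgebra.ι k DGen.ginv ^ (n + 1)

def fy (i : Fin P.θ) : P.Free := FreeAlgebra.ι k (DGen.y i)

def fu (j : ZMod P.m) : P.Free := FreeAlgebra.ι k (DGen.u j)

/-- `y_j = y_{m_1}^{j_1} ⋯ y_{m_θ}^{j_θ}`. -/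
def fyMon (j : ZMod P.m) : P.Free := (List.ofFn fun i => P.fy i ^ P.coord j i).prod

/-- A polynomial in `x`. -/
def fpoly (p : Polynomial k) : P.Free := Polynomial.aeval (P.fx 1) p

/-- The scalar
`(1/m) ∏ i, (-1)^{l_i} ξ_{m_i}^{-l_i} γ^{m_i^2 l_i (l_i + 1) / 2}` in the product `u_j u_l`. -/
def uuScalar (l : ZMod P.m) : k :=
  (P.m : k)⁻¹ * ∏ i, ((-1) ^ P.coord l i * (P.ξ i)⁻¹ ^ P.coord l i *
    P.γ ^ (P.M i ^ 2 * (P.coord l i * (P.coord l i + 1) / 2)))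

/-- The polynomial `∏ i, ]-1 - l_i, j_i - 1[_{m_i}` in the product `u_j u_l`. -/
def uuPoly (j l : ZMod P.m) : Polynomial k :=
  ∏ i, P.omitted i (-1 - (P.coord l i : ℤ)) ((P.coord j i : ℤ) - 1)

/-- The exponent `-((2 + ∑ i, (e_i - 1) m_i) / 2) d` of `x` in the product `u_j u_l` (an integer
if `2 ∣ ∑ i, (e_i - 1) m_i d`). -/
def uuExp : ℤ := -(((2 + P.N) * P.d / 2 : ℕ) : ℤ)

/-- The defining relations of `D(m̲, d, γ)`. -/
inductive Rel : P.Free → P.Free → Prop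
  | x_xinv : Rel (P.fx 1 * P.fx (-1)) 1
  | xinv_x : Rel (P.fx (-1) * P.fx 1) 1
  | g_ginv : Rel (P.fg 1 * P.fg (-1)) 1
  | ginv_g : Rel (P.fg (-1) * P.fg 1) 1
  | x_g : Rel (P.fx 1 * P.fg 1) (P.fg 1 * P.fx 1)
  | x_y (i) : Rel (P.fx 1 * P.fy i) (P.fy i * P.fx 1)
  | y_y (i l) : Rel (P.fy i * P.fy l) (P.fy l * P.fy i)
  | y_g (i) : Rel (P.fy i * P.fg 1) (P.γ ^ P.M i • (P.fg 1 * P.fy i))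
  | y_pow (i) : Rel (P.fy i ^ P.e i) (1 - P.fx ((P.e i * P.M i * P.d : ℕ) : ℤ))
  | g_pow : Rel (P.fg (P.m : ℤ)) (P.fx ((P.m * P.d : ℕ) : ℤ))
  | x_u (j) : Rel (P.fx 1 * P.fu j) (P.fu j * P.fx (-1))
  | y_u (i j) : Rel (P.fy i * P.fu j)
      (P.fpoly (P.phi i (P.coord j i)) * P.fu (j + (P.M i : ZMod P.m)))
  | y_u' (i j) : Rel (P.fy i * P.fu j)
      (P.ξ i • (P.fx ((P.M i * P.d : ℕ) : ℤ) * P.fu j * P.fy i))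
  | u_g (j) : Rel (P.fu j * P.fg 1)
      (P.γ ^ j.val • (P.fx (-((2 * P.d : ℕ) : ℤ)) * P.fg 1 * P.fu j))
  | u_u (j l) : Rel (P.fu j * P.fu l)
      (P.uuScalar l • (P.fx P.uuExp * P.fpoly (P.uuPoly j l) * P.fyMon (j + l) * P.fg 1))

/-- The algebra `D(m̲, d, γ)`. -/
abbrev D : Type u := RingQuot P.Rel

/-- The canonical projection from the free algebra. -/
def proj : P.Free →ₐ[k] P.D := RingQuot.mkAlgHom k P.Rel

/-- `x^n` in `D`, for `n ∈ ℤ`. -/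
def x (n : ℤ) : P.D := P.proj (P.fx n)

/-- `g^n` in `D`, for `n ∈ ℤ`. -/
def g (n : ℤ) : P.D := P.proj (P.fg n)

/-- `y_{m_i}` in `D`. -/
def y (i : Fin P.θ) : P.D := P.proj (P.fy i)

/-- `u_j` in `D`. -/
def u (j : ZMod P.m) : P.D := P.proj (P.fu j)

end

end DData

/-! ### Hopf algebra structures on a given algebra -/

/-- A Hopf algebra structure (with bijective antipode) on a `k`-algebra `A`. -/
structure HopfStructure (k A : Type u) [Field k] [Ring A] [Algebra k A] where
  comul : A →ₐ[k] A ⊗[k] A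
  counit : A →ₐ[k] k
  antipode : A →ₗ[k] A
  coassoc : (Algebra.TensorProduct.assoc k k k A A A).toAlgHom.comp
      ((Algebra.TensorProduct.map comul (.id k A)).comp comul)
      = (Algebra.TensorProduct.map (.id k A) comul).comp comul
  rTensor_counit : (Algebra.TensorProduct.map counit (.id k A)).comp comul
      = (Algebra.TensorProduct.lid k A).symm
  lTensor_counit : (Algebra.TensorProduct.map (.id k A) counit).comp comul
      = (Algebra.TensorProduct.rid k k A).symm
  mul_antipode_rTensor : LinearMap.mul' k A ∘ₗ antipode.rTensor A ∘ₗ comul.toLinearMap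
      = Algebra.linearMap k A ∘ₗ counit.toLinearMap
  mul_antipode_lTensor : LinearMap.mul' k A ∘ₗ antipode.lTensor A ∘ₗ comul.toLinearMap
      = Algebra.linearMap k A ∘ₗ counit.toLinearMap
  antipode_bijective : Function.Bijective antipode

/-- The associated Mathlib Hopf algebra; the underlying algebra is the given one. -/
@[reducible]
noncomputable def HopfStructure.toHopfAlgebra {k A : Type u} [Field k] [Ring A] [Algebra k A]
    (s : HopfStructure k A) : HopfAlgebra k A :=
  { Bialgebra.ofAlgHom s.comul s.counit s.coassoc s.rTensor_counit s.lTensor_counit with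
    antipode := s.antipode
    mul_antipode_rTensor_comul := s.mul_antipode_rTensor
    mul_antipode_lTensor_comul := s.mul_antipode_lTensor }

namespace DData

variable {k : Type u} [Field k] (P : DData k)

/-- The Hopf algebra structure `s` on `D(m̲, d, γ)` is the one given on the generators by the
standard formulas. -/
structure IsStandard (s : HopfStructure k P.D) : Prop where
  comul_x : s.comul (P.x 1) = P.x 1 ⊗ₜ P.x 1
  comul_g : s.comul (P.g 1) = P.g 1 ⊗ₜ P.g 1
  comul_y : ∀ i, s.comul (P.y i) = P.y i ⊗ₜ P.g (P.M i : ℤ) + 1 ⊗ₜ P.y i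
  comul_u : ∀ j : ZMod P.m, s.comul (P.u j) = ∑ l ∈ Finset.range P.m,
    P.γ ^ ((l : ℤ) * ((j.val : ℤ) - (l : ℤ))) •
      (P.u (l : ZMod P.m) ⊗ₜ[k]
        (P.x (-((l * P.d : ℕ) : ℤ)) * P.g (l : ℤ) * P.u (j - (l : ZMod P.m))))
  counit_x : s.counit (P.x 1) = 1
  counit_g : s.counit (P.g 1) = 1
  counit_y : ∀ i, s.counit (P.y i) = 0
  counit_u_zero : s.counit (P.u 0) = 1
  counit_u : ∀ j : ZMod P.m, j ≠ 0 → s.counit (P.u j) = 0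
  antipode_x : s.antipode (P.x 1) = P.x (-1)
  antipode_g : s.antipode (P.g 1) = P.g (-1)
  antipode_y : ∀ i, s.antipode (P.y i) = -(P.y i * P.g (-(P.M i : ℤ)))
  /-- Here `b = (1 - m) d - (∑ i, (e_i - 1) m_i) d / 2`. -/
  antipode_u : ∀ j : ZMod P.m, s.antipode (P.u j) =
    (∏ i, ((-1) ^ P.coord j i *
        (P.γ ^ (P.M i ^ 2 * (P.coord j i * (P.coord j i + 1) / 2)))⁻¹ *
        (P.ξ i)⁻¹ ^ P.coord j i)) •
      (P.x ((1 - (P.m : ℤ)) * P.d - ((P.N * P.d / 2 : ℕ) : ℤ)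
          + ((∑ i, P.coord j i * P.M i * P.d : ℕ) : ℤ)) *
        P.g ((P.m : ℤ) - 1 - ((∑ i, P.coord j i * P.M i : ℕ) : ℤ)) * P.u j)

end DData

/-! ### Ring-theoretic notions -/

/-- A (possibly noncommutative) ring is prime if it is nonzero and `a R b = 0` implies `a = 0` or
`b = 0`; equivalently, `0` is a prime ideal. -/
def IsPrimeRing (R : Type u) [Ring R] : Prop :=
  Nontrivial R ∧ ∀ a b : R, (∀ r : R, a * r * b = 0) → a = 0 ∨ b = 0

/-- `n` is the PI-degree of `R`: the least `n` such that `R` embeds into the ring of `n × n`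
matrices over some commutative ring. -/
def IsPIDegree (R : Type u) [Ring R] (n : ℕ) : Prop :=
  IsLeast {l : ℕ | ∃ (C : Type u) (_ : CommRing C) (f : R →+* Matrix (Fin l) (Fin l) C),
    Function.Injective f} n

/-! ### Notions for Hopf algebras -/

section Hopf

variable {k H : Type u} [Field k] [Ring H] [HopfAlgebra k H]

/-- The left winding endomorphism `a ↦ ∑ π(a₁) a₂` of a one-dimensional representation `π`. -/
noncomputable def leftWinding (π : H →ₐ[k] k) : H →ₐ[k] H :=
  (Algebra.TensorProduct.lid k H).toAlgHom.comp
    ((Algebra.TensorProduct.map π (AlgHom.id k H)).comp (Bialgebra.comulAlgHom k H))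

/-- The one-dimensional representation `π` has (finite) order `n`: the left winding map of `π` is
an automorphism of the algebra `H`, and it generates a group of order `n`. -/
def HasRepOrder (π : H →ₐ[k] k) (n : ℕ) : Prop :=
  0 < n ∧ ∃ σ : H ≃ₐ[k] H, (σ : H →ₐ[k] H) = leftWinding π ∧ Nat.card (Subgroup.zpowers σ) = n

/-- A subspace `C` is a subcoalgebra if `Δ(C) ⊆ C ⊗ C`. -/
def IsSubcoalgebra (C : Submodule k H) : Prop :=
  C.map (Coalgebra.comul (R := k) (A := H)) ≤
    LinearMap.range (TensorProduct.map C.subtype C.subtype)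

/-- A nonzero subcoalgebra without proper nonzero subcoalgebras. -/
def IsSimpleSubcoalgebra (C : Submodule k H) : Prop :=
  IsSubcoalgebra C ∧ C ≠ ⊥ ∧
    ∀ C' : Submodule k H, C' ≤ C → IsSubcoalgebra C' → C' = ⊥ ∨ C' = C

variable (k H)

/-- The coradical: the sum of all simple subcoalgebras. -/
def coradical : Submodule k H := sSup {C | IsSimpleSubcoalgebra C}

/-- `H` is pointed: every simple subcoalgebra is one-dimensional. -/
def IsPointed : Prop :=
  ∀ C : Submodule k H, IsSimpleSubcoalgebra C → Module.finrank k C = 1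

variable {k H}

/-- A subspace is a Hopf subalgebra if it is a subalgebra and a subcoalgebra that is stable under
the antipode. -/
structure IsHopfSubalgebra (V : Submodule k H) : Prop where
  one_mem : (1 : H) ∈ V
  mul_mem : ∀ a ∈ V, ∀ b ∈ V, a * b ∈ V
  subcoalgebra : IsSubcoalgebra V
  antipode_mem : ∀ a ∈ V, HopfAlgebra.antipode k a ∈ V

end Hopf

/-! ### Pivotal categories -/

open CategoryTheory MonoidalCategory

section Pivotal

universe v w

variable (C : Type w) [Category.{v} C] [MonoidalCategory C]

/-- The double dual `X**` of an object: with `X*` the object with evaluation `X* ⊗ X ⟶ 𝟙_` and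
coevaluation `𝟙_ ⟶ X ⊗ X*`. -/
abbrev doubleDual {C : Type w} [Category.{v} C] [MonoidalCategory C] [RightRigidCategory C]
    (X : C) : C :=
  HasRightDual.rightDual (HasRightDual.rightDual X)

/-- The tensor structure `X** ⊗ Y** ⟶ (Y* ⊗ X*)* ⟶ (X ⊗ Y)**` of the double dual functor. -/
noncomputable def doubleDualTensor {C : Type w} [Category.{v} C] [MonoidalCategory C]
    [RightRigidCategory C] (X Y : C) :
    doubleDual X ⊗ doubleDual Y ⟶ doubleDual (X ⊗ Y) :=
  (rightDualIso HasRightDual.exact ExactPairing.tensor :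
      HasRightDual.rightDual (HasRightDual.rightDual Y ⊗ HasRightDual.rightDual X) ≅
        doubleDual X ⊗ doubleDual Y).inv ≫
    rightAdjointMate (rightDualTensorIso X Y).hom

/-- A pivotal structure: an isomorphism of tensor functors from the identity functor to the
double dual functor. -/
structure PivotalStructure [RightRigidCategory C] where
  iso : ∀ X : C, X ≅ doubleDual X
  naturality : ∀ {X Y : C} (f : X ⟶ Y),
    f ≫ (iso Y).hom = (iso X).hom ≫ rightAdjointMate (rightAdjointMate f)
  tensor : ∀ X Y : C,
    (iso (X ⊗ Y)).hom = ((iso X).hom ⊗ₘ (iso Y).hom) ≫ doubleDualTensor X Y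

/-- A monoidal category is pivotal if every object has left and right duals and, for a choice of
duals (any other choice gives canonically isomorphic double duals), it has a pivotal structure. -/
def IsPivotalCategory : Prop :=
  ∃ _ : RigidCategory C, Nonempty (PivotalStructure C)

end Pivotal

/-! ### The category of finite-dimensional representations -/

/-- A finite-dimensional representation of the `k`-algebra `H`. -/
structure HRep (k H : Type u) [Field k] [Ring H] [Algebra k H] where
  V : ModuleCat.{u} k
  finite : Module.Finite k V
  ρ : H →ₐ[k] Module.End k V

namespace HRep

noncomputable section

section Cat

variable {k H : Type u} [Field k] [Ring H] [Algebra k H]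

/-- A morphism of representations: an `H`-equivariant linear map. -/
@[ext]
structure Hom (X Y : HRep k H) where
  hom : X.V ⟶ Y.V
  comm : ∀ h : H, hom.hom ∘ₗ X.ρ h = Y.ρ h ∘ₗ hom.hom

instance : Category (HRep k H) where
  Hom := Hom
  id X := ⟨𝟙 X.V, fun _ => rfl⟩
  comp f g := ⟨f.hom ≫ g.hom, fun h => by
    rw [ModuleCat.hom_comp, LinearMap.comp_assoc, f.comm, ← LinearMap.comp_assoc, g.comm,
      LinearMap.comp_assoc]⟩

/-- The forgetful functor to vector spaces. -/
def forgetV (k H : Type u) [Field k] [Ring H] [Algebra k H] : HRep k H ⥤ ModuleCat.{u} k where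
  obj X := X.V
  map f := Hom.hom f

instance : (forgetV k H).Faithful where
  map_injective h := Hom.ext h

/-- An equivariant linear isomorphism is an isomorphism of representations. -/
def mkIso {X Y : HRep k H} (i : X.V ≅ Y.V)
    (h : ∀ a : H, i.hom.hom ∘ₗ X.ρ a = Y.ρ a ∘ₗ i.hom.hom) : X ≅ Y where
  hom := ⟨i.hom, h⟩
  inv := ⟨i.inv, fun a => by
    have h1 : i.inv.hom ∘ₗ i.hom.hom = LinearMap.id := by
      rw [← ModuleCat.hom_comp, i.hom_inv_id]; rfl
    have h2 : i.hom.hom ∘ₗ i.inv.hom = LinearMap.id := by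
      rw [← ModuleCat.hom_comp, i.inv_hom_id]; rfl
    calc i.inv.hom ∘ₗ Y.ρ a
        = i.inv.hom ∘ₗ (Y.ρ a ∘ₗ (i.hom.hom ∘ₗ i.inv.hom)) := by rw [h2, LinearMap.comp_id]
      _ = i.inv.hom ∘ₗ ((i.hom.hom ∘ₗ X.ρ a) ∘ₗ i.inv.hom) := by
          rw [h a, LinearMap.comp_assoc]
      _ = (i.inv.hom ∘ₗ i.hom.hom) ∘ₗ (X.ρ a ∘ₗ i.inv.hom) := by
          simp only [LinearMap.comp_assoc]
      _ = X.ρ a ∘ₗ i.inv.hom := by rw [h1, LinearMap.id_comp]⟩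
  hom_inv_id := Hom.ext i.hom_inv_id
  inv_hom_id := Hom.ext i.inv_hom_id

/-- The action of `A ⊗ B` on `V ⊗ W`. -/
def act₂ {A B V W : Type u} [Ring A] [Algebra k A] [Ring B] [Algebra k B]
    [AddCommGroup V] [Module k V] [AddCommGroup W] [Module k W]
    (ρ : A →ₐ[k] Module.End k V) (σ : B →ₐ[k] Module.End k W) :
    A ⊗[k] B →ₐ[k] Module.End k (V ⊗[k] W) :=
  Module.endTensorEndAlgHom.comp (Algebra.TensorProduct.map ρ σ)

theorem act₂_tmul {A B V W : Type u} [Ring A] [Algebra k A] [Ring B] [Algebra k B]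
    [AddCommGroup V] [Module k V] [AddCommGroup W] [Module k W]
    (ρ : A →ₐ[k] Module.End k V) (σ : B →ₐ[k] Module.End k W) (a : A) (b : B) :
    act₂ ρ σ (a ⊗ₜ b) = TensorProduct.map (ρ a) (σ b) := rfl

end Cat

section Monoidal

variable {k H : Type u} [Field k] [Ring H] [HopfAlgebra k H]

/-- The tensor product of two representations, with `h` acting through `Δ(h)`. -/
def tensor (X Y : HRep k H) : HRep k H where
  V := ModuleCat.of k (X.V ⊗[k] Y.V)
  finite := by
    have := X.finite
    have := Y.finite
    exact inferInstanceAs (Module.Finite k (X.V ⊗[k] Y.V))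
  ρ := (act₂ X.ρ Y.ρ).comp (Bialgebra.comulAlgHom k H)

/-- The trivial representation `k`, with `h` acting through `ε(h)`. -/
def unit (k H : Type u) [Field k] [Ring H] [HopfAlgebra k H] : HRep k H where
  V := ModuleCat.of k k
  finite := inferInstanceAs (Module.Finite k k)
  ρ := (Algebra.ofId k (Module.End k k)).comp (Bialgebra.counitAlgHom k H)

theorem map_act₂ {X X' Y Y' : HRep k H} (f : X ⟶ X') (g : Y ⟶ Y') (z : H ⊗[k] H) :
    TensorProduct.map (Hom.hom f).hom (Hom.hom g).hom ∘ₗ act₂ X.ρ Y.ρ z =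
      act₂ X'.ρ Y'.ρ z ∘ₗ TensorProduct.map (Hom.hom f).hom (Hom.hom g).hom := by
  induction z using TensorProduct.induction_on with
  | zero => simp
  | add a b ha hb => rw [map_add, LinearMap.comp_add, ha, hb, map_add, LinearMap.add_comp]
  | tmul a b =>
    rw [act₂_tmul, act₂_tmul, ← TensorProduct.map_comp, ← TensorProduct.map_comp, f.comm, g.comm]

/-- The tensor product of two morphisms. -/
def tensorHom {X X' Y Y' : HRep k H} (f : X ⟶ X') (g : Y ⟶ Y') :
    tensor X Y ⟶ tensor X' Y' where
  hom := ModuleCat.ofHom (TensorProduct.map (Hom.hom f).hom (Hom.hom g).hom)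
  comm _ := map_act₂ f g _

theorem assoc_act₂_aux (X Y Z : HRep k H) (z : (H ⊗[k] H) ⊗[k] H) :
    (TensorProduct.assoc k X.V Y.V Z.V).toLinearMap ∘ₗ act₂ (act₂ X.ρ Y.ρ) Z.ρ z =
      act₂ X.ρ (act₂ Y.ρ Z.ρ) (Algebra.TensorProduct.assoc k k k H H H z) ∘ₗ
        (TensorProduct.assoc k X.V Y.V Z.V).toLinearMap := by
  induction z using TensorProduct.induction_on with
  | zero => simp
  | add a b ha hb => rw [map_add, LinearMap.comp_add, ha, hb, map_add, map_add, LinearMap.add_comp]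
  | tmul a c =>
    induction a using TensorProduct.induction_on with
    | zero => simp
    | add a b ha hb =>
      rw [TensorProduct.add_tmul, map_add, LinearMap.comp_add, ha, hb, map_add, map_add,
        LinearMap.add_comp]
    | tmul a b =>
      rw [Algebra.TensorProduct.assoc_tmul]
      simp only [act₂_tmul]
      exact TensorProduct.ext_threefold fun _ _ _ => rfl

theorem act₂_comp_left {A A' B V W : Type u} [Ring A] [Algebra k A] [Ring A'] [Algebra k A']
    [Ring B] [Algebra k B] [AddCommGroup V] [Module k V] [AddCommGroup W] [Module k W]
    (φ : A →ₐ[k] A') (ρ : A' →ₐ[k] Module.End k V) (σ : B →ₐ[k] Module.End k W) (z : A ⊗[k] B) :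
    act₂ (ρ.comp φ) σ z = act₂ ρ σ (Algebra.TensorProduct.map φ (.id k B) z) := by
  induction z using TensorProduct.induction_on with
  | zero => simp
  | add a b ha hb => rw [map_add, ha, hb, map_add, map_add]
  | tmul a b => rfl

theorem act₂_comp_right {A B B' V W : Type u} [Ring A] [Algebra k A] [Ring B] [Algebra k B]
    [Ring B'] [Algebra k B'] [AddCommGroup V] [Module k V] [AddCommGroup W] [Module k W]
    (φ : B →ₐ[k] B') (ρ : A →ₐ[k] Module.End k V) (σ : B' →ₐ[k] Module.End k W) (z : A ⊗[k] B) :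
    act₂ ρ (σ.comp φ) z = act₂ ρ σ (Algebra.TensorProduct.map (.id k A) φ z) := by
  induction z using TensorProduct.induction_on with
  | zero => simp
  | add a b ha hb => rw [map_add, ha, hb, map_add, map_add]
  | tmul a b => rfl

/-- The associativity isomorphism `(X ⊗ Y) ⊗ Z ≅ X ⊗ (Y ⊗ Z)` of vector spaces. -/
def assoc (X Y Z : HRep k H) : tensor (tensor X Y) Z ≅ tensor X (tensor Y Z) :=
  mkIso (TensorProduct.assoc k X.V Y.V Z.V).toModuleIso fun a => by
    change (TensorProduct.assoc k X.V Y.V Z.V).toLinearMap ∘ₗ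
        act₂ ((act₂ X.ρ Y.ρ).comp (Bialgebra.comulAlgHom k H)) Z.ρ (Coalgebra.comul a) =
      act₂ X.ρ ((act₂ Y.ρ Z.ρ).comp (Bialgebra.comulAlgHom k H)) (Coalgebra.comul a) ∘ₗ
        (TensorProduct.assoc k X.V Y.V Z.V).toLinearMap
    rw [act₂_comp_left, act₂_comp_right, assoc_act₂_aux]
    congr 2
    exact Coalgebra.coassoc_apply a

/-- The left unit isomorphism `k ⊗ X ≅ X` of vector spaces. -/
def leftUnit (X : HRep k H) : tensor (unit k H) X ≅ X :=
  mkIso (TensorProduct.lid k X.V).toModuleIso fun a => by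
    change (TensorProduct.lid k X.V).toLinearMap ∘ₗ
        act₂ ((Algebra.ofId k (Module.End k k)).comp (Bialgebra.counitAlgHom k H)) X.ρ
          (Coalgebra.comul a) =
      X.ρ a ∘ₗ (TensorProduct.lid k X.V).toLinearMap
    rw [act₂_comp_left]
    have h : Algebra.TensorProduct.map (Bialgebra.counitAlgHom k H) (.id k H)
        (Coalgebra.comul a) = (1 : k) ⊗ₜ[k] a := Coalgebra.rTensor_counit_comul a
    rw [h, act₂_tmul, map_one]
    exact TensorProduct.ext' fun r v => by simp

/-- The right unit isomorphism `X ⊗ k ≅ X` of vector spaces. -/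
def rightUnit (X : HRep k H) : tensor X (unit k H) ≅ X :=
  mkIso (TensorProduct.rid k X.V).toModuleIso fun a => by
    change (TensorProduct.rid k X.V).toLinearMap ∘ₗ
        act₂ X.ρ ((Algebra.ofId k (Module.End k k)).comp (Bialgebra.counitAlgHom k H))
          (Coalgebra.comul a) =
      X.ρ a ∘ₗ (TensorProduct.rid k X.V).toLinearMap
    rw [act₂_comp_right]
    have h : Algebra.TensorProduct.map (.id k H) (Bialgebra.counitAlgHom k H)
        (Coalgebra.comul a) = a ⊗ₜ[k] (1 : k) := Coalgebra.lTensor_counit_comul a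
    rw [h, act₂_tmul, map_one]
    exact TensorProduct.ext' fun v r => by simp

instance : MonoidalCategoryStruct (HRep k H) where
  tensorObj := tensor
  tensorHom f g := tensorHom f g
  whiskerLeft X _ _ f := tensorHom (𝟙 X) f
  whiskerRight f Y := tensorHom f (𝟙 Y)
  tensorUnit := unit k H
  associator := assoc
  leftUnitor := leftUnit
  rightUnitor := rightUnit

/-- The representations of `H` form a monoidal category; its structure is the one of vector
spaces. -/
instance : MonoidalCategory (HRep k H) :=
  Monoidal.induced (forgetV k H)
    { μIso := fun _ _ => Iso.refl _
      εIso := Iso.refl _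
      whiskerLeft_eq := fun _ _ _ _ => rfl
      whiskerRight_eq := fun _ _ => rfl
      tensorHom_eq := fun _ _ => rfl
      associator_eq := fun X Y Z => ModuleCat.hom_ext <|
        TensorProduct.ext_threefold (g := (TensorProduct.assoc k X.V Y.V Z.V).toLinearMap)
          fun _ _ _ => rfl
      leftUnitor_eq := fun X => ModuleCat.hom_ext <|
        TensorProduct.ext' (g := (TensorProduct.lid k X.V).toLinearMap) fun _ _ => rfl
      rightUnitor_eq := fun X => ModuleCat.hom_ext <|
        TensorProduct.ext' (g := (TensorProduct.rid k X.V).toLinearMap) fun _ _ => rfl }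

end Monoidal

end

end HRep

/-- The Hopf algebra `H` is pivotal: the category of its finite-dimensional representations is a
pivotal tensor category. -/
def IsPivotalHopf (k H : Type u) [Field k] [Ring H] [HopfAlgebra k H] : Prop :=
  IsPivotalCategory (HRep k H)

/-!
# The Hopf algebras `D(m̲, d, γ)`

Put `h = g x ^ (-d)`, so that `h ^ m = 1`, and `z_i = x ^ (m_i d)`. The products `]s, t[` in the
relation for `u_j u_l` are, in the coordinate `i`, products of consecutive factors
`1 - q ^ t z_i` ("arcs"), where `q = γ ^ (-m_i ^ 2)` is a primitive `e_i`-th root of unity: the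
arc starts at `j_i` and has length `e_i - 1 - (j + l)_i` (`DData.omitted_eq_arc`). The characters of
`ZMod m` and the sums over `ZMod m` that occur factor over the coordinates
(`DData.sum_prod_zcoord`), because `m_i m_l` is a multiple of `m` for `i ≠ l`; so all identities
between structure constants reduce to identities for one root of unity, which follow from the
`q`-binomial theorem, orthogonality of characters and the reflection of `q`-factorials.

*Hopf structure.* A tuple of elements of an algebra with the relations of `D` is a model
(`DData.Model`), and it yields a homomorphism from `D`. The comultiplication, the counit and the
antipode come from models in `D ⊗ D`, in `k` and in the opposite algebra of `D`. The relation for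
`u_j u_l` is the only hard one; for the comultiplication it is `sum_arc_mul_arc`, a convolution of
two arcs, and for the antipode it is the reversal of an arc under `z ↦ z⁻¹` (`arc_reverse`). The
coalgebra axioms are checked on the generators. Since `S²` is conjugation by the grouplike element
`ω = h ^ (∑ m_i) x ^ (-N d / 2)` (`DData.anti_anti`), the antipode is bijective.

*Primeness and PI-degree.* The elements `x ^ n y_j h ^ b` and `x ^ n u_j h ^ b` span `D`. The algebra
`D` acts on the left ideal generated by `∑ b, h ^ b`, with the `y_j` and the `u_j` as a basis of
`2m` elements over the Laurent polynomials in `x`. Written out, this is a representation by weighted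
shift matrices over `k[T;T⁻¹]` (`DData.matHom`). It shows that the spanning elements are linearly
independent, it is faithful, and its image spans nonzero multiples of all matrix units
(`DData.exists_single_mem_span`). Hence `D` is prime, and since the Capelli polynomial in `4m ^ 2`
variables does not vanish on `D`, it does not embed into smaller matrices over a commutative ring
(`card_le_of_matrix_embedding`).

*A representation of order `2m`.* For a primitive `2m`-th root of unity `ζ`, put `u_0 ↦ ζ`,
`h ↦ ζ ^ 2`, `x ↦ 1`, and send the `y_i` and the other `u_j` to `0`. The winding automorphism
multiplies the `u_j` by `ζ`.

*Coradical.* The elements `u_(b - a) h ^ a` are linearly independent matrix units of a coalgebra, so they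
span a simple subcoalgebra of dimension `m ^ 2`. Every simple subcoalgebra lies in the span of the
elements `x ^ n h ^ b` and `x ^ n u_j h ^ b` (`DData.coradical_le_lowest`): a functional that
vanishes on this span acts locally nilpotently on `D`. But `u_0 u_(m_i)` is a nonzero multiple of
`y_i h`, so that the coradical is not closed under multiplication.

*Pivotality.* If `S²` is conjugation by a grouplike element `ω`, the maps `v ↦ (f ↦ f(ωv))` form an
isomorphism of tensor functors from the identity to the double dual
(`PivotalElement.isPivotalHopf`). The tensor structure of the double dual is computed from the
fact that the mate of a morphism is its adjoint with respect to the evaluations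
(`HRep.pair_mate`).
-/

open Finset

/-! ### Powers of roots of unity with exponents in `ZMod n` -/

section RootPow

variable {k : Type*} [Field k]

/-- The power `q ^ a` of an `n`-th root of unity `q`, with exponent `a` in `ZMod n`. -/
def rootPow (q : k) {n : ℕ} (a : ZMod n) : k := q ^ a.val

variable {q : k} {n : ℕ}

theorem rootPow_natCast (hq : q ^ n = 1) (t : ℕ) : rootPow q (t : ZMod n) = q ^ t := by
  rw [rootPow, ZMod.val_natCast, ← pow_eq_pow_mod t hq]

theorem rootPow_zero : rootPow q (0 : ZMod n) = 1 := by simp [rootPow]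

theorem rootPow_one (hq : q ^ n = 1) : rootPow q (1 : ZMod n) = q := by
  simpa using rootPow_natCast (n := n) hq 1

variable [NeZero n]

theorem rootPow_add (hq : q ^ n = 1) (a b : ZMod n) :
    rootPow q (a + b) = rootPow q a * rootPow q b := by
  rw [rootPow, ZMod.val_add, ← pow_eq_pow_mod _ hq, pow_add, rootPow, rootPow]

theorem rootPow_ne_zero (hq : q ^ n = 1) (a : ZMod n) : rootPow q a ≠ 0 := by
  refine pow_ne_zero _ ?_
  rintro rfl
  simp [NeZero.ne n] at hq

theorem rootPow_neg (hq : q ^ n = 1) (a : ZMod n) : rootPow q (-a) = (rootPow q a)⁻¹ := by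
  refine eq_inv_of_mul_eq_one_left ?_
  rw [← rootPow_add hq, neg_add_cancel, rootPow_zero]

theorem rootPow_natCast_mul (hq : q ^ n = 1) (t : ℕ) (a : ZMod n) :
    rootPow q ((t : ZMod n) * a) = rootPow q a ^ t := by
  induction t with
  | zero => simp [rootPow_zero]
  | succ t ih => rw [Nat.cast_succ, add_mul, one_mul, rootPow_add hq, ih, pow_succ]

theorem rootPow_pow_card (hq : q ^ n = 1) (a : ZMod n) : rootPow q a ^ n = 1 := by
  rw [← rootPow_natCast_mul hq, ZMod.natCast_self, zero_mul, rootPow_zero]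

theorem rootPow_sum {ι : Type*} (hq : q ^ n = 1) (s : Finset ι) (f : ι → ZMod n) :
    rootPow q (∑ i ∈ s, f i) = ∏ i ∈ s, rootPow q (f i) := by
  classical
  induction s using Finset.induction_on with
  | empty => simp [rootPow_zero]
  | insert i s hi ih => rw [sum_insert hi, prod_insert hi, rootPow_add hq, ih]

theorem rootPow_eq_one_iff (hq : IsPrimitiveRoot q n) (a : ZMod n) : rootPow q a = 1 ↔ a = 0 := by
  rw [rootPow, hq.pow_eq_one_iff_dvd, ← ZMod.natCast_eq_zero_iff, ZMod.natCast_zmod_val]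

/-- Orthogonality of the characters of `ZMod n`. -/
theorem sum_rootPow_mul (hq : IsPrimitiveRoot q n) (w : ZMod n) :
    ∑ a : ZMod n, rootPow q (a * w) = if w = 0 then (n : k) else 0 := by
  split_ifs with hw
  · simp [hw, rootPow_zero]
  · have h1 : rootPow q w * ∑ a : ZMod n, rootPow q (a * w) = ∑ a : ZMod n, rootPow q (a * w) := by
      rw [mul_sum, ← Equiv.sum_comp (Equiv.addRight (1 : ZMod n)) (fun a => rootPow q (a * w))]
      refine sum_congr rfl fun a _ => ?_
      rw [Equiv.coe_addRight, add_mul, one_mul, rootPow_add hq.pow_eq_one, mul_comm]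
    have h2 : rootPow q w ≠ 1 := fun h => hw ((rootPow_eq_one_iff hq w).1 h)
    by_contra h3
    exact h2 (mul_right_cancel₀ h3 (h1.trans (one_mul _).symm))

end RootPow

/-! ### Gaussian binomial coefficients at a root of unity -/

section Gauss

variable {k : Type*} [Field k]

/-- The Gaussian binomial coefficients, defined by the `q`-Pascal rule. -/
def gaussBinom (q : k) : ℕ → ℕ → k
  | _, 0 => 1
  | 0, _ + 1 => 0
  | n + 1, s + 1 => gaussBinom q n s + q ^ (s + 1) * gaussBinom q n (s + 1)

/-- The `q`-factorial `(1 - q) (1 - q ^ 2) ⋯ (1 - q ^ n)`, without the usual denominators. -/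
def qFact (q : k) (n : ℕ) : k := ∏ t ∈ range n, (1 - q ^ (t + 1))

variable (q : k)

@[simp] theorem gaussBinom_zero_right (n : ℕ) : gaussBinom q n 0 = 1 := by
  cases n <;> rfl

theorem gaussBinom_succ_succ (n s : ℕ) :
    gaussBinom q (n + 1) (s + 1) = gaussBinom q n s + q ^ (s + 1) * gaussBinom q n (s + 1) := rfl

theorem gaussBinom_eq_zero {n s : ℕ} (h : n < s) : gaussBinom q n s = 0 := by
  induction n generalizing s with
  | zero =>
    obtain _ | s := s
    · omega
    · rfl
  | succ n ih =>
    obtain _ | s := s; · omega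
    rw [gaussBinom_succ_succ, ih (by omega), ih (by omega), mul_zero, add_zero]

theorem gaussBinom_self (n : ℕ) : gaussBinom q n n = 1 := by
  induction n with
  | zero => rfl
  | succ n ih => rw [gaussBinom_succ_succ, ih, gaussBinom_eq_zero q (by omega), mul_zero, add_zero]

theorem qFact_succ (n : ℕ) : qFact q (n + 1) = qFact q n * (1 - q ^ (n + 1)) :=
  prod_range_succ _ _

@[simp] theorem qFact_zero : qFact q 0 = 1 := rfl

theorem gaussBinom_mul_qFact (n s p : ℕ) (h : n = s + p) :
    gaussBinom q n s * (qFact q s * qFact q p) = qFact q n := by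
  induction n generalizing s p with
  | zero =>
    obtain ⟨rfl, rfl⟩ : s = 0 ∧ p = 0 := by omega
    simp
  | succ n ih =>
    obtain _ | s := s
    · obtain rfl : n + 1 = p := by omega
      simp
    obtain _ | p := p
    · obtain rfl : n = s := by omega
      simp [gaussBinom_self]
    have h1 := ih s (p + 1) (by omega)
    have h2 := ih (s + 1) p (by omega)
    have h3 : q ^ (n + 1) = q ^ (s + 1) * q ^ (p + 1) := by
      rw [← pow_add, show n + 1 = s + 1 + (p + 1) by omega]
    rw [gaussBinom_succ_succ, qFact_succ q n, h3]
    rw [qFact_succ q s] at *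
    rw [qFact_succ q p] at *
    linear_combination (1 - q ^ (s + 1)) * h1 + q ^ (s + 1) * (1 - q ^ (p + 1)) * h2

variable {q} {e : ℕ}

theorem qFact_ne_zero (hq : IsPrimitiveRoot q e) {n : ℕ} (h : n < e) : qFact q n ≠ 0 := by
  refine prod_ne_zero_iff.2 fun t ht => sub_ne_zero.2 fun h1 => ?_
  have := (hq.pow_eq_one_iff_dvd _).1 h1.symm
  have := Nat.le_of_dvd (by omega) this
  have := mem_range.1 ht
  omega

theorem gaussBinom_order (hq : IsPrimitiveRoot q e) {s : ℕ} (h0 : 0 < s) (h1 : s < e) :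
    gaussBinom q e s = 0 := by
  have h := gaussBinom_mul_qFact q e s (e - s) (by omega)
  obtain ⟨e', rfl⟩ : ∃ e', e = e' + 1 := ⟨e - 1, by omega⟩
  rw [qFact_succ q e', hq.pow_eq_one, sub_self, mul_zero] at h
  exact (mul_eq_zero.1 h).resolve_right
    (mul_ne_zero (qFact_ne_zero hq (by omega)) (qFact_ne_zero hq (by omega)))

theorem choose_succ_two (s : ℕ) : (s + 1).choose 2 = s.choose 2 + s := by
  rw [Nat.choose_succ_succ' s 1, Nat.choose_one_right, add_comm]

/-- The reflection formula for `q`-factorials at a primitive `e`-th root of unity. -/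
theorem qFact_mul_qFact_reflect (hq : IsPrimitiveRoot q e) (n p : ℕ) (h : n + p + 1 = e) :
    qFact q p * qFact q n = e * ((-1) ^ n * q ^ ((n + 1).choose 2)) := by
  induction n generalizing p with
  | zero =>
    obtain rfl : p + 1 = e := by omega
    simpa [qFact] using hq.prod_one_sub_pow_eq_order
  | succ n ih =>
    have h1 := ih (p + 1) (by omega)
    have h2 : q ^ (p + 1) * q ^ (n + 1) = 1 := by
      rw [← pow_add, ← hq.pow_eq_one]; congr 1; omega
    rw [qFact_succ] at h1
    rw [qFact_succ q n, choose_succ_two (n + 1), pow_add q (Nat.choose _ _), pow_succ (-1 : k)]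
    have h3 : qFact q p * (qFact q n * (1 - q ^ (n + 1)))
        = - q ^ (n + 1) * (qFact q p * (1 - q ^ (p + 1)) * qFact q n) := by
      linear_combination (- qFact q p * qFact q n) * h2
    rw [h3, h1]
    ring

theorem pow_choose_order (hq : IsPrimitiveRoot q e) (he : 0 < e) :
    (-1) ^ (e - 1) * q ^ (e.choose 2) = 1 := by
  obtain ⟨e, rfl⟩ : ∃ e', e = e' + 1 := ⟨e - 1, by omega⟩
  have h1 := qFact_mul_qFact_reflect hq e 0 (by omega)
  have h2 := qFact_mul_qFact_reflect hq 0 e (by omega)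
  have h3 := qFact_ne_zero hq (Nat.lt_succ_self e)
  simp only [qFact_zero, one_mul, mul_one, zero_add, pow_zero] at h1 h2
  simp only [show Nat.choose 1 2 = 0 from rfl, pow_zero, mul_one] at h2
  rw [h2] at h1 h3
  rw [Nat.add_sub_cancel]
  exact mul_left_cancel₀ h3 (h1.symm.trans (mul_one _).symm)

theorem qFact_inv (hq : q ≠ 0) (n : ℕ) :
    qFact q⁻¹ n * ((-1) ^ n * q ^ ((n + 1).choose 2)) = qFact q n := by
  induction n with
  | zero => simp
  | succ n ih =>
    rw [qFact_succ, qFact_succ, ← ih, choose_succ_two (n + 1), pow_add, pow_succ (-1 : k)]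
    have : q⁻¹ ^ (n + 1) * q ^ (n + 1) = 1 := by
      rw [← mul_pow, inv_mul_cancel₀ hq, one_pow]
    linear_combination (qFact q⁻¹ n * ((-1) ^ n * q ^ ((n + 1).choose 2))) * this

/-- The identity between Gaussian binomials behind the coproduct of a product `u_j u_r`. All binomials
are quotients of `q`-factorials, and the reflection formula reduces the factorials of the numbers
`e - 1 - a` to those of the numbers `a`. -/
theorem gaussBinom_reflect (hq : IsPrimitiveRoot q e) (n p s t : ℕ) (h : n + p + s + t + 1 = e) :
    gaussBinom q (p + s + t) s * ((-1) ^ (s + n) * q ^ ((s + n + 1).choose 2)) *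
      gaussBinom q (n + s + t) (s + n) = gaussBinom q⁻¹ (n + p) n * gaussBinom q (s + t) s := by
  have q0 : q ≠ 0 := hq.ne_zero (by omega)
  have hq' : IsPrimitiveRoot q⁻¹ e := hq.inv
  have a1 := gaussBinom_mul_qFact q (p + s + t) s (p + t) (by omega)
  have a2 := gaussBinom_mul_qFact q (n + s + t) (s + n) t (by omega)
  have a3 := gaussBinom_mul_qFact q (s + t) s t (by omega)
  have a4 := gaussBinom_mul_qFact q⁻¹ (n + p) n p (by omega)
  have b1 := qFact_mul_qFact_reflect hq n (p + s + t) (by omega)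
  have b2 := qFact_mul_qFact_reflect hq (s + n) (p + t) (by omega)
  have b3 := qFact_mul_qFact_reflect hq p (n + s + t) (by omega)
  have b4 := qFact_mul_qFact_reflect hq (n + p) (s + t) (by omega)
  have c1 := qFact_inv q0 n
  have c2 := qFact_inv q0 p
  have c3 := qFact_inv q0 (n + p)
  have r : ∀ n : ℕ, (-1 : k) ^ n * q ^ ((n + 1).choose 2) ≠ 0 := fun n =>
    mul_ne_zero (pow_ne_zero _ (by simp)) (pow_ne_zero _ q0)
  have r1 := r n
  have r2 := r p
  have r3 := r (n + p)
  have r4 := r (s + n)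
  generalize (-1 : k) ^ n * q ^ ((n + 1).choose 2) = x1 at *
  generalize (-1 : k) ^ p * q ^ ((p + 1).choose 2) = x2 at *
  generalize (-1 : k) ^ (n + p) * q ^ ((n + p + 1).choose 2) = x3 at *
  generalize (-1 : k) ^ (s + n) * q ^ ((s + n + 1).choose 2) = x4 at *
  have f : ∀ i, i < e → qFact q i ≠ 0 := fun i => qFact_ne_zero hq
  have f1 := f n (by omega)
  have f2 := f p (by omega)
  have f3 := f s (by omega)
  have f4 := f t (by omega)
  have f5 := f (n + p) (by omega)
  have f6 := f (s + n) (by omega)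
  have f7 := f (p + t) (by omega)
  have g : ∀ i, i < e → qFact q⁻¹ i ≠ 0 := fun i => qFact_ne_zero hq'
  have g1 := g n (by omega)
  have g2 := g p (by omega)
  rw [← eq_div_iff (mul_ne_zero f3 f7)] at a1
  rw [← eq_div_iff (mul_ne_zero f6 f4)] at a2
  rw [← eq_div_iff (mul_ne_zero f3 f4)] at a3
  rw [← eq_div_iff (mul_ne_zero g1 g2)] at a4
  rw [← eq_div_iff f1] at b1
  rw [← eq_div_iff f6] at b2
  rw [← eq_div_iff f2] at b3
  rw [← eq_div_iff f5] at b4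
  rw [← eq_div_iff r1] at c1
  rw [← eq_div_iff r2] at c2
  rw [← eq_div_iff r3] at c3
  have e0 : (e : k) ≠ 0 := by
    intro h0; rw [h0, zero_mul, zero_div] at b2; exact f7 b2
  rw [a1, a2, a3, a4, b1, b2, b3, b4, c1, c2, c3]
  field_simp

end Gauss

/-! ### Arcs of the product `∏ (1 - q ^ t z)` -/

section Arc

variable {k : Type*} [Field k] {A : Type*} [CommRing A] [Algebra k A] {e : ℕ}

/-- The product of the `n` consecutive factors `1 - q ^ (1 + a + t) z`, `0 ≤ t < n`, of the
cyclic product `1 - z ^ e`. -/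
def arc (q : k) (a : ZMod e) (n : ℕ) (z : A) : A :=
  ∏ t ∈ range n, (1 - algebraMap k A (rootPow q (1 + a + (t : ZMod e))) * z)

variable (q : k)

@[simp] theorem arc_zero (a : ZMod e) (z : A) : arc q a 0 z = 1 := rfl

theorem arc_add (a : ZMod e) (n p : ℕ) (z : A) :
    arc q a (n + p) z = arc q a n z * arc q (a + (n : ZMod e)) p z := by
  rw [arc, prod_range_add]
  congr 1
  refine prod_congr rfl fun t _ => ?_
  rw [Nat.cast_add]
  congr 4
  ring

theorem arc_one (a : ZMod e) (z : A) :
    arc q a 1 z = 1 - algebraMap k A (rootPow q (1 + a)) * z := by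
  simp [arc]

theorem arc_succ' (a : ZMod e) (n : ℕ) (z : A) :
    arc q a (n + 1) z = (1 - algebraMap k A (rootPow q (1 + a)) * z) * arc q (a + 1) n z := by
  rw [add_comm n 1, arc_add, arc_one, Nat.cast_one]

theorem arc_succ (a : ZMod e) (n : ℕ) (z : A) :
    arc q a (n + 1) z = arc q a n z * (1 - algebraMap k A (rootPow q (1 + a + (n : ZMod e))) * z) :=
  prod_range_succ _ _

theorem map_arc {B : Type*} [CommRing B] [Algebra k B] (f : A →ₐ[k] B) (a : ZMod e) (n : ℕ)
    (z : A) : f (arc q a n z) = arc q a n (f z) := by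
  simp [arc, map_prod]

/-- Two chains of arcs from `a` and `b` to `c` and `d` may exchange their ends. -/
theorem arc_exchange (a b c d : ZMod e) (n p n' p' : ℕ) (h1 : a + (n : ZMod e) = c)
    (h2 : b + (p : ZMod e) = d) (h3 : b + (n' : ZMod e) = c) (h4 : a + (p' : ZMod e) = d) (h : n + p = n' + p') (z : A) :
    arc q a n z * arc q b p z = arc q b n' z * arc q a p' z := by
  rcases le_total n p' with hn | hn
  · obtain ⟨r, rfl⟩ := Nat.exists_eq_add_of_le hn
    obtain rfl : p = n' + r := by omega
    rw [arc_add, arc_add, h1, h3]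
    ring
  · obtain ⟨r, rfl⟩ := Nat.exists_eq_add_of_le hn
    obtain rfl : n' = p + r := by omega
    rw [arc_add, arc_add, h2, h4]
    ring

/-- The `q`-binomial theorem. -/
theorem prod_one_sub_pow_mul (w : A) (n : ℕ) :
    ∏ t ∈ range n, (1 - algebraMap k A (q ^ t) * w) = ∑ s ∈ range (n + 1),
      algebraMap k A ((-1) ^ s * q ^ (s.choose 2) * gaussBinom q n s) * w ^ s := by
  induction n generalizing w with
  | zero => simp
  | succ n ih =>
    -- The first factor is split off; the others are the product for `n` with `q w` in place of `w`.
    have h1 : ∏ t ∈ range n, (1 - algebraMap k A (q ^ (t + 1)) * w) = ∑ s ∈ range (n + 1),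
        algebraMap k A ((-1) ^ s * q ^ (s.choose 2) * gaussBinom q n s * q ^ s) * w ^ s := by
      have := ih (algebraMap k A q * w)
      calc _ = _ := by
            rw [← this]
            refine prod_congr rfl fun t _ => ?_
            rw [pow_succ, map_mul]; ring
        _ = _ := sum_congr rfl fun s _ => by
            rw [mul_pow, map_mul _ _ (q ^ s), map_pow]; ring
    have h2 : ∑ s ∈ range (n + 1),
        algebraMap k A ((-1) ^ s * q ^ (s.choose 2) * gaussBinom q n s * q ^ s) * w ^ s
        = 1 + ∑ s ∈ range (n + 1), algebraMap k A
          ((-1) ^ (s + 1) * q ^ ((s + 1).choose 2) * gaussBinom q n (s + 1) * q ^ (s + 1)) *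
            w ^ (s + 1) := by
      have := sum_range_succ (fun s => algebraMap k A
        ((-1) ^ s * q ^ (s.choose 2) * gaussBinom q n s * q ^ s) * w ^ s) (n + 1)
      rw [gaussBinom_eq_zero q (Nat.lt_succ_self n)] at this
      simp only [mul_zero, zero_mul, map_zero, add_zero] at this
      rw [← this, sum_range_succ']
      simp [add_comm, show Nat.choose 0 2 = 0 from rfl]
    rw [prod_range_succ', h1, mul_sub, sum_range_succ' _ (n + 1), pow_zero, map_one, one_mul,
      mul_one]
    nth_rewrite 1 [h2]
    simp only [pow_zero, Nat.choose_zero_succ, gaussBinom_zero_right, mul_one, map_one]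
    have h3 : ∀ s, algebraMap k A ((-1) ^ (s + 1) * q ^ ((s + 1).choose 2) *
          gaussBinom q (n + 1) (s + 1)) * w ^ (s + 1)
        = algebraMap k A ((-1) ^ (s + 1) * q ^ ((s + 1).choose 2) * gaussBinom q n (s + 1) *
            q ^ (s + 1)) * w ^ (s + 1) -
          algebraMap k A ((-1) ^ s * q ^ (s.choose 2) * gaussBinom q n s * q ^ s) * w ^ s * w := by
      intro s
      rw [gaussBinom_succ_succ, choose_succ_two, pow_add q (s.choose 2)]
      simp only [map_mul, map_add, map_pow, map_neg, map_one]
      ring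
    rw [sum_congr rfl fun s _ => h3 s, sum_sub_distrib, sum_mul]
    ring

theorem natCast_add_eq_zero_iff {s n : ℕ} (h : s + n < e) :
    (s : ZMod e) + n = 0 ↔ s = 0 ∧ n = 0 := by
  rw [← Nat.cast_add, ZMod.natCast_eq_zero_iff]
  constructor
  · intro hd
    have := Nat.eq_zero_of_dvd_of_lt hd h
    omega
  · rintro ⟨rfl, rfl⟩
    simp

variable {q} [NeZero e]

/-- The coefficient of `q ^ (s a) z ^ s` in the arc of length `n` that starts at `a`. -/
def arcCoeff (q : k) (n s : ℕ) : k := (-1) ^ s * q ^ ((s + 1).choose 2) * gaussBinom q n s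

theorem arc_eq_sum (hq : q ^ e = 1) (a : ZMod e) (n : ℕ) (z : A) :
    arc q a n z = ∑ s ∈ range (n + 1),
      algebraMap k A (arcCoeff q n s * rootPow q ((s : ZMod e) * a)) * z ^ s := by
  have := prod_one_sub_pow_mul q (algebraMap k A (rootPow q (1 + a)) * z) n
  calc _ = _ := by
        rw [← this, arc]
        refine prod_congr rfl fun t _ => ?_
        rw [rootPow_add hq _ (t : ZMod e), rootPow_natCast hq, map_mul]
        ring
    _ = _ := sum_congr rfl fun s _ => by
        rw [mul_pow, ← map_pow, rootPow_add hq, rootPow_one hq, arcCoeff, choose_succ_two,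
          pow_add q, rootPow_natCast_mul hq, mul_pow]
        simp only [map_mul, map_pow]
        ring

theorem arc_full (hq : IsPrimitiveRoot q e) (a : ZMod e) (z : A) : arc q a e z = 1 - z ^ e := by
  have he := Nat.pos_of_ne_zero (NeZero.ne e)
  rw [arc_eq_sum hq.pow_eq_one, sum_range_succ]
  have h1 : arcCoeff q e e = -1 := by
    have := pow_choose_order hq he
    have h2 : (-1 : k) ^ e = - (-1) ^ (e - 1) := by
      obtain ⟨e', rfl⟩ : ∃ e', e = e' + 1 := ⟨e - 1, by omega⟩
      simp [pow_succ]
    rw [arcCoeff, gaussBinom_self, mul_one, choose_succ_two, pow_add, hq.pow_eq_one, mul_one, h2]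
    linear_combination -this
  have h3 : ∀ s ∈ range e, s ≠ 0 →
      algebraMap k A (arcCoeff q e s * rootPow q ((s : ZMod e) * a)) * z ^ s = 0 := by
    intro s hs h0
    rw [arcCoeff, gaussBinom_order hq (Nat.pos_of_ne_zero h0) (mem_range.1 hs)]
    simp
  rw [sum_eq_single_of_mem 0 (mem_range.2 he) h3, h1, ZMod.natCast_self, zero_mul, rootPow_zero]
  simp [arcCoeff, rootPow_zero]
  ring

/-- Averaging an arc over its starting point, against a character, extracts a coefficient. -/
theorem sum_rootPow_mul_arc (hq : IsPrimitiveRoot q e) (w : ZMod e) (n : ℕ) (z : A) :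
    ∑ a : ZMod e, algebraMap k A (rootPow q (a * w)) * arc q a n z =
      ∑ s ∈ range (n + 1), algebraMap k A (if (s : ZMod e) + w = 0 then e * arcCoeff q n s else 0) *
        z ^ s := by
  simp_rw [arc_eq_sum hq.pow_eq_one, mul_sum]
  rw [sum_comm]
  refine sum_congr rfl fun s _ => ?_
  have := sum_rootPow_mul hq ((s : ZMod e) + w)
  calc _ = algebraMap k A (arcCoeff q n s) * z ^ s *
        algebraMap k A (∑ a : ZMod e, rootPow q (a * ((s : ZMod e) + w))) := by
        rw [map_sum, mul_sum]
        refine sum_congr rfl fun a _ => ?_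
        rw [mul_add, rootPow_add hq.pow_eq_one, mul_comm a (s : ZMod e), map_mul, map_mul]
        ring
    _ = _ := by
        rw [this]
        split_ifs
        · rw [map_mul]; ring
        · simp

/-- The local form of the right antipode axiom for `u_j`. -/
theorem sum_rootPow_mul_arc_left (hq : IsPrimitiveRoot q e) (n : ℕ) (hn : n < e) (z : A) :
    ∑ a : ZMod e, algebraMap k A (rootPow q (a * (n : ZMod e))) * arc q a (e - 1 - n) z =
      if n = 0 then (e : A) else 0 := by
  rw [sum_rootPow_mul_arc hq]
  have h1 : ∀ s ∈ range (e - 1 - n + 1), s ≠ 0 → algebraMap k A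
      (if (s : ZMod e) + n = 0 then e * arcCoeff q (e - 1 - n) s else 0) * z ^ s = 0 := by
    intro s hs h0
    rw [if_neg, map_zero, zero_mul]
    rw [natCast_add_eq_zero_iff (by have := mem_range.1 hs; omega)]
    tauto
  rw [sum_eq_single_of_mem 0 (by simp) h1]
  have h2 := natCast_add_eq_zero_iff (e := e) (s := 0) (n := n) (by omega)
  by_cases h : n = 0
  · simp [h, arcCoeff]
  · rw [if_neg fun h' => h (h2.1 h').2, if_neg h, map_zero, zero_mul]

/-- The local form of the left antipode axiom for `u_j`. -/
theorem sum_rootPow_mul_arc_right (hq : IsPrimitiveRoot q e) (n : ℕ) (hn : n < e) (z : A) :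
    ∑ a : ZMod e, algebraMap k A (rootPow q a) * arc q a (e - 1 - n) z =
      if n = 0 then (e : A) * z ^ (e - 1) else 0 := by
  have h0 := sum_rootPow_mul_arc (A := A) hq 1 (e - 1 - n) z
  simp only [mul_one] at h0
  rw [h0]
  have h1 : ∀ s, s < e → ((s : ZMod e) + 1 = 0 ↔ s = e - 1) := by
    intro s hs
    rw [← Nat.cast_succ, ZMod.natCast_eq_zero_iff]
    constructor
    · intro h; have := Nat.le_of_dvd (by omega) h; omega
    · rintro rfl; rw [show (e - 1).succ = e by omega]
  split_ifs with h
  · subst h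
    rw [sum_eq_single_of_mem (e - 1) (by simp)]
    · rw [if_pos ((h1 _ (by omega)).2 rfl), arcCoeff, Nat.sub_zero, gaussBinom_self,
        Nat.sub_add_cancel (by omega), pow_choose_order hq (by omega)]
      simp
    · intro s hs hne
      rw [if_neg (fun h => hne ((h1 s (by have := mem_range.1 hs; omega)).1 h)), map_zero, zero_mul]
  · refine sum_eq_zero fun s hs => ?_
    have := mem_range.1 hs
    rw [if_neg (fun h' => by have := (h1 s (by omega)).1 h'; omega), map_zero, zero_mul]

/-- When both arcs are expanded in powers of `z` and `w`, the sum over `l` is a sum of values of a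
character, which vanishes unless the exponent of `w` exceeds the exponent of `z` by `n`. -/
theorem sum_arc_mul_arc_aux (hq : IsPrimitiveRoot q e) (j : ZMod e) (n p : ℕ) (hn : n < e)
    (hp : p < e) (z w : A) :
    ∑ l : ZMod e, algebraMap k A (rootPow q ((n : ZMod e) * (l - j))) * arc q l (e - 1 - n) z *
        arc q (j - l) (e - 1 - p) w =
      ∑ s ∈ range (e - n), if s + n ∈ range (e - p) then algebraMap k A (e *
        (arcCoeff q (e - 1 - n) s * arcCoeff q (e - 1 - p) (s + n) * rootPow q ((s : ZMod e) * j))) *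
          (z ^ s * w ^ (s + n)) else 0 := by
  have q1 := hq.pow_eq_one
  simp_rw [arc_eq_sum q1, mul_sum, sum_mul, show e - 1 - n + 1 = e - n by omega,
    show e - 1 - p + 1 = e - p by omega]
  calc _ = ∑ s ∈ range (e - n), ∑ s' ∈ range (e - p),
        algebraMap k A (arcCoeff q (e - 1 - n) s * arcCoeff q (e - 1 - p) s' *
          rootPow q ((s' : ZMod e) * j - (n : ZMod e) * j)) * (z ^ s * w ^ s') *
          algebraMap k A (∑ l : ZMod e, rootPow q (l * ((n : ZMod e) + (s : ZMod e) - (s' : ZMod e)))) := by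
        conv_rhs => rw [sum_comm]
        rw [sum_comm]
        refine sum_congr rfl fun s' _ => ?_
        rw [sum_comm]
        refine sum_congr rfl fun s _ => ?_
        rw [map_sum, mul_sum]
        refine sum_congr rfl fun l _ => ?_
        have h1 : rootPow q ((n : ZMod e) * (l - j)) * rootPow q ((s : ZMod e) * l) *
            rootPow q ((s' : ZMod e) * (j - l)) = rootPow q ((s' : ZMod e) * j - (n : ZMod e) * j) *
              rootPow q (l * ((n : ZMod e) + (s : ZMod e) - (s' : ZMod e))) := by
          rw [← rootPow_add q1, ← rootPow_add q1, ← rootPow_add q1]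
          congr 1
          ring
        have h2 := congrArg (algebraMap k A) h1
        simp only [map_mul] at h2 ⊢
        linear_combination (algebraMap k A (arcCoeff q (e - 1 - n) s) *
          algebraMap k A (arcCoeff q (e - 1 - p) s') * (z ^ s * w ^ s')) * h2
    _ = _ := by
        refine sum_congr rfl fun s hs => ?_
        have hs' := mem_range.1 hs
        simp_rw [sum_rootPow_mul hq]
        have h1 : ∀ s' ∈ range (e - p), s' ≠ s + n → (n : ZMod e) + (s : ZMod e) - (s' : ZMod e) ≠ 0 := by
          intro s' h' hne h0
          have h'' := mem_range.1 h'
          rw [sub_eq_zero, ← Nat.cast_add, ZMod.natCast_eq_natCast_iff] at h0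
          have := Nat.ModEq.eq_of_lt_of_lt h0 (by omega) (by omega)
          omega
        split_ifs with hm
        · rw [sum_eq_single_of_mem (s + n) hm fun s' h' hne => by
            rw [if_neg (h1 s' h' hne), map_zero, mul_zero], if_pos (by push_cast; ring)]
          have h2 : ((s + n : ℕ) : ZMod e) * j - (n : ZMod e) * j = (s : ZMod e) * j := by
            push_cast; ring
          rw [h2]
          simp only [map_mul]
          ring
        · refine sum_eq_zero fun s' h' => ?_
          rw [if_neg (h1 s' h' fun h => hm (h ▸ h')), map_zero, mul_zero]

/-- The local form of the coproduct of `u_j u_r`: convolution of two arcs against a character. -/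
theorem sum_arc_mul_arc (hq : IsPrimitiveRoot q e) (j : ZMod e) (n p : ℕ) (h : n + p < e)
    (z w : A) :
    ∑ l : ZMod e, algebraMap k A (rootPow q ((n : ZMod e) * (l - j))) * arc q l (e - 1 - n) z *
        arc q (j - l) (e - 1 - p) w =
      algebraMap k A (e * gaussBinom q⁻¹ (n + p) n) * (arc q j (e - 1 - (n + p)) (z * w) *
        w ^ n) := by
  rw [sum_arc_mul_arc_aux hq j n p (by omega) (by omega), arc_eq_sum hq.pow_eq_one, sum_mul,
    mul_sum]
  symm
  refine sum_subset_zero_on_sdiff (range_subset_range.2 (by omega)) (fun s hs => ?_)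
    (fun s hs => ?_)
  · simp only [mem_sdiff, mem_range] at hs
    rw [if_neg (by rw [mem_range]; omega)]
  · have hs' := mem_range.1 hs
    rw [if_pos (by rw [mem_range]; omega)]
    obtain ⟨t, ht⟩ : ∃ t, n + p + s + t + 1 = e := ⟨e - (n + p + s + 1), by omega⟩
    have h1 := gaussBinom_reflect hq n p s t ht
    have h2 : e * gaussBinom q⁻¹ (n + p) n * arcCoeff q (e - 1 - (n + p)) s =
        e * (arcCoeff q (e - 1 - n) s * arcCoeff q (e - 1 - p) (s + n)) := by
      simp only [arcCoeff]
      rw [show e - 1 - (n + p) = s + t by omega, show e - 1 - n = p + s + t by omega,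
        show e - 1 - p = n + s + t by omega]
      linear_combination (-(e : k) * ((-1) ^ s * q ^ ((s + 1).choose 2))) * h1
    have h3 := congrArg (algebraMap k A) h2
    simp only [map_mul] at h3 ⊢
    rw [mul_pow, pow_add]
    linear_combination (algebraMap k A (rootPow q ((s : ZMod e) * j)) * z ^ s * w ^ s * w ^ n) * h3

/-- The case of `sum_arc_mul_arc` in which the coordinates `n` and `p` add up with a carry; then the
sum vanishes. -/
theorem sum_arc_mul_arc_eq_zero (hq : IsPrimitiveRoot q e) (j : ZMod e) (n p : ℕ) (hn : n < e)
    (hp : p < e) (h : e ≤ n + p) (z w : A) :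
    ∑ l : ZMod e, algebraMap k A (rootPow q ((n : ZMod e) * (l - j))) * arc q l (e - 1 - n) z *
        arc q (j - l) (e - 1 - p) w = 0 := by
  rw [sum_arc_mul_arc_aux hq j n p hn hp]
  refine sum_eq_zero fun s _ => if_neg ?_
  rw [mem_range]
  omega

end Arc

open Finset

namespace DData

noncomputable section

/-! ### Arithmetic of a fraction of `m` -/

/-- The standing assumptions on the data `m`, `d`, `m̲`, `γ`, `ξ`. -/
class IsAdmissible {k : Type u} [Field k] (P : DData k) : Prop where
  m_pos : 0 < P.m
  d_pos : 0 < P.d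
  fraction : IsFraction P.m P.M
  two_dvd : 2 ∣ P.N * P.d
  gamma : IsPrimitiveRoot P.γ P.m
  xi_sq : ∀ i, P.ξ i ^ 2 = P.γ ^ P.M i
  xi : ∀ i, IsPrimitiveRoot (P.ξ i) (2 * P.e i)

variable {k : Type u} [Field k] (P : DData k) [hP : P.IsAdmissible]

instance : NeZero P.m := ⟨hP.m_pos.ne'⟩

theorem e_spec (i : Fin P.θ) : 0 < P.e i ∧ P.m ∣ P.e i * P.M i :=
  Nat.sInf_mem (s := {n : ℕ | 0 < n ∧ P.m ∣ n * P.M i}) ⟨P.m, hP.m_pos, dvd_mul_right _ _⟩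

theorem e_pos (i : Fin P.θ) : 0 < P.e i := (P.e_spec i).1

instance (i : Fin P.θ) : NeZero (P.e i) := ⟨(P.e_pos i).ne'⟩

theorem dvd_mul_M_iff (i : Fin P.θ) (n : ℕ) : P.m ∣ n * P.M i ↔ P.e i ∣ n := by
  constructor
  · intro hn
    by_contra hd
    have h1 : 0 < n % P.e i := Nat.pos_of_ne_zero fun h => hd (Nat.dvd_of_mod_eq_zero h)
    have h2 : P.m ∣ n % P.e i * P.M i := by
      have h3 : n * P.M i = n % P.e i * P.M i + P.e i * P.M i * (n / P.e i) := by
        conv_lhs => rw [← Nat.mod_add_div n (P.e i)]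
        ring
      rw [h3] at hn
      exact (Nat.dvd_add_left ((P.e_spec i).2.mul_right _)).1 hn
    have h4 : P.e i ≤ n % P.e i := Nat.sInf_le ⟨h1, h2⟩
    exact absurd (Nat.mod_lt n (P.e_pos i)) (not_lt.2 h4)
  · rintro ⟨c, rfl⟩
    rw [mul_assoc, mul_comm c, ← mul_assoc]
    exact (P.e_spec i).2.mul_right c

theorem M_mul_M {i l : Fin P.θ} (hil : i ≠ l) : (P.M i : ZMod P.m) * (P.M l : ZMod P.m) = 0 := by
  rw [← Nat.cast_mul, ZMod.natCast_eq_zero_iff]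
  exact hP.fraction.dvd_mul i l hil

theorem gamma_pow_M (i : Fin P.θ) : IsPrimitiveRoot (P.γ ^ P.M i) (P.e i) := by
  refine ⟨?_, fun n hn => ?_⟩
  · rw [← pow_mul, mul_comm, hP.gamma.pow_eq_one_iff_dvd]
    exact (P.e_spec i).2
  · rw [← pow_mul, mul_comm, hP.gamma.pow_eq_one_iff_dvd] at hn
    exact (P.dvd_mul_M_iff i n).1 hn

omit hP in
theorem γi_inv (i : Fin P.θ) : (P.γi i)⁻¹ = P.γ ^ (P.M i ^ 2) := by
  rw [γi, zpow_neg, inv_inv]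
  exact_mod_cast rfl

theorem γi_primitive (i : Fin P.θ) : IsPrimitiveRoot (P.γi i) (P.e i) := by
  have h1 := (P.gamma_pow_M i).pow_of_coprime (P.M i) (hP.fraction.coprime i).symm
  rw [← pow_mul, ← sq, ← γi_inv] at h1
  simpa using h1.inv

/-- The root of unity `γ ^ a` for a residue `a` modulo `m`. -/
def chi (a : ZMod P.m) : k := rootPow P.γ a

omit hP in
theorem chi_zero : P.chi 0 = 1 := rootPow_zero

theorem chi_add (a b : ZMod P.m) : P.chi (a + b) = P.chi a * P.chi b :=
  rootPow_add hP.gamma.pow_eq_one a b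
theorem chi_neg (a : ZMod P.m) : P.chi (-a) = (P.chi a)⁻¹ := rootPow_neg hP.gamma.pow_eq_one a
theorem chi_ne_zero (a : ZMod P.m) : P.chi a ≠ 0 := rootPow_ne_zero hP.gamma.pow_eq_one a
theorem chi_natCast (n : ℕ) : P.chi n = P.γ ^ n := rootPow_natCast hP.gamma.pow_eq_one n
theorem chi_natCast_mul (t : ℕ) (a : ZMod P.m) : P.chi (t * a) = P.chi a ^ t :=
  rootPow_natCast_mul hP.gamma.pow_eq_one t a
theorem chi_sum {ι : Type*} (s : Finset ι) (f : ι → ZMod P.m) :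
    P.chi (∑ i ∈ s, f i) = ∏ i ∈ s, P.chi (f i) := rootPow_sum hP.gamma.pow_eq_one s f
omit hP in
theorem chi_val (a : ZMod P.m) : P.γ ^ a.val = P.chi a := rfl

theorem chi_mul_chi_neg (a : ZMod P.m) : P.chi a * P.chi (-a) = 1 := by
  rw [← chi_add, add_neg_cancel, chi_zero]

theorem chi_intCast (n : ℤ) : P.chi n = P.γ ^ n := by
  obtain ⟨n, rfl | rfl⟩ := n.eq_nat_or_neg
  · rw [Int.cast_natCast, chi_natCast, zpow_natCast]
  · rw [Int.cast_neg, Int.cast_natCast, chi_neg, chi_natCast, zpow_neg, zpow_natCast]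

/-- The coordinate `j_i`, as a residue modulo `e_i`. -/
def zcoord (j : ZMod P.m) (i : Fin P.θ) : ZMod (P.e i) := (P.coord j i : ZMod (P.e i))

theorem coord_lt (j : ZMod P.m) (i : Fin P.θ) : P.coord j i < P.e i :=
  (hP.fraction.coord_spec hP.m_pos j).1 i

theorem sum_coord (j : ZMod P.m) : ∑ i, (P.coord j i : ZMod P.m) * (P.M i : ZMod P.m) = j := by
  have := (hP.fraction.coord_spec hP.m_pos j).2
  push_cast at this
  exact this

theorem zcoord_val (j : ZMod P.m) (i : Fin P.θ) : (P.zcoord j i).val = P.coord j i :=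
  ZMod.val_cast_of_lt (P.coord_lt j i)

omit [Field k] hP in
theorem coord_natCast (j : ZMod P.m) (i : Fin P.θ) : (P.coord j i : ZMod (P.e i)) = P.zcoord j i :=
  rfl

theorem natCast_mul_M_congr (i : Fin P.θ) {n p : ℕ} (hnp : (n : ZMod (P.e i)) = p) :
    (n : ZMod P.m) * (P.M i : ZMod P.m) = p * P.M i := by
  rw [ZMod.natCast_eq_natCast_iff] at hnp
  wlog hle : n ≤ p generalizing n p
  · exact (this hnp.symm (by omega)).symm
  obtain ⟨r, rfl⟩ := Nat.exists_eq_add_of_le hle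
  have h1 : P.e i ∣ r := by simpa using (Nat.modEq_iff_dvd' hle).1 hnp
  have h2 := (P.dvd_mul_M_iff i r).2 h1
  rw [← ZMod.natCast_eq_zero_iff] at h2
  push_cast at h2 ⊢
  rw [add_mul, h2, add_zero]

theorem coord_eq_of_sum {j : ZMod P.m} (a : Fin P.θ → ℕ) (ha : ∀ i, a i < P.e i)
    (hj : ∑ i, (a i : ZMod P.m) * (P.M i : ZMod P.m) = j) : P.coord j = a := by
  refine hP.fraction.unique _ _ (P.coord_lt j) ha ?_
  rw [← ZMod.natCast_eq_natCast_iff]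
  push_cast
  rw [hj, sum_coord]

theorem zcoord_eq_of_sum {j : ZMod P.m} (a : Fin P.θ → ℕ)
    (hj : ∑ i, (a i : ZMod P.m) * (P.M i : ZMod P.m) = j) (i : Fin P.θ) :
    P.zcoord j i = (a i : ZMod (P.e i)) := by
  have h1 : P.coord j = fun i => a i % P.e i := by
    refine P.coord_eq_of_sum _ (fun i => Nat.mod_lt _ (P.e_pos i)) ?_
    rw [← hj]
    exact sum_congr rfl fun i _ => P.natCast_mul_M_congr i (ZMod.natCast_mod _ _)
  rw [zcoord, h1, ZMod.natCast_mod]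

theorem zcoord_add (j l : ZMod P.m) (i : Fin P.θ) :
    P.zcoord (j + l) i = P.zcoord j i + P.zcoord l i := by
  rw [P.zcoord_eq_of_sum (fun i => P.coord j i + P.coord l i)]
  · push_cast; rfl
  · push_cast
    simp_rw [add_mul, sum_add_distrib, sum_coord]

theorem zcoord_zero (i : Fin P.θ) : P.zcoord 0 i = 0 := by
  rw [P.zcoord_eq_of_sum (fun _ => 0)] <;> simp

theorem zcoord_neg (j : ZMod P.m) (i : Fin P.θ) : P.zcoord (-j) i = -P.zcoord j i := by
  refine eq_neg_of_add_eq_zero_left ?_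
  rw [← zcoord_add, neg_add_cancel, zcoord_zero]

theorem zcoord_sub (j l : ZMod P.m) (i : Fin P.θ) :
    P.zcoord (j - l) i = P.zcoord j i - P.zcoord l i := by
  rw [sub_eq_add_neg, zcoord_add, zcoord_neg, ← sub_eq_add_neg]

theorem zcoord_M (i l : Fin P.θ) : P.zcoord (P.M i : ZMod P.m) l = if l = i then 1 else 0 := by
  rw [P.zcoord_eq_of_sum (fun l => if l = i then 1 else 0)]
  · split_ifs <;> simp
  · simp

theorem zcoord_M_self (i : Fin P.θ) : P.zcoord (P.M i : ZMod P.m) i = 1 := by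
  rw [zcoord_M, if_pos rfl]

theorem zcoord_M_ne {i l : Fin P.θ} (hil : l ≠ i) : P.zcoord (P.M i : ZMod P.m) l = 0 := by
  rw [zcoord_M, if_neg hil]

theorem coord_zero (i : Fin P.θ) : P.coord 0 i = 0 := by
  rw [← zcoord_val, zcoord_zero, ZMod.val_zero]

theorem zcoord_injective : Function.Injective P.zcoord := by
  intro j l hjl
  rw [← P.sum_coord j, ← P.sum_coord l]
  refine sum_congr rfl fun i _ => P.natCast_mul_M_congr i ?_
  exact congrFun hjl i

theorem coord_injective : Function.Injective P.coord := by
  intro j l hjl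
  rw [← P.sum_coord j, ← P.sum_coord l, hjl]

/-- The coordinates identify `ZMod m` with the product of the `ZMod e_i`. -/
def zcoordEquiv : ZMod P.m ≃ ∀ i, ZMod (P.e i) :=
  Equiv.ofBijective P.zcoord <| by
    rw [Fintype.bijective_iff_injective_and_card]
    refine ⟨P.zcoord_injective, ?_⟩
    rw [Fintype.card_pi, ZMod.card]
    simp only [ZMod.card]
    exact hP.fraction.prod_eq

/-- A sum over `ZMod m` of a product over the coordinates is a product of local sums. -/
theorem sum_prod_zcoord {A : Type*} [CommSemiring A] (f : ∀ i, ZMod (P.e i) → A) :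
    ∑ j : ZMod P.m, ∏ i, f i (P.zcoord j i) = ∏ i, ∑ a : ZMod (P.e i), f i a := by
  rw [prod_univ_sum, Fintype.piFinset_univ]
  exact Fintype.sum_equiv P.zcoordEquiv _ _ fun _ => rfl

theorem chi_M_mul (i : Fin P.θ) (j : ZMod P.m) :
    P.chi (P.M i * j) = rootPow (P.γi i) (-P.zcoord j i) := by
  have h1 : (P.M i : ZMod P.m) * j = ((P.coord j i * P.M i ^ 2 : ℕ) : ZMod P.m) := by
    conv_lhs => rw [← P.sum_coord j, mul_sum]
    rw [sum_eq_single i]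
    · push_cast; ring
    · intro l _ hl
      rw [mul_left_comm, P.M_mul_M hl.symm, mul_zero]
    · simp
  rw [h1, chi_natCast, mul_comm, pow_mul, ← γi_inv, rootPow_neg (P.γi_primitive i).pow_eq_one,
    rootPow, zcoord_val, inv_pow]

theorem chi_mul (j l : ZMod P.m) :
    P.chi (j * l) = ∏ i, rootPow (P.γi i) (-(P.zcoord j i * P.zcoord l i)) := by
  conv_lhs => rw [← P.sum_coord j, sum_mul, chi_sum]
  refine prod_congr rfl fun i _ => ?_
  have h1 := (P.γi_primitive i).pow_eq_one
  rw [mul_assoc, chi_natCast_mul, chi_M_mul, ← rootPow_natCast_mul h1, coord_natCast, mul_neg]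

theorem chi_eq_prod (j : ZMod P.m) : P.chi j = ∏ i, (P.γ ^ P.M i) ^ P.coord j i := by
  conv_lhs => rw [← P.sum_coord j, chi_sum]
  refine prod_congr rfl fun i _ => ?_
  rw [chi_natCast_mul, chi_natCast]

/-! ### The scalars in the products `u_j u_l` and in the antipode -/

/-- The local factor of the scalar in `u_j u_l`, as a function of a natural number. -/
def scalN (i : Fin P.θ) (n : ℕ) : k :=
  (-1) ^ n * (P.ξ i)⁻¹ ^ n * (P.γi i)⁻¹ ^ ((n + 1).choose 2)

theorem xi_ne_zero (i : Fin P.θ) : P.ξ i ≠ 0 :=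
  (hP.xi i).ne_zero (by have := P.e_pos i; omega)

theorem xi_pow_e (i : Fin P.θ) : P.ξ i ^ P.e i = -1 := by
  have h1 : (P.ξ i ^ P.e i) ^ 2 = 1 := by rw [← pow_mul, mul_comm, (hP.xi i).pow_eq_one]
  refine (by simpa using h1 : P.ξ i ^ P.e i = 1 ∨ P.ξ i ^ P.e i = -1).resolve_left fun h => ?_
  have h2 := Nat.le_of_dvd (P.e_pos i) ((hP.xi i).dvd_of_pow_eq_one _ h)
  have := P.e_pos i
  omega

theorem γi_ne_zero (i : Fin P.θ) : P.γi i ≠ 0 := (P.γi_primitive i).ne_zero (P.e_pos i).ne'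

omit hP in
theorem scalN_add (i : Fin P.θ) (n p : ℕ) :
    P.scalN i (n + p) = P.scalN i n * P.scalN i p * (P.γi i)⁻¹ ^ (n * p) := by
  have h1 : (n + p + 1).choose 2 = (n + 1).choose 2 + (p + 1).choose 2 + n * p := by
    induction p with
    | zero => simp
    | succ p ih => rw [← add_assoc, choose_succ_two (n + p + 1), ih, choose_succ_two (p + 1)]; ring
  simp only [scalN, h1, pow_add]
  ring

theorem scalN_e (i : Fin P.θ) : P.scalN i (P.e i) = 1 := by
  have h1 := pow_choose_order (P.γi_primitive i).inv (P.e_pos i)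
  have h2 := (P.γi_primitive i).inv.pow_eq_one
  obtain ⟨e', he⟩ : ∃ e', P.e i = e' + 1 := ⟨P.e i - 1, by have := P.e_pos i; omega⟩
  rw [scalN, inv_pow, P.xi_pow_e, choose_succ_two, pow_add, h2]
  rw [he] at h1 ⊢
  rw [Nat.add_sub_cancel] at h1
  rw [pow_succ]
  have h3 : ((-1 : k))⁻¹ = -1 := by norm_num
  rw [h3]
  linear_combination h1

theorem scalN_add_e (i : Fin P.θ) (n : ℕ) : P.scalN i (n + P.e i) = P.scalN i n := by
  rw [scalN_add, scalN_e, mul_one, mul_comm n, pow_mul, (P.γi_primitive i).inv.pow_eq_one, one_pow,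
    mul_one]

theorem scalN_mod (i : Fin P.θ) (n : ℕ) : P.scalN i (n % P.e i) = P.scalN i n := by
  conv_rhs => rw [← Nat.mod_add_div n (P.e i)]
  generalize n / P.e i = c
  induction c with
  | zero => rw [mul_zero, add_zero]
  | succ c ih => rw [mul_add, mul_one, ← add_assoc, scalN_add_e, ih]

/-- The scalar of `u_j u_l`, without the factor `1 / m`. -/
def scal (l : ZMod P.m) : k := ∏ i, P.scalN i (P.coord l i)

theorem scal_add (a b : ZMod P.m) : P.scal (a + b) = P.scal a * P.scal b * P.chi (a * b) := by
  rw [scal, scal, scal, chi_mul, ← prod_mul_distrib, ← prod_mul_distrib]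
  refine prod_congr rfl fun i _ => ?_
  have h1 := (P.γi_primitive i).pow_eq_one
  have h2 : P.coord (a + b) i = (P.coord a i + P.coord b i) % P.e i := by
    rw [← zcoord_val, zcoord_add, ZMod.val_add, zcoord_val, zcoord_val]
  rw [h2, scalN_mod, scalN_add, rootPow_neg h1, ← coord_natCast, rootPow_natCast_mul h1, rootPow,
    zcoord_val, ← pow_mul, inv_pow, mul_comm (P.coord b i)]

omit hP in
theorem scalN_zero (i : Fin P.θ) : P.scalN i 0 = 1 := by simp [scalN]

theorem scal_zero : P.scal 0 = 1 := prod_eq_one fun i _ => by rw [coord_zero, scalN_zero]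

theorem scal_ne_zero (a : ZMod P.m) : P.scal a ≠ 0 := by
  refine prod_ne_zero_iff.2 fun i _ => ?_
  exact mul_ne_zero (mul_ne_zero (pow_ne_zero _ (by simp))
    (pow_ne_zero _ (inv_ne_zero (P.xi_ne_zero i)))) (pow_ne_zero _ (inv_ne_zero (P.γi_ne_zero i)))

theorem choose_eq_div (n : ℕ) : (n + 1).choose 2 = n * (n + 1) / 2 := by
  rw [Nat.choose_two_right, Nat.add_sub_cancel, mul_comm]

omit hP in
theorem scalN_eq (i : Fin P.θ) (n : ℕ) : P.scalN i n =
    (-1) ^ n * (P.ξ i)⁻¹ ^ n * P.γ ^ (P.M i ^ 2 * (n * (n + 1) / 2)) := by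
  rw [scalN, γi_inv, choose_eq_div, ← pow_mul]

omit hP in
theorem uuScalar_eq (l : ZMod P.m) : P.uuScalar l = (P.m : k)⁻¹ * P.scal l := by
  simp only [uuScalar, scal, scalN_eq]

/-- The scalar in the antipode of `u_j`. -/
def antiScal (j : ZMod P.m) : k :=
  ∏ i, ((-1) ^ P.coord j i * (P.γ ^ (P.M i ^ 2 * (P.coord j i * (P.coord j i + 1) / 2)))⁻¹ *
    (P.ξ i)⁻¹ ^ P.coord j i)

theorem antiScal_mul_scal (j : ZMod P.m) : P.antiScal j * P.scal j = P.chi (-j) := by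
  rw [chi_neg, chi_eq_prod, antiScal, scal, ← prod_mul_distrib, ← prod_inv_distrib]
  refine prod_congr rfl fun i _ => ?_
  rw [scalN_eq]
  have h1 : P.γ ^ (P.M i ^ 2 * (P.coord j i * (P.coord j i + 1) / 2)) ≠ 0 :=
    pow_ne_zero _ (hP.gamma.ne_zero hP.m_pos.ne')
  have h2 := P.xi_ne_zero i
  rw [← hP.xi_sq i]
  generalize P.coord j i = n at *
  generalize P.γ ^ (P.M i ^ 2 * (n * (n + 1) / 2)) = y at *
  have h3 : (-1 : k) ^ n * (-1) ^ n = 1 := by rw [← mul_pow]; simp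
  rw [← pow_mul, mul_comm 2 n, pow_mul, sq]
  calc _ = ((-1 : k) ^ n * (-1) ^ n) * (y⁻¹ * y) * ((P.ξ i)⁻¹ ^ n * (P.ξ i)⁻¹ ^ n) := by ring
    _ = _ := by rw [h3, inv_mul_cancel₀ h1, inv_pow, mul_inv]; ring

/-! ### The polynomials `φ` and `]s, t[` -/

theorem phi_eq_arc (i : Fin P.θ) (a : ℕ) :
    P.phi i a = arc (P.γi i) (a : ZMod (P.e i)) 1 (Polynomial.X ^ (P.M i * P.d)) := by
  have h1 := (P.γi_primitive i).pow_eq_one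
  rw [phi, arc_one, ← rootPow_natCast (n := P.e i) h1]
  push_cast
  rfl

theorem prod_Ico_phi (i : Fin P.θ) {a b : ℕ} :
    ∏ t ∈ Ico a b, P.phi i t =
      arc (P.γi i) (a : ZMod (P.e i)) (b - a) (Polynomial.X ^ (P.M i * P.d)) := by
  rw [prod_Ico_eq_prod_range]
  refine prod_congr rfl fun t _ => ?_
  rw [phi_eq_arc, arc_one]
  push_cast
  rw [add_assoc]

/-- The polynomial `]-1 - b, a - 1[` is the arc that starts at `a` and has length
`e - 1 - (a + b mod e)`. -/
theorem omitted_eq_arc (i : Fin P.θ) {a b : ℕ} (ha : a < P.e i) (hb : b < P.e i) :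
    P.omitted i (-1 - (b : ℤ)) ((a : ℤ) - 1) =
      arc (P.γi i) (a : ZMod (P.e i)) (P.e i - 1 - (a + b) % P.e i)
        (Polynomial.X ^ (P.M i * P.d)) := by
  have he := P.e_pos i
  have hs : ((-1 - (b : ℤ)) % (P.e i : ℤ)).toNat = P.e i - 1 - b := by
    have : (-1 - (b : ℤ)) % (P.e i : ℤ) = ((P.e i - 1 - b : ℕ) : ℤ) := by
      rw [← Int.add_mul_emod_self_right _ 1, one_mul, Int.emod_eq_of_lt] <;> omega
    rw [this, Int.toNat_natCast]
  have hcyc : ((P.e i : ℕ) : ZMod (P.e i)) = ((0 : ℕ) : ZMod (P.e i)) := by simp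
  have h0 := prod_Ico_phi P i (a := 0) (b := P.e i - 1 - b)
  rw [← range_eq_Ico, Nat.sub_zero] at h0
  rcases Nat.eq_zero_or_pos a with rfl | ha0
  · have ht : (((0 : ℕ) : ℤ) - 1) % (P.e i : ℤ) = ((P.e i - 1 : ℕ) : ℤ) := by
      rw [← Int.add_mul_emod_self_right _ 1, one_mul, Int.emod_eq_of_lt] <;> push_cast <;> omega
    rw [omitted, ht, Int.toNat_natCast, hs, if_pos (by omega), Nat.sub_add_cancel he, Ico_self,
      prod_empty, one_mul, h0, zero_add, Nat.mod_eq_of_lt hb]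
  · have ht : ((a : ℤ) - 1) % (P.e i : ℤ) = ((a - 1 : ℕ) : ℤ) := by
      rw [Int.emod_eq_of_lt] <;> omega
    rw [omitted, ht, Int.toNat_natCast, hs, Nat.sub_add_cancel ha0]
    split_ifs with hle
    · rw [prod_Ico_phi P i, h0, ← hcyc]
      have h2 : (a + b) % P.e i = a + b - P.e i := by
        rw [Nat.mod_eq_sub_mod (by omega), Nat.mod_eq_of_lt (by omega)]
      have h3 : P.e i - 1 - (a + b) % P.e i = (P.e i - a) + (P.e i - 1 - b) := by omega
      rw [h3, arc_add]
      congr 2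
      rw [← Nat.cast_add, Nat.add_sub_cancel' ha.le]
    · rw [prod_Ico_phi P i, Nat.mod_eq_of_lt (by omega)]
      congr 1
      omega

theorem coord_add (j l : ZMod P.m) (i : Fin P.θ) :
    P.coord (j + l) i = (P.coord j i + P.coord l i) % P.e i := by
  rw [← zcoord_val, zcoord_add, ZMod.val_add, zcoord_val, zcoord_val]

theorem uuPoly_eq (j l : ZMod P.m) : P.uuPoly j l =
    ∏ i, arc (P.γi i) (P.zcoord j i) (P.e i - 1 - P.coord (j + l) i)
      (Polynomial.X ^ (P.M i * P.d)) := by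
  refine prod_congr rfl fun i _ => ?_
  rw [P.omitted_eq_arc i (P.coord_lt j i) (P.coord_lt l i), coord_add]
  rfl

/-- Half of `N d`, the integer that governs the powers of `x` in the products `u_j u_l`. -/
def halfNd : ℕ := P.N * P.d / 2

theorem two_mul_halfNd : 2 * P.halfNd = P.N * P.d := Nat.mul_div_cancel' hP.two_dvd

theorem uuExp_eq : P.uuExp = -(P.d + P.halfNd : ℕ) := by
  have h1 := P.two_mul_halfNd
  have h2 : (2 + P.N) * P.d = 2 * (P.d + P.halfNd) := by rw [mul_add, h1]; ring
  rw [uuExp, h2, Nat.mul_div_cancel_left _ (by norm_num)]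

end

end DData

open Finset
open scoped LaurentPolynomial

/-! ### Laurent polynomials and commuting families in a noncommutative algebra -/

section Aux

variable {k : Type*} [Field k] {A B : Type*} [Semiring A] [Algebra k A] [Semiring B] [Algebra k B]

/-- Evaluation of Laurent polynomials at a unit. -/
noncomputable def laurentEval (x : Aˣ) : k[T;T⁻¹] →ₐ[k] A :=
  AddMonoidAlgebra.lift k A ℤ ((Units.coeHom A).comp (zpowersHom Aˣ x))

theorem laurentEval_T (x : Aˣ) (n : ℤ) :
    laurentEval x (LaurentPolynomial.T n : k[T;T⁻¹]) = ((x ^ n : Aˣ) : A) := by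
  rw [laurentEval, LaurentPolynomial.T, AddMonoidAlgebra.lift_single, one_smul]
  simp

theorem laurent_induction {p : k[T;T⁻¹] → Prop} (add : ∀ f g, p f → p g → p (f + g))
    (T : ∀ (c : k) n, p (c • LaurentPolynomial.T n)) (f : k[T;T⁻¹]) : p f := by
  induction f using LaurentPolynomial.induction_on' with
  | add f g hf hg => exact add f g hf hg
  | C_mul_T n a => rw [← LaurentPolynomial.smul_eq_C_mul]; exact T a n

theorem laurent_algHom_ext {f g : k[T;T⁻¹] →ₐ[k] A}
    (h : f (LaurentPolynomial.T 1) = g (LaurentPolynomial.T 1)) : f = g := by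
  have h' : f (LaurentPolynomial.T (-1)) = g (LaurentPolynomial.T (-1)) := by
    have h1 : f (LaurentPolynomial.T (-1)) * f (LaurentPolynomial.T 1) = 1 := by
      rw [← map_mul, ← LaurentPolynomial.T_add]; simp
    have h2 : g (LaurentPolynomial.T 1) * g (LaurentPolynomial.T (-1)) = 1 := by
      rw [← map_mul, ← LaurentPolynomial.T_add]; simp
    rw [h] at h1
    exact left_inv_eq_right_inv h1 h2
  have h'' : ∀ n : ℕ, f (LaurentPolynomial.T n) = g (LaurentPolynomial.T n) ∧
      f (LaurentPolynomial.T (-n)) = g (LaurentPolynomial.T (-n)) := by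
    intro n
    have h1 : (LaurentPolynomial.T n : k[T;T⁻¹]) = LaurentPolynomial.T 1 ^ n := by
      rw [LaurentPolynomial.T_pow, mul_one]
    have h2 : (LaurentPolynomial.T (-n) : k[T;T⁻¹]) = LaurentPolynomial.T (-1) ^ n := by
      rw [LaurentPolynomial.T_pow, mul_neg_one]
    rw [h1, h2, map_pow, map_pow, map_pow, map_pow, h, h']
    exact ⟨rfl, rfl⟩
  refine AlgHom.ext fun p => ?_
  induction p using laurent_induction with
  | add p p' h1 h2 => rw [map_add, map_add, h1, h2]
  | T c n =>
  rw [map_smul, map_smul]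
  congr 1
  obtain ⟨n, rfl | rfl⟩ := n.eq_nat_or_neg
  · exact (h'' n).1
  · exact (h'' n).2

theorem commute_laurentEval {x : Aˣ} {a : A} (h : Commute (x : A) a) (f : k[T;T⁻¹]) :
    Commute (laurentEval x f) a := by
  induction f using laurent_induction with
  | add f g hf hg => rw [map_add]; exact hf.add_left hg
  | T c n => rw [map_smul, laurentEval_T]; exact (h.units_zpow_left n).smul_left c

theorem laurentEval_mul_of_mul_inv {x : Aˣ} {a : A} (h : (x : A) * a = a * ((x⁻¹ : Aˣ) : A))
    (f : k[T;T⁻¹]) : laurentEval x f * a = a * laurentEval x (LaurentPolynomial.invert f) := by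
  have h1 : SemiconjBy a ((x⁻¹ : Aˣ) : A) (x : A) := h.symm
  induction f using laurent_induction with
  | add f g hf hg => rw [map_add, map_add, map_add, add_mul, mul_add, hf, hg]
  | T c n =>
    have h2 := h1.units_zpow_right n
    rw [map_smul, map_smul, map_smul, laurentEval_T, LaurentPolynomial.invert_T, laurentEval_T,
      smul_mul_assoc, mul_smul_comm, ← h2.eq, inv_zpow, zpow_neg]

/-- A commuting family of elements extends to a homomorphism from a polynomial ring. -/
theorem exists_mvPolynomial_hom {n : ℕ} (y : Fin n → A) (h : ∀ i l, Commute (y i) (y l)) :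
    ∃ Y : MvPolynomial (Fin n) k →ₐ[k] A, ∀ i, Y (MvPolynomial.X i) = y i := by
  have hc : ∀ a ∈ Set.range y, ∀ b ∈ Set.range y, a * b = b * a := by
    rintro _ ⟨i, rfl⟩ _ ⟨l, rfl⟩
    exact h i l
  have := Algebra.isMulCommutative_adjoin k hc
  let _ : CommSemiring (Algebra.adjoin k (Set.range y)) :=
    { (inferInstance : Semiring (Algebra.adjoin k (Set.range y))) with mul_comm := mul_comm' }
  let y' : Fin n → Algebra.adjoin k (Set.range y) := fun i =>
    ⟨y i, Algebra.subset_adjoin (Set.mem_range_self i)⟩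
  refine ⟨(Algebra.adjoin k (Set.range y)).val.comp (MvPolynomial.aeval y'), fun i => ?_⟩
  simp [y']

/-- The ordered monomial `y_1 ^ a_1 ⋯ y_n ^ a_n`. -/
def listMon {n : ℕ} (y : Fin n → A) (a : Fin n → ℕ) : A := (List.ofFn fun i => y i ^ a i).prod

theorem map_listMon {n : ℕ} (f : A →ₐ[k] B) (y : Fin n → A) (a : Fin n → ℕ) :
    f (listMon y a) = listMon (fun i => f (y i)) a := by
  rw [listMon, map_list_prod, List.map_ofFn, listMon]
  congr 2
  funext i
  simp

theorem listMon_eq_prod {n : ℕ} {C : Type*} [CommSemiring C] (y : Fin n → C) (a : Fin n → ℕ) :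
    listMon y a = ∏ i, y i ^ a i := by
  rw [listMon, List.prod_ofFn]

theorem listMon_add (k : Type*) {A : Type*} [Field k] [Semiring A] [Algebra k A] {n : ℕ} {y : Fin n → A} (h : ∀ i l, Commute (y i) (y l)) (a b : Fin n → ℕ) :
    listMon y (a + b) = listMon y a * listMon y b := by
  obtain ⟨Y, hY⟩ := exists_mvPolynomial_hom (k := k) y h
  obtain rfl : (fun i => Y (MvPolynomial.X i)) = y := funext hY
  rw [← map_listMon, ← map_listMon, ← map_listMon, ← map_mul, listMon_eq_prod, listMon_eq_prod,
    listMon_eq_prod, ← prod_mul_distrib]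
  simp_rw [Pi.add_apply, pow_add]

theorem mul_listMon (k : Type*) {A : Type*} [Field k] [Semiring A] [Algebra k A] {n : ℕ} {y : Fin n → A} (h : ∀ i l, Commute (y i) (y l)) (i : Fin n)
    (a : Fin n → ℕ) : y i * listMon y a = listMon y (a + Pi.single i 1) := by
  rw [add_comm, listMon_add k h]
  congr 1
  obtain ⟨Y, hY⟩ := exists_mvPolynomial_hom (k := k) y h
  obtain rfl : (fun i => Y (MvPolynomial.X i)) = y := funext hY
  rw [← map_listMon, listMon_eq_prod, prod_eq_single i]
  · simp
  · intro l _ hl; simp [Pi.single_eq_of_ne hl]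
  · simp

theorem listMon_zero {n : ℕ} (y : Fin n → A) : listMon y 0 = 1 := by
  simp [listMon, List.ofFn_const]

theorem list_prod_semiconj {n : ℕ} (y y' : Fin n → A) (a : A)
    (h : ∀ i, a * y i = y' i * a) : a * (List.ofFn y).prod = (List.ofFn y').prod * a := by
  induction n with
  | zero => simp
  | succ n ih =>
    rw [List.ofFn_succ, List.ofFn_succ, List.prod_cons, List.prod_cons, ← mul_assoc, h, mul_assoc,
      ih _ _ (fun i => h i.succ), mul_assoc]

theorem list_prod_smul {n : ℕ} (c : Fin n → k) (y : Fin n → A) :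
    (List.ofFn fun i => c i • y i).prod = (∏ i, c i) • (List.ofFn y).prod := by
  induction n with
  | zero => simp
  | succ n ih =>
    rw [List.ofFn_succ, List.ofFn_succ, List.prod_cons, List.prod_cons, ih, Fin.prod_univ_succ,
      smul_mul_smul_comm]

theorem list_prod_mul {n : ℕ} (y z : Fin n → A) (h : ∀ i l, i ≠ l → Commute (y i) (z l)) :
    (List.ofFn fun i => y i * z i).prod = (List.ofFn y).prod * (List.ofFn z).prod := by
  induction n with
  | zero => simp
  | succ n ih =>
    rw [List.ofFn_succ, List.ofFn_succ, List.ofFn_succ, List.prod_cons, List.prod_cons,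
      List.prod_cons, ih _ _ (fun i l hil => h i.succ l.succ (by simpa using hil))]
    have h1 : z 0 * (List.ofFn fun i : Fin n => y i.succ).prod =
        (List.ofFn fun i : Fin n => y i.succ).prod * z 0 :=
      list_prod_semiconj _ _ _ fun i => ((h i.succ 0 (Fin.succ_ne_zero i)).eq).symm
    rw [mul_assoc, ← mul_assoc (z 0), h1]
    simp only [mul_assoc]

/-- Distributivity for ordered products in a noncommutative algebra. -/
theorem list_prod_sum {n : ℕ} {ι : Type*} [DecidableEq ι] (s : Fin n → Finset ι)
    (f : Fin n → ι → A) : (List.ofFn fun i => ∑ a ∈ s i, f i a).prod =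
      ∑ p ∈ Fintype.piFinset s, (List.ofFn fun i => f i (p i)).prod := by
  induction n with
  | zero => simp
  | succ n ih =>
    rw [List.ofFn_succ, List.prod_cons, ih, sum_mul_sum, ← sum_product']
    refine sum_bij' (fun a _ => Fin.cons a.1 a.2) (fun p _ => (p 0, fun i => p i.succ)) ?_ ?_ ?_ ?_ ?_
    · intro a ha
      simp only [mem_product, Fintype.mem_piFinset] at ha ⊢
      intro i
      refine Fin.cases ?_ (fun i => ?_) i
      · exact ha.1
      · exact ha.2 i
    · intro p hp
      simp only [mem_product, Fintype.mem_piFinset] at hp ⊢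
      exact ⟨hp 0, fun i => hp i.succ⟩
    · intro a _; simp
    · intro p _
      funext i
      refine Fin.cases ?_ (fun i => ?_) i <;> simp
    · intro a _
      simp [List.ofFn_succ]

open scoped TensorProduct in
theorem list_prod_tmul {n : ℕ} (y : Fin n → A) (z : Fin n → B) :
    (List.ofFn fun i => y i ⊗ₜ[k] z i).prod = (List.ofFn y).prod ⊗ₜ[k] (List.ofFn z).prod := by
  induction n with
  | zero => simp [Algebra.TensorProduct.one_def]
  | succ n ih =>
    rw [List.ofFn_succ, List.ofFn_succ, List.ofFn_succ, List.prod_cons, List.prod_cons,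
      List.prod_cons, ih, Algebra.TensorProduct.tmul_mul_tmul]

end Aux

open Finset
open scoped LaurentPolynomial

namespace DData

noncomputable section

variable {k : Type u} [Field k] (P : DData k)

/-! ### Models of the presentation -/

/-- The element `x ^ (m_i d)` of the ring of Laurent polynomials. -/
def z (i : Fin P.θ) : k[T;T⁻¹] := LaurentPolynomial.T ((P.M i * P.d : ℕ) : ℤ)

/-- The Laurent polynomial `φ_{m_i, j}`. -/
def phiL (i : Fin P.θ) (j : ZMod P.m) : k[T;T⁻¹] := arc (P.γi i) (P.zcoord j i) 1 (P.z i)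

/-- The coefficient of `y_{j + l} h` in `u_j u_l`, where `h = g x ^ (-d)`. -/
def uuCoeff (j l : ZMod P.m) : k[T;T⁻¹] :=
  ((P.m : k)⁻¹ * P.scal l) • (LaurentPolynomial.T (-(P.halfNd : ℤ)) *
    ∏ i, arc (P.γi i) (P.zcoord j i) (P.e i - 1 - P.coord (j + l) i) (P.z i))

/-- A model of the presentation of `D` in an algebra `A`: elements that satisfy the defining
relations, in which `g` has been replaced by the element `h = g x ^ (-d)` of order `m`. -/
structure Model (A : Type*) [Semiring A] [Algebra k A] where
  x : Aˣ
  h : A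
  y : Fin P.θ → A
  u : ZMod P.m → A
  h_pow : h ^ P.m = 1
  x_h : Commute (x : A) h
  x_y : ∀ i, Commute (x : A) (y i)
  y_y : ∀ i l, Commute (y i) (y l)
  y_h : ∀ i, y i * h = P.chi (P.M i) • (h * y i)
  y_pow : ∀ i, y i ^ P.e i = laurentEval x (1 - P.z i ^ P.e i)
  x_u : ∀ j, (x : A) * u j = u j * ((x⁻¹ : Aˣ) : A)
  y_u : ∀ i j, y i * u j = laurentEval x (P.phiL i j) * u (j + P.M i)
  y_u' : ∀ i j, y i * u j = P.ξ i • (laurentEval x (P.z i) * u j * y i)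
  u_h : ∀ j, u j * h = P.chi j • (h * u j)
  u_u : ∀ j l, u j * u l = laurentEval x (P.uuCoeff j l) * listMon y (P.coord (j + l)) * h

variable {P}

namespace Model

variable {A B : Type*} [Semiring A] [Algebra k A] [Semiring B] [Algebra k B] (M : P.Model A)

/-- Laurent polynomials in `x`. -/
def X : k[T;T⁻¹] →ₐ[k] A := laurentEval M.x

theorem X_T (n : ℤ) : M.X (LaurentPolynomial.T n) = ((M.x ^ n : Aˣ) : A) := laurentEval_T _ _

/-- The power of `h` with exponent in `ZMod m`. -/
def hp (a : ZMod P.m) : A := M.h ^ a.val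

theorem X_mul_y (f : k[T;T⁻¹]) (i : Fin P.θ) : Commute (M.X f) (M.y i) :=
  commute_laurentEval (M.x_y i) f

theorem X_mul_h (f : k[T;T⁻¹]) : Commute (M.X f) M.h := commute_laurentEval M.x_h f

theorem X_mul_hp (f : k[T;T⁻¹]) (a : ZMod P.m) : Commute (M.X f) (M.hp a) :=
  (M.X_mul_h f).pow_right _

theorem X_mul_X (f g : k[T;T⁻¹]) : Commute (M.X f) (M.X g) := by
  rw [Commute, SemiconjBy, ← map_mul, ← map_mul, mul_comm]

theorem X_mul_u (f : k[T;T⁻¹]) (j : ZMod P.m) :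
    M.X f * M.u j = M.u j * M.X (LaurentPolynomial.invert f) :=
  laurentEval_mul_of_mul_inv (M.x_u j) f

theorem u_mul_X (f : k[T;T⁻¹]) (j : ZMod P.m) :
    M.u j * M.X f = M.X (LaurentPolynomial.invert f) * M.u j := by
  rw [X_mul_u]
  congr 2
  exact (LaurentPolynomial.involutive_invert f).symm

theorem X_mul_listMon (f : k[T;T⁻¹]) (a : Fin P.θ → ℕ) : Commute (M.X f) (listMon M.y a) := by
  refine list_prod_semiconj _ _ _ fun i => ?_
  exact (M.X_mul_y f i).pow_right _

theorem hp_zero : M.hp 0 = 1 := by simp [hp]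

theorem hp_natCast (n : ℕ) : M.hp n = M.h ^ n := by
  rw [hp, ZMod.val_natCast, ← pow_eq_pow_mod n M.h_pow]

variable [hP : P.IsAdmissible]

omit hP in
theorem hp_one : M.hp 1 = M.h := by simpa using M.hp_natCast 1

theorem hp_add (a b : ZMod P.m) : M.hp (a + b) = M.hp a * M.hp b := by
  rw [hp, ZMod.val_add, ← pow_eq_pow_mod _ M.h_pow, pow_add, hp, hp]

theorem hp_natCast_mul (n : ℕ) (a : ZMod P.m) : M.hp (n * a) = M.hp a ^ n := by
  induction n with
  | zero => simp [hp_zero]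
  | succ n ih => rw [Nat.cast_succ, add_mul, one_mul, hp_add, ih, pow_succ]

theorem hp_comm (a b : ZMod P.m) : Commute (M.hp a) (M.hp b) := by
  rw [Commute, SemiconjBy, ← hp_add, ← hp_add, add_comm]

theorem mul_h_pow {c : k} {a b : A} (h : a * b = c • (b * a)) (n : ℕ) :
    a * b ^ n = c ^ n • (b ^ n * a) := by
  induction n with
  | zero => simp
  | succ n ih =>
    rw [pow_succ b, ← mul_assoc, ih, smul_mul_assoc, mul_assoc, h, mul_smul_comm, smul_smul,
      pow_succ, mul_assoc]

theorem y_mul_hp (i : Fin P.θ) (a : ZMod P.m) :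
    M.y i * M.hp a = P.chi (P.M i * a) • (M.hp a * M.y i) := by
  rw [hp, mul_h_pow (M.y_h i), ← chi_natCast_mul, ZMod.natCast_zmod_val, mul_comm a]

theorem u_mul_hp (j a : ZMod P.m) : M.u j * M.hp a = P.chi (j * a) • (M.hp a * M.u j) := by
  rw [hp, mul_h_pow (M.u_h j), ← chi_natCast_mul, ZMod.natCast_zmod_val, mul_comm a]

theorem listMon_mul_hp (n : Fin P.θ → ℕ) (a : ZMod P.m) : listMon M.y n * M.hp a =
    P.chi ((∑ i, (n i : ZMod P.m) * P.M i) * a) • (M.hp a * listMon M.y n) := by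
  have h1 : ∀ i, M.hp a * M.y i ^ n i = (P.chi (-((n i : ZMod P.m) * P.M i * a)) • M.y i ^ n i) *
      M.hp a := by
    intro i
    have h2 : M.hp a * M.y i = P.chi (-(P.M i * a)) • (M.y i * M.hp a) := by
      rw [y_mul_hp, smul_smul, mul_comm, chi_mul_chi_neg, one_smul]
    rw [mul_h_pow h2, ← chi_natCast_mul, mul_neg, mul_assoc, smul_mul_assoc]
  have h3 := list_prod_semiconj (fun i => M.y i ^ n i) _ (M.hp a) h1
  rw [list_prod_smul, ← chi_sum] at h3
  rw [listMon, h3, smul_mul_assoc, smul_smul, sum_mul, ← chi_add, ← sum_add_distrib]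
  simp [chi_zero]

theorem yMon_mul_hp (n a : ZMod P.m) : listMon M.y (P.coord n) * M.hp a =
    P.chi (n * a) • (M.hp a * listMon M.y (P.coord n)) := by
  rw [listMon_mul_hp, sum_coord]

/-- The unit `h`. -/
def hUnit : Aˣ := Units.ofPowEqOne M.h P.m M.h_pow hP.m_pos.ne'

theorem val_hUnit : (M.hUnit : A) = M.h := rfl

theorem val_hUnit_zpow (n : ℤ) : ((M.hUnit ^ n : Aˣ) : A) = M.hp n := by
  have h1 : ∀ n : ℕ, ((M.hUnit ^ n : Aˣ) : A) = M.hp n := fun n => by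
    rw [hp_natCast, Units.val_pow_eq_pow_val, val_hUnit]
  obtain ⟨n, rfl | rfl⟩ := n.eq_nat_or_neg
  · rw [zpow_natCast, h1, Int.cast_natCast]
  · rw [zpow_neg, zpow_natCast, Int.cast_neg, Int.cast_natCast, Units.inv_eq_of_mul_eq_one_right]
    rw [h1, ← hp_add, add_neg_cancel, hp_zero]

/-- The unit `g = h x ^ d`. -/
def gUnit : Aˣ := M.hUnit * M.x ^ P.d

theorem commute_hUnit : Commute M.hUnit (M.x ^ P.d) := by
  refine Units.ext ?_
  have := (M.X_mul_h (LaurentPolynomial.T P.d)).eq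
  rw [X_T, zpow_natCast] at this
  exact this.symm

theorem val_gUnit_zpow (n : ℤ) : ((M.gUnit ^ n : Aˣ) : A) =
    M.X (LaurentPolynomial.T (n * P.d)) * M.hp n := by
  rw [gUnit, M.commute_hUnit.mul_zpow, (M.commute_hUnit.zpow_zpow n n).eq, Units.val_mul,
    val_hUnit_zpow, X_T, mul_comm n, zpow_mul, zpow_natCast]

/-- The images of the generators. -/
def gen : DGen P.m P.θ → A
  | .x => M.x
  | .xinv => (M.x⁻¹ : Aˣ)
  | .g => M.gUnit
  | .ginv => (M.gUnit⁻¹ : Aˣ)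
  | .y i => M.y i
  | .u j => M.u j

/-- The homomorphism from the free algebra. -/
def freeLift : P.Free →ₐ[k] A := FreeAlgebra.lift k M.gen

theorem freeLift_fx (n : ℤ) : M.freeLift (P.fx n) = M.X (LaurentPolynomial.T n) := by
  rw [X_T]
  obtain n | n := n <;> simp [fx, freeLift, gen]

theorem freeLift_fg (n : ℤ) : M.freeLift (P.fg n) = M.X (LaurentPolynomial.T (n * P.d)) * M.hp n := by
  rw [← val_gUnit_zpow]
  obtain n | n := n <;> simp [fg, freeLift, gen]

theorem freeLift_fy (i : Fin P.θ) : M.freeLift (P.fy i) = M.y i := by simp [fy, freeLift, gen]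

theorem freeLift_fu (j : ZMod P.m) : M.freeLift (P.fu j) = M.u j := by simp [fu, freeLift, gen]

theorem freeLift_fyMon (j : ZMod P.m) : M.freeLift (P.fyMon j) = listMon M.y (P.coord j) := by
  have := map_listMon M.freeLift P.fy (P.coord j)
  simp_rw [freeLift_fy] at this
  exact this

theorem freeLift_fpoly (p : Polynomial k) :
    M.freeLift (P.fpoly p) = M.X (Polynomial.toLaurentAlg p) := by
  have h1 : (M.freeLift.comp (Polynomial.aeval (P.fx 1))) =
      (M.X.comp Polynomial.toLaurentAlg) := by
    ext
    simp [freeLift_fx]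
  exact DFunLike.congr_fun h1 p

end Model

variable [hP : P.IsAdmissible]

omit hP in
theorem toLaurentAlg_X_pow (i : Fin P.θ) :
    Polynomial.toLaurentAlg (Polynomial.X ^ (P.M i * P.d) : Polynomial k) = P.z i := by
  rw [Polynomial.toLaurentAlg_apply, Polynomial.toLaurent_X_pow, z]

theorem toLaurentAlg_phi (i : Fin P.θ) (j : ZMod P.m) :
    Polynomial.toLaurentAlg (P.phi i (P.coord j i)) = P.phiL i j := by
  rw [phi_eq_arc, map_arc, toLaurentAlg_X_pow, coord_natCast, phiL]

theorem toLaurentAlg_uuPoly (j l : ZMod P.m) : Polynomial.toLaurentAlg (P.uuPoly j l) =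
    ∏ i, arc (P.γi i) (P.zcoord j i) (P.e i - 1 - P.coord (j + l) i) (P.z i) := by
  rw [uuPoly_eq, map_prod]
  exact prod_congr rfl fun i _ => by rw [map_arc, toLaurentAlg_X_pow]

theorem uuCoeff_eq (j l : ZMod P.m) : P.uuCoeff j l = P.uuScalar l •
    (LaurentPolynomial.T (P.uuExp + P.d) * Polynomial.toLaurentAlg (P.uuPoly j l)) := by
  rw [uuCoeff, uuScalar_eq, toLaurentAlg_uuPoly, uuExp_eq]
  congr 4
  push_cast
  ring

namespace Model

variable {A B : Type*} [Semiring A] [Algebra k A] [Semiring B] [Algebra k B] (M : P.Model A)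

/-- The defining relations of `D` hold in every model. -/
theorem freeLift_rel {a b : P.Free} (h : P.Rel a b) : M.freeLift a = M.freeLift b := by
  have T0 : ∀ n p : ℤ, n + p = 0 → (LaurentPolynomial.T n * LaurentPolynomial.T p : k[T;T⁻¹]) = 1 :=
    fun n p h => by rw [← LaurentPolynomial.T_add, h, LaurentPolynomial.T_zero]
  induction h with
  | x_xinv => rw [map_mul, freeLift_fx, freeLift_fx, ← map_mul, T0 _ _ (by norm_num), map_one,
      map_one]
  | xinv_x => rw [map_mul, freeLift_fx, freeLift_fx, ← map_mul, T0 _ _ (by norm_num), map_one,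
      map_one]
  | g_ginv => rw [map_mul, freeLift_fg, freeLift_fg, ← val_gUnit_zpow, ← val_gUnit_zpow,
      ← Units.val_mul, ← zpow_add, add_neg_cancel, zpow_zero, Units.val_one, map_one]
  | ginv_g => rw [map_mul, freeLift_fg, freeLift_fg, ← val_gUnit_zpow, ← val_gUnit_zpow,
      ← Units.val_mul, ← zpow_add, neg_add_cancel, zpow_zero, Units.val_one, map_one]
  | x_g =>
    rw [map_mul, map_mul, freeLift_fx, freeLift_fg]
    exact ((M.X_mul_X _ _).mul_right (M.X_mul_hp _ _)).eq
  | x_y i =>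
    rw [map_mul, map_mul, freeLift_fx, freeLift_fy]
    exact (M.X_mul_y _ _).eq
  | y_y i l =>
    rw [map_mul, map_mul, freeLift_fy, freeLift_fy]
    exact (M.y_y _ _).eq
  | y_g i =>
    rw [map_smul, map_mul, map_mul, freeLift_fy, freeLift_fg, ← mul_assoc, ← (M.X_mul_y _ _).eq,
      mul_assoc, y_mul_hp, ← chi_natCast, Int.cast_one, mul_one, mul_smul_comm, mul_assoc]
  | y_pow i =>
    have h1 : 1 - P.fx ((P.e i * P.M i * P.d : ℕ) : ℤ) =
        P.fpoly (1 - (Polynomial.X ^ (P.M i * P.d)) ^ P.e i) := by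
      have h2 : P.fx ((P.e i * P.M i * P.d : ℕ) : ℤ) = P.fx 1 ^ (P.e i * P.M i * P.d) := by
        simp [fx]
      rw [fpoly, map_sub, map_one, map_pow, map_pow, Polynomial.aeval_X, h2, ← pow_mul]
      congr 2
      ring
    have h3 : Polynomial.toLaurentAlg (1 - (Polynomial.X ^ (P.M i * P.d)) ^ P.e i : Polynomial k) =
        1 - P.z i ^ P.e i := by
      rw [map_sub, map_one, map_pow, toLaurentAlg_X_pow]
    rw [map_pow, freeLift_fy, M.y_pow, h1, freeLift_fpoly, h3, X]
  | g_pow =>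
    rw [freeLift_fg, freeLift_fx, Int.cast_natCast, ZMod.natCast_self, hp_zero, mul_one]
    push_cast
    rfl
  | x_u j =>
    rw [map_mul, map_mul, freeLift_fx, freeLift_fu, freeLift_fx, X_mul_u, LaurentPolynomial.invert_T]
  | y_u i j =>
    rw [map_mul, map_mul, freeLift_fy, freeLift_fu, freeLift_fu, freeLift_fpoly, toLaurentAlg_phi]
    exact M.y_u i j
  | y_u' i j =>
    rw [map_smul, map_mul, map_mul, map_mul, freeLift_fy, freeLift_fu, freeLift_fx]
    exact M.y_u' i j
  | u_g j =>
    rw [map_smul, map_mul, map_mul, map_mul, freeLift_fu, freeLift_fg, freeLift_fx, ← mul_assoc,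
      u_mul_X, mul_assoc, u_mul_hp, LaurentPolynomial.invert_T, mul_smul_comm, Int.cast_one,
      mul_one, chi_val, ← mul_assoc (M.X _) (M.X _), ← map_mul, ← LaurentPolynomial.T_add, mul_assoc]
    congr 4
    push_cast
    ring
  | u_u j l =>
    rw [map_smul, map_mul, map_mul, map_mul, map_mul, freeLift_fu, freeLift_fu, freeLift_fx,
      freeLift_fg, freeLift_fpoly, freeLift_fyMon, M.u_u, ← X, uuCoeff_eq, map_smul, map_mul,
      LaurentPolynomial.T_add, map_mul, Int.cast_one, hp_one, one_mul]
    simp only [smul_mul_assoc]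
    congr 1
    have h1 := (M.X_mul_listMon (LaurentPolynomial.T (P.d : ℤ)) (P.coord (j + l))).eq
    have h2 := (M.X_mul_X (LaurentPolynomial.T (P.d : ℤ)) (Polynomial.toLaurentAlg (P.uuPoly j l))).eq
    rw [mul_assoc (M.X _) (M.X _) (M.X _), h2]
    simp only [mul_assoc]
    rw [← mul_assoc (M.X (LaurentPolynomial.T (P.d : ℤ))), h1]
    simp only [mul_assoc]

/-- The homomorphism from `D` given by a model. -/
def lift : P.D →ₐ[k] A := RingQuot.liftAlgHom k ⟨M.freeLift, fun _ _ h => M.freeLift_rel h⟩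

theorem lift_proj (a : P.Free) : M.lift (P.proj a) = M.freeLift a :=
  RingQuot.liftAlgHom_mkAlgHom_apply k _ _ _

end Model

/-! ### The canonical model -/

omit hP in
theorem proj_rel {a b : P.Free} (h : P.Rel a b) : P.proj a = P.proj b :=
  RingQuot.mkAlgHom_rel k h

variable (P)

/-- The unit `x` of `D`. -/
def xUnit : P.Dˣ where
  val := P.x 1
  inv := P.x (-1)
  val_inv := by rw [x, x, ← map_mul, proj_rel .x_xinv, map_one]
  inv_val := by rw [x, x, ← map_mul, proj_rel .xinv_x, map_one]

/-- The unit `g` of `D`. -/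
def gUnit : P.Dˣ where
  val := P.g 1
  inv := P.g (-1)
  val_inv := by rw [g, g, ← map_mul, proj_rel .g_ginv, map_one]
  inv_val := by rw [g, g, ← map_mul, proj_rel .ginv_g, map_one]

omit hP in
theorem xUnit_zpow (n : ℤ) : ((P.xUnit ^ n : P.Dˣ) : P.D) = P.x n := by
  obtain n | n := n
  · have : (P.xUnit : P.D) = P.proj (FreeAlgebra.ι k DGen.x) := by simp [xUnit, x, fx]
    simp [x, fx, this]
  · have : ((P.xUnit⁻¹ : P.Dˣ) : P.D) = P.proj (FreeAlgebra.ι k DGen.xinv) := by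
      have h1 : P.fx (-1) = FreeAlgebra.ι k DGen.xinv ^ (0 + 1) := rfl
      rw [zero_add, pow_one] at h1
      rw [← h1]
      rfl
    rw [zpow_negSucc, ← inv_pow, Units.val_pow_eq_pow_val, this, ← map_pow]
    rfl

omit hP in
theorem gUnit_zpow (n : ℤ) : ((P.gUnit ^ n : P.Dˣ) : P.D) = P.g n := by
  obtain n | n := n
  · have : (P.gUnit : P.D) = P.proj (FreeAlgebra.ι k DGen.g) := by simp [gUnit, g, fg]
    simp [g, fg, this]
  · have : ((P.gUnit⁻¹ : P.Dˣ) : P.D) = P.proj (FreeAlgebra.ι k DGen.ginv) := by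
      have h1 : P.fg (-1) = FreeAlgebra.ι k DGen.ginv ^ (0 + 1) := rfl
      rw [zero_add, pow_one] at h1
      rw [← h1]
      rfl
    rw [zpow_negSucc, ← inv_pow, Units.val_pow_eq_pow_val, this, ← map_pow]
    rfl

omit hP in
theorem proj_fpoly (p : Polynomial k) :
    P.proj (P.fpoly p) = laurentEval P.xUnit (Polynomial.toLaurentAlg p) := by
  have h1 : (P.proj.comp (Polynomial.aeval (P.fx 1))) =
      ((laurentEval P.xUnit).comp Polynomial.toLaurentAlg) := by
    ext
    simp [laurentEval_T]
    rfl
  exact DFunLike.congr_fun h1 p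

omit hP in
theorem commute_xUnit_gUnit : Commute P.xUnit P.gUnit := by
  refine Units.ext ?_
  have : P.proj (P.fx 1 * P.fg 1) = P.proj (P.fg 1 * P.fx 1) := proj_rel .x_g
  rwa [map_mul, map_mul] at this

omit hP in
theorem commute_x_y (i : Fin P.θ) : Commute (P.xUnit : P.D) (P.y i) := by
  have : P.proj (P.fx 1 * P.fy i) = P.proj (P.fy i * P.fx 1) := proj_rel (.x_y i)
  rwa [map_mul, map_mul] at this

omit hP in
theorem x_mul_u (j : ZMod P.m) : (P.xUnit : P.D) * P.u j = P.u j * ((P.xUnit⁻¹ : P.Dˣ) : P.D) := by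
  have : P.proj (P.fx 1 * P.fu j) = P.proj (P.fu j * P.fx (-1)) := proj_rel (.x_u j)
  rwa [map_mul, map_mul] at this

/-- The element `h = g x ^ (-d)` of `D`. -/
def hElem : P.D := ((P.gUnit * P.xUnit ^ (-(P.d : ℤ)) : P.Dˣ) : P.D)

omit hP in
theorem hElem_eq : P.hElem =
    P.g 1 * laurentEval P.xUnit (LaurentPolynomial.T (-(P.d : ℤ)) : k[T;T⁻¹]) := by
  rw [laurentEval_T]
  rfl

/-- The canonical model of the presentation, in `D` itself. -/
def canon : P.Model P.D where
  x := P.xUnit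
  h := P.hElem
  y := P.y
  u := P.u
  h_pow := by
    have h1 : P.gUnit ^ P.m = P.xUnit ^ ((P.m * P.d : ℕ) : ℤ) := by
      refine Units.ext ?_
      rw [← zpow_natCast, gUnit_zpow, xUnit_zpow]
      exact proj_rel .g_pow
    rw [hElem, ← Units.val_pow_eq_pow_val,
      ((P.commute_xUnit_gUnit.zpow_left (-(P.d : ℤ))).symm).mul_pow, h1, ← zpow_natCast,
      ← zpow_mul, ← zpow_add]
    have : ((P.m * P.d : ℕ) : ℤ) + -(P.d : ℤ) * (P.m : ℤ) = 0 := by push_cast; ring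
    rw [this, zpow_zero, Units.val_one]
  x_h := by
    have h1 : Commute P.xUnit (P.gUnit * P.xUnit ^ (-(P.d : ℤ))) :=
      P.commute_xUnit_gUnit.mul_right ((Commute.refl _).zpow_right _)
    exact congrArg Units.val h1.eq
  x_y := P.commute_x_y
  y_y i l := by
    have : P.proj (P.fy i * P.fy l) = P.proj (P.fy l * P.fy i) := proj_rel (.y_y i l)
    rwa [map_mul, map_mul] at this
  y_h i := by
    have h1 : P.y i * P.g 1 = P.γ ^ P.M i • (P.g 1 * P.y i) := by
      have : P.proj (P.fy i * P.fg 1) = P.proj (P.γ ^ P.M i • (P.fg 1 * P.fy i)) :=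
        proj_rel (.y_g i)
      rwa [map_smul, map_mul, map_mul] at this
    have h2 := commute_laurentEval (P.commute_x_y i) (LaurentPolynomial.T (-(P.d : ℤ)) : k[T;T⁻¹])
    rw [chi_natCast, hElem_eq, ← mul_assoc, h1, smul_mul_assoc, mul_assoc, mul_assoc, h2.eq]
  y_pow i := by
    have : P.proj (P.fy i ^ P.e i) = P.proj (1 - P.fx ((P.e i * P.M i * P.d : ℕ) : ℤ)) :=
      proj_rel (.y_pow i)
    rw [map_pow, map_sub, map_one] at this
    rw [map_sub, map_one, z, LaurentPolynomial.T_pow, laurentEval_T, xUnit_zpow]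
    refine this.trans ?_
    rw [x]
    congr 3
    push_cast
    ring
  x_u := P.x_mul_u
  y_u i j := by
    have : P.proj (P.fy i * P.fu j) = P.proj (P.fpoly (P.phi i (P.coord j i)) *
      P.fu (j + (P.M i : ZMod P.m))) := proj_rel (.y_u i j)
    rwa [map_mul, map_mul, proj_fpoly, toLaurentAlg_phi] at this
  y_u' i j := by
    have : P.proj (P.fy i * P.fu j) = P.proj (P.ξ i • (P.fx ((P.M i * P.d : ℕ) : ℤ) * P.fu j *
      P.fy i)) := proj_rel (.y_u' i j)
    rw [map_mul, map_smul, map_mul, map_mul] at this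
    rw [z, laurentEval_T, xUnit_zpow]
    exact this
  u_h j := by
    have h1 : P.u j * P.g 1 = P.γ ^ j.val • (P.x (-((2 * P.d : ℕ) : ℤ)) * P.g 1 * P.u j) := by
      have : P.proj (P.fu j * P.fg 1) = P.proj (P.γ ^ j.val • (P.fx (-((2 * P.d : ℕ) : ℤ)) *
        P.fg 1 * P.fu j)) := proj_rel (.u_g j)
      rwa [map_smul, map_mul, map_mul, map_mul] at this
    have h2 := laurentEval_mul_of_mul_inv (P.x_mul_u j) (LaurentPolynomial.T (P.d : ℤ) : k[T;T⁻¹])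
    rw [LaurentPolynomial.invert_T, laurentEval_T, laurentEval_T] at h2
    rw [hElem, Units.val_mul, ← mul_assoc, ← chi_val]
    have h3 : (P.gUnit : P.D) = P.g 1 := rfl
    rw [h3, h1, smul_mul_assoc, mul_assoc, ← h2, ← mul_assoc, ← xUnit_zpow, ← h3, ← Units.val_mul,
      ← Units.val_mul, ← Units.val_mul, (P.commute_xUnit_gUnit.zpow_left _).eq, mul_assoc,
      ← zpow_add]
    congr 4
    push_cast
    ring_nf
  u_u j l := by
    have : P.proj (P.fu j * P.fu l) = P.proj (P.uuScalar l • (P.fx P.uuExp *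
      P.fpoly (P.uuPoly j l) * P.fyMon (j + l) * P.fg 1)) := proj_rel (.u_u j l)
    rw [map_smul, map_mul, map_mul, map_mul, map_mul, proj_fpoly] at this
    refine this.trans ?_
    have h1 : P.proj (P.fyMon (j + l)) = listMon P.y (P.coord (j + l)) :=
      map_listMon P.proj P.fy (P.coord (j + l))
    have h2 : P.proj (P.fx P.uuExp) = laurentEval P.xUnit (LaurentPolynomial.T P.uuExp : k[T;T⁻¹]) := by
      rw [laurentEval_T, xUnit_zpow]
      rfl
    have h3 : P.proj (P.fg 1) =
        laurentEval P.xUnit (LaurentPolynomial.T (P.d : ℤ) : k[T;T⁻¹]) * P.hElem := by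
      rw [laurentEval_T, hElem, ← Units.val_mul,
        ((P.commute_xUnit_gUnit.zpow_left (-(P.d : ℤ))).symm).eq, ← mul_assoc, ← zpow_add,
        add_neg_cancel, zpow_zero, one_mul]
      rfl
    have h4 : Commute (laurentEval P.xUnit (LaurentPolynomial.T (P.d : ℤ) : k[T;T⁻¹]))
        (listMon P.y (P.coord (j + l))) :=
      list_prod_semiconj _ _ _ fun i =>
        (commute_laurentEval (P.commute_x_y i) _).pow_right _
    rw [h1, h2, h3, uuCoeff_eq, map_smul, smul_mul_assoc, smul_mul_assoc, LaurentPolynomial.T_add,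
      map_mul, map_mul, ← map_mul, ← map_mul, ← map_mul, mul_assoc, ← mul_assoc (listMon _ _),
      ← h4.eq, mul_assoc, ← mul_assoc (laurentEval _ _) (laurentEval _ _), ← map_mul, ← mul_assoc]
    congr 3
    ring_nf

theorem canon_X_T (n : ℤ) : P.canon.X (LaurentPolynomial.T n) = P.x n := by
  rw [Model.X_T]
  exact P.xUnit_zpow n

theorem canon_g (n : ℤ) : P.g n = P.canon.X (LaurentPolynomial.T (n * P.d)) * P.canon.hp n := by
  rw [← Model.val_gUnit_zpow, ← gUnit_zpow]
  congr 2
  refine Units.ext ?_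
  rw [← zpow_one (P.canon.gUnit), Model.val_gUnit_zpow, Int.cast_one, Model.hp_one, Model.X_T,
    one_mul]
  change _ = ((P.xUnit ^ (P.d : ℤ) : P.Dˣ) : P.D) * P.hElem
  rw [hElem, ← Units.val_mul, ((P.commute_xUnit_gUnit.zpow_left (-(P.d : ℤ))).symm).eq, ← mul_assoc,
    ← zpow_add, add_neg_cancel, zpow_zero, one_mul]

variable {P}

namespace Model

variable {A B : Type*} [Semiring A] [Algebra k A] [Semiring B] [Algebra k B] (M : P.Model A)

theorem lift_y (i : Fin P.θ) : M.lift (P.canon.y i) = M.y i :=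
  (M.lift_proj _).trans (M.freeLift_fy i)

theorem lift_u (j : ZMod P.m) : M.lift (P.canon.u j) = M.u j :=
  (M.lift_proj _).trans (M.freeLift_fu j)

theorem lift_X (f : k[T;T⁻¹]) : M.lift (P.canon.X f) = M.X f := by
  have h1 : M.lift.comp P.canon.X = M.X := by
    refine laurent_algHom_ext ?_
    rw [AlgHom.comp_apply, canon_X_T]
    exact (M.lift_proj _).trans (M.freeLift_fx 1)
  exact DFunLike.congr_fun h1 f

theorem lift_h : M.lift P.canon.h = M.h := by
  have h1 : M.lift (P.g 1) = M.X (LaurentPolynomial.T P.d) * M.h := by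
    refine (M.lift_proj _).trans ?_
    rw [freeLift_fg, Int.cast_one, hp_one, one_mul]
  have h2 : P.canon.h = P.canon.X (LaurentPolynomial.T (-(P.d : ℤ))) * P.g 1 := by
    rw [canon_g, Int.cast_one, hp_one, one_mul, ← mul_assoc, ← map_mul, ← LaurentPolynomial.T_add,
      neg_add_cancel, LaurentPolynomial.T_zero, map_one, one_mul]
  rw [h2, map_mul, h1, lift_X, ← mul_assoc, ← map_mul, ← LaurentPolynomial.T_add, neg_add_cancel,
    LaurentPolynomial.T_zero, map_one, one_mul]

theorem lift_hp (a : ZMod P.m) : M.lift (P.canon.hp a) = M.hp a := by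
  rw [hp, map_pow, lift_h, hp]

theorem lift_listMon (a : Fin P.θ → ℕ) : M.lift (listMon P.canon.y a) = listMon M.y a := by
  rw [map_listMon]
  simp_rw [lift_y]

end Model

/-- A homomorphism from `D` is determined by its values on `x`, `h`, the `y_i` and the `u_j`. -/
theorem algHom_ext {B : Type*} [Semiring B] [Algebra k B] {f f' : P.D →ₐ[k] B}
    (hx : f (P.canon.X (LaurentPolynomial.T 1)) = f' (P.canon.X (LaurentPolynomial.T 1)))
    (hh : f P.canon.h = f' P.canon.h) (hy : ∀ i, f (P.canon.y i) = f' (P.canon.y i))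
    (hu : ∀ j, f (P.canon.u j) = f' (P.canon.u j)) : f = f' := by
  have hx' : f (P.canon.X (LaurentPolynomial.T (-1))) =
      f' (P.canon.X (LaurentPolynomial.T (-1))) := by
    have h1 : ∀ n : ℤ, P.canon.X (LaurentPolynomial.T n) * P.canon.X (LaurentPolynomial.T (-n)) = 1 :=
      fun n => by
        rw [← map_mul, ← LaurentPolynomial.T_add, add_neg_cancel, LaurentPolynomial.T_zero, map_one]
    refine left_inv_eq_right_inv (a := f (P.canon.X (LaurentPolynomial.T 1))) ?_ ?_
    · rw [← map_mul]
      have := h1 (-1)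
      rw [neg_neg] at this
      rw [this, map_one]
    · rw [hx, ← map_mul, h1, map_one]
  have hX : ∀ n, f (P.canon.X (LaurentPolynomial.T n)) = f' (P.canon.X (LaurentPolynomial.T n)) := by
    intro n
    obtain ⟨n, rfl | rfl⟩ := n.eq_nat_or_neg
    · rw [← mul_one (n : ℤ), ← LaurentPolynomial.T_pow, map_pow, map_pow, map_pow, hx]
    · rw [← mul_neg_one (n : ℤ), ← LaurentPolynomial.T_pow, map_pow, map_pow, map_pow, hx']
  have hg : ∀ n, f (P.g n) = f' (P.g n) := by
    intro n
    rw [canon_g, map_mul, map_mul, hX, Model.hp, map_pow, map_pow, hh]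
  refine RingQuot.ringQuot_ext' _ _ _ (FreeAlgebra.hom_ext (funext fun a => ?_))
  have hx0 : ∀ n, f (P.x n) = f' (P.x n) := fun n => by rw [← canon_X_T, hX]
  cases a with
  | x =>
    have h1 : P.fx 1 = FreeAlgebra.ι k DGen.x := pow_one _
    have h2 := hx0 1
    rwa [x, h1] at h2
  | xinv =>
    have h1 : P.fx (-1) = FreeAlgebra.ι k DGen.xinv := pow_one _
    have h2 := hx0 (-1)
    rwa [x, h1] at h2
  | g =>
    have h1 : P.fg 1 = FreeAlgebra.ι k DGen.g := pow_one _
    have h2 := hg 1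
    rwa [g, h1] at h2
  | ginv =>
    have h1 : P.fg (-1) = FreeAlgebra.ι k DGen.ginv := pow_one _
    have h2 := hg (-1)
    rwa [g, h1] at h2
  | y i => exact hy i
  | u j => exact hu j

end

end DData

open Finset
open scoped LaurentPolynomial TensorProduct

/-! ### The `q`-binomial theorem for `q`-commuting elements -/

section QComm

variable {k : Type*} [Field k] {A : Type*} [Semiring A] [Algebra k A]

theorem mul_pow_of_qcomm {c : k} {a b : A} (h : a * b = c • (b * a)) (n : ℕ) :
    a * b ^ n = c ^ n • (b ^ n * a) := by
  induction n with
  | zero => simp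
  | succ n ih =>
    rw [pow_succ b, ← mul_assoc, ih, smul_mul_assoc, mul_assoc, h, mul_smul_comm, smul_smul,
      pow_succ, mul_assoc]

/-- The `q`-binomial theorem for elements with `a b = p b a`. -/
theorem add_pow_of_qcomm {p : k} {a b : A} (h : a * b = p • (b * a)) (n : ℕ) :
    (a + b) ^ n = ∑ s ∈ range (n + 1), gaussBinom p n s • (b ^ s * a ^ (n - s)) := by
  induction n with
  | zero => simp
  | succ n ih =>
    have h1 : ∑ s ∈ range (n + 1), gaussBinom p n s • (a * (b ^ s * a ^ (n - s))) =
        ∑ s ∈ range (n + 1), (p ^ (s + 1) * gaussBinom p n (s + 1)) •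
          (b ^ (s + 1) * a ^ (n - s)) + a ^ (n + 1) := by
      have h2 : ∀ s ∈ range (n + 1), gaussBinom p n s • (a * (b ^ s * a ^ (n - s))) =
          (p ^ s * gaussBinom p n s) • (b ^ s * a ^ (n + 1 - s)) := by
        intro s hs
        have := mem_range.1 hs
        rw [← mul_assoc, mul_pow_of_qcomm h, smul_mul_assoc, mul_assoc, ← pow_succ', smul_smul,
          mul_comm (gaussBinom p n s), show n - s + 1 = n + 1 - s by omega]
      have h3 := sum_range_succ (fun s => (p ^ s * gaussBinom p n s) •
        (b ^ s * a ^ (n + 1 - s))) (n + 1)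
      rw [gaussBinom_eq_zero p (Nat.lt_succ_self n), mul_zero, zero_smul, add_zero] at h3
      rw [sum_congr rfl h2, ← h3, sum_range_succ']
      simp
    rw [pow_succ', ih, add_mul, mul_sum, mul_sum, sum_range_succ' _ (n + 1)]
    simp_rw [mul_smul_comm]
    rw [h1, gaussBinom_zero_right, one_smul, pow_zero, one_mul, Nat.sub_zero, add_right_comm]
    congr 1
    rw [← sum_add_distrib]
    refine sum_congr rfl fun s _ => ?_
    rw [gaussBinom_succ_succ, add_smul, ← mul_assoc b, ← pow_succ', Nat.add_sub_add_right, add_comm]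

end QComm

namespace DData

noncomputable section

variable {k : Type u} [Field k] {P : DData k} [hP : P.IsAdmissible]

theorem phiL_eq (i : Fin P.θ) (j : ZMod P.m) :
    P.phiL i j = 1 - algebraMap k _ (P.chi (-(P.M i * (j + P.M i)))) * P.z i := by
  rw [phiL, arc_one, chi_neg, chi_M_mul, rootPow_neg (P.γi_primitive i).pow_eq_one, inv_inv,
    zcoord_add, zcoord_M_self, add_comm]

theorem chi_M_mul_M (i : Fin P.θ) : P.chi ((P.M i : ZMod P.m) * P.M i) = (P.γi i)⁻¹ := by
  rw [chi_M_mul, rootPow_neg (P.γi_primitive i).pow_eq_one, zcoord_M_self,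
    rootPow_one (P.γi_primitive i).pow_eq_one]

namespace Model

variable {A : Type*} [Semiring A] [Algebra k A] (M : P.Model A)

omit hP in
theorem y_mul_u (i : Fin P.θ) (j : ZMod P.m) :
    M.y i * M.u j = M.X (P.phiL i j) * M.u (j + P.M i) := M.y_u i j

omit hP in
theorem y_mul_u' (i : Fin P.θ) (j : ZMod P.m) :
    M.y i * M.u j = P.ξ i • (M.X (P.z i) * M.u j * M.y i) := M.y_u' i j

omit hP in
theorem u_mul_u (j l : ZMod P.m) :
    M.u j * M.u l = M.X (P.uuCoeff j l) * listMon M.y (P.coord (j + l)) * M.h := M.u_u j l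

omit hP in
theorem y_pow_e (i : Fin P.θ) : M.y i ^ P.e i = M.X (1 - P.z i ^ P.e i) := M.y_pow i

theorem hp_M_pow_e (i : Fin P.θ) : M.hp (P.M i) ^ P.e i = 1 := by
  rw [← hp_natCast_mul, ← Nat.cast_mul, (ZMod.natCast_eq_zero_iff _ _).2 (P.e_spec i).2, hp_zero]

theorem hp_M_mul_y {i l : Fin P.θ} (hil : i ≠ l) : Commute (M.hp (P.M i)) (M.y l) := by
  rw [Commute, SemiconjBy, y_mul_hp, M_mul_M _ hil.symm, chi_zero, one_smul]

theorem h_mul_hp (a : ZMod P.m) : Commute M.h (M.hp a) := by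
  rw [← hp_one]; exact M.hp_comm _ _

end Model

/-! ### The comultiplication -/

variable (P)

/-- The unit `x ⊗ x`. -/
def comulX : (P.D ⊗[k] P.D)ˣ where
  val := (P.canon.x : P.D) ⊗ₜ (P.canon.x : P.D)
  inv := ((P.canon.x⁻¹ : P.Dˣ) : P.D) ⊗ₜ ((P.canon.x⁻¹ : P.Dˣ) : P.D)
  val_inv := by simp [Algebra.TensorProduct.one_def]
  inv_val := by simp [Algebra.TensorProduct.one_def]

/-- The element `y_i ⊗ g ^ m_i + 1 ⊗ y_i`. -/
def comulY (i : Fin P.θ) : P.D ⊗[k] P.D :=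
  P.canon.y i ⊗ₜ (P.canon.X (P.z i) * P.canon.hp (P.M i)) + 1 ⊗ₜ P.canon.y i

/-- The tensors `u_l ⊗ h ^ l u_(n - l)`. -/
def uTensor (l n : ZMod P.m) : P.D ⊗[k] P.D :=
  P.canon.u l ⊗ₜ (P.canon.hp l * P.canon.u (n - l))

/-- The element `∑ l, γ ^ (l (j - l)) u_l ⊗ h ^ l u_(j - l)`. -/
def comulU (j : ZMod P.m) : P.D ⊗[k] P.D :=
  ∑ l, P.chi (l * (j - l)) • P.uTensor l j

/-- The inclusion of Laurent polynomials in `x ⊗ 1` and `1 ⊗ x`. -/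
def XX : k[T;T⁻¹] ⊗[k] k[T;T⁻¹] →ₐ[k] P.D ⊗[k] P.D :=
  Algebra.TensorProduct.map P.canon.X P.canon.X

omit hP in
/-- The comultiplication of the Hopf algebra of Laurent polynomials. -/
def laurentComul (k : Type*) [Field k] : k[T;T⁻¹] →ₐ[k] k[T;T⁻¹] ⊗[k] k[T;T⁻¹] :=
  laurentEval
    { val := LaurentPolynomial.T 1 ⊗ₜ LaurentPolynomial.T 1
      inv := LaurentPolynomial.T (-1) ⊗ₜ LaurentPolynomial.T (-1)
      val_inv := by
        rw [Algebra.TensorProduct.tmul_mul_tmul, ← LaurentPolynomial.T_add]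
        rfl
      inv_val := by
        rw [Algebra.TensorProduct.tmul_mul_tmul, ← LaurentPolynomial.T_add]
        rfl }

omit hP in
theorem laurentComul_T (n : ℤ) : laurentComul k (LaurentPolynomial.T n) =
    LaurentPolynomial.T n ⊗ₜ LaurentPolynomial.T n := by
  rw [laurentComul, laurentEval_T]
  obtain ⟨n, rfl | rfl⟩ := n.eq_nat_or_neg
  · rw [zpow_natCast, Units.val_pow_eq_pow_val, Algebra.TensorProduct.tmul_pow]
    simp [LaurentPolynomial.T_pow]
  · rw [zpow_neg, zpow_natCast, ← inv_pow, Units.val_pow_eq_pow_val]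
    change (LaurentPolynomial.T (-1) ⊗ₜ LaurentPolynomial.T (-1)) ^ n = _
    rw [Algebra.TensorProduct.tmul_pow]
    simp [LaurentPolynomial.T_pow]

theorem XX_tmul (a b : k[T;T⁻¹]) : P.XX (a ⊗ₜ b) = P.canon.X a ⊗ₜ P.canon.X b := rfl

theorem laurentEval_comulX (f : k[T;T⁻¹]) :
    laurentEval P.comulX f = P.XX (laurentComul k f) := by
  have : laurentEval P.comulX = P.XX.comp (laurentComul k) := by
    refine laurent_algHom_ext ?_
    rw [laurentEval_T, AlgHom.comp_apply, laurentComul_T, XX_tmul, zpow_one, Model.X_T, zpow_one]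
    rfl
  rw [this]; rfl

/-- The Laurent polynomial `x ^ (m_i d)` in the first variable. -/
def z₁ (i : Fin P.θ) : k[T;T⁻¹] ⊗[k] k[T;T⁻¹] := P.z i ⊗ₜ 1

/-- The Laurent polynomial `x ^ (m_i d)` in the second variable. -/
def z₂ (i : Fin P.θ) : k[T;T⁻¹] ⊗[k] k[T;T⁻¹] := 1 ⊗ₜ P.z i

omit hP in
theorem laurentComul_z (i : Fin P.θ) : laurentComul k (P.z i) = P.z₁ i * P.z₂ i := by
  rw [z, laurentComul_T, z₁, z₂, Algebra.TensorProduct.tmul_mul_tmul, one_mul, mul_one, z]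

theorem comulX_h : Commute (P.comulX : P.D ⊗[k] P.D) (P.canon.h ⊗ₜ P.canon.h) := by
  have h1 := P.canon.x_h.eq
  simp [Commute, SemiconjBy, comulX, Algebra.TensorProduct.tmul_mul_tmul, h1]

theorem comulX_y (i : Fin P.θ) : Commute (P.comulX : P.D ⊗[k] P.D) (P.comulY i) := by
  have h1 := (P.canon.x_y i).eq
  have h2 : (P.canon.x : P.D) * (P.canon.X (P.z i) * P.canon.hp (P.M i)) =
      P.canon.X (P.z i) * P.canon.hp (P.M i) * P.canon.x := by
    have h3 := P.canon.X_mul_X (LaurentPolynomial.T 1) (P.z i)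
    have h4 := P.canon.X_mul_hp (LaurentPolynomial.T 1) (P.M i)
    rw [Model.X_T, zpow_one] at h3 h4
    exact (h3.mul_right h4).eq
  rw [Commute, SemiconjBy, comulY, comulX, mul_add, add_mul]
  simp only [Algebra.TensorProduct.tmul_mul_tmul, h1, h2, mul_one, one_mul]

theorem comulX_mul_uTensor (l n : ZMod P.m) :
    P.comulX * P.uTensor l n = P.uTensor l n * ((P.comulX⁻¹ : (P.D ⊗[k] P.D)ˣ) : P.D ⊗[k] P.D) := by
  have h4 := P.canon.X_mul_hp (LaurentPolynomial.T 1) l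
  rw [Model.X_T, zpow_one] at h4
  change ((P.canon.x : P.D) ⊗ₜ[k] (P.canon.x : P.D)) * _ = _ *
    (((P.canon.x⁻¹ : P.Dˣ) : P.D) ⊗ₜ[k] ((P.canon.x⁻¹ : P.Dˣ) : P.D))
  rw [uTensor, Algebra.TensorProduct.tmul_mul_tmul, Algebra.TensorProduct.tmul_mul_tmul,
    P.canon.x_u, ← mul_assoc, h4.eq, mul_assoc, P.canon.x_u, mul_assoc]

theorem comulY_comm (i l : Fin P.θ) : Commute (P.comulY i) (P.comulY l) := by
  by_cases hil : i = l
  · rw [hil]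
  · have h1 := (P.canon.y_y i l).eq
    have h2 : Commute (P.canon.X (P.z i) * P.canon.hp (P.M i)) (P.canon.y l) :=
      (P.canon.X_mul_y _ _).mul_left (P.canon.hp_M_mul_y hil)
    have h3 : Commute (P.canon.X (P.z l) * P.canon.hp (P.M l)) (P.canon.y i) :=
      (P.canon.X_mul_y _ _).mul_left (P.canon.hp_M_mul_y (Ne.symm hil))
    have h4 : Commute (P.canon.X (P.z i) * P.canon.hp (P.M i))
        (P.canon.X (P.z l) * P.canon.hp (P.M l)) :=
      ((P.canon.X_mul_X _ _).mul_right (P.canon.X_mul_hp _ _)).mul_left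
        ((P.canon.X_mul_hp _ _).symm.mul_right (P.canon.hp_comm _ _))
    rw [Commute, SemiconjBy, comulY, comulY, mul_add, add_mul, add_mul, mul_add, add_mul, add_mul]
    simp only [Algebra.TensorProduct.tmul_mul_tmul, h1, h2.eq, h4.eq, mul_one, one_mul]
    rw [h3.eq]
    abel

theorem comulY_h (i : Fin P.θ) : P.comulY i * (P.canon.h ⊗ₜ P.canon.h) =
    P.chi (P.M i) • (P.canon.h ⊗ₜ P.canon.h * P.comulY i) := by
  have h2 : P.canon.X (P.z i) * P.canon.hp (P.M i) * P.canon.h =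
      P.canon.h * (P.canon.X (P.z i) * P.canon.hp (P.M i)) :=
    ((P.canon.X_mul_h _).mul_left (P.canon.h_mul_hp _).symm).eq
  rw [comulY, add_mul, mul_add, smul_add]
  simp only [Algebra.TensorProduct.tmul_mul_tmul, P.canon.y_h, h2, one_mul, mul_one,
    TensorProduct.smul_tmul', TensorProduct.tmul_smul]

theorem comulY_qcomm (i : Fin P.θ) :
    ((1 : P.D) ⊗ₜ[k] P.canon.y i) *
      (P.canon.y i ⊗ₜ[k] (P.canon.X (P.z i) * P.canon.hp (P.M i))) =
    (P.γi i)⁻¹ • ((P.canon.y i ⊗ₜ[k] (P.canon.X (P.z i) * P.canon.hp (P.M i))) *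
      ((1 : P.D) ⊗ₜ[k] P.canon.y i)) := by
  rw [Algebra.TensorProduct.tmul_mul_tmul, Algebra.TensorProduct.tmul_mul_tmul, one_mul, mul_one,
    ← mul_assoc, ← (P.canon.X_mul_y _ _).eq, mul_assoc, P.canon.y_mul_hp, chi_M_mul_M,
    mul_smul_comm, TensorProduct.tmul_smul, mul_assoc]

theorem comulY_pow (i : Fin P.θ) (n : ℕ) : P.comulY i ^ n = ∑ s ∈ range (n + 1),
    gaussBinom (P.γi i)⁻¹ n s • ((P.canon.y i ^ s) ⊗ₜ[k]
      ((P.canon.X (P.z i) * P.canon.hp (P.M i)) ^ s * P.canon.y i ^ (n - s))) := by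
  rw [comulY, add_comm, add_pow_of_qcomm (P.comulY_qcomm i)]
  refine sum_congr rfl fun s _ => ?_
  rw [Algebra.TensorProduct.tmul_pow, Algebra.TensorProduct.tmul_pow,
    Algebra.TensorProduct.tmul_mul_tmul, one_pow, mul_one]

theorem comulY_pow_e (i : Fin P.θ) :
    P.comulY i ^ P.e i = laurentEval P.comulX (1 - P.z i ^ P.e i) := by
  have he := P.e_pos i
  rw [comulY_pow, sum_range_succ, sum_eq_single_of_mem 0 (mem_range.2 he)]
  · rw [gaussBinom_self, gaussBinom_zero_right, one_smul, one_smul, pow_zero, pow_zero, one_mul,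
      Nat.sub_zero, Nat.sub_self, pow_zero, mul_one, (P.canon.X_mul_hp _ _).mul_pow,
      Model.hp_M_pow_e, mul_one, Model.y_pow_e, laurentEval_comulX, ← map_pow, map_sub, map_sub,
      map_sub, map_pow (laurentComul k), laurentComul_z, z₁, z₂, map_one, map_one, map_one,
      Algebra.TensorProduct.tmul_mul_tmul, one_mul, mul_one, Algebra.TensorProduct.tmul_pow,
      XX_tmul, TensorProduct.tmul_sub, TensorProduct.sub_tmul, Algebra.TensorProduct.one_def]
    abel
  · intro s hs h0
    rw [gaussBinom_order (P.γi_primitive i).inv (Nat.pos_of_ne_zero h0) (mem_range.1 hs), zero_smul]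

theorem y_tmul_uTensor (i : Fin P.θ) (l j : ZMod P.m) :
    (P.canon.y i ⊗ₜ[k] (P.canon.X (P.z i) * P.canon.hp (P.M i))) * P.uTensor l j =
      P.XX (P.phiL i l ⊗ₜ P.z i) * P.uTensor (l + P.M i) (j + P.M i) := by
  rw [uTensor, uTensor, XX_tmul, Algebra.TensorProduct.tmul_mul_tmul,
    Algebra.TensorProduct.tmul_mul_tmul, Model.y_mul_u, mul_assoc, ← mul_assoc (P.canon.hp _),
    ← Model.hp_add, add_comm (P.M i : ZMod P.m) l, add_sub_add_right_eq_sub]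

theorem one_tmul_y_uTensor (i : Fin P.θ) (l j : ZMod P.m) :
    ((1 : P.D) ⊗ₜ[k] P.canon.y i) * P.uTensor l j =
      P.chi (P.M i * l) • (P.XX (1 ⊗ₜ P.phiL i (j - l)) * P.uTensor l (j + P.M i)) := by
  rw [uTensor, uTensor, XX_tmul, Algebra.TensorProduct.tmul_mul_tmul,
    Algebra.TensorProduct.tmul_mul_tmul, map_one, one_mul, ← mul_assoc,
    Model.y_mul_hp, smul_mul_assoc, mul_assoc, Model.y_mul_u, ← mul_assoc, ← mul_assoc,
    (P.canon.X_mul_hp _ _).eq, TensorProduct.tmul_smul, sub_add_eq_add_sub]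

/-- The relation `y_i u_j = φ_{m_i, j} u_(j + m_i)` for the images under the comultiplication. -/
theorem comulY_mul_comulU (i : Fin P.θ) (j : ZMod P.m) : P.comulY i * P.comulU j =
    laurentEval P.comulX (P.phiL i j) * P.comulU (j + P.M i) := by
  rw [laurentEval_comulX, comulU, comulU, mul_sum, mul_sum]
  simp_rw [mul_smul_comm, comulY, add_mul, y_tmul_uTensor, one_tmul_y_uTensor, smul_add]
  -- The shift of `l` by `m_i` makes the contributions of `y_i ⊗ g ^ m_i` and of `1 ⊗ y_i` multiples
  -- of the same tensor `u_l ⊗ h ^ l u_(j + m_i - l)`.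
  rw [sum_add_distrib, ← Equiv.sum_comp (Equiv.subRight (P.M i : ZMod P.m)), ← sum_add_distrib]
  refine sum_congr rfl fun l _ => ?_
  simp only [Equiv.subRight_apply, sub_add_cancel]
  rw [smul_smul, ← smul_mul_assoc, ← smul_mul_assoc, ← smul_mul_assoc, ← add_mul, ← map_smul,
    ← map_smul, ← map_smul, ← map_add]
  congr 2
  have e1 : P.chi ((l - P.M i) * (j - (l - P.M i))) =
      P.chi (l * (j + P.M i - l)) * P.chi (-(P.M i * (j + P.M i - l))) := by
    rw [← chi_add]; congr 1; ring
  have e2 : P.chi (l * (j - l)) * P.chi (P.M i * l) = P.chi (l * (j + P.M i - l)) := by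
    rw [← chi_add]; congr 1; ring
  have e3 : P.chi (-(P.M i * (j + P.M i))) =
      P.chi (-(P.M i * (j + P.M i - l))) * P.chi (-(P.M i * l)) := by
    rw [← chi_add]; congr 1; ring
  have e4 : P.phiL i (l - P.M i) = 1 - algebraMap k _ (P.chi (-(P.M i * l))) * P.z i := by
    rw [phiL_eq, sub_add_cancel]
  have e5 : P.phiL i (j - l) =
      1 - algebraMap k _ (P.chi (-(P.M i * (j + P.M i - l)))) * P.z i := by
    rw [phiL_eq, sub_add_eq_add_sub]
  have e6 : ∀ a b : k[T;T⁻¹], a ⊗ₜ[k] b = Algebra.TensorProduct.includeLeft (R := k) (S := k) a *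
      Algebra.TensorProduct.includeRight (R := k) b := fun a b => by simp
  have e7 : Algebra.TensorProduct.includeLeft (R := k) (S := k) (B := k[T;T⁻¹]) (P.z i) =
    P.z₁ i := rfl
  have e8 : Algebra.TensorProduct.includeRight (R := k) (A := k[T;T⁻¹]) (P.z i) = P.z₂ i := rfl
  have e9 : ∀ (c : k) (a : k[T;T⁻¹] ⊗[k] k[T;T⁻¹]), c • a = algebraMap k _ c * a :=
    fun c a => Algebra.smul_def c a
  rw [e1, e2, e4, e5, e6, e6, phiL_eq, e3]
  simp only [map_sub, map_one, map_mul, laurentComul_z, AlgHom.commutes, e7, e8, e9]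
  ring

end

end DData

open Finset
open scoped LaurentPolynomial TensorProduct
namespace DData

noncomputable section

variable {k : Type u} [Field k] (P : DData k) [hP : P.IsAdmissible]

theorem uTensor_mul_y_tmul (i : Fin P.θ) (l j : ZMod P.m) :
    P.ξ i • (P.XX (P.z i ⊗ₜ P.z i) * P.uTensor l j *
      (P.canon.y i ⊗ₜ[k] (P.canon.X (P.z i) * P.canon.hp (P.M i)))) =
      P.chi (P.M i * (j - l)) • (P.XX (P.phiL i l ⊗ₜ 1) * P.uTensor (l + P.M i) (j + P.M i)) := by
  have h1 : P.z i * LaurentPolynomial.invert (P.z i) = 1 := by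
    rw [z, LaurentPolynomial.invert_T, ← LaurentPolynomial.T_add, add_neg_cancel,
      LaurentPolynomial.T_zero]
  have h2 : P.canon.X (P.z i) * (P.canon.hp l * P.canon.u (j - l)) *
      (P.canon.X (P.z i) * P.canon.hp (P.M i)) =
      P.chi (P.M i * (j - l)) • (P.canon.hp (l + P.M i) * P.canon.u (j - l)) := by
    rw [← mul_assoc, mul_assoc (P.canon.X _) (P.canon.hp l * P.canon.u (j - l)),
      mul_assoc (P.canon.hp l), P.canon.u_mul_X, ← mul_assoc (P.canon.hp l),
      ← (P.canon.X_mul_hp _ _).eq, ← mul_assoc, ← mul_assoc, ← map_mul, h1, map_one, one_mul,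
      mul_assoc, P.canon.u_mul_hp, mul_smul_comm, ← mul_assoc, ← P.canon.hp_add,
      mul_comm (j - l)]
  rw [uTensor, uTensor, XX_tmul, XX_tmul, Algebra.TensorProduct.tmul_mul_tmul,
    Algebra.TensorProduct.tmul_mul_tmul, Algebra.TensorProduct.tmul_mul_tmul, h2,
    TensorProduct.smul_tmul', ← P.canon.y_mul_u', map_one, one_mul, P.canon.y_mul_u,
    TensorProduct.tmul_smul, add_sub_add_right_eq_sub]

theorem uTensor_mul_one_tmul_y (i : Fin P.θ) (l j : ZMod P.m) :
    P.ξ i • (P.XX (P.z i ⊗ₜ P.z i) * P.uTensor l j * ((1 : P.D) ⊗ₜ[k] P.canon.y i)) =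
      P.XX (P.z i ⊗ₜ P.phiL i (j - l)) * P.uTensor l (j + P.M i) := by
  have h2 : P.ξ i • (P.canon.X (P.z i) * (P.canon.hp l * P.canon.u (j - l)) * P.canon.y i) =
      P.canon.X (P.phiL i (j - l)) * (P.canon.hp l * P.canon.u (j + P.M i - l)) := by
    rw [← mul_assoc, (P.canon.X_mul_hp _ _).eq, mul_assoc, mul_assoc, ← mul_smul_comm, ← mul_assoc,
      ← P.canon.y_mul_u', P.canon.y_mul_u, ← mul_assoc, ← (P.canon.X_mul_hp _ _).eq, mul_assoc,
      sub_add_eq_add_sub]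
  rw [uTensor, uTensor, XX_tmul, XX_tmul, Algebra.TensorProduct.tmul_mul_tmul,
    Algebra.TensorProduct.tmul_mul_tmul, Algebra.TensorProduct.tmul_mul_tmul, mul_one,
    ← TensorProduct.tmul_smul, h2]

/-- The relation `ξ_i x ^ (m_i d) u_j y_i = φ_{m_i, j} u_(j + m_i)` for the images under the
comultiplication. -/
theorem comulU_mul_comulY (i : Fin P.θ) (j : ZMod P.m) :
    P.ξ i • (laurentEval P.comulX (P.z i) * P.comulU j * P.comulY i) =
    laurentEval P.comulX (P.phiL i j) * P.comulU (j + P.M i) := by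
  rw [laurentEval_comulX, laurentEval_comulX, comulU, comulU, mul_sum, sum_mul, mul_sum, smul_sum]
  have h0 : laurentComul k (P.z i) = P.z i ⊗ₜ P.z i := laurentComul_T _
  simp_rw [mul_smul_comm, smul_mul_assoc, smul_comm (P.ξ i), h0, comulY, mul_add, smul_add (P.ξ i),
    uTensor_mul_y_tmul, uTensor_mul_one_tmul_y, smul_add]
  -- The shift of `l` by `m_i` makes the contributions of `y_i ⊗ g ^ m_i` and of `1 ⊗ y_i` multiples
  -- of the same tensor `u_l ⊗ h ^ l u_(j + m_i - l)`.
  rw [sum_add_distrib, ← Equiv.sum_comp (Equiv.subRight (P.M i : ZMod P.m)), ← sum_add_distrib]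
  refine sum_congr rfl fun l _ => ?_
  simp only [Equiv.subRight_apply, sub_add_cancel]
  rw [smul_smul, ← smul_mul_assoc, ← smul_mul_assoc, ← smul_mul_assoc, ← add_mul, ← map_smul,
    ← map_smul, ← map_smul, ← map_add]
  congr 2
  have e1 : P.chi ((l - P.M i) * (j - (l - P.M i))) * P.chi (P.M i * (j - (l - P.M i))) =
      P.chi (l * (j + P.M i - l)) := by
    rw [← chi_add]; congr 1; ring
  have e2 : P.chi (l * (j - l)) = P.chi (l * (j + P.M i - l)) * P.chi (-(P.M i * l)) := by
    rw [← chi_add]; congr 1; ring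
  have e3 : P.chi (-(P.M i * (j + P.M i))) =
      P.chi (-(P.M i * (j + P.M i - l))) * P.chi (-(P.M i * l)) := by
    rw [← chi_add]; congr 1; ring
  have e4 : P.phiL i (l - P.M i) = 1 - algebraMap k _ (P.chi (-(P.M i * l))) * P.z i := by
    rw [phiL_eq, sub_add_cancel]
  have e5 : P.phiL i (j - l) =
      1 - algebraMap k _ (P.chi (-(P.M i * (j + P.M i - l)))) * P.z i := by
    rw [phiL_eq, sub_add_eq_add_sub]
  have e6 : ∀ a b : k[T;T⁻¹], a ⊗ₜ[k] b = Algebra.TensorProduct.includeLeft (R := k) (S := k) a *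
      Algebra.TensorProduct.includeRight (R := k) b := fun a b => by simp
  have e7 : Algebra.TensorProduct.includeLeft (R := k) (S := k) (B := k[T;T⁻¹]) (P.z i) =
    P.z₁ i := rfl
  have e8 : Algebra.TensorProduct.includeRight (R := k) (A := k[T;T⁻¹]) (P.z i) = P.z₂ i := rfl
  have e9 : ∀ (c : k) (a : k[T;T⁻¹] ⊗[k] k[T;T⁻¹]), c • a = algebraMap k _ c * a :=
    fun c a => Algebra.smul_def c a
  rw [e1, e2, e4, e5, e6, e6, phiL_eq, e3]
  simp only [map_sub, map_one, map_mul, laurentComul_z, AlgHom.commutes, e7, e8, e9]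
  ring

theorem comulU_h (j : ZMod P.m) : P.comulU j * (P.canon.h ⊗ₜ P.canon.h) =
    P.chi j • (P.canon.h ⊗ₜ P.canon.h * P.comulU j) := by
  rw [comulU, sum_mul, mul_sum, smul_sum]
  refine sum_congr rfl fun l _ => ?_
  rw [smul_mul_assoc, mul_smul_comm, smul_comm]
  congr 1
  rw [uTensor, Algebra.TensorProduct.tmul_mul_tmul, Algebra.TensorProduct.tmul_mul_tmul, mul_assoc,
    P.canon.u_h, P.canon.u_h, mul_smul_comm, ← mul_assoc, ← (P.canon.h_mul_hp l).eq, mul_assoc,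
    TensorProduct.tmul_smul, TensorProduct.smul_tmul', smul_smul, ← chi_add, sub_add_cancel,
    TensorProduct.smul_tmul']

/-- The tensors `y_n h ⊗ h ^ n y_(p - n) h`. -/
def yTensor (n p : ZMod P.m) : P.D ⊗[k] P.D :=
  listMon P.canon.y (P.coord n) ⊗ₜ
    (P.canon.hp n * listMon P.canon.y (P.coord (p - n)))

theorem coord_sub_cases (p n : ZMod P.m) (i : Fin P.θ) :
    (P.coord n i ≤ P.coord p i ∧ P.coord n i + P.coord (p - n) i = P.coord p i) ∨
    (P.coord p i < P.coord n i ∧ P.e i ≤ P.coord n i + P.coord (p - n) i) := by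
  have h1 := P.coord_add n (p - n) i
  rw [add_sub_cancel] at h1
  have h2 := P.coord_lt n i
  have h3 := P.coord_lt (p - n) i
  rcases lt_or_ge (P.coord n i + P.coord (p - n) i) (P.e i) with h | h
  · rw [Nat.mod_eq_of_lt h] at h1
    omega
  · rw [Nat.mod_eq_sub_mod h, Nat.mod_eq_of_lt (by omega)] at h1
    omega

theorem list_prod_XzHp (n : Fin P.θ → ℕ) :
    (List.ofFn fun i => (P.canon.X (P.z i) * P.canon.hp (P.M i)) ^ n i).prod =
      P.canon.X (∏ i, P.z i ^ n i) * P.canon.hp (∑ i, (n i : ZMod P.m) * P.M i) := by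
  have h1 : ∀ i, (P.canon.X (P.z i) * P.canon.hp (P.M i)) ^ n i =
      P.canon.X (P.z i ^ n i) * P.canon.hp ((n i : ZMod P.m) * P.M i) := fun i => by
    rw [(P.canon.X_mul_hp _ _).mul_pow, map_pow, P.canon.hp_natCast_mul]
  simp_rw [h1]
  rw [list_prod_mul _ _ fun i l _ => P.canon.X_mul_hp (P.z i ^ n i) ((n l : ZMod P.m) * P.M l)]
  congr 1
  · rw [← List.prod_ofFn, map_list_prod, List.map_ofFn]
    rfl
  · rw [← List.sum_ofFn]
    have h2 : ∀ L : List (ZMod P.m), (L.map P.canon.hp).prod = P.canon.hp L.sum := by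
      intro L
      induction L with
      | nil => simp [P.canon.hp_zero]
      | cons a L ih => rw [List.map_cons, List.prod_cons, ih, List.sum_cons, P.canon.hp_add]
    rw [← h2, List.map_ofFn]
    rfl

/-- The comultiplication of the monomials `y_p`. -/
theorem listMon_comulY (p : ZMod P.m) : listMon P.comulY (P.coord p) =
    ∑ n : ZMod P.m, (∏ i, gaussBinom (P.γi i)⁻¹ (P.coord p i) (P.coord n i)) •
      (P.XX (1 ⊗ₜ ∏ i, P.z i ^ P.coord n i) * P.yTensor n p) := by
  classical
  have h1 : listMon P.comulY (P.coord p) =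
      ∑ n ∈ Fintype.piFinset fun i => range (P.coord p i + 1),
      (∏ i, gaussBinom (P.γi i)⁻¹ (P.coord p i) (n i)) •
        (listMon P.canon.y n ⊗ₜ[k] (P.canon.X (∏ i, P.z i ^ n i) *
          P.canon.hp (∑ i, (n i : ZMod P.m) * P.M i) *
          listMon P.canon.y (fun i => P.coord p i - n i))) := by
    rw [listMon]
    simp_rw [comulY_pow]
    rw [list_prod_sum]
    refine sum_congr rfl fun n _ => ?_
    refine (list_prod_smul (fun i => gaussBinom (P.γi i)⁻¹ (P.coord p i) (n i)) _).trans ?_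
    rw [list_prod_tmul, list_prod_mul, list_prod_XzHp]
    · rfl
    · intro i l hil
      exact (((P.canon.X_mul_y _ _).mul_left (P.canon.hp_M_mul_y hil)).pow_pow _ _)
  rw [h1]
  have h2 : ∑ n : ZMod P.m, (∏ i, gaussBinom (P.γi i)⁻¹ (P.coord p i) (P.coord n i)) •
      (P.XX (1 ⊗ₜ ∏ i, P.z i ^ P.coord n i) * P.yTensor n p) =
      ∑ n with ∀ i, P.coord n i ≤ P.coord p i,
        (∏ i, gaussBinom (P.γi i)⁻¹ (P.coord p i) (P.coord n i)) •
      (P.XX (1 ⊗ₜ ∏ i, P.z i ^ P.coord n i) * P.yTensor n p) := by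
    rw [sum_filter]
    refine sum_congr rfl fun n _ => ?_
    split_ifs with h
    · rfl
    · push Not at h
      obtain ⟨i, hi⟩ := h
      rw [prod_eq_zero (mem_univ i) (gaussBinom_eq_zero _ hi), zero_smul]
  rw [h2]
  symm
  refine sum_bij (fun n _ => P.coord n) (fun n hn => ?_) (fun n _ n' _ h => P.coord_injective h)
    (fun a ha => ?_) (fun n hn => ?_)
  · rw [Fintype.mem_piFinset]
    exact fun i => mem_range_succ_iff.2 ((mem_filter.1 hn).2 i)
  · have h3 : ∀ i, a i ≤ P.coord p i := fun i =>
      mem_range_succ_iff.1 (Fintype.mem_piFinset.1 ha i)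
    have h4 : P.coord (∑ i, (a i : ZMod P.m) * P.M i) = a :=
      P.coord_eq_of_sum a (fun i => (h3 i).trans_lt (P.coord_lt p i)) rfl
    refine ⟨∑ i, (a i : ZMod P.m) * P.M i, mem_filter.2 ⟨mem_univ _, ?_⟩, h4⟩
    rw [h4]; exact h3
  · have h3 := (mem_filter.1 hn).2
    have h4 : (fun i => P.coord p i - P.coord n i) = P.coord (p - n) := by
      funext i
      have := P.coord_sub_cases p n i
      have := h3 i
      omega
    rw [h4, yTensor, XX_tmul, Algebra.TensorProduct.tmul_mul_tmul, map_one, one_mul, sum_coord,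
      mul_assoc]

theorem prod_e_cast : ∏ i, (P.e i : k) = P.m := by
  conv_rhs => rw [hP.fraction.prod_eq]
  push_cast
  rfl

/-- The sum over `ZMod m` that yields the coefficients of `Δ(u_j) Δ(u_r)`: it is the product over the
coordinates of the sums in `sum_arc_mul_arc`. If `p - n` has a carry in some coordinate, then both
sides vanish. -/
theorem sum_chi_arc_mul_arc {A : Type*} [CommRing A] [Algebra k A] (j p n : ZMod P.m)
    (z w : Fin P.θ → A) :
    ∑ l : ZMod P.m, algebraMap k A (P.chi (n * (j - l))) *
      ((∏ i, arc (P.γi i) (P.zcoord l i) (P.e i - 1 - P.coord n i) (z i)) *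
      ∏ i, arc (P.γi i) (P.zcoord (j - l) i) (P.e i - 1 - P.coord (p - n) i) (w i)) =
    algebraMap k A (P.m * ∏ i, gaussBinom (P.γi i)⁻¹ (P.coord p i) (P.coord n i)) *
      ((∏ i, arc (P.γi i) (P.zcoord j i) (P.e i - 1 - P.coord p i) (z i * w i)) *
        ∏ i, w i ^ P.coord n i) := by
  have h1 : ∀ l, algebraMap k A (P.chi (n * (j - l))) *
      ((∏ i, arc (P.γi i) (P.zcoord l i) (P.e i - 1 - P.coord n i) (z i)) *
      ∏ i, arc (P.γi i) (P.zcoord (j - l) i) (P.e i - 1 - P.coord (p - n) i) (w i)) =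
      ∏ i, (fun i (a : ZMod (P.e i)) => algebraMap k A
        (rootPow (P.γi i) ((P.coord n i : ZMod (P.e i)) * (a - P.zcoord j i))) *
        arc (P.γi i) a (P.e i - 1 - P.coord n i) (z i) *
        arc (P.γi i) (P.zcoord j i - a) (P.e i - 1 - P.coord (p - n) i) (w i)) i
          (P.zcoord l i) := by
    intro l
    rw [chi_mul, map_prod, ← prod_mul_distrib, ← prod_mul_distrib]
    refine prod_congr rfl fun i _ => ?_
    rw [zcoord_sub, ← mul_assoc, ← mul_neg, neg_sub]
    rfl
  rw [sum_congr rfl fun l _ => h1 l, sum_prod_zcoord (P := P) (fun i (a : ZMod (P.e i)) =>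
    algebraMap k A (rootPow (P.γi i) ((P.coord n i : ZMod (P.e i)) * (a - P.zcoord j i))) *
      arc (P.γi i) a (P.e i - 1 - P.coord n i) (z i) *
      arc (P.γi i) (P.zcoord j i - a) (P.e i - 1 - P.coord (p - n) i) (w i)), ← prod_e_cast, ← prod_mul_distrib, map_prod,
    ← prod_mul_distrib, ← prod_mul_distrib]
  refine prod_congr rfl fun i _ => ?_
  have hq := P.γi_primitive i
  rcases P.coord_sub_cases p n i with ⟨-, h⟩ | ⟨h0, h⟩
  · rw [sum_arc_mul_arc hq _ _ _ (h.symm ▸ P.coord_lt p i), h]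
  · rw [sum_arc_mul_arc_eq_zero hq _ _ _ (P.coord_lt n i) (P.coord_lt _ i) h,
      gaussBinom_eq_zero _ h0, mul_zero, map_zero, zero_mul]

theorem uTensor_mul_uTensor (l j l' r : ZMod P.m) :
    P.uTensor l j * P.uTensor l' r = P.chi ((j - l) * l') •
      (P.XX (P.uuCoeff l l' ⊗ₜ P.uuCoeff (j - l) (r - l')) * P.yTensor (l + l') (j + r) *
        (P.canon.h ⊗ₜ P.canon.h)) := by
  have h1 : P.canon.hp l * P.canon.u (j - l) * (P.canon.hp l' * P.canon.u (r - l')) =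
      P.chi ((j - l) * l') • (P.canon.X (P.uuCoeff (j - l) (r - l')) * (P.canon.hp (l + l') *
        listMon P.canon.y (P.coord (j + r - (l + l')))) * P.canon.h) := by
    rw [mul_assoc, ← mul_assoc (P.canon.u _), P.canon.u_mul_hp, smul_mul_assoc, mul_assoc,
      P.canon.u_mul_u, mul_smul_comm, ← mul_assoc, ← P.canon.hp_add, ← mul_assoc, ← mul_assoc,
      ← (P.canon.X_mul_hp _ _).eq, sub_add_sub_comm]
    simp only [mul_assoc]
  rw [uTensor, uTensor, yTensor, XX_tmul, Algebra.TensorProduct.tmul_mul_tmul,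
    Algebra.TensorProduct.tmul_mul_tmul, Algebra.TensorProduct.tmul_mul_tmul, h1, P.canon.u_mul_u,
    TensorProduct.tmul_smul]

/-- The relation for `u_j u_r` for the images under the comultiplication. In `Δ(u_j) Δ(u_r)` the terms
in which the indices of the first tensor factors add up to `n` are multiples of
`y_n h ⊗ h ^ n y_(j + r - n) h`, and their sum is the matching term of `Δ(y_(j + r))`. -/
theorem comulU_mul_comulU (j r : ZMod P.m) : P.comulU j * P.comulU r =
    laurentEval P.comulX (P.uuCoeff j r) * listMon P.comulY (P.coord (j + r)) *
      (P.canon.h ⊗ₜ P.canon.h) := by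
  have key : ∀ n : ZMod P.m, ∑ l : ZMod P.m, (P.chi (l * (j - l)) *
      (P.chi ((n - l) * (r - (n - l))) * P.chi ((j - l) * (n - l)))) •
        (P.uuCoeff l (n - l) ⊗ₜ[k] P.uuCoeff (j - l) (r - (n - l))) =
      (∏ i, gaussBinom (P.γi i)⁻¹ (P.coord (j + r) i) (P.coord n i)) •
        (laurentComul k (P.uuCoeff j r) * (1 ⊗ₜ ∏ i, P.z i ^ P.coord n i)) := by
    intro n
    have e6 : ∀ a b : k[T;T⁻¹], a ⊗ₜ[k] b =
      Algebra.TensorProduct.includeLeft (R := k) (S := k) a *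
      Algebra.TensorProduct.includeRight (R := k) b := fun a b => by simp
    have e7 : ∀ i, Algebra.TensorProduct.includeLeft (R := k) (S := k) (B := k[T;T⁻¹]) (P.z i) =
      P.z₁ i := fun _ => rfl
    have e8 : ∀ i, Algebra.TensorProduct.includeRight (R := k) (A := k[T;T⁻¹]) (P.z i) =
      P.z₂ i := fun _ => rfl
    have hm : (P.m : k) ≠ 0 := by
      rw [← prod_e_cast]
      exact prod_ne_zero_iff.2 fun i _ => (P.γi_primitive i).neZero'.ne
    have hterm : ∀ l, (P.chi (l * (j - l)) *
        (P.chi ((n - l) * (r - (n - l))) * P.chi ((j - l) * (n - l)))) •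
        (P.uuCoeff l (n - l) ⊗ₜ[k] P.uuCoeff (j - l) (r - (n - l))) =
        ((P.m : k)⁻¹ * (P.m : k)⁻¹ * P.scal r) •
          ((LaurentPolynomial.T (-(P.halfNd : ℤ)) ⊗ₜ LaurentPolynomial.T (-(P.halfNd : ℤ))) *
          (algebraMap k _ (P.chi (n * (j - l))) *
      ((∏ i, arc (P.γi i) (P.zcoord l i) (P.e i - 1 - P.coord n i) (P.z₁ i)) *
      ∏ i, arc (P.γi i) (P.zcoord (j - l) i) (P.e i - 1 - P.coord (j + r - n) i) (P.z₂ i)))) := by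
      intro l
      have s1 : P.scal r = P.scal (n - l) * P.scal (r - (n - l)) *
          P.chi ((n - l) * (r - (n - l))) := by
        rw [← scal_add, add_sub_cancel]
      have s2 : P.chi (n * (j - l)) = P.chi (l * (j - l)) * P.chi ((j - l) * (n - l)) := by
        rw [← chi_add]; congr 1; ring
      rw [uuCoeff, uuCoeff, add_sub_cancel, show j - l + (r - (n - l)) = j + r - n by ring,
        ← TensorProduct.smul_tmul', TensorProduct.tmul_smul, ← Algebra.smul_def, mul_smul_comm,
        smul_smul, smul_smul, smul_smul, s1, s2, e6, e6, map_mul, map_mul, map_prod, map_prod]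
      simp_rw [map_arc, e7, e8]
      congr 1 <;> ring
    rw [sum_congr rfl fun l _ => hterm l, ← smul_sum, ← mul_sum, sum_chi_arc_mul_arc, uuCoeff,
      map_smul, map_mul (laurentComul k), laurentComul_T, map_prod (laurentComul k)]
    simp_rw [map_arc, laurentComul_z]
    rw [e6 1, map_one, one_mul, map_prod]
    simp_rw [map_pow, e8]
    rw [← Algebra.smul_def, mul_smul_comm, smul_mul_assoc, smul_smul, smul_smul]
    congr 1
    · field_simp
    · ring
  have hL : P.comulU j * P.comulU r = ∑ n : ZMod P.m, P.XX (∑ l : ZMod P.m, (P.chi (l * (j - l)) *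
      (P.chi ((n - l) * (r - (n - l))) * P.chi ((j - l) * (n - l)))) •
        (P.uuCoeff l (n - l) ⊗ₜ[k] P.uuCoeff (j - l) (r - (n - l)))) * P.yTensor n (j + r) *
        (P.canon.h ⊗ₜ P.canon.h) := by
    rw [comulU, comulU, sum_mul_sum]
    simp_rw [map_sum, sum_mul]
    conv_rhs => rw [sum_comm]
    refine sum_congr rfl fun l _ => ?_
    rw [← Equiv.sum_comp (Equiv.subRight l)]
    refine sum_congr rfl fun n _ => ?_
    rw [Equiv.subRight_apply, smul_mul_smul_comm, uTensor_mul_uTensor, smul_smul, map_smul,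
      smul_mul_assoc, smul_mul_assoc, add_sub_cancel, mul_assoc (P.chi _)]
  rw [hL]
  simp_rw [key]
  rw [listMon_comulY, laurentEval_comulX, mul_sum, sum_mul]
  refine sum_congr rfl fun n _ => ?_
  rw [map_smul, map_mul, smul_mul_assoc, smul_mul_assoc, mul_smul_comm, smul_mul_assoc, mul_assoc,
    mul_assoc, mul_assoc, mul_assoc]

/-- The model of the presentation of `D` in `D ⊗ D` that defines the comultiplication. -/
def comulModel : P.Model (P.D ⊗[k] P.D) where
  x := P.comulX
  h := P.canon.h ⊗ₜ P.canon.h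
  y := P.comulY
  u := P.comulU
  h_pow := by
    rw [Algebra.TensorProduct.tmul_pow, P.canon.h_pow, Algebra.TensorProduct.one_def]
  x_h := P.comulX_h
  x_y := P.comulX_y
  y_y := P.comulY_comm
  y_h := P.comulY_h
  y_pow := P.comulY_pow_e
  x_u j := by
    rw [comulU, mul_sum, sum_mul]
    refine sum_congr rfl fun l _ => ?_
    rw [mul_smul_comm, comulX_mul_uTensor, smul_mul_assoc]
  y_u := P.comulY_mul_comulU
  y_u' i j := by rw [comulY_mul_comulU, ← comulU_mul_comulY]
  u_h := P.comulU_h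
  u_u := P.comulU_mul_comulU

end

end DData

open Finset
open scoped LaurentPolynomial TensorProduct
namespace DData

noncomputable section

variable {k : Type u} [Field k] (P : DData k) [hP : P.IsAdmissible]

theorem comul_X (f : k[T;T⁻¹]) : P.comulModel.lift (P.canon.X f) = P.XX (laurentComul k f) := by
  rw [Model.lift_X, ← laurentEval_comulX]
  rfl

theorem comul_h : P.comulModel.lift P.canon.h = P.canon.h ⊗ₜ P.canon.h := Model.lift_h _

theorem comul_hp (a : ZMod P.m) :
    P.comulModel.lift (P.canon.hp a) = P.canon.hp a ⊗ₜ P.canon.hp a := by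
  rw [Model.hp, map_pow, comul_h, Algebra.TensorProduct.tmul_pow]

theorem comul_y (i : Fin P.θ) : P.comulModel.lift (P.canon.y i) = P.comulY i := Model.lift_y _ i

theorem comul_u (j : ZMod P.m) : P.comulModel.lift (P.canon.u j) = P.comulU j := Model.lift_u _ j

/-! ### One-dimensional representations -/

theorem prod_e_mul_inv : (∏ i, (P.e i : k)) * (P.m : k)⁻¹ = 1 := by
  have hm : (P.m : k) ≠ 0 := by
    rw [← prod_e_cast]
    exact prod_ne_zero_iff.2 fun i _ => (P.γi_primitive i).neZero'.ne
  rw [prod_e_cast, mul_inv_cancel₀ hm]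

theorem arc_zero_order_one (i : Fin P.θ) : arc (P.γi i) (0 : ZMod (P.e i)) (P.e i - 1) (1 : k) =
    P.e i := by
  have hq := P.γi_primitive i
  have he := P.e_pos i
  have h := qFact_mul_qFact_reflect hq 0 (P.e i - 1) (by omega)
  rw [qFact_zero, mul_one, pow_zero, one_mul, zero_add,
    Nat.choose_eq_zero_of_lt (by norm_num : 1 < 2), pow_zero, mul_one] at h
  rw [← h, arc, qFact]
  refine prod_congr rfl fun t _ => ?_
  have h1 : (1 : ZMod (P.e i)) + t = ((t + 1 : ℕ) : ZMod (P.e i)) := by push_cast; ring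
  rw [add_zero, mul_one, Algebra.algebraMap_self, RingHom.id_apply, h1,
    rootPow_natCast hq.pow_eq_one]

theorem arc_order_one_eq_zero (i : Fin P.θ) {a : ZMod (P.e i)} (ha : a ≠ 0) :
    arc (P.γi i) a (P.e i - 1) (1 : k) = 0 := by
  have h1 := a.val_lt
  have h0 : 0 < a.val := Nat.pos_of_ne_zero fun h => ha ((ZMod.val_eq_zero a).1 h)
  refine prod_eq_zero (i := P.e i - 1 - a.val) (mem_range.2 (by omega)) ?_
  have h2 : (1 : ZMod (P.e i)) + a + ((P.e i - 1 - a.val : ℕ) : ZMod (P.e i)) = 0 := by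
    have h3 : ((1 + a.val + (P.e i - 1 - a.val) : ℕ) : ZMod (P.e i)) = 0 := by
      rw [show 1 + a.val + (P.e i - 1 - a.val) = P.e i by omega, ZMod.natCast_self]
    push_cast at h3
    rwa [ZMod.natCast_zmod_val] at h3
  rw [h2, rootPow_zero, map_one, one_mul, sub_self]

/-- The model in `k` with `x ↦ 1`, `h ↦ ζ ^ 2`, `y_i ↦ 0`, `u_0 ↦ ζ` and `u_j ↦ 0` for `j ≠ 0`, for
a `2m`-th root of unity `ζ`. -/
def charModel (ζ : k) (hζ : ζ ^ (2 * P.m) = 1) : P.Model k where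
  x := 1
  h := ζ ^ 2
  y _ := 0
  u j := if j = 0 then ζ else 0
  h_pow := by rw [← pow_mul, hζ]
  x_h := Commute.all _ _
  x_y _ := Commute.all _ _
  y_y _ _ := Commute.all _ _
  y_h i := by simp
  y_pow i := by
    rw [map_sub, map_one, map_pow, z, laurentEval_T, one_zpow, Units.val_one, one_pow, sub_self,
      zero_pow (P.e_pos i).ne']
  x_u j := by simp
  y_u i j := by
    split_ifs with h1 h2 <;> try simp
    · rw [phiL_eq, h2, mul_zero, neg_zero, chi_zero, map_sub, map_one, map_one, one_mul, z,
        laurentEval_T, one_zpow, Units.val_one, sub_self]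
      simp
    · rename_i h2
      rw [phiL_eq, h2, mul_zero, neg_zero, chi_zero, map_sub, map_one, map_one, one_mul, z,
        laurentEval_T, one_zpow, Units.val_one, sub_self]
      simp
  y_u' i j := by simp
  u_h j := by
    split_ifs with h
    · rw [h, chi_zero, one_smul, mul_comm]
    · simp
  u_u j l := by
    have hz : ∀ i, laurentEval (1 : kˣ) (P.z i) = 1 := fun i => by
      rw [z, laurentEval_T, one_zpow, Units.val_one]
    rw [uuCoeff, map_smul, map_mul, map_prod, laurentEval_T, one_zpow, Units.val_one, one_mul,
      listMon_eq_prod]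
    simp_rw [map_arc, hz]
    by_cases hjl : j + l = 0
    · simp_rw [hjl, coord_zero, pow_zero, prod_const_one, mul_one, Nat.sub_zero]
      by_cases hj : j = 0
      · have hl : l = 0 := by rwa [hj, zero_add] at hjl
        simp_rw [hj, hl, zcoord_zero, arc_zero_order_one]
        rw [if_pos trivial, scal_zero, mul_one, smul_eq_mul, mul_comm (_⁻¹), prod_e_mul_inv, one_mul, sq]
      · obtain ⟨i, hi⟩ : ∃ i, P.zcoord j i ≠ 0 := by
          by_contra! h
          exact hj (P.zcoord_injective (funext fun i => (h i).trans (P.zcoord_zero i).symm))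
        rw [prod_eq_zero (mem_univ i) (P.arc_order_one_eq_zero i hi), if_neg hj]
        simp
    · obtain ⟨i, hi⟩ : ∃ i, P.coord (j + l) i ≠ 0 := by
        by_contra! h
        exact hjl (P.coord_injective (funext fun i => (h i).trans (P.coord_zero i).symm))
      rw [prod_eq_zero (f := fun i => (0 : k) ^ P.coord (j + l) i) (mem_univ i) (zero_pow hi)]
      split_ifs with h1 h2 <;> try simp
      exact absurd (by rw [h1, h2, add_zero]) hjl

/-- The comultiplication of `D`. -/
def comulHom : P.D →ₐ[k] P.D ⊗[k] P.D := P.comulModel.lift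

/-- The counit of `D`. -/
def counitHom : P.D →ₐ[k] k := (P.charModel 1 (one_pow _)).lift

section charModel

variable (ζ : k) (hζ : ζ ^ (2 * P.m) = 1)

theorem charModel_X_T (n : ℤ) :
    (P.charModel ζ hζ).lift (P.canon.X (LaurentPolynomial.T n)) = 1 := by
  rw [Model.lift_X, Model.X_T]
  change (((1 : kˣ) ^ n : kˣ) : k) = 1
  rw [one_zpow, Units.val_one]

theorem charModel_h : (P.charModel ζ hζ).lift P.canon.h = ζ ^ 2 := Model.lift_h _

theorem charModel_y (i : Fin P.θ) : (P.charModel ζ hζ).lift (P.canon.y i) = 0 := Model.lift_y _ i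

theorem charModel_u (j : ZMod P.m) :
    (P.charModel ζ hζ).lift (P.canon.u j) = if j = 0 then ζ else 0 := Model.lift_u _ j

end charModel

theorem counit_X_T (n : ℤ) : P.counitHom (P.canon.X (LaurentPolynomial.T n)) = 1 :=
  P.charModel_X_T _ _ n

theorem counit_h : P.counitHom P.canon.h = 1 := (P.charModel_h _ _).trans (one_pow 2)

theorem counit_hp (a : ZMod P.m) : P.counitHom (P.canon.hp a) = 1 := by
  rw [Model.hp, map_pow, counit_h, one_pow]

theorem counit_y (i : Fin P.θ) : P.counitHom (P.canon.y i) = 0 := P.charModel_y _ _ i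

theorem counit_u (j : ZMod P.m) : P.counitHom (P.canon.u j) = if j = 0 then 1 else 0 :=
  P.charModel_u _ _ j

/-! ### The coalgebra axioms -/

theorem comulHom_X_T (n : ℤ) : P.comulHom (P.canon.X (LaurentPolynomial.T n)) =
    P.canon.X (LaurentPolynomial.T n) ⊗ₜ P.canon.X (LaurentPolynomial.T n) := by
  refine (P.comul_X _).trans ?_
  rw [laurentComul_T, XX_tmul]

theorem comulHom_h : P.comulHom P.canon.h = P.canon.h ⊗ₜ P.canon.h := P.comul_h

theorem comulHom_hp (a : ZMod P.m) : P.comulHom (P.canon.hp a) = P.canon.hp a ⊗ₜ P.canon.hp a :=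
  P.comul_hp a

theorem comulHom_y (i : Fin P.θ) : P.comulHom (P.canon.y i) =
    P.canon.y i ⊗ₜ (P.canon.X (P.z i) * P.canon.hp (P.M i)) + 1 ⊗ₜ P.canon.y i := P.comul_y i

theorem comulHom_u (j : ZMod P.m) : P.comulHom (P.canon.u j) =
    ∑ l, P.chi (l * (j - l)) • (P.canon.u l ⊗ₜ[k] (P.canon.hp l * P.canon.u (j - l))) :=
  P.comul_u j

theorem comulHom_coassoc : (Algebra.TensorProduct.assoc k k k P.D P.D P.D).toAlgHom.comp
      ((Algebra.TensorProduct.map P.comulHom (.id k P.D)).comp P.comulHom)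
      = (Algebra.TensorProduct.map (.id k P.D) P.comulHom).comp P.comulHom := by
  have hz : ∀ i, P.comulHom (P.canon.X (P.z i)) =
    P.canon.X (P.z i) ⊗ₜ P.canon.X (P.z i) := fun i => P.comulHom_X_T _
  have ha : ∀ a b c : P.D, (Algebra.TensorProduct.assoc k k k P.D P.D P.D).toAlgHom
    ((a ⊗ₜ b) ⊗ₜ c) = a ⊗ₜ (b ⊗ₜ c) := fun _ _ _ => rfl
  refine algHom_ext ?_ ?_ (fun i => ?_) (fun j => ?_)
  · simp [comulHom_X_T]
  · simp [comulHom_h]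
  · simp [comulHom_y, comulHom_hp, hz, TensorProduct.add_tmul, TensorProduct.tmul_add,
      Algebra.TensorProduct.one_def, add_assoc]
  · simp only [AlgHom.comp_apply, comulHom_u, map_sum, map_smul, Algebra.TensorProduct.map_tmul,
      AlgHom.id_apply, map_mul, comulHom_hp, TensorProduct.sum_tmul, TensorProduct.tmul_sum,
      smul_sum, mul_sum]
    rw [sum_comm]
    refine sum_congr rfl fun p _ => ?_
    rw [← Equiv.sum_comp (Equiv.addLeft p)]
    refine sum_congr rfl fun q _ => ?_
    rw [Equiv.coe_addLeft, ← TensorProduct.smul_tmul', map_smul, ha,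
      mul_smul_comm, TensorProduct.tmul_smul, smul_smul, smul_smul,
      Algebra.TensorProduct.tmul_mul_tmul, add_sub_cancel_left, ← mul_assoc, ← Model.hp_add,
      sub_sub, ← chi_add, ← chi_add]
    congr 2
    ring

theorem comulHom_rTensor_counit :
    (Algebra.TensorProduct.map P.counitHom (.id k P.D)).comp P.comulHom
      = (Algebra.TensorProduct.lid k P.D).symm := by
  refine algHom_ext ?_ ?_ (fun i => ?_) (fun j => ?_)
  · simp [comulHom_X_T, counit_X_T]
  · simp [comulHom_h, counit_h]
  · simp [comulHom_y, counit_y]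
  · simp only [AlgHom.comp_apply, comulHom_u, map_sum, map_smul, Algebra.TensorProduct.map_tmul,
      AlgHom.id_apply, counit_u]
    rw [sum_eq_single_of_mem 0 (mem_univ _)]
    · simp [chi_zero, Model.hp_zero]
    · intro l _ hl
      simp [hl]

theorem comulHom_lTensor_counit :
    (Algebra.TensorProduct.map (.id k P.D) P.counitHom).comp P.comulHom
      = (Algebra.TensorProduct.rid k k P.D).symm := by
  have hz : ∀ i, P.counitHom (P.canon.X (P.z i)) = 1 := fun i => P.counit_X_T _
  refine algHom_ext ?_ ?_ (fun i => ?_) (fun j => ?_)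
  · simp [comulHom_X_T, counit_X_T]
  · simp [comulHom_h, counit_h]
  · simp [comulHom_y, counit_y, hz, counit_hp]
  · simp only [AlgHom.comp_apply, comulHom_u, map_sum, map_smul, Algebra.TensorProduct.map_tmul,
      AlgHom.id_apply, map_mul, counit_hp, counit_u]
    rw [sum_eq_single_of_mem j (mem_univ _)]
    · simp [chi_zero]
    · intro l _ hl
      rw [if_neg (sub_ne_zero.2 (Ne.symm hl))]
      simp

end

end DData

open Finset MulOpposite
open scoped LaurentPolynomial TensorProduct

theorem list_prod_op {A : Type*} [Monoid A] {n : ℕ} (y : Fin n → A)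
    (h : ∀ i l, Commute (y i) (y l)) :
    (List.ofFn fun i => op (y i)).prod = op (List.ofFn y).prod := by
  induction n with
  | zero => simp
  | succ n ih =>
    have h1 : Commute (List.ofFn fun i : Fin n => y i.succ).prod (y 0) := by
      refine Commute.list_prod_left _ _ fun a ha => ?_
      obtain ⟨i, rfl⟩ := (List.mem_ofFn' _ _).1 ha
      exact h _ _
    rw [List.ofFn_succ, List.prod_cons, ih (fun i => y i.succ) (fun i l => h _ _), ← op_mul,
      List.ofFn_succ, List.prod_cons, h1.eq]

/-- The reversal of an arc under `z ↦ z⁻¹`. -/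
theorem arc_reverse {k A : Type*} [Field k] [CommRing A] [Algebra k A] {e : ℕ} [NeZero e] {q : k}
    (hq : q ^ e = 1) (a b : ZMod e) (N : ℕ) (h : a + b + N + 1 = 0) {z w : A} (hzw : z * w = 1) :
    arc q a N w = algebraMap k A ((-1) ^ N * rootPow q ((N : ZMod e) * (1 + a)) *
      q ^ (N.choose 2)) * w ^ N * arc q b N z := by
  induction N generalizing b with
  | zero => simp [rootPow_zero]
  | succ N ih =>
    have h1 : a + (b + 1) + N + 1 = 0 := by rw [← h]; push_cast; ring
    have h2 : rootPow q (1 + a + (N : ZMod e)) * rootPow q (1 + b) = 1 := by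
      rw [← rootPow_add hq, show 1 + a + (N : ZMod e) + (1 + b) = a + (b + 1) + N + 1 by ring, h1,
        rootPow_zero]
    have h3 : (1 : A) - algebraMap k A (rootPow q (1 + a + (N : ZMod e))) * w =
        - algebraMap k A (rootPow q (1 + a + (N : ZMod e))) * w *
          (1 - algebraMap k A (rootPow q (1 + b)) * z) := by
      have h4 : algebraMap k A (rootPow q (1 + a + (N : ZMod e))) *
        algebraMap k A (rootPow q (1 + b)) = 1 := by rw [← map_mul, h2, map_one]
      linear_combination (-z * w) * h4 - hzw
    have h5 : rootPow q (((N + 1 : ℕ) : ZMod e) * (1 + a)) * q ^ ((N + 1).choose 2) =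
        rootPow q ((N : ZMod e) * (1 + a)) * q ^ (N.choose 2) *
          rootPow q (1 + a + (N : ZMod e)) := by
      rw [choose_succ_two, pow_add, rootPow_add hq (1 + a), rootPow_natCast hq, Nat.cast_succ,
        add_mul, one_mul, rootPow_add hq]
      ring
    rw [arc_succ, arc_succ', ih _ h1, h3, mul_assoc (_ ^ (N + 1)), h5, pow_succ w, pow_succ (-1 : k)]
    simp only [map_mul, map_neg, map_one]
    ring

theorem choose_two_add (n N : ℕ) :
    (n + 1 + N).choose 2 + n.choose 2 = N.choose 2 + n * n + (n + 1) * N := by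
  induction N with
  | zero =>
    induction n with
    | zero => simp
    | succ n ih =>
      have h1 := choose_succ_two (n + 1)
      have h2 := choose_succ_two n
      simp only [Nat.add_zero] at ih ⊢
      rw [h1]
      simp at ih
      simp
      linarith
  | succ N ih =>
    rw [← add_assoc, choose_succ_two, choose_succ_two N]
    linarith

namespace DData

noncomputable section

variable {k : Type u} [Field k] (P : DData k) [hP : P.IsAdmissible]

theorem scalN_mul_self (i : Fin P.θ) (l : ZMod P.m) :
    P.scalN i (P.coord l i) * P.scalN i (P.coord l i) * (P.γ ^ P.M i) ^ P.coord l i =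
      rootPow (P.γi i) (-(P.zcoord l i * (P.zcoord l i + 1))) := by
  have hq := P.γi_primitive i
  have hx := P.xi_ne_zero i
  have h1 : ∀ n : ℕ, (n + 1).choose 2 + (n + 1).choose 2 = n * (n + 1) := fun n => by
    rw [Nat.choose_two_right, Nat.add_sub_cancel]
    have := Nat.even_mul_succ_self n
    rw [mul_comm, ← two_mul]
    exact Nat.mul_div_cancel' this.two_dvd
  rw [scalN, ← hP.xi_sq i, rootPow_neg hq.pow_eq_one, ← coord_natCast]
  have h2 : ((P.coord l i : ZMod (P.e i)) * ((P.coord l i : ZMod (P.e i)) + 1)) =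
    ((P.coord l i * (P.coord l i + 1) : ℕ) : ZMod (P.e i)) := by push_cast; ring
  rw [h2, rootPow_natCast hq.pow_eq_one, ← h1, pow_add, mul_inv, ← inv_pow]
  have h3 : (-1 : k) ^ P.coord l i * (-1) ^ P.coord l i = 1 := by
    rw [← mul_pow]; norm_num
  have h4 : (P.ξ i)⁻¹ ^ P.coord l i * (P.ξ i)⁻¹ ^ P.coord l i * (P.ξ i ^ 2) ^ P.coord l i = 1 := by
    rw [← mul_pow, ← mul_pow, sq, mul_mul_mul_comm, inv_mul_cancel₀ hx, one_mul, one_pow]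
  linear_combination ((P.γi i)⁻¹ ^ (P.coord l i + 1).choose 2) ^ 2 *
    ((P.ξ i)⁻¹ ^ P.coord l i * (P.ξ i)⁻¹ ^ P.coord l i * (P.ξ i ^ 2) ^ P.coord l i) * h3 +
    ((P.γi i)⁻¹ ^ (P.coord l i + 1).choose 2) ^ 2 * h4

theorem scal_mul_self (l : ZMod P.m) : P.scal l * P.scal l * P.chi l =
    ∏ i, rootPow (P.γi i) (-(P.zcoord l i * (P.zcoord l i + 1))) := by
  rw [scal, chi_eq_prod, ← prod_mul_distrib, ← prod_mul_distrib]
  exact prod_congr rfl fun i _ => P.scalN_mul_self i l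

theorem scal_mul_self_mul (l : ZMod P.m) : P.scal l * P.scal l * P.chi l *
    ∏ i, rootPow (P.γi i) (P.zcoord l i) = P.chi (l * l) := by
  rw [scal_mul_self, chi_mul, ← prod_mul_distrib]
  refine prod_congr rfl fun i _ => ?_
  rw [← rootPow_add (P.γi_primitive i).pow_eq_one]
  congr 1
  ring

theorem antiScal_eq (j : ZMod P.m) : P.antiScal j = P.chi (-j) * (P.scal j)⁻¹ := by
  rw [eq_mul_inv_iff_mul_eq₀ (P.scal_ne_zero j), antiScal_mul_scal]

theorem antiScal_mul_scal_sub (l j : ZMod P.m) :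
    P.antiScal l * P.scal (j - l) * P.chi (l * j) =
      P.scal j * ∏ i, rootPow (P.γi i) (P.zcoord l i) := by
  have h1 : P.scal j = P.scal l * P.scal (j - l) * P.chi (l * (j - l)) := by
    rw [← scal_add, add_sub_cancel]
  have h2 := P.scal_mul_self_mul l
  have h3 : P.chi (l * j) = P.chi (l * (j - l)) * P.chi (l * l) := by
    rw [← chi_add]; congr 1; ring
  rw [antiScal_eq, h1, h3, ← h2, chi_neg]
  have := P.scal_ne_zero l
  have := P.chi_ne_zero l
  field_simp

theorem scal_M (i : Fin P.θ) : P.scal (P.M i) = -(P.ξ i)⁻¹ * (P.γi i)⁻¹ := by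
  rw [scal, prod_eq_single i]
  · have h1 : P.coord (P.M i) i = 1 % P.e i := by
      rw [← zcoord_val, zcoord_M_self, ← Nat.cast_one, ZMod.val_natCast]
    rw [h1, scalN_mod, scalN]
    simp
  · intro l _ hl
    have h1 : P.coord (P.M i) l = 0 := by
      rw [← zcoord_val, zcoord_M_ne _ hl, ZMod.val_zero]
    rw [h1, scalN_zero]
  · simp

theorem antiScal_add_M (i : Fin P.θ) (j : ZMod P.m) :
    P.antiScal (j + P.M i) = -(P.ξ i)⁻¹ * P.chi (-(P.M i * (j + P.M i))) * P.antiScal j := by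
  have h1 : P.chi (P.M i) = P.ξ i * P.ξ i := by rw [chi_natCast, ← hP.xi_sq, sq]
  have h2 := P.xi_ne_zero i
  have h3 := P.chi_ne_zero (j * P.M i)
  have h4 := P.chi_ne_zero j
  have h5 := P.scal_ne_zero j
  have h6 : P.chi (P.M i * (j + P.M i)) = P.chi (j * P.M i) * (P.γi i)⁻¹ := by
    rw [← chi_M_mul_M, ← chi_add]; congr 1; ring
  have h7 := P.γi_ne_zero i
  rw [antiScal_eq, antiScal_eq, scal_add, chi_neg, chi_neg, chi_neg, h6, chi_add, scal_M, h1]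
  field_simp

/-! ### The antipode -/

/-- The image of `y_i` under the antipode. -/
def antiY (i : Fin P.θ) : P.D :=
  (-1 : k) • (P.canon.y i * (P.canon.X (LaurentPolynomial.invert (P.z i)) * P.canon.hp (-P.M i)))

/-- The image of `u_j` under the antipode. -/
def antiU (j : ZMod P.m) : P.D :=
  P.antiScal j • (P.canon.X (LaurentPolynomial.T (-(P.halfNd : ℤ))) * P.canon.hp (-1 - j) *
    P.canon.u j)

/-- The inverse of `x` in the opposite algebra. -/
def antiX : (P.Dᵐᵒᵖ)ˣ where
  val := op ((P.canon.x⁻¹ : P.Dˣ) : P.D)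
  inv := op (P.canon.x : P.D)
  val_inv := by rw [← op_mul, Units.mul_inv, op_one]
  inv_val := by rw [← op_mul, Units.inv_mul, op_one]

omit hP in
theorem invert_z_mul (i : Fin P.θ) : P.z i * LaurentPolynomial.invert (P.z i) = 1 := by
  rw [z, LaurentPolynomial.invert_T, ← LaurentPolynomial.T_add, add_neg_cancel,
    LaurentPolynomial.T_zero]

theorem laurentEval_antiX (f : k[T;T⁻¹]) :
    laurentEval P.antiX f = op (P.canon.X (LaurentPolynomial.invert f)) := by
  induction f using laurent_induction with
  | add f g hf hg => simp only [map_add, hf, hg, MulOpposite.op_add]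
  | T c n =>
    simp only [map_smul, LaurentPolynomial.invert_T, op_smul]
    congr 1
    rw [laurentEval_T, Model.X_T]
    obtain ⟨n, rfl | rfl⟩ := n.eq_nat_or_neg
    · rw [zpow_natCast, zpow_neg, zpow_natCast, ← inv_pow, Units.val_pow_eq_pow_val,
        Units.val_pow_eq_pow_val, op_pow]
      rfl
    · rw [zpow_neg, neg_neg, zpow_natCast, zpow_natCast, ← inv_pow, Units.val_pow_eq_pow_val,
        Units.val_pow_eq_pow_val, op_pow]
      rfl

theorem X_mul_hp_commute_X (f g : k[T;T⁻¹]) (a : ZMod P.m) :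
    Commute (P.canon.X f * P.canon.hp a) (P.canon.X g) :=
  (P.canon.X_mul_X _ _).mul_left (P.canon.X_mul_hp _ _).symm

theorem commute_XhpM_y (f : k[T;T⁻¹]) {i l : Fin P.θ} (hil : i ≠ l) :
    Commute (P.canon.X f * P.canon.hp (-P.M i)) (P.canon.y l) := by
  refine (P.canon.X_mul_y _ _).mul_left ?_
  rw [Commute, SemiconjBy, P.canon.y_mul_hp, mul_neg, M_mul_M _ hil.symm, neg_zero, chi_zero,
    one_smul]

theorem antiY_comm (i l : Fin P.θ) : Commute (P.antiY i) (P.antiY l) := by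
  by_cases hil : i = l
  · rw [hil]
  · have h1 := P.commute_XhpM_y (LaurentPolynomial.invert (P.z i)) hil
    have h2 := P.commute_XhpM_y (LaurentPolynomial.invert (P.z l)) (Ne.symm hil)
    have h3 := (P.X_mul_hp_commute_X (LaurentPolynomial.invert (P.z i))
      (LaurentPolynomial.invert (P.z l)) (-P.M i)).mul_right
        ((P.canon.X_mul_hp (LaurentPolynomial.invert (P.z i)) (-P.M l)).mul_left
          (P.canon.hp_comm (-P.M i) (-P.M l)))
    exact (((P.canon.y_y i l).mul_right h2.symm).mul_left (h1.mul_right h3)).smul_left _ |>.smul_right _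

theorem mul_pow_of_qcomm' {A : Type*} [Semiring A] [Algebra k A] {q : k} (hq : q ≠ 0) {a b : A}
    (h : a * b = q • (b * a)) (n : ℕ) :
    (a * b) ^ n = (q ^ (n.choose 2))⁻¹ • (a ^ n * b ^ n) := by
  induction n with
  | zero => simp
  | succ n ih =>
    have h1 := mul_pow_of_qcomm h n
    have h2 : b ^ n * a = (q ^ n)⁻¹ • (a * b ^ n) := by
      rw [h1, smul_smul, inv_mul_cancel₀ (pow_ne_zero n hq), one_smul]
    rw [pow_succ, ih, smul_mul_assoc, mul_assoc (a ^ n), ← mul_assoc (b ^ n), h2, smul_mul_assoc,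
      mul_smul_comm, smul_smul, choose_succ_two, pow_add, mul_inv, pow_succ a, pow_succ b]
    simp only [mul_assoc]

theorem y_mul_XhpM (f : k[T;T⁻¹]) (i : Fin P.θ) :
    P.canon.y i * (P.canon.X f * P.canon.hp (-P.M i)) =
      P.γi i • (P.canon.X f * P.canon.hp (-P.M i) * P.canon.y i) := by
  rw [← mul_assoc, ← (P.canon.X_mul_y _ _).eq, mul_assoc, P.canon.y_mul_hp, mul_neg, chi_neg,
    chi_M_mul_M, inv_inv, mul_smul_comm, mul_assoc]

theorem antiY_pow (i : Fin P.θ) (n : ℕ) : P.antiY i ^ n =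
    ((-1) ^ n * (P.γi i ^ (n.choose 2))⁻¹) • (P.canon.y i ^ n *
      (P.canon.X (LaurentPolynomial.invert (P.z i) ^ n) * P.canon.hp (-((n : ZMod P.m) * P.M i)))) := by
  have h1 : (P.canon.X (LaurentPolynomial.invert (P.z i)) * P.canon.hp (-P.M i)) ^ n =
      P.canon.X (LaurentPolynomial.invert (P.z i) ^ n) * P.canon.hp (-((n : ZMod P.m) * P.M i)) := by
    rw [(P.canon.X_mul_hp _ _).mul_pow, ← Model.hp_natCast_mul, map_pow, mul_neg]
  rw [antiY, smul_pow, mul_pow_of_qcomm' (P.γi_ne_zero i) (P.y_mul_XhpM _ i), h1,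
    smul_smul]

theorem antiY_pow_e (i : Fin P.θ) :
    P.antiY i ^ P.e i = P.canon.X (LaurentPolynomial.invert (1 - P.z i ^ P.e i)) := by
  have h1 := pow_choose_order (P.γi_primitive i) (P.e_pos i)
  have h2 : (P.e i : ZMod P.m) * P.M i = 0 := by
    rw [← Nat.cast_mul, (ZMod.natCast_eq_zero_iff _ _).2 (P.e_spec i).2]
  have h3 : (-1 : k) ^ P.e i * (P.γi i ^ ((P.e i).choose 2))⁻¹ = -1 := by
    obtain ⟨e, he⟩ : ∃ e, P.e i = e + 1 := ⟨P.e i - 1, by have := P.e_pos i; omega⟩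
    rw [he, Nat.add_sub_cancel] at h1
    have h4 : P.γi i ^ ((e + 1).choose 2) ≠ 0 := pow_ne_zero _ (P.γi_ne_zero i)
    have h5 : (-1 : k) ^ e * (-1) ^ e = 1 := by rw [← mul_pow]; norm_num
    rw [he, pow_succ]
    field_simp
    linear_combination (-1 : k) ^ e * h1 - (P.γi i ^ ((e + 1).choose 2)) * h5
  have h6 : P.z i ^ P.e i * LaurentPolynomial.invert (P.z i) ^ P.e i = 1 := by
    rw [← mul_pow, invert_z_mul, one_pow]
  rw [antiY_pow, h2, neg_zero, Model.hp_zero, mul_one, h3, Model.y_pow_e, ← map_mul, sub_mul, h6,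
    one_mul, ← map_smul, neg_smul, one_smul, neg_sub, map_sub LaurentPolynomial.invert, map_one, map_pow LaurentPolynomial.invert]

/-- The image of the monomial `y_p` under the antipode. -/
theorem listMon_antiY (p : ZMod P.m) : listMon P.antiY (P.coord p) =
    (∏ i, ((-1) ^ P.coord p i * (P.γi i ^ ((P.coord p i).choose 2))⁻¹)) •
      (listMon P.canon.y (P.coord p) *
        (P.canon.X (∏ i, LaurentPolynomial.invert (P.z i) ^ P.coord p i) * P.canon.hp (-p))) := by
  rw [listMon]
  simp_rw [antiY_pow]
  rw [list_prod_smul (fun i => (-1 : k) ^ P.coord p i * (P.γi i ^ ((P.coord p i).choose 2))⁻¹),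
    list_prod_mul]
  · congr 2
    rw [list_prod_mul _ _ fun i l _ => P.canon.X_mul_hp _ _]
    congr 1
    · rw [← List.prod_ofFn, map_list_prod, List.map_ofFn]
      rfl
    · have h2 : ∀ L : List (ZMod P.m), (L.map P.canon.hp).prod = P.canon.hp L.sum := by
        intro L
        induction L with
        | nil => simp [P.canon.hp_zero]
        | cons a L ih => rw [List.map_cons, List.prod_cons, ih, List.sum_cons, P.canon.hp_add]
      conv_rhs => rw [← P.sum_coord p, ← sum_neg_distrib, ← List.sum_ofFn]
      rw [← h2, List.map_ofFn]
      rfl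
  · intro i l hil
    refine (Commute.mul_left ?_ ?_).symm.pow_left _
    · exact P.canon.X_mul_y _ _
    · have h1 : ((P.coord p l : ZMod P.m) * P.M l) * (P.M i : ZMod P.m) = 0 := by
        rw [mul_assoc, M_mul_M _ (Ne.symm hil), mul_zero]
      rw [Commute, SemiconjBy, Model.y_mul_hp, mul_neg, mul_comm (P.M i : ZMod P.m), h1, neg_zero,
        chi_zero, one_smul]

theorem u_mul_y (i : Fin P.θ) (j : ZMod P.m) : P.canon.u j * P.canon.y i =
    (P.ξ i)⁻¹ • (P.canon.X (LaurentPolynomial.invert (P.z i)) *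
      (P.canon.X (P.phiL i j) * P.canon.u (j + P.M i))) := by
  rw [← P.canon.y_mul_u, P.canon.y_mul_u', mul_smul_comm, smul_smul, inv_mul_cancel₀ (P.xi_ne_zero i),
    one_smul, mul_assoc, ← mul_assoc, ← map_mul, mul_comm, invert_z_mul, map_one, one_mul]

theorem invert_invert (f : k[T;T⁻¹]) :
    LaurentPolynomial.invert (LaurentPolynomial.invert f) = f :=
  LaurentPolynomial.involutive_invert f

theorem antiU_mul_antiY (i : Fin P.θ) (j : ZMod P.m) : P.antiU j * P.antiY i =
    P.antiU (j + P.M i) * P.canon.X (LaurentPolynomial.invert (P.phiL i j)) := by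
  have h1 : P.canon.u j * (P.canon.y i *
      (P.canon.X (LaurentPolynomial.invert (P.z i)) * P.canon.hp (-P.M i))) =
      ((P.ξ i)⁻¹ * P.chi (-(P.M i * (j + P.M i)))) •
        (P.canon.hp (-P.M i) * (P.canon.X (P.phiL i j) * P.canon.u (j + P.M i))) := by
    rw [← mul_assoc, u_mul_y, smul_mul_assoc, mul_assoc, mul_assoc, ← mul_assoc (P.canon.u _),
      Model.u_mul_X, invert_invert, mul_assoc, Model.u_mul_hp, mul_smul, mul_smul_comm,
      mul_smul_comm, mul_smul_comm, mul_neg, mul_comm (P.M i : ZMod P.m)]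
    congr 2
    rw [← mul_assoc (P.canon.X (P.phiL i j)), (P.canon.X_mul_X (P.phiL i j) (P.z i)).eq,
      mul_assoc, ← mul_assoc, ← map_mul, mul_comm (LaurentPolynomial.invert _), invert_z_mul,
      map_one, one_mul, ← mul_assoc, (P.canon.X_mul_hp _ _).eq, mul_assoc]
  rw [antiU, antiY, mul_smul_comm, smul_mul_assoc, mul_assoc, h1, antiU, mul_smul_comm, smul_smul,
    smul_smul, antiScal_add_M, smul_mul_assoc, mul_assoc _ (P.canon.u _), Model.u_mul_X,
    invert_invert, ← mul_assoc _ (P.canon.hp (-P.M i)), mul_assoc _ (P.canon.hp _) (P.canon.hp _),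
    ← Model.hp_add, ← sub_eq_add_neg, sub_sub]
  congr 1
  ring

theorem antiY_mul_antiU (i : Fin P.θ) (j : ZMod P.m) : P.antiU j * P.antiY i =
    P.ξ i • (P.antiY i * (P.antiU j * P.canon.X (LaurentPolynomial.invert (P.z i)))) := by
  have h0 : P.ξ i * P.chi (-P.M i) = (P.ξ i)⁻¹ := by
    have := P.xi_ne_zero i
    rw [chi_neg, chi_natCast, ← hP.xi_sq, sq]
    field_simp
  have h1 : P.canon.y i * (P.canon.X (LaurentPolynomial.invert (P.z i)) * P.canon.hp (-P.M i)) *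
      (P.canon.X (LaurentPolynomial.T (-(P.halfNd : ℤ))) * P.canon.hp (-1 - j) *
        P.canon.u j * P.canon.X (LaurentPolynomial.invert (P.z i))) =
      P.chi (-(P.M i * (j + P.M i)) - P.M i) •
        (P.canon.X (LaurentPolynomial.T (-(P.halfNd : ℤ))) * P.canon.hp (-1 - j - P.M i) *
        (P.canon.X (P.phiL i j) * P.canon.u (j + P.M i))) := by
    have h2 : (P.canon.X (LaurentPolynomial.invert (P.z i)) * P.canon.hp (-P.M i)) *
      (P.canon.X (LaurentPolynomial.T (-(P.halfNd : ℤ))) * P.canon.hp (-1 - j) *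
        P.canon.u j * P.canon.X (LaurentPolynomial.invert (P.z i))) =
        P.canon.X (LaurentPolynomial.T (-(P.halfNd : ℤ))) * (P.canon.hp (-1 - j - P.M i) *
          P.canon.u j) := by
      rw [mul_assoc _ (P.canon.u j), Model.u_mul_X, invert_invert, mul_assoc (P.canon.X _)
        (P.canon.hp (-1 - j)), ← mul_assoc (P.canon.hp (-1 - j)) (P.canon.X _) (P.canon.u j),
        ← (P.canon.X_mul_hp _ _).eq, mul_assoc (P.canon.X _) (P.canon.hp (-1 - j)),
        ← mul_assoc (P.canon.X _) (P.canon.X _), ← map_mul,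
        mul_assoc (P.canon.X _) (P.canon.hp (-P.M i)), ← mul_assoc (P.canon.hp (-P.M i)),
        ← (P.canon.X_mul_hp _ _).eq, mul_assoc (P.canon.X _) (P.canon.hp (-P.M i)),
        ← mul_assoc (P.canon.hp (-P.M i)), ← Model.hp_add, ← mul_assoc (P.canon.X _) (P.canon.X _),
        ← map_mul, mul_comm (LaurentPolynomial.invert _), mul_assoc (LaurentPolynomial.T _),
        invert_z_mul, mul_one, neg_add_eq_sub]
    rw [mul_assoc, h2, ← mul_assoc, ← (P.canon.X_mul_y _ _).eq, mul_assoc, ← mul_assoc (P.canon.y i),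
      Model.y_mul_hp, smul_mul_assoc, mul_smul_comm, mul_assoc (P.canon.hp _), Model.y_mul_u,
      ← mul_assoc]
    congr 2
    ring
  have h3 : P.antiU j * P.antiY i = (-(P.antiScal j * ((P.ξ i)⁻¹ * P.chi (-(P.M i * (j + P.M i)))))) •
      (P.canon.X (LaurentPolynomial.T (-(P.halfNd : ℤ))) * P.canon.hp (-1 - j - P.M i) *
        (P.canon.X (P.phiL i j) * P.canon.u (j + P.M i))) := by
    rw [antiU_mul_antiY, antiU, smul_mul_assoc, mul_assoc _ (P.canon.u _), Model.u_mul_X,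
      invert_invert, antiScal_add_M, sub_sub]
    congr 1
    ring
  rw [h3, antiU, antiY, smul_mul_assoc, smul_mul_assoc, mul_smul_comm, h1, smul_smul, smul_smul,
    smul_smul, sub_eq_add_neg (-(_ * _) : ZMod P.m), chi_add, ← h0]
  congr 2
  ring

/-- The scalar identity behind `S(u_j u_l) = S(u_l) S(u_j)`; it holds in each coordinate separately. -/
theorem antiScal_reverse (l j : ZMod P.m) :
    P.antiScal l * P.chi (-(l * j)) =
      (∏ i, ((-1) ^ P.coord (j + l) i * (P.γi i ^ ((P.coord (j + l) i).choose 2))⁻¹)) *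
        P.chi (-((j + l) * (j + l))) * P.scal l *
      ∏ i, ((-1) ^ (P.e i - 1 - P.coord (j + l) i) *
        rootPow (P.γi i) (((P.e i - 1 - P.coord (j + l) i : ℕ) : ZMod (P.e i)) * (1 + P.zcoord j i)) *
        P.γi i ^ ((P.e i - 1 - P.coord (j + l) i).choose 2)) := by
  have h0 : P.antiScal l = P.scal l * ∏ i, rootPow (P.γi i) (P.zcoord l i * (P.zcoord l i + 1)) := by
    have h1 := P.scal_mul_self l
    have h2 : (∏ i, rootPow (P.γi i) (-(P.zcoord l i * (P.zcoord l i + 1)))) *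
        ∏ i, rootPow (P.γi i) (P.zcoord l i * (P.zcoord l i + 1)) = 1 := by
      rw [← prod_mul_distrib]
      refine prod_eq_one fun i _ => ?_
      rw [rootPow_neg (P.γi_primitive i).pow_eq_one,
        inv_mul_cancel₀ (rootPow_ne_zero (P.γi_primitive i).pow_eq_one _)]
    rw [antiScal_eq, chi_neg]
    have h3 := P.chi_ne_zero l
    have h4 := P.scal_ne_zero l
    rw [← h1] at h2
    field_simp
    linear_combination -h2
  rw [h0, mul_assoc, mul_comm _ (P.scal l), mul_assoc (P.scal l)]
  congr 1
  rw [← mul_neg, ← mul_neg, chi_mul, chi_mul, ← prod_mul_distrib, ← prod_mul_distrib,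
    ← prod_mul_distrib]
  refine prod_congr rfl fun i _ => ?_
  have hq := P.γi_primitive i
  have h1 := pow_choose_order hq (P.e_pos i)
  have hlt := P.coord_lt (j + l) i
  have hz : (P.coord (j + l) i : ZMod (P.e i)) = P.zcoord j i + P.zcoord l i := by
    rw [coord_natCast, zcoord_add]
  rw [zcoord_neg, zcoord_neg, zcoord_add]
  generalize P.coord (j + l) i = n at *
  generalize P.zcoord j i = a at *
  generalize P.zcoord l i = b at *
  obtain ⟨N, hN⟩ : ∃ N, P.e i = n + 1 + N := ⟨P.e i - 1 - n, by omega⟩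
  have hN' : P.e i - 1 - n = N := by omega
  rw [hN']
  have h2 := choose_two_add n N
  rw [← hN] at h2
  have hNz : (N : ZMod (P.e i)) = -1 - a - b := by
    have : ((n + 1 + N : ℕ) : ZMod (P.e i)) = 0 := by rw [← hN, ZMod.natCast_self]
    push_cast at this
    linear_combination this - hz
  have h3 : P.γi i ^ (P.e i).choose 2 * P.γi i ^ (n.choose 2) = P.γi i ^ N.choose 2 *
      rootPow (P.γi i) ((n : ZMod (P.e i)) * (n : ZMod (P.e i)) + ((n : ZMod (P.e i)) + 1) * (N : ZMod (P.e i))) := by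
    have : (n : ZMod (P.e i)) * (n : ZMod (P.e i)) + ((n : ZMod (P.e i)) + 1) * (N : ZMod (P.e i)) = ((n * n + (n + 1) * N : ℕ) : ZMod (P.e i)) := by
      push_cast; ring
    rw [this, rootPow_natCast hq.pow_eq_one, ← pow_add, ← pow_add, h2, add_assoc]
  have h4 : (-1 : k) ^ (P.e i - 1) = (-1) ^ n * (-1) ^ N := by
    rw [← pow_add]; congr 1; omega
  have hq0 := P.γi_ne_zero i
  have h5 : P.γi i ^ (n.choose 2) ≠ 0 := pow_ne_zero _ hq0
  have h6 : P.γi i ^ ((P.e i).choose 2) ≠ 0 := pow_ne_zero _ hq0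
  rw [h4] at h1
  have h7 : rootPow (P.γi i) (b * (b + 1)) * rootPow (P.γi i) (-(b * -a)) *
      rootPow (P.γi i) ((n : ZMod (P.e i)) * (n : ZMod (P.e i)) + ((n : ZMod (P.e i)) + 1) * (N : ZMod (P.e i))) =
      rootPow (P.γi i) (-((a + b) * -(a + b))) * rootPow (P.γi i) ((N : ZMod (P.e i)) * (1 + a)) := by
    rw [← rootPow_add hq.pow_eq_one, ← rootPow_add hq.pow_eq_one, ← rootPow_add hq.pow_eq_one, hz, hNz]
    congr 1
    ring
  have h9 : rootPow (P.γi i) (b * (b + 1)) * rootPow (P.γi i) (-(b * -a)) *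
    (P.γi i ^ (P.e i).choose 2 * P.γi i ^ (n.choose 2)) = rootPow (P.γi i) (-((a + b) * -(a + b))) *
      rootPow (P.γi i) ((N : ZMod (P.e i)) * (1 + a)) * P.γi i ^ N.choose 2 := by
    rw [h3, ← h7]; ring
  have h10 := mul_inv_cancel₀ h5
  linear_combination (-1) ^ n * (-1) ^ N * (P.γi i ^ (n.choose 2))⁻¹ * h9 -
    rootPow (P.γi i) (b * (b + 1)) * rootPow (P.γi i) (-(b * -a)) * h1 -
    rootPow (P.γi i) (b * (b + 1)) * rootPow (P.γi i) (-(b * -a)) * (-1) ^ n * (-1) ^ N *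
      P.γi i ^ (P.e i).choose 2 * h10

end

end DData

open Finset MulOpposite
open scoped LaurentPolynomial TensorProduct

namespace DData

noncomputable section

variable {k : Type u} [Field k] (P : DData k) [hP : P.IsAdmissible]

/-- The product of the `z_i ^ (e_i - 1)` is `x ^ (N d)`. -/
theorem prod_z_pow : ∏ i, P.z i ^ (P.e i - 1) =
    LaurentPolynomial.T (P.halfNd : ℤ) * LaurentPolynomial.T (P.halfNd : ℤ) := by
  have h1 : ∀ i, P.z i ^ (P.e i - 1) = LaurentPolynomial.T (((P.e i - 1) * P.M i * P.d : ℕ) : ℤ) := by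
    intro i
    rw [z, LaurentPolynomial.T_pow]
    congr 1
    push_cast
    ring
  have h2 : ∀ (s : Finset (Fin P.θ)) (f : Fin P.θ → ℕ), ∏ i ∈ s, (LaurentPolynomial.T (f i : ℤ) : k[T;T⁻¹]) =
      LaurentPolynomial.T ((∑ i ∈ s, f i : ℕ) : ℤ) := by
    intro s f
    induction s using Finset.induction_on with
    | empty => simp
    | insert a s ha ih => rw [prod_insert ha, ih, sum_insert ha, Nat.cast_add, LaurentPolynomial.T_add]
  simp_rw [h1]
  rw [h2, ← sum_mul, ← LaurentPolynomial.T_add]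
  congr 1
  have h3 := P.two_mul_halfNd
  rw [N] at h3
  rw [← h3]
  push_cast
  ring

/-- Replacing `x` by `x⁻¹` in the coefficient of `u_j u_l` reverses its arcs. Up to a scalar and a
monomial in `x` this gives the coefficient of `u_l u_j`. -/
theorem uuCoeff_reverse (j l : ZMod P.m) :
    ((∏ i, ((-1) ^ P.coord (j + l) i * (P.γi i ^ ((P.coord (j + l) i).choose 2))⁻¹)) *
        P.chi (-((j + l) * (j + l)))) •
      LaurentPolynomial.invert ((∏ i, P.z i ^ P.coord (j + l) i) * P.uuCoeff j l) =
    (P.antiScal l * P.antiScal j * P.chi (j - l * j)) • P.uuCoeff l j := by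
  have hz : ∀ i, P.z i ^ (P.e i - 1) = P.z i ^ P.coord (j + l) i *
      P.z i ^ (P.e i - 1 - P.coord (j + l) i) := fun i => by
    rw [← pow_add]
    congr 1
    have := P.coord_lt (j + l) i
    omega
  have hrev : ∀ i, arc (P.γi i) (P.zcoord j i) (P.e i - 1 - P.coord (j + l) i)
      (LaurentPolynomial.invert (P.z i)) = algebraMap k _ ((-1) ^ (P.e i - 1 - P.coord (j + l) i) *
        rootPow (P.γi i) (((P.e i - 1 - P.coord (j + l) i : ℕ) : ZMod (P.e i)) * (1 + P.zcoord j i)) *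
        P.γi i ^ ((P.e i - 1 - P.coord (j + l) i).choose 2)) *
        LaurentPolynomial.invert (P.z i) ^ (P.e i - 1 - P.coord (j + l) i) *
        arc (P.γi i) (P.zcoord l i) (P.e i - 1 - P.coord (j + l) i) (P.z i) := by
    intro i
    refine arc_reverse (P.γi_primitive i).pow_eq_one _ _ _ ?_ (P.invert_z_mul i)
    have h1 : ((P.coord (j + l) i + (P.e i - 1 - P.coord (j + l) i) + 1 : ℕ) : ZMod (P.e i)) = 0 := by
      have := P.coord_lt (j + l) i
      rw [show P.coord (j + l) i + (P.e i - 1 - P.coord (j + l) i) + 1 = P.e i by omega,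
        ZMod.natCast_self]
    rwa [Nat.cast_add, Nat.cast_add, Nat.cast_one, coord_natCast, zcoord_add] at h1
  have h1 : LaurentPolynomial.invert ((∏ i, P.z i ^ P.coord (j + l) i) * P.uuCoeff j l) =
      ((P.m : k)⁻¹ * P.scal l * ∏ i, ((-1) ^ (P.e i - 1 - P.coord (j + l) i) *
        rootPow (P.γi i) (((P.e i - 1 - P.coord (j + l) i : ℕ) : ZMod (P.e i)) * (1 + P.zcoord j i)) *
        P.γi i ^ ((P.e i - 1 - P.coord (j + l) i).choose 2))) •
      (LaurentPolynomial.T (-(P.halfNd : ℤ)) *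
        ∏ i, arc (P.γi i) (P.zcoord l i) (P.e i - 1 - P.coord (j + l) i) (P.z i)) := by
    have h2 : LaurentPolynomial.invert (∏ i, P.z i ^ (P.e i - 1)) =
        LaurentPolynomial.T (-(P.halfNd : ℤ)) * LaurentPolynomial.T (-(P.halfNd : ℤ)) := by
      rw [prod_z_pow, map_mul, LaurentPolynomial.invert_T]
    simp_rw [hz] at h2
    rw [prod_mul_distrib, map_mul, map_prod, map_prod] at h2
    have h3 : (LaurentPolynomial.T (P.halfNd : ℤ) * LaurentPolynomial.T (-(P.halfNd : ℤ)) : k[T;T⁻¹])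
        = 1 := by
      rw [← LaurentPolynomial.T_add, add_neg_cancel, LaurentPolynomial.T_zero]
    have h4 : ∀ i, LaurentPolynomial.invert (arc (P.γi i) (P.zcoord j i)
        (P.e i - 1 - P.coord (j + l) i) (P.z i)) = arc (P.γi i) (P.zcoord j i)
        (P.e i - 1 - P.coord (j + l) i) (LaurentPolynomial.invert (P.z i)) := fun i =>
      map_arc _ (LaurentPolynomial.invert : k[T;T⁻¹] ≃ₐ[k] k[T;T⁻¹]).toAlgHom _ _ _
    rw [uuCoeff, map_mul, map_smul, map_mul, map_prod, map_prod, LaurentPolynomial.invert_T, neg_neg]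
    simp_rw [h4, hrev]
    rw [prod_mul_distrib, prod_mul_distrib, ← map_prod (algebraMap k k[T;T⁻¹]), mul_smul_comm,
      mul_smul _ (∏ i, _)]
    congr 1
    rw [Algebra.smul_def]
    simp_rw [map_pow] at h2 ⊢
    linear_combination (LaurentPolynomial.T (P.halfNd : ℤ) *
      (algebraMap k k[T;T⁻¹]) (∏ i, ((-1) ^ (P.e i - 1 - P.coord (j + l) i) *
        rootPow (P.γi i) (((P.e i - 1 - P.coord (j + l) i : ℕ) : ZMod (P.e i)) * (1 + P.zcoord j i)) *
        P.γi i ^ ((P.e i - 1 - P.coord (j + l) i).choose 2))) *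
      ∏ i, arc (P.γi i) (P.zcoord l i) (P.e i - 1 - P.coord (j + l) i) (P.z i)) * h2 +
      (LaurentPolynomial.T (-(P.halfNd : ℤ)) *
      (algebraMap k k[T;T⁻¹]) (∏ i, ((-1) ^ (P.e i - 1 - P.coord (j + l) i) *
        rootPow (P.γi i) (((P.e i - 1 - P.coord (j + l) i : ℕ) : ZMod (P.e i)) * (1 + P.zcoord j i)) *
        P.γi i ^ ((P.e i - 1 - P.coord (j + l) i).choose 2))) *
      ∏ i, arc (P.γi i) (P.zcoord l i) (P.e i - 1 - P.coord (j + l) i) (P.z i)) * h3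
  rw [h1, uuCoeff, smul_smul, smul_smul, add_comm l j]
  congr 1
  have h5 := P.antiScal_reverse l j
  have h6 := P.antiScal_mul_scal j
  have h7 : P.chi (j - l * j) = P.chi j * P.chi (-(l * j)) := by
    rw [← chi_add, sub_eq_add_neg]
  have h8 := P.chi_mul_chi_neg j
  rw [h7]
  linear_combination (-(P.m : k)⁻¹) * h5 - (P.antiScal l * P.chi j * P.chi (-(l * j)) * (P.m : k)⁻¹) * h6 -
    (P.antiScal l * P.chi (-(l * j)) * (P.m : k)⁻¹) * h8

/-- The relation for `u_j u_l` for the images under the antipode. -/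
theorem antiU_mul_antiU (j l : ZMod P.m) : P.antiU l * P.antiU j =
    P.canon.hp (-1) * (listMon P.antiY (P.coord (j + l)) *
      P.canon.X (LaurentPolynomial.invert (P.uuCoeff j l))) := by
  have hR : P.canon.hp (-1) * (listMon P.antiY (P.coord (j + l)) *
      P.canon.X (LaurentPolynomial.invert (P.uuCoeff j l))) =
      P.canon.X (((∏ i, ((-1) ^ P.coord (j + l) i * (P.γi i ^ ((P.coord (j + l) i).choose 2))⁻¹)) *
        P.chi (-((j + l) * (j + l)))) •
      LaurentPolynomial.invert ((∏ i, P.z i ^ P.coord (j + l) i) * P.uuCoeff j l)) *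
      (P.canon.hp (-1 - (j + l)) * listMon P.canon.y (P.coord (j + l))) := by
    rw [listMon_antiY, smul_mul_assoc, mul_smul_comm, mul_smul, map_smul, map_smul, smul_mul_assoc,
      smul_mul_assoc]
    congr 1
    rw [map_mul LaurentPolynomial.invert, map_prod LaurentPolynomial.invert]
    simp_rw [map_pow LaurentPolynomial.invert]
    rw [map_mul, ← mul_assoc (listMon _ _), ← (P.canon.X_mul_listMon _ _).eq, mul_assoc, mul_assoc,
      ← (P.canon.X_mul_hp _ (-(j + l))).eq, ← mul_assoc (listMon _ _),
      ← (P.canon.X_mul_listMon _ _).eq, ← mul_assoc (P.canon.X _), ← mul_assoc (P.canon.X _),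
      ← map_mul, mul_assoc, Model.yMon_mul_hp, mul_smul_comm, mul_smul_comm, ← mul_assoc,
      ← (P.canon.X_mul_hp _ _).eq, mul_assoc, ← mul_assoc (P.canon.hp _), ← Model.hp_add, mul_neg,
      ← sub_eq_add_neg]
  have hT : LaurentPolynomial.invert (LaurentPolynomial.T (-(P.halfNd : ℤ)) : k[T;T⁻¹]) =
    LaurentPolynomial.T (P.halfNd : ℤ) := by rw [LaurentPolynomial.invert_T, neg_neg]
  have hT2 : (LaurentPolynomial.T (-(P.halfNd : ℤ)) * LaurentPolynomial.T (P.halfNd : ℤ) : k[T;T⁻¹])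
        = 1 := by
      rw [← LaurentPolynomial.T_add, neg_add_cancel, LaurentPolynomial.T_zero]
  have hL : P.canon.X (LaurentPolynomial.T (-(P.halfNd : ℤ))) * P.canon.hp (-1 - l) * P.canon.u l *
      (P.canon.X (LaurentPolynomial.T (-(P.halfNd : ℤ))) * P.canon.hp (-1 - j) * P.canon.u j) =
      P.chi (j - l * j) • (P.canon.X (P.uuCoeff l j) * (P.canon.hp (-1 - (j + l)) *
        listMon P.canon.y (P.coord (j + l)))) := by
    have h1 : listMon P.canon.y (P.coord (j + l)) * P.canon.h = P.chi (j + l) •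
        (P.canon.h * listMon P.canon.y (P.coord (j + l))) := by
      have := P.canon.yMon_mul_hp (j + l) 1
      rwa [Model.hp_one, mul_one] at this
    rw [mul_assoc (P.canon.X _ * _), mul_assoc (P.canon.X _) (P.canon.hp (-1 - j)),
      ← mul_assoc (P.canon.u l) (P.canon.X _), Model.u_mul_X, hT, mul_assoc (P.canon.X _) (P.canon.u l),
      ← mul_assoc (P.canon.u l), Model.u_mul_hp, smul_mul_assoc, mul_assoc _ (P.canon.u l),
      Model.u_mul_u, add_comm l j, mul_smul_comm, mul_smul_comm,
      mul_assoc (P.canon.X _) (P.canon.hp (-1 - l)),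
      ← mul_assoc (P.canon.hp (-1 - l)), ← (P.canon.X_mul_hp _ _).eq,
      mul_assoc (P.canon.X _) (P.canon.hp (-1 - l)), ← mul_assoc (P.canon.X _) (P.canon.X _), ← map_mul,
      hT2, map_one, one_mul, ← mul_assoc (P.canon.hp _) (P.canon.hp _), ← Model.hp_add,
      mul_assoc (P.canon.X _), h1, mul_smul_comm, mul_smul_comm, smul_smul, ← chi_add, ← mul_assoc,
      ← (P.canon.X_mul_hp _ _).eq, ← Model.hp_one, mul_assoc,
      ← mul_assoc (P.canon.hp _) (P.canon.hp _), ← Model.hp_add]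
    congr 2
    · ring
    · congr 3; ring
  rw [hR, uuCoeff_reverse, antiU, antiU, smul_mul_smul_comm, hL, smul_smul, map_smul, smul_mul_assoc]

/-- The model of the presentation of `D` in the opposite algebra that defines the antipode. -/
def antipodeModel : P.Model P.Dᵐᵒᵖ where
  x := P.antiX
  h := op (P.canon.hp (-1))
  y i := op (P.antiY i)
  u j := op (P.antiU j)
  h_pow := by
    rw [← op_pow, ← Model.hp_natCast_mul, ZMod.natCast_self, zero_mul, Model.hp_zero, op_one]
  x_h := by
    have := laurentEval_antiX P (LaurentPolynomial.T 1)
    rw [laurentEval_T, zpow_one] at this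
    rw [this]
    exact congrArg op (P.canon.X_mul_hp _ _).eq.symm
  x_y i := by
    have := laurentEval_antiX P (LaurentPolynomial.T 1)
    rw [laurentEval_T, zpow_one] at this
    rw [this]
    refine congrArg op (Commute.eq ?_)
    exact ((P.canon.X_mul_y _ _).symm.mul_left (P.X_mul_hp_commute_X _ _ _)).smul_left _
  y_y i l := congrArg op (P.antiY_comm i l).eq.symm
  y_h i := by
    rw [← op_mul, ← op_mul, ← op_smul]
    congr 1
    rw [antiY, smul_mul_assoc, mul_smul_comm, smul_comm]
    congr 1
    rw [mul_assoc (P.canon.y i), mul_assoc (P.canon.X _) (P.canon.hp _) (P.canon.hp _),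
      (P.canon.hp_comm _ (-1)).eq, ← mul_assoc (P.canon.X _) (P.canon.hp (-1)),
      (P.canon.X_mul_hp _ (-1)).eq,
      mul_assoc (P.canon.hp _), ← mul_assoc (P.canon.y i) (P.canon.hp (-1)), Model.y_mul_hp,
      smul_mul_assoc, smul_smul,
      mul_neg, mul_one, chi_mul_chi_neg, one_smul, mul_assoc]
  y_pow i := by
    rw [← op_pow, antiY_pow_e, laurentEval_antiX]
  x_u j := by
    have h1 := laurentEval_antiX P (LaurentPolynomial.T 1)
    have h2 := laurentEval_antiX P (LaurentPolynomial.T (-1))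
    rw [laurentEval_T, zpow_one] at h1
    rw [laurentEval_T, zpow_neg_one] at h2
    rw [h1, h2, ← op_mul, ← op_mul]
    congr 1
    rw [antiU, smul_mul_assoc, mul_smul_comm, mul_assoc, Model.u_mul_X, invert_invert, ← mul_assoc,
      ← mul_assoc, (P.X_mul_hp_commute_X _ _ _).eq, LaurentPolynomial.invert_T, neg_neg]
  y_u i j := by
    rw [laurentEval_antiX, ← op_mul, ← op_mul, antiU_mul_antiY]
  y_u' i j := by
    rw [laurentEval_antiX, ← op_mul, ← op_mul, ← op_mul, ← op_smul, antiY_mul_antiU]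
  u_h j := by
    rw [← op_mul, ← op_mul, ← op_smul]
    congr 1
    rw [antiU, smul_mul_assoc, mul_smul_comm, smul_comm]
    congr 1
    rw [mul_assoc _ (P.canon.u j), Model.u_mul_hp, mul_smul_comm, smul_smul, mul_neg, mul_one,
      chi_mul_chi_neg, one_smul, ← mul_assoc, ← mul_assoc,
      ← (P.canon.X_mul_hp _ (-1)).eq, mul_assoc (P.canon.X _), (P.canon.hp_comm _ _).eq]
    simp only [mul_assoc]
  u_u j l := by
    have h1 : listMon (fun i => op (P.antiY i)) (P.coord (j + l)) =
        op (listMon P.antiY (P.coord (j + l))) := by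
      rw [listMon, listMon, ← list_prod_op _ fun i l => (P.antiY_comm i l).pow_pow _ _]
      rfl
    rw [laurentEval_antiX, h1, ← op_mul, ← op_mul, ← op_mul, antiU_mul_antiU]

end

end DData

open Finset MulOpposite
open scoped LaurentPolynomial TensorProduct

/-! ### The antipode axioms on generators -/

section Convolution

variable {k A : Type*} [Field k] [Ring A] [Algebra k A] (S : A →ₐ[k] Aᵐᵒᵖ)

/-- The linear map underlying a homomorphism to the opposite algebra. -/
noncomputable def unopLinear : A →ₗ[k] A :=
  (opLinearEquiv k).symm.toLinearMap ∘ₗ S.toLinearMap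

theorem neg_one_smul_add (a : A) : (-1 : k) • a + a = 0 := by simp

theorem unopLinear_apply (a : A) : unopLinear S a = unop (S a) := rfl

theorem unopLinear_mul (a b : A) : unopLinear S (a * b) = unopLinear S b * unopLinear S a := by
  simp [unopLinear_apply]

/-- The linear map `a ⊗ b ↦ S(a) b`. -/
noncomputable def convLeft : A ⊗[k] A →ₗ[k] A :=
  LinearMap.mul' k A ∘ₗ (unopLinear S).rTensor A

/-- The linear map `a ⊗ b ↦ a S(b)`. -/
noncomputable def convRight : A ⊗[k] A →ₗ[k] A :=
  LinearMap.mul' k A ∘ₗ (unopLinear S).lTensor A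

theorem convLeft_tmul (a b : A) : convLeft S (a ⊗ₜ b) = unopLinear S a * b := rfl

theorem convRight_tmul (a b : A) : convRight S (a ⊗ₜ b) = a * unopLinear S b := rfl

theorem convLeft_mul {t : A ⊗[k] A} {r : k} (ht : convLeft S t = algebraMap k A r)
    (s : A ⊗[k] A) : convLeft S (t * s) = r • convLeft S s := by
  have h : ∀ a b : A, ∀ t : A ⊗[k] A,
      convLeft S (t * a ⊗ₜ b) = unopLinear S a * convLeft S t * b := by
    intro a b t
    induction t with
    | zero => simp
    | add t t' ht ht' => rw [add_mul, map_add, ht, ht', map_add, mul_add, add_mul]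
    | tmul c d =>
      rw [Algebra.TensorProduct.tmul_mul_tmul, convLeft_tmul, convLeft_tmul, unopLinear_mul]
      simp only [mul_assoc]
  induction s with
  | zero => simp
  | add s s' hs hs' => rw [mul_add, map_add, hs, hs', map_add, smul_add]
  | tmul a b =>
    rw [h, ht, convLeft_tmul, ← Algebra.commutes, mul_assoc, Algebra.smul_def]

theorem convRight_mul {s : A ⊗[k] A} {r : k} (hs : convRight S s = algebraMap k A r)
    (t : A ⊗[k] A) : convRight S (t * s) = r • convRight S t := by
  have h : ∀ a b : A, ∀ t : A ⊗[k] A,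
      convRight S (a ⊗ₜ b * t) = a * convRight S t * unopLinear S b := by
    intro a b t
    induction t with
    | zero => simp
    | add t t' ht ht' => rw [mul_add, map_add, ht, ht', map_add, mul_add, add_mul]
    | tmul c d =>
      rw [Algebra.TensorProduct.tmul_mul_tmul, convRight_tmul, convRight_tmul, unopLinear_mul]
      simp only [mul_assoc]
  induction t with
  | zero => simp
  | add s s' hs hs' => rw [add_mul, map_add, hs, hs', map_add, smul_add]
  | tmul a b =>
    rw [h, hs, convRight_tmul, ← Algebra.commutes, mul_assoc, Algebra.smul_def]

variable (Δ : A →ₐ[k] A ⊗[k] A) (ε : A →ₐ[k] k)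

/-- The subalgebra of elements for which the left antipode axiom holds. -/
noncomputable def leftAntipodeSubalgebra : Subalgebra k A where
  carrier := {a | convLeft S (Δ a) = algebraMap k A (ε a)}
  mul_mem' {a b} ha hb := by
    change convLeft S (Δ (a * b)) = _
    rw [map_mul, convLeft_mul S ha, hb, map_mul, map_mul, Algebra.smul_def]
  add_mem' {a b} ha hb := by
    change convLeft S (Δ (a + b)) = _
    rw [map_add, map_add, ha, hb, map_add, map_add]
  algebraMap_mem' r := by
    change convLeft S (Δ (algebraMap k A r)) = _
    rw [AlgHom.commutes, AlgHom.commutes, Algebra.algebraMap_self, RingHom.id_apply,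
      Algebra.TensorProduct.algebraMap_apply, convLeft_tmul, unopLinear_apply, AlgHom.commutes]
    simp

/-- The subalgebra of elements for which the right antipode axiom holds. -/
noncomputable def rightAntipodeSubalgebra : Subalgebra k A where
  carrier := {a | convRight S (Δ a) = algebraMap k A (ε a)}
  mul_mem' {a b} ha hb := by
    change convRight S (Δ (a * b)) = _
    rw [map_mul, convRight_mul S hb, ha, map_mul, map_mul, Algebra.smul_def, Algebra.commutes]
  add_mem' {a b} ha hb := by
    change convRight S (Δ (a + b)) = _
    rw [map_add, map_add, ha, hb, map_add, map_add]
  algebraMap_mem' r := by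
    change convRight S (Δ (algebraMap k A r)) = _
    rw [AlgHom.commutes, AlgHom.commutes, Algebra.algebraMap_self, RingHom.id_apply,
      Algebra.TensorProduct.algebraMap_apply, convRight_tmul, unopLinear_apply, map_one]
    simp

end Convolution

namespace DData

noncomputable section

variable {k : Type u} [Field k] (P : DData k) [hP : P.IsAdmissible]

/-- `D` is generated by `x`, `x⁻¹`, `h`, the `y_i` and the `u_j`. -/
theorem subalgebra_eq_top (B : Subalgebra k P.D)
    (hx : ∀ n, P.canon.X (LaurentPolynomial.T n) ∈ B) (hh : P.canon.h ∈ B)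
    (hy : ∀ i, P.canon.y i ∈ B) (hu : ∀ j, P.canon.u j ∈ B) (a : P.D) : a ∈ B := by
  have hg : ∀ n, P.g n ∈ B := fun n => by
    rw [canon_g]
    exact mul_mem (hx _) (pow_mem hh _)
  have hx' : ∀ n, P.x n ∈ B := fun n => by
    rw [← canon_X_T]
    exact hx n
  obtain ⟨a, rfl⟩ := RingQuot.mkAlgHom_surjective k P.Rel a
  change P.proj a ∈ B
  induction a using FreeAlgebra.induction with
  | grade0 r => rw [AlgHom.commutes]; exact B.algebraMap_mem r
  | mul a b ha hb => rw [map_mul]; exact mul_mem ha hb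
  | add a b ha hb => rw [map_add]; exact add_mem ha hb
  | grade1 a =>
    cases a with
    | x => have := hx' 1; rwa [x, show P.fx 1 = FreeAlgebra.ι k DGen.x from pow_one _] at this
    | xinv =>
      have := hx' (-1); rwa [x, show P.fx (-1) = FreeAlgebra.ι k DGen.xinv from pow_one _] at this
    | g => have := hg 1; rwa [g, show P.fg 1 = FreeAlgebra.ι k DGen.g from pow_one _] at this
    | ginv =>
      have := hg (-1); rwa [g, show P.fg (-1) = FreeAlgebra.ι k DGen.ginv from pow_one _] at this
    | y i => exact hy i
    | u j => exact hu j

/-- The antipode of `D`. -/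
def anti : P.D →ₗ[k] P.D := unopLinear P.antipodeModel.lift

theorem anti_mul (a b : P.D) : P.anti (a * b) = P.anti b * P.anti a := unopLinear_mul _ _ _

theorem anti_X (f : k[T;T⁻¹]) :
    P.anti (P.canon.X f) = P.canon.X (LaurentPolynomial.invert f) := by
  rw [anti, unopLinear_apply, Model.lift_X]
  exact congrArg unop (P.laurentEval_antiX f)

theorem anti_h : P.anti P.canon.h = P.canon.hp (-1) := by
  rw [anti, unopLinear_apply, Model.lift_h]
  rfl

theorem anti_hp (a : ZMod P.m) : P.anti (P.canon.hp a) = P.canon.hp (-a) := by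
  rw [anti, unopLinear_apply, Model.lift_hp, Model.hp]
  change unop (op (P.canon.hp (-1)) ^ a.val) = _
  rw [← op_pow, unop_op, ← Model.hp_natCast_mul, ZMod.natCast_zmod_val, mul_neg, mul_one]

theorem anti_y (i : Fin P.θ) : P.anti (P.canon.y i) = P.antiY i := by
  rw [anti, unopLinear_apply, Model.lift_y]
  rfl

theorem anti_u (j : ZMod P.m) : P.anti (P.canon.u j) = P.antiU j := by
  rw [anti, unopLinear_apply, Model.lift_u]
  rfl

theorem T_mul_T_neg (n : ℤ) :
    (LaurentPolynomial.T n * LaurentPolynomial.T (-n) : k[T;T⁻¹]) = 1 := by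
  rw [← LaurentPolynomial.T_add, add_neg_cancel, LaurentPolynomial.T_zero]

theorem coord_ne_zero_of_ne {j : ZMod P.m} (hj : j ≠ 0) : ∃ i, P.coord j i ≠ 0 := by
  by_contra! h
  exact hj (P.coord_injective (funext fun i => (h i).trans (P.coord_zero i).symm))

theorem prod_ite_coord {A : Type*} [CommRing A] (j : ZMod P.m) (f : Fin P.θ → A) :
    (∏ i, if P.coord j i = 0 then f i else 0) = if j = 0 then ∏ i, f i else 0 := by
  split_ifs with hj
  · simp [hj, coord_zero]
  · obtain ⟨i, hi⟩ := P.coord_ne_zero_of_ne hj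
    exact prod_eq_zero (mem_univ i) (if_neg hi)

/-- The coefficient of `∑ S(a₁) a₂` for `a = u_j`. -/
theorem sum_antiScal_uuCoeff (j : ZMod P.m) : ∑ l, (P.antiScal l * P.chi (l * j)) •
    P.uuCoeff l (j - l) =
    if j = 0 then LaurentPolynomial.T (P.halfNd : ℤ) else 0 := by
  have h1 : ∀ l, (P.antiScal l * P.chi (l * j)) • P.uuCoeff l (j - l) =
      ((P.m : k)⁻¹ * P.scal j) • (LaurentPolynomial.T (-(P.halfNd : ℤ)) *
        ∏ i, (fun i a => algebraMap k k[T;T⁻¹] (rootPow (P.γi i) a) *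
          arc (P.γi i) a (P.e i - 1 - P.coord j i) (P.z i)) i (P.zcoord l i)) := by
    intro l
    have := P.antiScal_mul_scal_sub l j
    rw [uuCoeff, smul_smul, add_sub_cancel, prod_mul_distrib, ← map_prod, ← Algebra.smul_def,
      mul_smul_comm, smul_smul]
    congr 1
    linear_combination (P.m : k)⁻¹ * this
  rw [sum_congr rfl fun l _ => h1 l, ← smul_sum, ← mul_sum, sum_prod_zcoord P (fun i a =>
    algebraMap k k[T;T⁻¹] (rootPow (P.γi i) a) * arc (P.γi i) a (P.e i - 1 - P.coord j i) (P.z i)),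
    prod_congr rfl fun i _ => sum_rootPow_mul_arc_right (P.γi_primitive i) (P.coord j i)
      (P.coord_lt j i) (P.z i), prod_ite_coord]
  split_ifs with hj
  · rw [prod_mul_distrib, prod_z_pow, hj, scal_zero, mul_one, Algebra.smul_def]
    have h2 := congrArg (algebraMap k k[T;T⁻¹]) P.prod_e_mul_inv
    rw [map_mul, map_prod, map_one] at h2
    simp_rw [map_natCast] at h2
    have h3 := T_mul_T_neg (k := k) (P.halfNd : ℤ)
    linear_combination (LaurentPolynomial.T (P.halfNd : ℤ) * (LaurentPolynomial.T (P.halfNd : ℤ) *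
      LaurentPolynomial.T (-(P.halfNd : ℤ)))) * h2 + LaurentPolynomial.T (P.halfNd : ℤ) * h3
  · rw [mul_zero, smul_zero]

/-- The coefficient of `∑ a₁ S(a₂)` for `a = u_j`. -/
theorem sum_antiScal_uuCoeff' (j : ZMod P.m) : ∑ l, (P.antiScal (j - l) * P.chi (-l - l * j)) •
    P.uuCoeff l (j - l) =
    if j = 0 then LaurentPolynomial.T (-(P.halfNd : ℤ)) else 0 := by
  have h1 : ∀ l, (P.antiScal (j - l) * P.chi (-l - l * j)) • P.uuCoeff l (j - l) =
      ((P.m : k)⁻¹ * P.chi (-j)) • (LaurentPolynomial.T (-(P.halfNd : ℤ)) *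
        ∏ i, (fun i a => algebraMap k k[T;T⁻¹]
          (rootPow (P.γi i) (a * (P.coord j i : ZMod (P.e i)))) *
          arc (P.γi i) a (P.e i - 1 - P.coord j i) (P.z i)) i (P.zcoord l i)) := by
    intro l
    have h2 := P.antiScal_mul_scal (j - l)
    have h3 : ∏ i, rootPow (P.γi i) (P.zcoord l i * (P.coord j i : ZMod (P.e i))) =
        P.chi (-(l * j)) := by
      rw [← mul_neg, chi_mul]
      refine prod_congr rfl fun i _ => ?_
      rw [zcoord_neg, coord_natCast, mul_neg, neg_neg]
    have h4 : P.chi (-(j - l)) * P.chi (-l - l * j) = P.chi (-j) * P.chi (-(l * j)) := by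
      rw [← chi_add, ← chi_add]; congr 1; ring
    rw [uuCoeff, smul_smul, add_sub_cancel, prod_mul_distrib, ← map_prod, ← Algebra.smul_def,
      mul_smul_comm, smul_smul, h3]
    congr 1
    linear_combination (P.m : k)⁻¹ * P.chi (-l - l * j) * h2 + (P.m : k)⁻¹ * h4
  rw [sum_congr rfl fun l _ => h1 l, ← smul_sum, ← mul_sum, sum_prod_zcoord P (fun i a =>
    algebraMap k k[T;T⁻¹] (rootPow (P.γi i) (a * (P.coord j i : ZMod (P.e i)))) *
      arc (P.γi i) a (P.e i - 1 - P.coord j i) (P.z i)),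
    prod_congr rfl fun i _ => sum_rootPow_mul_arc_left (P.γi_primitive i) (P.coord j i)
      (P.coord_lt j i) (P.z i), prod_ite_coord]
  split_ifs with hj
  · rw [hj, neg_zero, chi_zero, mul_one, Algebra.smul_def]
    have h2 := congrArg (algebraMap k k[T;T⁻¹]) P.prod_e_mul_inv
    rw [map_mul, map_prod, map_one] at h2
    simp_rw [map_natCast] at h2
    linear_combination LaurentPolynomial.T (-(P.halfNd : ℤ)) * h2
  · rw [mul_zero, smul_zero]

theorem X_T_neg_mul (n : ℤ) : P.canon.X (LaurentPolynomial.T (-n)) *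
    P.canon.X (LaurentPolynomial.T n) = 1 := by
  rw [← map_mul, mul_comm, T_mul_T_neg, map_one]

theorem hp_neg_mul (a : ZMod P.m) : P.canon.hp (-a) * P.canon.hp a = 1 := by
  rw [← Model.hp_add, neg_add_cancel, Model.hp_zero]

theorem hp_mul_neg (a : ZMod P.m) : P.canon.hp a * P.canon.hp (-a) = 1 := by
  rw [← Model.hp_add, add_neg_cancel, Model.hp_zero]

theorem listMon_coord_zero : listMon P.canon.y (P.coord 0) = 1 := by
  rw [show P.coord 0 = 0 from funext P.coord_zero, listMon_zero]

theorem convLeft_comulU (j : ZMod P.m) :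
    convLeft P.antipodeModel.lift (P.comulHom (P.canon.u j)) =
      algebraMap k P.D (P.counitHom (P.canon.u j)) := by
  have h1 : ∀ l, P.chi (l * (j - l)) • (P.anti (P.canon.u l) * (P.canon.hp l * P.canon.u (j - l))) =
      P.canon.X (LaurentPolynomial.T (-(P.halfNd : ℤ))) * (P.canon.hp (-1) *
        (P.canon.X ((P.antiScal l * P.chi (l * j)) • P.uuCoeff l (j - l)) *
          (listMon P.canon.y (P.coord j) * P.canon.h))) := by
    intro l
    rw [anti_u, antiU, smul_mul_assoc, mul_assoc, ← mul_assoc (P.canon.u l), Model.u_mul_hp,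
      smul_mul_assoc, mul_smul_comm, smul_smul, smul_smul, mul_assoc (P.canon.X _),
      mul_assoc (P.canon.hp l), ← mul_assoc (P.canon.hp _) (P.canon.hp l), ← Model.hp_add,
      Model.u_mul_u, add_sub_cancel, sub_add_cancel, map_smul, smul_mul_assoc, mul_smul_comm, mul_smul_comm]
    simp only [mul_assoc]
    congr 1
    rw [mul_left_comm, ← chi_add]
    congr 2
    ring
  rw [comulHom_u, map_sum]
  simp_rw [map_smul, convLeft_tmul]
  refine (sum_congr rfl fun l _ => h1 l).trans ?_
  rw [← mul_sum, ← mul_sum, ← sum_mul, ← map_sum,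
    sum_antiScal_uuCoeff, counit_u]
  split_ifs with hj
  · rw [hj, listMon_coord_zero, one_mul, ← mul_assoc (P.canon.hp _), ← (P.canon.X_mul_hp _ _).eq,
      mul_assoc, ← mul_assoc, X_T_neg_mul, one_mul, ← Model.hp_one, hp_neg_mul, map_one]
  · simp

theorem convRight_comulU (j : ZMod P.m) :
    convRight P.antipodeModel.lift (P.comulHom (P.canon.u j)) =
      algebraMap k P.D (P.counitHom (P.canon.u j)) := by
  have h1 : ∀ l, P.chi (l * (j - l)) • (P.canon.u l * P.anti (P.canon.hp l * P.canon.u (j - l))) =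
      P.canon.X (LaurentPolynomial.T (P.halfNd : ℤ)) * (P.canon.hp (-1 - j) *
        (P.canon.X ((P.antiScal (j - l) * P.chi (-l - l * j)) • P.uuCoeff l (j - l)) *
          (listMon P.canon.y (P.coord j) * P.canon.h))) := by
    intro l
    rw [anti_mul, anti_hp, anti_u, antiU, smul_mul_assoc, mul_smul_comm, smul_smul,
      mul_assoc _ (P.canon.u _), Model.u_mul_hp, mul_smul_comm, mul_smul_comm, smul_smul,
      mul_assoc (P.canon.X _), ← mul_assoc (P.canon.hp _) (P.canon.hp _), ← Model.hp_add,
      ← mul_assoc (P.canon.u l), Model.u_mul_X, mul_assoc (P.canon.X _), ← mul_assoc (P.canon.u l),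
      Model.u_mul_hp, smul_mul_assoc, mul_smul_comm, smul_smul, mul_assoc (P.canon.hp _),
      Model.u_mul_u, add_sub_cancel, LaurentPolynomial.invert_T, neg_neg, map_smul, smul_mul_assoc,
      mul_smul_comm, mul_smul_comm, show -1 - (j - l) + -l = -1 - j by ring]
    simp only [mul_assoc]
    congr 1
    rw [mul_left_comm, ← chi_add, ← chi_add]
    congr 2
    ring
  rw [comulHom_u, map_sum]
  simp_rw [map_smul, convRight_tmul]
  refine (sum_congr rfl fun l _ => h1 l).trans ?_
  rw [← mul_sum, ← mul_sum, ← sum_mul, ← map_sum,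
    sum_antiScal_uuCoeff', counit_u]
  split_ifs with hj
  · rw [hj, listMon_coord_zero, one_mul, ← mul_assoc (P.canon.hp _), ← (P.canon.X_mul_hp _ _).eq,
      mul_assoc, ← mul_assoc, ← map_mul, T_mul_T_neg, map_one, one_mul, sub_zero, ← Model.hp_one,
      hp_neg_mul, map_one]
  · simp

theorem convLeft_comul (a : P.D) : convLeft P.antipodeModel.lift (P.comulHom a) =
    algebraMap k P.D (P.counitHom a) := by
  refine P.subalgebra_eq_top (leftAntipodeSubalgebra P.antipodeModel.lift P.comulHom P.counitHom)
    (fun n => ?_) ?_ (fun i => ?_) P.convLeft_comulU a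
  · change convLeft _ _ = _
    rw [comulHom_X_T, convLeft_tmul, counit_X_T, map_one]
    change P.anti _ * _ = _
    rw [anti_X, LaurentPolynomial.invert_T, X_T_neg_mul]
  · change convLeft _ _ = _
    rw [comulHom_h, convLeft_tmul, counit_h, map_one]
    change P.anti _ * _ = _
    rw [anti_h, ← Model.hp_one, hp_neg_mul]
  · change convLeft _ _ = _
    rw [comulHom_y, map_add, convLeft_tmul, convLeft_tmul, counit_y, map_zero, unopLinear_apply _ 1,
      map_one, unop_one, one_mul]
    change P.anti _ * _ + _ = _
    have h1 : P.canon.X (LaurentPolynomial.invert (P.z i)) * P.canon.hp (-P.M i) *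
        (P.canon.X (P.z i) * P.canon.hp (P.M i)) = 1 := by
      rw [← mul_assoc, (P.X_mul_hp_commute_X _ _ _).eq, ← mul_assoc, ← map_mul, invert_z_mul, map_one,
        one_mul, hp_neg_mul]
    rw [anti_y, antiY, smul_mul_assoc, mul_assoc, h1, mul_one]
    exact neg_one_smul_add (k := k) (A := P.D) _

theorem convRight_comul (a : P.D) : convRight P.antipodeModel.lift (P.comulHom a) =
    algebraMap k P.D (P.counitHom a) := by
  refine P.subalgebra_eq_top (rightAntipodeSubalgebra P.antipodeModel.lift P.comulHom P.counitHom)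
    (fun n => ?_) ?_ (fun i => ?_) P.convRight_comulU a
  · change convRight _ _ = _
    rw [comulHom_X_T, convRight_tmul, counit_X_T, map_one]
    change _ * P.anti _ = _
    rw [anti_X, LaurentPolynomial.invert_T, ← map_mul, T_mul_T_neg, map_one]
  · change convRight _ _ = _
    rw [comulHom_h, convRight_tmul, counit_h, map_one]
    change _ * P.anti _ = _
    rw [anti_h, ← Model.hp_one, hp_mul_neg]
  · change convRight _ _ = _
    rw [comulHom_y, map_add, convRight_tmul, convRight_tmul, counit_y, map_zero, one_mul]
    change _ * P.anti _ + P.anti _ = _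
    rw [anti_y, antiY, anti_mul, anti_X, anti_hp, (P.canon.X_mul_hp _ _).eq, add_comm]
    exact neg_one_smul_add (k := k) (A := P.D) _

/-! ### The square of the antipode -/

/-- The grouplike element `ω = h ^ (∑ m_i) x ^ (-N d / 2)`. -/
def omega : P.D := P.canon.X (LaurentPolynomial.T (-(P.halfNd : ℤ))) * P.canon.hp (∑ i, (P.M i : ZMod P.m))

/-- The inverse of `ω`. -/
def omegaInv : P.D :=
  P.canon.X (LaurentPolynomial.T (P.halfNd : ℤ)) * P.canon.hp (-∑ i, (P.M i : ZMod P.m))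

theorem omega_mul_inv : P.omega * P.omegaInv = 1 := by
  rw [omega, omegaInv, mul_assoc, ← mul_assoc (P.canon.hp _), ← (P.canon.X_mul_hp _ _).eq, mul_assoc,
    hp_mul_neg, mul_one, X_T_neg_mul]

theorem omega_inv_mul : P.omegaInv * P.omega = 1 := by
  rw [omega, omegaInv, mul_assoc, ← mul_assoc (P.canon.hp _), ← (P.canon.X_mul_hp _ _).eq, mul_assoc,
    hp_neg_mul, mul_one, ← map_mul, T_mul_T_neg, map_one]

theorem antiScal_sq (j : ZMod P.m) : P.antiScal j * P.antiScal j * P.chi (j * (1 + j)) =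
    P.chi (-(j * ∑ i, (P.M i : ZMod P.m))) := by
  have h1 : P.chi (-(j * ∑ i, (P.M i : ZMod P.m))) = ∏ i, rootPow (P.γi i) (P.zcoord j i) := by
    rw [← mul_neg, chi_mul]
    refine prod_congr rfl fun i _ => ?_
    have h0 : P.zcoord (∑ i, (P.M i : ZMod P.m)) i = 1 := by
      rw [P.zcoord_eq_of_sum (fun _ => 1) (by simp) i, Nat.cast_one]
    rw [zcoord_neg, h0, mul_neg, mul_one, neg_neg]
  have h2 := P.scal_mul_self_mul j
  have h3 : P.chi (j * (1 + j)) = P.chi j * P.chi (j * j) := by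
    rw [← chi_add]; congr 1; ring
  have h4 := P.scal_ne_zero j
  have h5 := P.chi_ne_zero j
  rw [h1, antiScal_eq, chi_neg, h3, ← h2]
  field_simp

theorem anti_anti_algHom : ∃ f : P.D →ₐ[k] P.D, ∀ a, f a = P.anti (P.anti a) :=
  ⟨AlgHom.ofLinearMap (P.anti ∘ₗ P.anti)
    (by
      have h1 : P.anti 1 = 1 := by rw [anti, unopLinear_apply, map_one, unop_one]
      rw [LinearMap.comp_apply, h1, h1])
    (fun a b => by
      simp only [LinearMap.comp_apply, anti_mul]), fun _ => rfl⟩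

theorem conj_omega_algHom : ∃ f : P.D →ₐ[k] P.D, ∀ a, f a = P.omega * a * P.omegaInv :=
  ⟨AlgHom.ofLinearMap (LinearMap.mulRight k P.omegaInv ∘ₗ LinearMap.mulLeft k P.omega)
    (by simp [omega_mul_inv])
    (fun a b => by
      simp only [LinearMap.comp_apply, LinearMap.mulLeft_apply, LinearMap.mulRight_apply]
      rw [mul_assoc (P.omega * a), mul_assoc P.omega b, ← mul_assoc P.omegaInv P.omega,
        omega_inv_mul, one_mul]
      simp only [mul_assoc]), fun _ => rfl⟩

theorem conj_omega_y (i : Fin P.θ) :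
    P.omega * P.canon.y i * P.omegaInv = P.γi i • P.canon.y i := by
  have h1 : P.chi (P.M i * ∑ l, (P.M l : ZMod P.m)) = (P.γi i)⁻¹ := by
    rw [← chi_M_mul_M, mul_sum, sum_eq_single i (fun l _ hl => P.M_mul_M (Ne.symm hl)) (by simp)]
  have h2 : P.canon.y i * P.omega = (P.γi i)⁻¹ • (P.omega * P.canon.y i) := by
    rw [omega, ← mul_assoc, ← (P.canon.X_mul_y _ _).eq, mul_assoc, Model.y_mul_hp, h1, mul_smul_comm,
      mul_assoc]
  have h3 : P.omega * P.canon.y i = P.γi i • (P.canon.y i * P.omega) := by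
    rw [h2, smul_smul, mul_inv_cancel₀ (P.γi_ne_zero i), one_smul]
  rw [h3, smul_mul_assoc, mul_assoc, omega_mul_inv, mul_one]

theorem conj_omega_u (j : ZMod P.m) : P.omega * P.canon.u j * P.omegaInv =
    P.chi (-(j * ∑ i, (P.M i : ZMod P.m))) • (P.canon.X (LaurentPolynomial.T (-(P.halfNd : ℤ))) *
      (P.canon.X (LaurentPolynomial.T (-(P.halfNd : ℤ))) * P.canon.u j)) := by
  have h3 : P.omega * P.canon.u j = P.chi (-(j * ∑ i, (P.M i : ZMod P.m))) •
      (P.canon.X (LaurentPolynomial.T (-(P.halfNd : ℤ))) *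
      (P.canon.X (LaurentPolynomial.T (-(P.halfNd : ℤ))) * (P.canon.u j * P.omega))) := by
    rw [omega, ← mul_assoc (P.canon.u j), Model.u_mul_X, LaurentPolynomial.invert_T, neg_neg,
      mul_assoc _ (P.canon.u j), Model.u_mul_hp, mul_smul_comm, mul_smul_comm, mul_smul_comm, smul_smul,
      mul_comm (P.chi _), chi_mul_chi_neg, one_smul, ← mul_assoc (P.canon.X (LaurentPolynomial.T (-(P.halfNd : ℤ))))
        (P.canon.X (LaurentPolynomial.T (P.halfNd : ℤ))), X_T_neg_mul, one_mul, mul_assoc]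
  rw [h3, smul_mul_assoc, mul_assoc (P.canon.X _), mul_assoc (P.canon.X _), mul_assoc (P.canon.u j),
    omega_mul_inv, mul_one]

/-- The square of the antipode is conjugation by `ω`. Both sides are algebra homomorphisms, so it
suffices to compare them on the generators. -/
theorem anti_anti (a : P.D) : P.anti (P.anti a) = P.omega * a * P.omegaInv := by
  obtain ⟨f, hf⟩ := P.anti_anti_algHom
  obtain ⟨f', hf'⟩ := P.conj_omega_algHom
  have hc : ∀ b, Commute P.omega b → P.omega * b * P.omegaInv = b := fun b hb => by
    rw [hb.eq, mul_assoc, omega_mul_inv, mul_one]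
  rw [← hf, ← hf']
  refine DFunLike.congr_fun (algHom_ext ?_ ?_ (fun i => ?_) (fun j => ?_)) a
  · rw [hf, hf', anti_X, anti_X, invert_invert, hc]
    exact P.X_mul_hp_commute_X _ _ _
  · rw [hf, hf', anti_h, anti_hp, neg_neg, Model.hp_one, hc]
    exact (P.canon.X_mul_h _).mul_left (P.canon.h_mul_hp _).symm
  · rw [hf, hf', conj_omega_y, anti_y, antiY, map_smul, anti_mul, anti_mul, anti_X, anti_hp,
      invert_invert, neg_neg, anti_y, antiY, mul_smul_comm, smul_smul, neg_mul_neg, one_mul, one_smul,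
      mul_assoc (P.canon.hp _), ← mul_assoc (P.canon.X _) (P.canon.y i), (P.canon.X_mul_y _ _).eq,
      mul_assoc (P.canon.y i), ← mul_assoc (P.canon.X _) (P.canon.X _), ← map_mul, invert_z_mul,
      map_one, one_mul, Model.y_mul_hp, mul_smul_comm, ← mul_assoc, hp_mul_neg, one_mul, mul_neg,
      chi_neg, chi_M_mul_M, inv_inv]
  · have h1 : P.canon.u j * (P.canon.X (LaurentPolynomial.T (P.halfNd : ℤ)) * P.canon.hp (1 + j)) =
        P.chi (j * (1 + j)) • (P.canon.X (LaurentPolynomial.T (-(P.halfNd : ℤ))) *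
          (P.canon.hp (1 + j) * P.canon.u j)) := by
      rw [← mul_assoc, Model.u_mul_X, LaurentPolynomial.invert_T, mul_assoc, Model.u_mul_hp,
        mul_smul_comm]
    rw [hf, hf', conj_omega_u, anti_u, antiU, map_smul, anti_mul, anti_mul, anti_X, anti_hp, anti_u,
      antiU, LaurentPolynomial.invert_T, neg_neg, ← (P.canon.X_mul_hp _ _).eq, smul_mul_assoc,
      mul_assoc _ (P.canon.u j), show -(-1 - j) = 1 + j by ring, h1, mul_smul_comm, smul_smul,
      smul_smul, antiScal_sq, mul_assoc (P.canon.X _), ← mul_assoc (P.canon.hp _),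
      ← (P.canon.X_mul_hp _ _).eq, mul_assoc (P.canon.X _) (P.canon.hp _),
      ← mul_assoc (P.canon.hp _), show -1 - j = -(1 + j) by ring, hp_neg_mul, one_mul]

theorem anti_bijective : Function.Bijective P.anti := by
  have h : Function.Bijective (P.anti ∘ P.anti) := by
    have h1 : P.anti ∘ P.anti = fun a => P.omega * a * P.omegaInv := funext P.anti_anti
    rw [h1]
    refine Function.bijective_iff_has_inverse.2 ⟨fun a => P.omegaInv * a * P.omega,
      fun a => ?_, fun a => ?_⟩
    · simp only [← mul_assoc, omega_inv_mul, one_mul]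
      rw [mul_assoc, omega_inv_mul, mul_one]
    · simp only [← mul_assoc, omega_mul_inv, one_mul]
      rw [mul_assoc, omega_mul_inv, mul_one]
  exact ⟨Function.Injective.of_comp h.1, Function.Surjective.of_comp h.2⟩

/-! ### The Hopf algebra structure -/

/-- The Hopf algebra structure on `D`. -/
def hopfStructure : HopfStructure k P.D where
  comul := P.comulHom
  counit := P.counitHom
  antipode := P.anti
  coassoc := P.comulHom_coassoc
  rTensor_counit := P.comulHom_rTensor_counit
  lTensor_counit := P.comulHom_lTensor_counit
  mul_antipode_rTensor := LinearMap.ext P.convLeft_comul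
  mul_antipode_lTensor := LinearMap.ext P.convRight_comul
  antipode_bijective := P.anti_bijective

theorem isStandard_hopfStructure : P.IsStandard P.hopfStructure where
  comul_x := by
    rw [← canon_X_T]
    exact P.comulHom_X_T 1
  comul_g := by
    rw [canon_g]
    refine (map_mul P.comulHom _ _).trans ?_
    rw [comulHom_X_T, comulHom_hp, Algebra.TensorProduct.tmul_mul_tmul]
  comul_y i := by
    rw [canon_g, Int.cast_natCast]
    refine (P.comulHom_y i).trans ?_
    rw [z, Nat.cast_mul]
    rfl
  comul_u j := by
    refine (P.comulHom_u j).trans ?_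
    refine sum_nbij' (fun l => l.val) (fun l => (l : ZMod P.m)) (fun l _ => mem_range.2 l.val_lt)
      (fun l _ => mem_univ _) (fun l _ => ZMod.natCast_zmod_val l)
      (fun l hl => ZMod.val_cast_of_lt (mem_range.1 hl)) (fun l _ => ?_)
    rw [← chi_intCast, ← canon_X_T, canon_g, ZMod.natCast_zmod_val, ← mul_assoc (P.canon.X _),
      ← map_mul, ← LaurentPolynomial.T_add]
    have h1 : -((l.val * P.d : ℕ) : ℤ) + (l.val : ℤ) * P.d = 0 := by push_cast; ring
    have h2 : (((l.val : ℤ) * ((j.val : ℤ) - (l.val : ℤ)) : ℤ) : ZMod P.m) = l * (j - l) := by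
      push_cast
      rw [ZMod.natCast_zmod_val, ZMod.natCast_zmod_val]
    rw [h1, h2, LaurentPolynomial.T_zero, map_one, one_mul, Int.cast_natCast, ZMod.natCast_zmod_val]
    rfl
  counit_x := by
    rw [← canon_X_T]
    exact P.counit_X_T 1
  counit_g := by
    rw [canon_g]
    refine (map_mul P.counitHom _ _).trans ?_
    rw [counit_X_T, counit_hp, one_mul]
  counit_y i := P.counit_y i
  counit_u_zero := (P.counit_u 0).trans (if_pos rfl)
  counit_u j hj := (P.counit_u j).trans (if_neg hj)
  antipode_x := by
    rw [← canon_X_T, ← canon_X_T]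
    refine (P.anti_X _).trans ?_
    rw [LaurentPolynomial.invert_T]
  antipode_g := by
    rw [canon_g, canon_g]
    refine (P.anti_mul _ _).trans ?_
    rw [anti_X, anti_hp, LaurentPolynomial.invert_T, ← (P.canon.X_mul_hp _ _).eq, neg_mul,
      Int.cast_neg]
  antipode_y i := by
    rw [canon_g]
    refine (P.anti_y i).trans ?_
    rw [antiY, z, LaurentPolynomial.invert_T, Nat.cast_mul, neg_mul, Int.cast_neg, Int.cast_natCast]
    exact neg_one_smul k (_ : P.D)
  antipode_u j := by
    refine (P.anti_u j).trans ?_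
    rw [antiU]
    refine congrArg (P.antiScal j • ·) ?_
    rw [← canon_X_T, canon_g, ← mul_assoc (P.canon.X _), ← map_mul, ← LaurentPolynomial.T_add]
    have h1 : (((P.m : ℤ) - 1 - ((∑ i, P.coord j i * P.M i : ℕ) : ℤ) : ℤ) : ZMod P.m) = -1 - j := by
      push_cast
      rw [sum_coord, ZMod.natCast_self, zero_sub]
    have h2 : (1 - (P.m : ℤ)) * P.d - ((P.N * P.d / 2 : ℕ) : ℤ)
          + ((∑ i, P.coord j i * P.M i * P.d : ℕ) : ℤ) +
          ((P.m : ℤ) - 1 - ((∑ i, P.coord j i * P.M i : ℕ) : ℤ)) * P.d = -(P.halfNd : ℤ) := by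
      rw [← sum_mul, halfNd]
      generalize P.N * P.d / 2 = c
      push_cast
      ring
    rw [h1, h2]
    rfl

end

end DData

open Finset
open scoped LaurentPolynomial TensorProduct

/-! ### Weighted shift matrices -/

section Wshift

variable {I R : Type*} [Fintype I] [DecidableEq I] [CommRing R]

/-- The matrix that sends the basis vector `i` to `c i` times the basis vector `σ i`. -/
def wshift (σ : I → I) (c : I → R) : Matrix I I R :=
  Matrix.of fun a b => if a = σ b then c b else 0

omit [Fintype I] in
theorem wshift_apply (σ : I → I) (c : I → R) (a b : I) :
    wshift σ c a b = if a = σ b then c b else 0 := rfl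

theorem wshift_mul (σ τ : I → I) (c d : I → R) :
    wshift σ c * wshift τ d = wshift (σ ∘ τ) (fun i => d i * c (τ i)) := by
  ext a b
  rw [Matrix.mul_apply, wshift_apply, sum_eq_single (τ b)]
  · rw [wshift_apply, wshift_apply, if_pos rfl, Function.comp_apply, ite_mul, zero_mul, mul_comm]
  · intro p _ hp
    rw [wshift_apply _ _ p, if_neg hp, mul_zero]
  · simp

theorem wshift_one : (wshift id fun _ => 1 : Matrix I I R) = 1 := by
  ext a b
  rw [wshift_apply, Matrix.one_apply]
  rfl

theorem wshift_pow (σ : I → I) (c : I → R) (n : ℕ) :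
    wshift σ c ^ n = wshift σ^[n] (fun i => ∏ t ∈ range n, c (σ^[t] i)) := by
  induction n with
  | zero => simp [wshift_one]
  | succ n ih =>
    rw [pow_succ', ih, wshift_mul, ← Function.iterate_succ']
    congr 1
    funext i
    rw [prod_range_succ]

omit [Fintype I] in
theorem smul_wshift {k : Type*} [Field k] [Algebra k R] (r : k) (σ : I → I) (c : I → R) :
    r • wshift σ c = wshift σ (fun i => r • c i) := by
  ext a b
  rw [Matrix.smul_apply, wshift_apply, wshift_apply]
  split_ifs <;> simp

omit [Fintype I] in
theorem wshift_id_add (c d : I → R) :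
    wshift id c + wshift id d = wshift id (fun i => c i + d i) := by
  ext a b
  rw [Matrix.add_apply, wshift_apply, wshift_apply, wshift_apply]
  split_ifs <;> simp

omit [Fintype I] in
theorem wshift_congr {σ τ : I → I} {c d : I → R} (h : ∀ i, σ i = τ i) (h' : ∀ i, c i = d i) :
    wshift σ c = wshift τ d := by
  rw [funext h, funext h']

end Wshift

namespace DData

noncomputable section

variable {k : Type u} [Field k] (P : DData k)

/-- The automorphism `T ↦ T` of the Laurent polynomials for `true`, and `T ↦ T⁻¹` for `false`. -/
def tw : Bool → (k[T;T⁻¹] ≃ₐ[k] k[T;T⁻¹])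
  | true => AlgEquiv.refl
  | false => LaurentPolynomial.invert

theorem tw_true (f : k[T;T⁻¹]) : tw true f = f := rfl

theorem tw_false (f : k[T;T⁻¹]) : tw false f = LaurentPolynomial.invert f := rfl

theorem tw_not (b : Bool) (f : k[T;T⁻¹]) : tw (!b) f = tw b (LaurentPolynomial.invert f) := by
  cases b
  · exact (LaurentPolynomial.involutive_invert f).symm
  · rfl

/-- The index set of the basis of the regular-like representation: `(true, j)` stands for `y_j`, and
`(false, j)` for `u_j`. -/
abbrev Idx : Type := Bool × ZMod P.m

variable [hP : P.IsAdmissible]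

/-- The matrix of `x`. -/
def matX : (Matrix P.Idx P.Idx k[T;T⁻¹])ˣ where
  val := wshift id fun p => tw p.1 (LaurentPolynomial.T 1)
  inv := wshift id fun p => tw p.1 (LaurentPolynomial.T (-1))
  val_inv := by
    rw [wshift_mul, ← wshift_one]
    refine wshift_congr (fun _ => rfl) fun p => ?_
    rw [id, ← map_mul, ← LaurentPolynomial.T_add]
    simp
  inv_val := by
    rw [wshift_mul, ← wshift_one]
    refine wshift_congr (fun _ => rfl) fun p => ?_
    rw [id, ← map_mul, ← LaurentPolynomial.T_add]
    simp

/-- The coefficients of the matrix of `y_i`. -/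
def yCoeff (i : Fin P.θ) : P.Idx → k[T;T⁻¹]
  | (true, j) => if P.coord j i + 1 = P.e i then 1 - P.z i ^ P.e i else 1
  | (false, j) => LaurentPolynomial.invert (P.phiL i j)

/-- The local factors of the action of `u_l` on `y_j`. -/
def uLoc (l : ZMod P.m) (i : Fin P.θ) (n : ℕ) : k[T;T⁻¹] :=
  (P.ξ i)⁻¹ ^ n • (P.z i ^ n * arc (P.γi i) (P.zcoord l i) n (LaurentPolynomial.invert (P.z i)))

/-- The coefficients of the matrix of `u_l`. -/
def uCoeff (l : ZMod P.m) : P.Idx → k[T;T⁻¹]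
  | (true, j) => ∏ i, P.uLoc l i (P.coord j i)
  | (false, j) => P.uuCoeff l j

/-- The matrix of `h`. -/
def matH : Matrix P.Idx P.Idx k[T;T⁻¹] := wshift id fun p => algebraMap k _ (P.chi (-p.2))

/-- The matrix of `y_i`. -/
def matY (i : Fin P.θ) : Matrix P.Idx P.Idx k[T;T⁻¹] :=
  wshift (fun p => (p.1, p.2 + P.M i)) (P.yCoeff i)

/-- The matrix of `u_l`. -/
def matU (l : ZMod P.m) : Matrix P.Idx P.Idx k[T;T⁻¹] :=
  wshift (fun p => (!p.1, p.2 + l)) (P.uCoeff l)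

/-- A Laurent polynomial `f` in `x` acts diagonally, by `f(T)` on the `y_j` and by `f(T⁻¹)` on the
`u_j`. -/
theorem laurentEval_matX (f : k[T;T⁻¹]) :
    laurentEval P.matX f = wshift id fun p => tw p.1 f := by
  induction f using laurent_induction with
  | add f g hf hg =>
    rw [map_add, hf, hg, wshift_id_add]
    simp
  | T c n =>
    have h1 : ∀ (m : ℤ) (n : ℕ), (wshift id (fun p : P.Idx => tw p.1 (LaurentPolynomial.T m : k[T;T⁻¹]))) ^ n =
        wshift id fun p => tw p.1 (LaurentPolynomial.T (n * m)) := by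
      intro m n
      rw [wshift_pow]
      refine wshift_congr (fun p => by simp) fun p => ?_
      simp [← LaurentPolynomial.T_pow]
    have h2 : laurentEval P.matX (LaurentPolynomial.T n : k[T;T⁻¹]) =
        wshift id fun p => tw p.1 (LaurentPolynomial.T n) := by
      rw [laurentEval_T]
      obtain ⟨n, rfl | rfl⟩ := n.eq_nat_or_neg
      · rw [zpow_natCast, Units.val_pow_eq_pow_val]
        refine (h1 1 n).trans ?_
        rw [mul_one]
      · rw [zpow_neg, zpow_natCast, ← inv_pow, Units.val_pow_eq_pow_val]
        refine (h1 (-1) n).trans ?_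
        rw [mul_neg_one]
    rw [map_smul, h2, smul_wshift]
    simp

theorem coord_add_M_self (i : Fin P.θ) (j : ZMod P.m) :
    P.coord (j + P.M i) i = if P.coord j i + 1 = P.e i then 0 else P.coord j i + 1 := by
  have h1 := P.coord_lt j i
  have h2 : P.coord (P.M i) i = 1 % P.e i := by
    rw [← zcoord_val, zcoord_M_self, ← Nat.cast_one, ZMod.val_natCast]
  rw [coord_add, h2, Nat.add_mod_mod]
  split_ifs with h
  · rw [h, Nat.mod_self]
  · exact Nat.mod_eq_of_lt (by omega)

theorem zcoord_add_M_ne {i l : Fin P.θ} (hil : l ≠ i) (j : ZMod P.m) :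
    P.zcoord (j + P.M i) l = P.zcoord j l := by
  rw [zcoord_add, zcoord_M_ne _ hil, add_zero]

theorem coord_add_M_ne {i l : Fin P.θ} (hil : l ≠ i) (j : ZMod P.m) :
    P.coord (j + P.M i) l = P.coord j l := by
  rw [← zcoord_val, zcoord_add_M_ne _ hil, zcoord_val]

theorem yCoeff_congr {i : Fin P.θ} {b : Bool} {j j' : ZMod P.m} (h : P.zcoord j i = P.zcoord j' i) :
    P.yCoeff i (b, j) = P.yCoeff i (b, j') := by
  have h' : P.coord j i = P.coord j' i := by rw [← zcoord_val, h, zcoord_val]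
  cases b
  · simp only [yCoeff, phiL, h]
  · simp only [yCoeff, h']

theorem arc_mul_yCoeff (i : Fin P.θ) (a : ZMod (P.e i)) (s : ZMod P.m) :
    arc (P.γi i) a (P.e i - 1 - P.coord s i) (P.z i) * P.yCoeff i (true, s) =
      arc (P.γi i) a (P.e i - 1 - P.coord (s + P.M i) i + 1) (P.z i) := by
  have h1 := P.coord_lt s i
  rw [coord_add_M_self, yCoeff]
  split_ifs with h
  · have h2 : P.e i - 1 - P.coord s i = 0 := by omega
    have h3 : P.e i - 1 - 0 + 1 = P.e i := by omega
    rw [h2, h3, arc_zero, one_mul, arc_full (P.γi_primitive i)]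
  · rw [mul_one]
    congr 1
    omega

omit hP in
theorem uLoc_succ (l : ZMod P.m) (i : Fin P.θ) (n : ℕ) : P.uLoc l i (n + 1) =
    (P.ξ i)⁻¹ • (P.uLoc l i n * (P.z i * (1 - algebraMap k _ (rootPow (P.γi i)
      (1 + P.zcoord l i + (n : ZMod (P.e i)))) * LaurentPolynomial.invert (P.z i)))) := by
  rw [uLoc, uLoc, arc_succ, smul_mul_assoc, smul_smul, pow_succ, pow_succ, mul_comm (P.ξ i)⁻¹]
  congr 1
  ring

theorem uLoc_e (l : ZMod P.m) (i : Fin P.θ) : P.uLoc l i (P.e i) = 1 - P.z i ^ P.e i := by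
  have h1 : P.z i ^ P.e i * LaurentPolynomial.invert (P.z i) ^ P.e i = 1 := by
    rw [← mul_pow, invert_z_mul, one_pow]
  rw [uLoc, arc_full (P.γi_primitive i), inv_pow, xi_pow_e, mul_sub, h1]
  simp

theorem yCoeff_mul_uLoc (l : ZMod P.m) (i : Fin P.θ) (n : ZMod P.m) :
    P.yCoeff i (true, n) * P.uLoc l i (P.coord (n + P.M i) i) = P.uLoc l i (P.coord n i + 1) := by
  rw [coord_add_M_self, yCoeff]
  split_ifs with h
  · rw [h, uLoc_e]
    simp [uLoc]
  · rw [one_mul]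

theorem prod_eq_mul_erase {A : Type*} [CommRing A] {n : ℕ} (i : Fin n) (f : Fin n → A) :
    ∏ l, f l = f i * ∏ l ∈ univ.erase i, f l := (mul_prod_erase univ f (mem_univ i)).symm

theorem zcoord_add_natCast (j n : ZMod P.m) (i : Fin P.θ) :
    1 + P.zcoord j i + (P.coord n i : ZMod (P.e i)) = 1 + P.zcoord (n + j) i := by
  rw [zcoord_add, coord_natCast]
  ring

omit hP in
theorem phiL_eq_rootPow (i : Fin P.θ) (j : ZMod P.m) : P.phiL i j =
    1 - algebraMap k _ (rootPow (P.γi i) (1 + P.zcoord j i)) * P.z i := by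
  rw [phiL, arc_one]

omit hP in
theorem invert_phiL (i : Fin P.θ) (j : ZMod P.m) : LaurentPolynomial.invert (P.phiL i j) =
    1 - algebraMap k _ (rootPow (P.γi i) (1 + P.zcoord j i)) *
      LaurentPolynomial.invert (P.z i) := by
  rw [phiL_eq_rootPow, map_sub, map_one, map_mul]
  congr 2
  exact AlgEquiv.commutes _ _

theorem matY_mul_matU_true (i : Fin P.θ) (j n : ZMod P.m) :
    P.uCoeff j (true, n) * P.yCoeff i (false, n + j) =
      P.uCoeff (j + P.M i) (true, n) * LaurentPolynomial.invert (P.phiL i j) := by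
  simp only [uCoeff, yCoeff]
  rw [prod_eq_mul_erase i, prod_eq_mul_erase i (fun l => P.uLoc (j + P.M i) l _)]
  have h1 : ∀ l ∈ univ.erase i, P.uLoc j l (P.coord n l) = P.uLoc (j + P.M i) l (P.coord n l) := by
    intro l hl
    rw [uLoc, uLoc, zcoord_add_M_ne _ (ne_of_mem_erase hl)]
  have h2 : P.uLoc j i (P.coord n i) * LaurentPolynomial.invert (P.phiL i (n + j)) =
      P.uLoc (j + P.M i) i (P.coord n i) * LaurentPolynomial.invert (P.phiL i j) := by
    have h3 := arc_succ (P.γi i) (P.zcoord j i) (P.coord n i) (LaurentPolynomial.invert (P.z i))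
    rw [arc_succ', zcoord_add_natCast] at h3
    rw [invert_phiL, invert_phiL, uLoc, uLoc, P.zcoord_add j, zcoord_M_self, smul_mul_assoc,
      smul_mul_assoc]
    congr 1
    linear_combination (-P.z i ^ P.coord n i) * h3
  rw [prod_congr rfl h1]
  linear_combination (∏ l ∈ univ.erase i, P.uLoc (j + P.M i) l (P.coord n l)) * h2

theorem matY_mul_matU_false (i : Fin P.θ) (j n : ZMod P.m) :
    P.uCoeff j (false, n) * P.yCoeff i (true, n + j) =
      P.uCoeff (j + P.M i) (false, n) * P.phiL i j := by
  simp only [uCoeff]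
  rw [uuCoeff, uuCoeff, smul_mul_assoc, smul_mul_assoc]
  congr 1
  rw [prod_eq_mul_erase i, prod_eq_mul_erase i (fun l => arc _ (P.zcoord (j + P.M i) l) _ _)]
  have h1 : ∀ l ∈ univ.erase i, arc (P.γi l) (P.zcoord (j + P.M i) l)
      (P.e l - 1 - P.coord (j + P.M i + n) l) (P.z l) = arc (P.γi l) (P.zcoord j l)
      (P.e l - 1 - P.coord (j + n) l) (P.z l) := by
    intro l hl
    rw [add_right_comm, zcoord_add_M_ne _ (ne_of_mem_erase hl), coord_add_M_ne _ (ne_of_mem_erase hl)]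
  have h2 := P.arc_mul_yCoeff i (P.zcoord j i) (j + n)
  rw [arc_succ', add_right_comm j n, ← phiL_eq_rootPow] at h2
  rw [prod_congr rfl h1, add_comm n j, P.zcoord_add j, zcoord_M_self]
  linear_combination (LaurentPolynomial.T (-(P.halfNd : ℤ)) *
    ∏ l ∈ univ.erase i, arc (P.γi l) (P.zcoord j l) (P.e l - 1 - P.coord (j + n) l) (P.z l)) * h2

theorem matU_mul_matY_true (i : Fin P.θ) (j n : ZMod P.m) :
    P.uCoeff j (true, n) * P.yCoeff i (false, n + j) =
      P.ξ i • (P.yCoeff i (true, n) * (P.uCoeff j (true, n + P.M i) *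
        LaurentPolynomial.invert (P.z i))) := by
  simp only [uCoeff]
  rw [prod_eq_mul_erase i, prod_eq_mul_erase i (fun l => P.uLoc j l (P.coord (n + P.M i) l))]
  have h1 : ∀ l ∈ univ.erase i, P.uLoc j l (P.coord (n + P.M i) l) = P.uLoc j l (P.coord n l) := by
    intro l hl
    rw [coord_add_M_ne _ (ne_of_mem_erase hl)]
  have h2 := P.yCoeff_mul_uLoc j i n
  have h3 := P.invert_z_mul i
  rw [uLoc_succ, zcoord_add_natCast, ← invert_phiL] at h2
  have h4 : P.ξ i • (P.yCoeff i (true, n) * P.uLoc j i (P.coord (n + P.M i) i)) =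
      P.uLoc j i (P.coord n i) * (P.z i * LaurentPolynomial.invert (P.phiL i (n + j))) := by
    rw [h2, smul_smul, mul_inv_cancel₀ (P.xi_ne_zero i), one_smul]
  rw [prod_congr rfl h1]
  rw [Algebra.smul_def] at h4 ⊢
  simp only [yCoeff] at h4 ⊢
  linear_combination (-(∏ l ∈ univ.erase i, P.uLoc j l (P.coord n l)) *
    LaurentPolynomial.invert (P.z i)) * h4 - (∏ l ∈ univ.erase i, P.uLoc j l (P.coord n l)) *
      P.uLoc j i (P.coord n i) * LaurentPolynomial.invert (P.phiL i (n + j)) * h3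

/-- The relation between `u_j` and `y_i` on the basis vectors that stand for `u_n`. -/
theorem matU_mul_matY_false (i : Fin P.θ) (j n : ZMod P.m) :
    P.uCoeff j (false, n) * P.yCoeff i (true, n + j) =
      P.ξ i • (P.yCoeff i (false, n) * (P.uCoeff j (false, n + P.M i) * P.z i)) := by
  have hq := P.γi_primitive i
  simp only [uCoeff]
  rw [uuCoeff, uuCoeff, prod_eq_mul_erase i,
    prod_eq_mul_erase i (fun l => arc _ _ (P.e l - 1 - P.coord (j + (n + P.M i)) l) _)]
  have h1 : ∀ l ∈ univ.erase i, arc (P.γi l) (P.zcoord j l)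
      (P.e l - 1 - P.coord (j + (n + P.M i)) l) (P.z l) = arc (P.γi l) (P.zcoord j l)
      (P.e l - 1 - P.coord (j + n) l) (P.z l) := by
    intro l hl
    rw [← add_assoc, coord_add_M_ne _ (ne_of_mem_erase hl)]
  have h2 := P.arc_mul_yCoeff i (P.zcoord j i) (j + n)
  have h3 : 1 + P.zcoord j i + ((P.e i - 1 - P.coord (j + n + P.M i) i : ℕ) : ZMod (P.e i)) =
      -(1 + P.zcoord n i) := by
    have h5 : ((1 + P.coord (j + n + P.M i) i + (P.e i - 1 - P.coord (j + n + P.M i) i) : ℕ) :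
        ZMod (P.e i)) = 0 := by
      have := P.coord_lt (j + n + P.M i) i
      rw [show 1 + P.coord (j + n + P.M i) i + (P.e i - 1 - P.coord (j + n + P.M i) i) = P.e i by omega,
        ZMod.natCast_self]
    rw [Nat.cast_add, Nat.cast_add, coord_natCast, zcoord_add, zcoord_add, zcoord_M_self] at h5
    linear_combination h5
  rw [arc_succ, h3] at h2
  simp only [← add_assoc] at h1 ⊢
  have h4 : P.scal (n + P.M i) = P.scal n * (-(P.ξ i)⁻¹ * rootPow (P.γi i) (-(1 + P.zcoord n i))) := by
    rw [scal_add, scal_M, mul_comm n, chi_M_mul, neg_add, rootPow_add hq.pow_eq_one,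
      rootPow_neg hq.pow_eq_one 1, rootPow_one hq.pow_eq_one]
    ring
  have h5 : rootPow (P.γi i) (-(1 + P.zcoord n i)) * rootPow (P.γi i) (1 + P.zcoord n i) = 1 := by
    rw [← rootPow_add hq.pow_eq_one, neg_add_cancel, rootPow_zero]
  have h7 := mul_inv_cancel₀ (P.xi_ne_zero i)
  rw [prod_congr rfl h1, add_comm n j, h4]
  have h8 : P.yCoeff i (false, n) = 1 - algebraMap k _ (rootPow (P.γi i) (1 + P.zcoord n i)) *
      LaurentPolynomial.invert (P.z i) := P.invert_phiL i n
  have h5' := congrArg (algebraMap k k[T;T⁻¹]) h5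
  have h7' := congrArg (algebraMap k k[T;T⁻¹]) h7
  have h6 := P.invert_z_mul i
  rw [map_mul, map_one] at h5' h7'
  rw [h8]
  simp only [Algebra.smul_def, map_mul, map_neg]
  generalize algebraMap k k[T;T⁻¹] (rootPow (P.γi i) (-(1 + P.zcoord n i))) = r at *
  generalize algebraMap k k[T;T⁻¹] (rootPow (P.γi i) (1 + P.zcoord n i)) = s at *
  generalize LaurentPolynomial.invert (P.z i) = w at *
  generalize (∏ l ∈ univ.erase i, arc (P.γi l) (P.zcoord j l)
    (P.e l - 1 - P.coord (j + n) l) (P.z l)) = E at *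
  generalize algebraMap k k[T;T⁻¹] (P.ξ i) = a at *
  generalize algebraMap k k[T;T⁻¹] (P.ξ i)⁻¹ = a' at *
  generalize arc (P.γi i) (P.zcoord j i) (P.e i - 1 - P.coord (j + n + P.M i) i) (P.z i) = B at *
  have h9 : a * ((1 - s * w) * (a' * r * P.z i)) = r * P.z i - 1 := by
    linear_combination (1 - s * w) * r * P.z i * h7' - s * r * h6 - h5'
  linear_combination (algebraMap k k[T;T⁻¹] (P.m : k)⁻¹ * algebraMap k k[T;T⁻¹] (P.scal n) *
    LaurentPolynomial.T (-(P.halfNd : ℤ)) * E) * (h2 + B * h9)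

end

end DData

open Finset
open scoped LaurentPolynomial TensorProduct

section Wshift

variable {I R : Type*} [Fintype I] [DecidableEq I] [CommRing R]

theorem mul_wshift_apply (A : Matrix I I R) (σ : I → I) (c : I → R) (a b : I) :
    (A * wshift σ c) a b = A a (σ b) * c b := by
  rw [Matrix.mul_apply, sum_eq_single (σ b)]
  · rw [wshift_apply, if_pos rfl]
  · intro p _ hp
    rw [wshift_apply, if_neg hp, mul_zero]
  · simp

end Wshift

namespace DData

noncomputable section

variable {k : Type u} [Field k] (P : DData k) [hP : P.IsAdmissible]

/-! ### The relations between the matrices -/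

theorem matX_val : (P.matX : Matrix P.Idx P.Idx k[T;T⁻¹]) =
    wshift id fun p => tw p.1 (LaurentPolynomial.T 1) := rfl

theorem matX_inv_val : ((P.matX⁻¹ : (Matrix P.Idx P.Idx k[T;T⁻¹])ˣ) : Matrix P.Idx P.Idx k[T;T⁻¹]) =
    wshift id fun p => tw p.1 (LaurentPolynomial.T (-1)) := rfl

theorem matH_pow : P.matH ^ P.m = 1 := by
  rw [matH, wshift_pow, ← wshift_one]
  refine wshift_congr (fun p => by simp) fun p => ?_
  simp only [Function.iterate_id, id, prod_const, card_range, ← map_pow]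
  rw [chi, rootPow_pow_card hP.gamma.pow_eq_one, map_one]

theorem matX_matH : Commute (P.matX : Matrix P.Idx P.Idx k[T;T⁻¹]) P.matH := by
  rw [Commute, SemiconjBy, matX_val, matH, wshift_mul, wshift_mul]
  exact wshift_congr (fun _ => rfl) fun _ => mul_comm _ _

theorem matX_matY (i : Fin P.θ) : Commute (P.matX : Matrix P.Idx P.Idx k[T;T⁻¹]) (P.matY i) := by
  rw [Commute, SemiconjBy, matX_val, matY, wshift_mul, wshift_mul]
  exact wshift_congr (fun _ => rfl) fun _ => mul_comm _ _

theorem matX_matU (j : ZMod P.m) : (P.matX : Matrix P.Idx P.Idx k[T;T⁻¹]) * P.matU j =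
    P.matU j * ((P.matX⁻¹ : (Matrix P.Idx P.Idx k[T;T⁻¹])ˣ) : Matrix P.Idx P.Idx k[T;T⁻¹]) := by
  rw [matX_val, matX_inv_val, matU, wshift_mul, wshift_mul]
  refine wshift_congr (fun _ => rfl) fun p => ?_
  rw [mul_comm, id, tw_not]
  congr 2
  simp

theorem matY_matY (i l : Fin P.θ) : Commute (P.matY i) (P.matY l) := by
  rcases eq_or_ne l i with rfl | h
  · exact Commute.refl _
  rw [Commute, SemiconjBy, matY, matY, wshift_mul, wshift_mul]
  refine wshift_congr (fun p => Prod.ext rfl (add_right_comm _ _ _)) fun p => ?_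
  rw [P.yCoeff_congr (b := p.1) (P.zcoord_add_M_ne h p.2), P.yCoeff_congr (b := p.1) (P.zcoord_add_M_ne h.symm p.2), mul_comm]

theorem matY_matH (i : Fin P.θ) : P.matY i * P.matH = P.chi (P.M i) • (P.matH * P.matY i) := by
  rw [matY, matH, wshift_mul, wshift_mul, smul_wshift]
  refine wshift_congr (fun _ => rfl) fun p => ?_
  rw [id, neg_add, chi_add, map_mul, Algebra.smul_def, chi_neg _ (P.M i : ZMod P.m)]
  have h1 : algebraMap k k[T;T⁻¹] (P.chi (P.M i)) * algebraMap k k[T;T⁻¹] (P.chi (P.M i))⁻¹ = 1 := by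
    rw [← map_mul, mul_inv_cancel₀ (P.chi_ne_zero _), map_one]
  linear_combination (-algebraMap k k[T;T⁻¹] (P.chi (-p.2)) * P.yCoeff i p) * h1

theorem matU_matH (j : ZMod P.m) : P.matU j * P.matH = P.chi j • (P.matH * P.matU j) := by
  rw [matU, matH, wshift_mul, wshift_mul, smul_wshift]
  refine wshift_congr (fun _ => rfl) fun p => ?_
  rw [id, neg_add, chi_add, map_mul, Algebra.smul_def, chi_neg _ j]
  have h1 : algebraMap k k[T;T⁻¹] (P.chi j) * algebraMap k k[T;T⁻¹] (P.chi j)⁻¹ = 1 := by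
    rw [← map_mul, mul_inv_cancel₀ (P.chi_ne_zero _), map_one]
  linear_combination (-algebraMap k k[T;T⁻¹] (P.chi (-p.2)) * P.uCoeff j p) * h1

theorem matY_pow (i : Fin P.θ) (n : ℕ) : P.matY i ^ n = wshift (fun p : P.Idx => (p.1, p.2 + n * P.M i))
    (fun p : P.Idx => ∏ t ∈ range n, P.yCoeff i (p.1, p.2 + t * P.M i)) := by
  have h : ∀ (n : ℕ) (p : P.Idx), (fun p : P.Idx => ((p.1, p.2 + P.M i) : P.Idx))^[n] p =
      (p.1, p.2 + n * P.M i) := by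
    intro n
    induction n with
    | zero => simp
    | succ n ih =>
      intro p
      rw [Function.iterate_succ_apply', ih]
      refine Prod.ext rfl ?_
      push_cast
      ring
  rw [matY, wshift_pow]
  refine wshift_congr (h n) fun p => prod_congr rfl fun t _ => ?_
  rw [h]

theorem zcoord_add_mul_M (i : Fin P.θ) (j : ZMod P.m) (t : ℕ) :
    P.zcoord (j + t * P.M i) i = P.zcoord j i + t := by
  induction t with
  | zero => simp
  | succ t ih =>
    rw [Nat.cast_succ, Nat.cast_succ, add_mul, one_mul, ← add_assoc, P.zcoord_add, ih, zcoord_M_self]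
    ring

theorem coord_add_mul_M (i : Fin P.θ) (j : ZMod P.m) (t : ℕ) :
    P.coord (j + t * P.M i) i = (P.coord j i + t) % P.e i := by
  rw [← zcoord_val, zcoord_add_mul_M, ← coord_natCast, ← Nat.cast_add, ZMod.val_natCast]

theorem prod_yCoeff_false (i : Fin P.θ) (j : ZMod P.m) (n : ℕ) :
    ∏ t ∈ range n, P.yCoeff i (false, j + t * P.M i) =
      arc (P.γi i) (P.zcoord j i) n (LaurentPolynomial.invert (P.z i)) := by
  rw [arc]
  refine prod_congr rfl fun t _ => ?_
  rw [yCoeff, invert_phiL, zcoord_add_mul_M, add_assoc]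

theorem e_mul_M (i : Fin P.θ) : ((P.e i : ℕ) : ZMod P.m) * (P.M i : ZMod P.m) = 0 := by
  rw [← Nat.cast_mul, ZMod.natCast_eq_zero_iff]
  exact (P.e_spec i).2

theorem prod_yCoeff_true (i : Fin P.θ) (j : ZMod P.m) :
    ∏ t ∈ range (P.e i), P.yCoeff i (true, j + t * P.M i) = 1 - P.z i ^ P.e i := by
  have h1 := P.coord_lt j i
  have h2 : ∀ t < P.e i, ((P.coord j i + t) % P.e i + 1 = P.e i ↔ t = P.e i - 1 - P.coord j i) := by
    intro t ht
    rcases lt_or_ge (P.coord j i + t) (P.e i) with h | h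
    · rw [Nat.mod_eq_of_lt h]
      omega
    · rw [Nat.mod_eq_sub_mod h, Nat.mod_eq_of_lt (by omega)]
      omega
  have h3 : ∀ t ∈ range (P.e i), P.yCoeff i (true, j + t * P.M i) =
      if t = P.e i - 1 - P.coord j i then 1 - P.z i ^ P.e i else 1 := by
    intro t ht
    rw [yCoeff, coord_add_mul_M]
    simp only [h2 t (mem_range.1 ht)]
  rw [prod_congr rfl h3, prod_ite_eq', if_pos]
  rw [mem_range]
  omega

theorem matY_pow_e (i : Fin P.θ) :
    P.matY i ^ P.e i = laurentEval P.matX (1 - P.z i ^ P.e i) := by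
  rw [matY_pow, laurentEval_matX]
  refine wshift_congr (fun p => ?_) ?_
  · rw [e_mul_M, add_zero]
    rfl
  · rintro ⟨b, j⟩
    cases b
    · rw [prod_yCoeff_false, arc_full (P.γi_primitive i), tw_false, map_sub, map_pow, map_one]
    · exact P.prod_yCoeff_true i j

theorem matY_matU (i : Fin P.θ) (j : ZMod P.m) :
    P.matY i * P.matU j = laurentEval P.matX (P.phiL i j) * P.matU (j + P.M i) := by
  rw [laurentEval_matX, matY, matU, matU, wshift_mul, wshift_mul]
  refine wshift_congr (fun p => Prod.ext rfl (add_assoc _ _ _)) ?_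
  rintro ⟨b, n⟩
  cases b
  · exact P.matY_mul_matU_false i j n
  · exact P.matY_mul_matU_true i j n

theorem matY_matU' (i : Fin P.θ) (j : ZMod P.m) :
    P.matY i * P.matU j = P.ξ i • (laurentEval P.matX (P.z i) * P.matU j * P.matY i) := by
  rw [laurentEval_matX, matY, matU, wshift_mul, wshift_mul, wshift_mul, smul_wshift]
  refine wshift_congr (fun p => Prod.ext rfl (add_right_comm _ _ _)) ?_
  rintro ⟨b, n⟩
  cases b
  · exact P.matU_mul_matY_false i j n
  · exact P.matU_mul_matY_true i j n

/-- The coefficients of the matrix of the monomial `y_p`. -/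
def yMonCoeff (p : ZMod P.m) (q : P.Idx) : k[T;T⁻¹] :=
  ∏ i, ∏ t ∈ range (P.coord p i), P.yCoeff i (q.1, q.2 + t * P.M i)

/-- The monomial `y_p` acts as a weighted shift by `p`. -/
theorem listMon_matY (p : ZMod P.m) : listMon P.matY (P.coord p) =
    wshift (fun q : P.Idx => (q.1, q.2 + p)) (P.yMonCoeff p) := by
  have h : ∀ (a : Fin P.θ → ℕ) (l : List (Fin P.θ)), l.Nodup →
      (l.map fun i => P.matY i ^ a i).prod =
        wshift (fun q : P.Idx => (q.1, q.2 + ∑ i ∈ l.toFinset, (a i : ZMod P.m) * P.M i))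
          (fun q : P.Idx => ∏ i ∈ l.toFinset, ∏ t ∈ range (a i), P.yCoeff i (q.1, q.2 + t * P.M i)) := by
    intro a l
    induction l with
    | nil => intro _; simp [← wshift_one]; rfl
    | cons i l ih =>
      intro hl
      have hi : i ∉ l.toFinset := by simpa using (List.nodup_cons.1 hl).1
      rw [List.map_cons, List.prod_cons, ih (List.nodup_cons.1 hl).2, matY_pow, wshift_mul,
        List.toFinset_cons]
      refine wshift_congr (fun q => Prod.ext rfl ?_) fun q => ?_
      · rw [sum_insert hi]
        simp only [Function.comp_apply]
        ring
      · rw [prod_insert hi, mul_comm]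
        congr 1
        refine prod_congr rfl fun t _ => P.yCoeff_congr ?_
        have h0 : ∀ s : Finset (Fin P.θ), i ∉ s →
            P.zcoord (∑ l ∈ s, (a l : ZMod P.m) * P.M l) i = 0 := by
          intro s
          induction s using Finset.induction_on with
          | empty => intro _; simp [P.zcoord_zero]
          | insert l s hls ihs =>
            intro his
            rw [sum_insert hls, P.zcoord_add, ihs fun h => his (mem_insert_of_mem h), add_zero]
            have hil : i ≠ l := fun h => his (h ▸ mem_insert_self _ _)
            generalize a l = n
            induction n with
            | zero => simp [P.zcoord_zero]
            | succ n ihn => rw [Nat.cast_succ, add_mul, one_mul, zcoord_add_M_ne P hil, ihn]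
        rw [P.zcoord_add, P.zcoord_add, h0 _ hi, add_zero, P.zcoord_add]
  have h' := h (P.coord p) (List.finRange P.θ) (List.nodup_finRange _)
  rw [List.toFinset_finRange, P.sum_coord, ← List.ofFn_eq_map] at h'
  exact h'

theorem one_sub_mul_T_ne_zero (r : k) {n : ℤ} (hn : n ≠ 0) :
    (1 - algebraMap k k[T;T⁻¹] r * LaurentPolynomial.T n : k[T;T⁻¹]) ≠ 0 := by
  intro h
  have h2 : algebraMap k k[T;T⁻¹] r * LaurentPolynomial.T n = AddMonoidAlgebra.single n r :=
    (LaurentPolynomial.single_eq_C_mul_T r n).symm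
  have h3 : (1 : k[T;T⁻¹]) = AddMonoidAlgebra.single 0 1 := rfl
  rw [h2, h3] at h
  have h1 := congrArg (fun f : k[T;T⁻¹] => f.coeff 0) h
  simp [hn, -LaurentPolynomial.single_eq_C_mul_T] at h1

theorem z_exp_ne_zero (i : Fin P.θ) : ((P.M i * P.d : ℕ) : ℤ) ≠ 0 :=
  Int.natCast_ne_zero.2 (Nat.mul_pos (hP.fraction.pos i) hP.d_pos).ne'

theorem one_sub_z_pow_ne_zero (i : Fin P.θ) : 1 - P.z i ^ P.e i ≠ 0 := by
  have h : ((P.e i : ℤ) * ((P.M i * P.d : ℕ) : ℤ)) ≠ 0 :=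
    mul_ne_zero (Int.natCast_ne_zero.2 (P.e_pos i).ne') (P.z_exp_ne_zero i)
  have h1 := one_sub_mul_T_ne_zero (1 : k) h
  rwa [map_one, one_mul, ← LaurentPolynomial.T_pow] at h1

theorem invert_phiL_ne_zero (i : Fin P.θ) (j : ZMod P.m) :
    LaurentPolynomial.invert (P.phiL i j) ≠ 0 := by
  rw [invert_phiL, z, LaurentPolynomial.invert_T]
  exact one_sub_mul_T_ne_zero _ (neg_ne_zero.2 (P.z_exp_ne_zero i))

theorem yCoeff_ne_zero (i : Fin P.θ) (q : P.Idx) : P.yCoeff i q ≠ 0 := by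
  rcases q with ⟨_ | _, j⟩
  · exact P.invert_phiL_ne_zero i j
  · rw [yCoeff]
    split_ifs
    · exact P.one_sub_z_pow_ne_zero i
    · exact one_ne_zero

theorem yMonCoeff_ne_zero (p : ZMod P.m) (q : P.Idx) : P.yMonCoeff p q ≠ 0 :=
  prod_ne_zero_iff.2 fun i _ => prod_ne_zero_iff.2 fun _ _ => P.yCoeff_ne_zero i _

theorem yMonCoeff_true_zero (p : ZMod P.m) : P.yMonCoeff p (true, 0) = 1 := by
  refine prod_eq_one fun i _ => prod_eq_one fun t ht => ?_
  have h1 := P.coord_lt p i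
  have h2 := mem_range.1 ht
  rw [yCoeff, coord_add_mul_M, P.coord_zero, zero_add, Nat.mod_eq_of_lt (by omega), if_neg (by omega)]

theorem yMonCoeff_false_zero (p : ZMod P.m) : P.yMonCoeff p (false, 0) =
    ∏ i, arc (P.γi i) (0 : ZMod (P.e i)) (P.coord p i) (LaurentPolynomial.invert (P.z i)) := by
  refine prod_congr rfl fun i _ => ?_
  rw [prod_yCoeff_false, P.zcoord_zero]

theorem zmod_induction {Q : ZMod P.m → Prop} (h0 : Q 0) (h : ∀ i n, Q n → Q (n + P.M i))
    (n : ZMod P.m) : Q n := by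
  have h1 : ∀ i (t : ℕ) n, Q n → Q (n + t * P.M i) := by
    intro i t
    induction t with
    | zero => intro n hn; simpa using hn
    | succ t ih =>
      intro n hn
      rw [Nat.cast_succ, add_mul, one_mul, ← add_assoc]
      exact h i _ (ih n hn)
  have h2 : ∀ s : Finset (Fin P.θ), Q (∑ i ∈ s, (P.coord n i : ZMod P.m) * P.M i) := by
    intro s
    induction s using Finset.induction_on with
    | empty => simpa using h0
    | insert i s hi ih =>
      rw [sum_insert hi, add_comm]
      exact h1 i _ _ ih
  rw [← P.sum_coord n]
  exact h2 univ

/-- A matrix that commutes with the `y_i` up to nonzero scalars is determined by its columns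
`(true, 0)` and `(false, 0)`: the `y_i` act injectively, and they generate the other basis vectors
from these two over the field of fractions. -/
theorem eq_zero_of_col_zero {A : Matrix P.Idx P.Idx k[T;T⁻¹]} {r : Fin P.θ → k} (hr : ∀ i, r i ≠ 0)
    (h : ∀ i, P.matY i * A = r i • (A * P.matY i)) (h0 : ∀ a b, A a (b, 0) = 0) : A = 0 := by
  suffices hs : ∀ (n : ZMod P.m) a b, A a (b, n) = 0 by
    refine Matrix.ext fun a b => ?_
    exact hs b.2 a b.1
  refine P.zmod_induction h0 fun i n hn a b => ?_
  have h1 := congrFun (congrFun (h i) a) (b, n)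
  rw [Matrix.smul_apply, matY, mul_wshift_apply, Matrix.mul_apply,
    sum_eq_zero fun p _ => by rw [hn, mul_zero]] at h1
  have h2 := (smul_eq_zero.1 h1.symm).resolve_left (hr i)
  exact (mul_eq_zero.1 h2).resolve_right (P.yCoeff_ne_zero i _)

theorem arc_scalar (i : Fin P.θ) (l : ZMod P.m) :
    (-1) ^ (P.e i - 1 - P.coord l i) * rootPow (P.γi i)
      (((P.e i - 1 - P.coord l i : ℕ) : ZMod (P.e i)) * (1 + P.zcoord l i)) *
        P.γi i ^ (P.e i - 1 - P.coord l i).choose 2 * (P.ξ i)⁻¹ ^ P.coord l i =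
      P.scalN i (P.coord l i) := by
  have hq := P.γi_primitive i
  have hlt := P.coord_lt l i
  have h1 := pow_choose_order hq (P.e_pos i)
  rw [scalN, ← coord_natCast]
  generalize P.coord l i = s at *
  obtain ⟨N, hN⟩ : ∃ N, P.e i = s + 1 + N := ⟨P.e i - 1 - s, by omega⟩
  have hN' : P.e i - 1 - s = N := by omega
  have h2 : (P.e i).choose 2 = N.choose 2 + (s + 1).choose 2 + N * (1 + s) := by
    rw [hN]
    clear hN hN' h1 hlt
    induction N with
    | zero => simp
    | succ n ih => rw [← add_assoc, choose_succ_two, ih, choose_succ_two n]; ring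
  have h3 : (N : ZMod (P.e i)) * (1 + (s : ZMod (P.e i))) = ((N * (1 + s) : ℕ) : ZMod (P.e i)) := by
    push_cast; ring
  have h4 : (-1 : k) ^ (P.e i - 1) = (-1) ^ s * (-1) ^ N := by
    rw [← pow_add]; congr 1; omega
  have h5 : P.γi i ^ (s + 1).choose 2 ≠ 0 := pow_ne_zero _ (P.γi_ne_zero i)
  have h6 : (-1 : k) ^ s * (-1) ^ s = 1 := by rw [← mul_pow]; simp
  have h7 : (-1 : k) ^ N * (-1) ^ N = 1 := by rw [← mul_pow]; simp
  rw [h2, h4, pow_add, pow_add] at h1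
  rw [hN', h3, rootPow_natCast hq.pow_eq_one, inv_pow (P.γi i)]
  field_simp
  linear_combination (P.ξ i)⁻¹ ^ s * (-1) ^ s * h1 - (P.ξ i)⁻¹ ^ s * P.γi i ^ (N * (1 + s)) *
    P.γi i ^ N.choose 2 * P.γi i ^ (s + 1).choose 2 * (-1) ^ N * h6

/-- The local form of the relation for `u_j u_l` on the basis vector that stands for `u_0`: it
combines the reversal of an arc with an exchange of the ends of two arcs. -/
theorem arc_mul_uLoc (i : Fin P.θ) (j l : ZMod P.m) :
    arc (P.γi i) (P.zcoord l i) (P.e i - 1 - P.coord l i) (P.z i) * P.uLoc j i (P.coord l i) =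
      P.scalN i (P.coord l i) • (P.z i ^ (P.e i - 1) *
        (arc (P.γi i) (0 : ZMod (P.e i)) (P.coord (j + l) i) (LaurentPolynomial.invert (P.z i)) *
          arc (P.γi i) (P.zcoord j i) (P.e i - 1 - P.coord (j + l) i)
            (LaurentPolynomial.invert (P.z i)))) := by
  have hq := P.γi_primitive i
  have h1 := P.coord_lt l i
  have h2 := P.coord_lt (j + l) i
  have hc : ∀ n : ZMod P.m, ((P.e i - 1 - P.coord n i : ℕ) : ZMod (P.e i)) = -1 - P.zcoord n i := by
    intro n
    have h3 := P.coord_lt n i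
    have h4 : ((P.e i - 1 - P.coord n i + 1 + P.coord n i : ℕ) : ZMod (P.e i)) = 0 := by
      rw [show P.e i - 1 - P.coord n i + 1 + P.coord n i = P.e i by omega, ZMod.natCast_self]
    push_cast at h4
    rw [coord_natCast] at h4
    linear_combination h4
  have h3 := arc_reverse hq.pow_eq_one (P.zcoord l i) 0 (P.e i - 1 - P.coord l i)
    (by rw [hc]; ring) ((mul_comm _ _).trans (P.invert_z_mul i))
  have h4 := arc_exchange (P.γi i) 0 (P.zcoord j i) (P.zcoord (j + l) i) (-1 - P.zcoord l i)
    (P.coord (j + l) i) (P.e i - 1 - P.coord (j + l) i) (P.coord l i) (P.e i - 1 - P.coord l i)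
    (by rw [coord_natCast, zero_add]) (by rw [hc, P.zcoord_add]; ring)
    (by rw [coord_natCast, P.zcoord_add]) (by rw [hc, zero_add]) (by omega)
    (LaurentPolynomial.invert (P.z i))
  rw [h3, h4, uLoc, ← arc_scalar]
  simp only [Algebra.smul_def, map_mul]
  have h5 : P.z i ^ (P.e i - 1) = P.z i ^ (P.e i - 1 - P.coord l i) * P.z i ^ P.coord l i := by
    rw [← pow_add]; congr 1; omega
  rw [h5]
  ring

theorem uCoeff_true_zero (l : ZMod P.m) : P.uCoeff l (true, 0) = 1 :=
  prod_eq_one fun i _ => by simp [uLoc, P.coord_zero]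

theorem uuCoeff_zero_mul_uCoeff (j l : ZMod P.m) : P.uuCoeff l 0 * P.uCoeff j (true, l) =
    P.yMonCoeff (j + l) (false, 0) * LaurentPolynomial.invert (P.uuCoeff j l) := by
  have h1 := prod_congr (s₁ := univ) rfl fun i (_ : i ∈ univ) => P.arc_mul_uLoc i j l
  simp only [Algebra.smul_def] at h1
  rw [prod_mul_distrib, prod_mul_distrib, prod_mul_distrib, prod_mul_distrib, P.prod_z_pow,
    ← map_prod, ← scal] at h1
  have h2 : LaurentPolynomial.T (-(P.halfNd : ℤ)) * LaurentPolynomial.T (P.halfNd : ℤ) =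
      (1 : k[T;T⁻¹]) := by rw [← LaurentPolynomial.T_add]; simp
  rw [yMonCoeff_false_zero, uuCoeff, uuCoeff, P.scal_zero, mul_one, add_zero, map_smul, map_mul,
    map_prod, LaurentPolynomial.invert_T, neg_neg, uCoeff]
  simp only [Algebra.smul_def, map_mul]
  have h3 : ∀ i, LaurentPolynomial.invert (arc (P.γi i) (P.zcoord j i)
      (P.e i - 1 - P.coord (j + l) i) (P.z i)) = arc (P.γi i) (P.zcoord j i)
      (P.e i - 1 - P.coord (j + l) i) (LaurentPolynomial.invert (P.z i)) :=
    fun i => map_arc (P.γi i) (LaurentPolynomial.invert (R := k)).toAlgHom _ _ _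
  rw [prod_congr rfl fun i _ => h3 i]
  linear_combination algebraMap k k[T;T⁻¹] (P.m : k)⁻¹ * LaurentPolynomial.T (-(P.halfNd : ℤ)) * h1 +
    algebraMap k k[T;T⁻¹] (P.m : k)⁻¹ * algebraMap k k[T;T⁻¹] (P.scal l) *
    LaurentPolynomial.T (P.halfNd : ℤ) *
    (∏ i, arc (P.γi i) (0 : ZMod (P.e i)) (P.coord (j + l) i) (LaurentPolynomial.invert (P.z i))) *
    (∏ i, arc (P.γi i) (P.zcoord j i) (P.e i - 1 - P.coord (j + l) i)
            (LaurentPolynomial.invert (P.z i))) * h2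

/-- The relation for `u_j u_l`. Both sides commute with the `y_i` up to the same scalars, so it suffices
to compare them on the basis vectors that stand for `y_0` and `u_0`. -/
theorem matU_matU (j l : ZMod P.m) : P.matU j * P.matU l =
    laurentEval P.matX (P.uuCoeff j l) * listMon P.matY (P.coord (j + l)) * P.matH := by
  rw [← sub_eq_zero]
  refine P.eq_zero_of_col_zero (r := fun i => P.ξ i ^ 2)
    (fun i => pow_ne_zero _ (P.xi_ne_zero i)) (fun i => ?_) ?_
  · have h1 : P.matY i * (P.matU j * P.matU l) = P.ξ i ^ 2 • (P.matU j * P.matU l * P.matY i) := by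
      have h2 := laurentEval_mul_of_mul_inv (P.matX_matU j) (P.z i)
      have h3 : laurentEval P.matX (LaurentPolynomial.invert (P.z i)) * laurentEval P.matX (P.z i) =
          1 := by rw [← map_mul, mul_comm, P.invert_z_mul, map_one]
      rw [← mul_assoc, matY_matU', smul_mul_assoc, mul_assoc, matY_matU', mul_smul_comm, smul_smul,
        h2, sq, mul_assoc (P.matU j), ← mul_assoc _ _ (P.matY i), ← mul_assoc _ _ (P.matU l), h3,
        one_mul, mul_assoc (P.matU j)]
    have h2 : P.matY i * (laurentEval P.matX (P.uuCoeff j l) * listMon P.matY (P.coord (j + l)) *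
        P.matH) = P.ξ i ^ 2 • (laurentEval P.matX (P.uuCoeff j l) *
          listMon P.matY (P.coord (j + l)) * P.matH * P.matY i) := by
      have h3 : Commute (P.matY i) (listMon P.matY (P.coord (j + l))) :=
        list_prod_semiconj _ _ _ fun l => (P.matY_matY i l).pow_right _
      have h4 := (commute_laurentEval (P.matX_matY i) (P.uuCoeff j l)).symm
      rw [(h4.mul_right h3).left_comm, matY_matH, mul_smul_comm, ← mul_assoc, hP.xi_sq,
        P.chi_natCast]
    rw [mul_sub, sub_mul, h1, h2, smul_sub]
  · rintro a b
    rw [Matrix.sub_apply, sub_eq_zero, laurentEval_matX, matU, matU, matH, listMon_matY, wshift_mul,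
      wshift_mul, wshift_mul]
    have h1 : ∀ (σ τ : P.Idx → P.Idx) (c d : P.Idx → k[T;T⁻¹]) (a b : P.Idx), σ b = τ b → c b = d b →
        wshift σ c a b = wshift τ d a b := by
      intro σ τ c d a b h h'
      rw [wshift_apply, wshift_apply, h, h']
    refine h1 _ _ _ _ _ _ ?_ ?_
    · simp [add_comm]
    · cases b
      · have h2 := P.uuCoeff_zero_mul_uCoeff j l
        rw [show P.uuCoeff l 0 = P.uCoeff l (false, 0) from rfl] at h2
        simpa [P.chi_zero, tw_false] using h2
      · rw [uCoeff_true_zero]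
        simp [yMonCoeff_true_zero, P.chi_zero, tw_true, uCoeff]

/-- The matrices `x`, `h`, `y_i`, `u_j` form a model of the presentation. -/
def matModel : P.Model (Matrix P.Idx P.Idx k[T;T⁻¹]) where
  x := P.matX
  h := P.matH
  y := P.matY
  u := P.matU
  h_pow := P.matH_pow
  x_h := P.matX_matH
  x_y := P.matX_matY
  y_y := P.matY_matY
  y_h := P.matY_matH
  y_pow := P.matY_pow_e
  x_u := P.matX_matU
  y_u := P.matY_matU
  y_u' := P.matY_matU'
  u_h := P.matU_matH
  u_u := P.matU_matU

/-- The representation of `D` by matrices over the Laurent polynomials. -/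
def matHom : P.D →ₐ[k] Matrix P.Idx P.Idx k[T;T⁻¹] := P.matModel.lift

end

end DData

open Finset
open scoped LaurentPolynomial TensorProduct

/-! ### Capelli polynomials and rings that generate matrix rings -/

/-- A multilinear map that vanishes on families in a set vanishes on families in its span. -/
theorem MultilinearMap.eq_zero_of_mem_span {R M N ι : Type*} [CommSemiring R] [AddCommMonoid M]
    [Module R M] [AddCommMonoid N] [Module R N] [Fintype ι] [DecidableEq ι]
    (f : MultilinearMap R (fun _ : ι => M) N) {S : Set M} (h : ∀ v, (∀ i, v i ∈ S) → f v = 0)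
    {v : ι → M} (hv : ∀ i, v i ∈ Submodule.span R S) : f v = 0 := by
  suffices hs : ∀ s : Finset ι, ∀ v : ι → M, (∀ i ∈ s, v i ∈ Submodule.span R S) →
      (∀ i ∉ s, v i ∈ S) → f v = 0 from hs univ v (fun i _ => hv i) fun i hi => absurd (mem_univ i) hi
  intro s
  induction s using Finset.induction_on with
  | empty => exact fun v _ hv => h v fun i => hv i (notMem_empty i)
  | insert j s hj ih =>
    intro v hv hv'
    rw [← Function.update_eq_self j v]
    have hvj := hv j (mem_insert_self j s)
    generalize v j = w at hvj ⊢
    induction hvj using Submodule.span_induction with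
    | mem x hx =>
      refine ih _ (fun i hi => ?_) fun i hi => ?_
      · rw [Function.update_of_ne (ne_of_mem_of_not_mem hi hj)]
        exact hv i (mem_insert_of_mem hi)
      · by_cases hij : i = j
        · subst hij
          rwa [Function.update_self]
        · rw [Function.update_of_ne hij]
          exact hv' i (by simp [hij, hi])
    | zero => exact f.map_update_zero v j
    | add x y _ _ hx hy => rw [f.map_update_add, hx, hy, add_zero]
    | smul r x _ hx => rw [f.map_update_smul, hx, smul_zero]

section Capelli

variable {A : Type*} [Ring A] {N : ℕ}

/-- The Capelli polynomial: the alternating sum over the permutations of the `b t` of the products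
of the `a t * b t * c t`. -/
def capelli (a b c : Fin N → A) : A :=
  ∑ σ : Equiv.Perm (Fin N), Equiv.Perm.sign σ • (List.ofFn fun t => a t * b (σ t) * c t).prod

theorem map_capelli {B : Type*} [Ring B] (f : A →+* B) (a b c : Fin N → A) :
    f (capelli a b c) = capelli (f ∘ a) (f ∘ b) (f ∘ c) := by
  rw [capelli, capelli, map_sum]
  refine sum_congr rfl fun σ _ => ?_
  rw [Units.smul_def, Units.smul_def, map_zsmul, map_list_prod, List.map_ofFn]
  congr 4
  funext t
  simp

variable (R : Type*) [CommRing R] [Algebra R A]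

/-- The Capelli polynomial as an alternating map in its middle variables. -/
noncomputable def capelliAlternating (a c : Fin N → A) : A [⋀^Fin N]→ₗ[R] A :=
  MultilinearMap.alternatization ((MultilinearMap.mkPiAlgebraFin R N A).compLinearMap
    fun t => (LinearMap.mulLeft R (a t)).comp (LinearMap.mulRight R (c t)))

theorem capelliAlternating_apply (a b c : Fin N → A) :
    capelliAlternating R a c b = capelli a b c := by
  rw [capelliAlternating, MultilinearMap.alternatization_apply]
  refine sum_congr rfl fun σ _ => ?_
  simp [MultilinearMap.mkPiAlgebraFin_apply, mul_assoc]

/-- The Capelli polynomial as a multilinear map in its outer variables. -/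
noncomputable def capelliOuter (b : Fin N → A) (L : Fin N → A → A →ₗ[R] A) :
    MultilinearMap R (fun _ : Fin N => A) A :=
  ∑ σ : Equiv.Perm (Fin N), ((Equiv.Perm.sign σ : ℤˣ) : ℤ) •
    (MultilinearMap.mkPiAlgebraFin R N A).compLinearMap fun t => L t (b (σ t))

theorem capelli_eq_left (a b c : Fin N → A) : capelli a b c =
    capelliOuter R b (fun t x => LinearMap.mulRight R (x * c t)) a := by
  rw [capelliOuter, _root_.sum_apply]
  refine sum_congr rfl fun σ _ => ?_
  rw [Units.smul_def, _root_.smul_apply, MultilinearMap.compLinearMap_apply,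
    MultilinearMap.mkPiAlgebraFin_apply]
  simp [mul_assoc]

theorem capelli_eq_right (a b c : Fin N → A) : capelli a b c =
    capelliOuter R b (fun t x => LinearMap.mulLeft R (a t * x)) c := by
  rw [capelliOuter, _root_.sum_apply]
  refine sum_congr rfl fun σ _ => ?_
  rw [Units.smul_def, _root_.smul_apply, MultilinearMap.compLinearMap_apply,
    MultilinearMap.mkPiAlgebraFin_apply]
  simp [mul_assoc]

theorem capelli_eq_zero_of_mem_span {S : Set A}
    (h : ∀ a b c : Fin N → A, (∀ t, a t ∈ S) → (∀ t, b t ∈ S) → (∀ t, c t ∈ S) → capelli a b c = 0)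
    {a b c : Fin N → A} (ha : ∀ t, a t ∈ Submodule.span R S) (hb : ∀ t, b t ∈ Submodule.span R S)
    (hc : ∀ t, c t ∈ Submodule.span R S) : capelli a b c = 0 := by
  rw [capelli_eq_left R]
  refine MultilinearMap.eq_zero_of_mem_span _ (fun a ha => ?_) ha
  rw [← capelli_eq_left, capelli_eq_right R]
  refine MultilinearMap.eq_zero_of_mem_span _ (fun c hc => ?_) hc
  rw [← capelli_eq_right, ← capelliAlternating_apply R]
  refine MultilinearMap.eq_zero_of_mem_span (capelliAlternating R a c).toMultilinearMap
    (fun b hb => ?_) hb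
  exact (capelliAlternating_apply R a b c).trans (h a b c ha hb hc)

end Capelli

/-- The Capelli polynomial in more than `l ^ 2` variables vanishes on matrices of size `l`. -/
theorem capelli_matrix_eq_zero {C : Type*} [CommRing C] {l N : ℕ} (h : l * l < N)
    (a b c : Fin N → Matrix (Fin l) (Fin l) C) : capelli a b c = 0 := by
  rw [← capelliAlternating_apply C]
  suffices hs : capelliAlternating C a c = 0 by rw [hs]; rfl
  refine Module.Basis.ext_alternating (Matrix.stdBasis C (Fin l) (Fin l)) fun v hv => ?_
  have := Fintype.card_le_of_injective v hv
  simp at this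
  omega

theorem prod_single_apply {I R : Type*} [Fintype I] [DecidableEq I] [CommRing R] (o : I)
    (l : List R) : (l.map fun r => Matrix.single o o r).prod o o = l.prod := by
  induction l with
  | nil => simp
  | cons r l ih =>
    rw [List.map_cons, List.prod_cons, List.prod_cons, Matrix.mul_apply, sum_eq_single o, ih]
    · simp
    · intro j _ hj
      rw [Matrix.single_apply, if_neg fun h => hj h.2.symm, zero_mul]
    · simp

/-- On suitable multiples of matrix units, only the trivial permutation contributes to the Capelli
polynomial. -/
theorem capelli_single {I R : Type*} [Fintype I] [DecidableEq I] [CommRing R] (o : I) {N : ℕ}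
    (e : Fin N → I × I) (he : Function.Injective e) (a b c : Fin N → R) :
    capelli (fun t => Matrix.single o (e t).1 (a t)) (fun t => Matrix.single (e t).1 (e t).2 (b t))
      (fun t => Matrix.single (e t).2 o (c t)) o o = ∏ t, a t * b t * c t := by
  rw [capelli, Matrix.sum_apply, sum_eq_single 1]
  · rw [Equiv.Perm.sign_one, one_smul]
    have h := prod_single_apply o (List.ofFn fun t => a t * b t * c t)
    rw [List.prod_ofFn, List.map_ofFn] at h
    rw [← h]
    have h' : (fun t => Matrix.single o (e t).1 (a t) * Matrix.single (e ((1 : Equiv.Perm (Fin N)) t)).1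
        (e ((1 : Equiv.Perm (Fin N)) t)).2 (b ((1 : Equiv.Perm (Fin N)) t)) * Matrix.single (e t).2 o (c t)) =
        (fun r => Matrix.single o o r) ∘ fun t => a t * b t * c t := by
      funext t
      simp [Matrix.single_mul_single_same]
    rw [h']
  · intro σ _ hσ
    obtain ⟨t, ht⟩ : ∃ t, σ t ≠ t := by
      by_contra! hall
      exact hσ (Equiv.ext hall)
    rw [List.prod_eq_zero, smul_zero, Matrix.zero_apply]
    rw [List.mem_ofFn']
    refine ⟨t, ?_⟩
    beta_reduce
    by_cases h1 : (e t).1 = (e (σ t)).1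
    · have h2 : (e (σ t)).2 ≠ (e t).2 := fun h2 => ht (he (Prod.ext h1.symm h2))
      rw [mul_assoc, Matrix.single_mul_single_of_ne _ _ _ _ h2, mul_zero]
    · rw [Matrix.single_mul_single_of_ne _ _ _ _ h1, zero_mul]
  · simp

section Generate

variable {D I R : Type*} [Ring D] [Fintype I] [DecidableEq I] [CommRing R] [IsDomain R]

/-- If the image of `D` in a matrix ring over a domain spans nonzero multiples of all matrix units,
then `D` does not embed into matrices of a smaller size over a commutative ring. -/
theorem card_le_of_matrix_embedding [Nonempty I] (ρ : D →+* Matrix I I R)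
    (hs : ∀ p q, ∃ c ≠ 0, Matrix.single p q c ∈ Submodule.span R (Set.range ρ))
    {l : ℕ} {C : Type*} [CommRing C] (f : D →+* Matrix (Fin l) (Fin l) C)
    (hf : Function.Injective f) : Fintype.card I ≤ l := by
  by_contra! hl
  choose c hc hcs using hs
  obtain ⟨o⟩ := ‹Nonempty I›
  let e := (Fintype.equivFin (I × I)).symm
  have hN : l * l < Fintype.card (I × I) := by
    rw [Fintype.card_prod]
    exact Nat.mul_lt_mul'' hl hl
  have h1 : ∀ a b c : Fin (Fintype.card (I × I)) → D, capelli a b c = 0 := by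
    intro a b c
    apply hf
    rw [map_capelli, capelli_matrix_eq_zero hN, map_zero]
  have h2 : ∀ a b c : Fin (Fintype.card (I × I)) → Matrix I I R, (∀ t, a t ∈ Set.range ρ) →
      (∀ t, b t ∈ Set.range ρ) → (∀ t, c t ∈ Set.range ρ) → capelli a b c = 0 := by
    intro a b c ha hb hc
    choose a' ha' using ha
    choose b' hb' using hb
    choose c' hc' using hc
    rw [← funext ha', ← funext hb', ← funext hc']
    exact (map_capelli ρ a' b' c').symm.trans (by rw [h1, map_zero])
  have h3 := capelli_single o e e.injective (fun t => c o (e t).1) (fun t => c (e t).1 (e t).2)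
    (fun t => c (e t).2 o)
  rw [capelli_eq_zero_of_mem_span R h2 (fun t => hcs _ _) (fun t => hcs _ _) (fun t => hcs _ _),
    Matrix.zero_apply] at h3
  exact prod_ne_zero_iff.2 (fun t _ => mul_ne_zero (mul_ne_zero (hc _ _) (hc _ _)) (hc _ _)) h3.symm

/-- A ring whose image in a matrix ring over a domain spans nonzero multiples of all matrix units
is prime. -/
theorem eq_zero_or_eq_zero_of_matrix_embedding (ρ : D →+* Matrix I I R) (hρ : Function.Injective ρ)
    (hs : ∀ p q, ∃ c ≠ 0, Matrix.single p q c ∈ Submodule.span R (Set.range ρ))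
    (a b : D) (h : ∀ r, a * r * b = 0) : a = 0 ∨ b = 0 := by
  by_contra! hab
  have h1 : ∀ M ∈ Submodule.span R (Set.range ρ), ρ a * M * ρ b = 0 := by
    intro M hM
    induction hM using Submodule.span_induction with
    | mem x hx =>
      obtain ⟨r, rfl⟩ := hx
      rw [← map_mul, ← map_mul, h, map_zero]
    | zero => simp
    | add x y _ _ hx hy => rw [mul_add, add_mul, hx, hy, add_zero]
    | smul r x _ hx => rw [mul_smul_comm, smul_mul_assoc, hx, smul_zero]
  have h2 : ∀ x : D, x ≠ 0 → ∃ i j, ρ x i j ≠ 0 := by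
    intro x hx
    by_contra! h0
    exact hx (hρ (by rw [map_zero]; exact Matrix.ext h0))
  obtain ⟨i, p, hip⟩ := h2 a hab.1
  obtain ⟨q, j, hqj⟩ := h2 b hab.2
  obtain ⟨c, hc, hcs⟩ := hs p q
  have h3 := congrFun (congrFun (h1 _ hcs) i) j
  rw [Matrix.mul_apply, sum_eq_single q, Matrix.mul_single_apply_same, Matrix.zero_apply] at h3
  · exact mul_ne_zero (mul_ne_zero hip hc) hqj h3
  · intro r _ hr
    rw [Matrix.mul_single_apply_of_ne (hbj := hr), zero_mul]
  · simp

end Generate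

open Finset
open scoped LaurentPolynomial TensorProduct

namespace DData

noncomputable section

variable {k : Type u} [Field k] (P : DData k) [hP : P.IsAdmissible]

/-! ### The normal form of the elements of the algebra -/

/-- The elements `y_n` and `u_n`, which form a basis of `D` over the commutative algebras that `x`
generates from the left and `h` from the right. -/
def basisElt : P.Idx → P.D
  | (true, n) => listMon P.canon.y (P.coord n)
  | (false, n) => P.canon.u n

/-- The coefficients of the matrices of `y_n` and `u_n`. -/
def basisCoeff : P.Idx → P.Idx → k[T;T⁻¹]
  | (true, n) => P.yMonCoeff n
  | (false, n) => P.uCoeff n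

theorem m_ne_zero : (P.m : k) ≠ 0 := by
  intro h
  have := P.prod_e_mul_inv
  rw [h, inv_zero, mul_zero] at this
  exact zero_ne_one this

omit hP in
theorem arc_ne_zero (i : Fin P.θ) (a : ZMod (P.e i)) (n : ℕ) {t : ℤ} (ht : t ≠ 0) :
    arc (P.γi i) a n (LaurentPolynomial.T t : k[T;T⁻¹]) ≠ 0 :=
  prod_ne_zero_iff.2 fun _ _ => one_sub_mul_T_ne_zero _ ht

theorem T_ne_zero (n : ℤ) : (LaurentPolynomial.T n : k[T;T⁻¹]) ≠ 0 :=
  (LaurentPolynomial.isUnit_T n).ne_zero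

theorem uuCoeff_ne_zero (j l : ZMod P.m) : P.uuCoeff j l ≠ 0 := by
  rw [uuCoeff, Ne, smul_eq_zero, not_or]
  exact ⟨mul_ne_zero (inv_ne_zero P.m_ne_zero) (P.scal_ne_zero l), mul_ne_zero (T_ne_zero _)
    (prod_ne_zero_iff.2 fun i _ => P.arc_ne_zero i _ _ (P.z_exp_ne_zero i))⟩

theorem uCoeff_ne_zero (l : ZMod P.m) (p : P.Idx) : P.uCoeff l p ≠ 0 := by
  rcases p with ⟨_ | _, n⟩
  · exact P.uuCoeff_ne_zero l n
  · refine prod_ne_zero_iff.2 fun i _ => ?_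
    rw [uLoc, Ne, smul_eq_zero, not_or, z, LaurentPolynomial.invert_T]
    exact ⟨pow_ne_zero _ (inv_ne_zero (P.xi_ne_zero i)), mul_ne_zero (pow_ne_zero _ (T_ne_zero _))
      (P.arc_ne_zero i _ _ (neg_ne_zero.2 (P.z_exp_ne_zero i)))⟩

theorem basisCoeff_ne_zero (q p : P.Idx) : P.basisCoeff q p ≠ 0 := by
  rcases q with ⟨_ | _, n⟩
  · exact P.uCoeff_ne_zero n p
  · exact P.yMonCoeff_ne_zero n p

theorem matHom_basisElt (q : P.Idx) : P.matHom (P.basisElt q) =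
    wshift (fun p : P.Idx => (p.1 == q.1, p.2 + q.2)) (P.basisCoeff q) := by
  rcases q with ⟨_ | _, n⟩
  · rw [basisElt, matHom, Model.lift_u]
    exact wshift_congr (fun p => by simp) fun _ => rfl
  · rw [basisElt, matHom, Model.lift_listMon]
    refine (P.listMon_matY n).trans (wshift_congr (fun p => by simp) fun _ => rfl)

theorem matHom_X (f : k[T;T⁻¹]) : P.matHom (P.canon.X f) = wshift id fun p : P.Idx => tw p.1 f := by
  rw [matHom, Model.lift_X]
  exact P.laurentEval_matX f

theorem matHom_hp (b : ZMod P.m) : P.matHom (P.canon.hp b) =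
    wshift id fun p : P.Idx => algebraMap k _ (P.chi (-(p.2 * b))) := by
  rw [matHom, Model.lift_hp, Model.hp]
  change P.matH ^ b.val = _
  rw [matH, wshift_pow]
  refine wshift_congr (fun p => by simp) fun p => ?_
  simp only [Function.iterate_id, id, prod_const, card_range, ← map_pow]
  rw [← chi_natCast_mul, ZMod.natCast_zmod_val, mul_neg, mul_comm]

theorem matHom_term (f : k[T;T⁻¹]) (q : P.Idx) (b : ZMod P.m) :
    P.matHom (P.canon.X f * P.basisElt q * P.canon.hp b) =
      wshift (fun p : P.Idx => (p.1 == q.1, p.2 + q.2)) fun p =>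
        P.basisCoeff q p * tw (p.1 == q.1) (P.chi (-(p.2 * b)) • f) := by
  rw [map_mul, map_mul, matHom_X, matHom_hp, matHom_basisElt, wshift_mul, wshift_mul]
  refine wshift_congr (fun _ => rfl) fun p => ?_
  rw [map_smul, Algebra.smul_def]
  simp only [id]
  ring

/-- The element of `D` with given coefficients. -/
def normalForm (F : P.Idx → ZMod P.m → k[T;T⁻¹]) : P.D :=
  ∑ q, ∑ b, P.canon.X (F q b) * P.basisElt q * P.canon.hp b

theorem matHom_normalForm_apply (F : P.Idx → ZMod P.m → k[T;T⁻¹]) (q p : P.Idx) :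
    P.matHom (P.normalForm F) (p.1 == q.1, p.2 + q.2) p =
      P.basisCoeff q p * tw (p.1 == q.1) (∑ b, P.chi (-(p.2 * b)) • F q b) := by
  rw [normalForm, map_sum, Matrix.sum_apply, sum_eq_single q]
  · rw [map_sum, Matrix.sum_apply, map_sum, mul_sum]
    refine sum_congr rfl fun b _ => ?_
    rw [matHom_term, wshift_apply, if_pos rfl]
  · intro q' _ hq'
    rw [map_sum, Matrix.sum_apply]
    refine sum_eq_zero fun b _ => ?_
    rw [matHom_term, wshift_apply, if_neg]
    intro h
    rw [Prod.mk.injEq] at h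
    apply hq'
    refine Prod.ext ?_ (add_left_cancel h.2).symm
    revert h
    rcases p.1 <;> rcases q.1 <;> rcases q'.1 <;> simp
  · simp

theorem eq_zero_of_sum_chi_smul {V : Type*} [AddCommGroup V] [Module k V] {v : ZMod P.m → V}
    (h : ∀ j, ∑ b, P.chi (-(j * b)) • v b = 0) : v = 0 := by
  funext c
  have h1 : ∑ j, P.chi (j * c) • ∑ b, P.chi (-(j * b)) • v b = (P.m : k) • v c := by
    simp_rw [smul_sum, smul_smul]
    rw [sum_comm, sum_eq_single c]
    · simp [← chi_add, P.chi_zero, ← Nat.cast_smul_eq_nsmul k]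
    · intro b _ hb
      rw [← sum_smul]
      have h2 : ∀ j, P.chi (j * c) * P.chi (-(j * b)) = P.chi (j * (c - b)) := fun j => by
        rw [← chi_add]
        congr 1
        ring
      rw [sum_congr rfl fun j _ => h2 j]
      have h3 := sum_rootPow_mul hP.gamma (c - b)
      rw [if_neg (sub_ne_zero.2 hb.symm)] at h3
      exact (congrArg (· • v b) h3).trans (zero_smul _ _)
    · simp
  simp only [h, smul_zero, sum_const_zero] at h1
  exact (smul_eq_zero.1 h1.symm).resolve_left P.m_ne_zero

theorem eq_zero_of_matHom_normalForm {F : P.Idx → ZMod P.m → k[T;T⁻¹]}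
    (h : P.matHom (P.normalForm F) = 0) : F = 0 := by
  funext q
  refine P.eq_zero_of_sum_chi_smul fun j => ?_
  have h1 := P.matHom_normalForm_apply F q (true, j)
  rw [h, Matrix.zero_apply] at h1
  have h2 := (mul_eq_zero.1 h1.symm).resolve_left (P.basisCoeff_ne_zero _ _)
  exact (map_eq_zero_iff _ (AlgEquiv.injective _)).1 h2

theorem normalForm_add (F G : P.Idx → ZMod P.m → k[T;T⁻¹]) :
    P.normalForm (F + G) = P.normalForm F + P.normalForm G := by
  simp only [normalForm, ← sum_add_distrib, Pi.add_apply, map_add, add_mul]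

theorem normalForm_smul (c : k) (F : P.Idx → ZMod P.m → k[T;T⁻¹]) :
    P.normalForm (c • F) = c • P.normalForm F := by
  simp only [normalForm, smul_sum, Pi.smul_apply, map_smul, smul_mul_assoc]

theorem normalForm_single (q : P.Idx) (b : ZMod P.m) (f : k[T;T⁻¹]) :
    P.normalForm (Pi.single q (Pi.single b f)) = P.canon.X f * P.basisElt q * P.canon.hp b := by
  rw [normalForm, sum_eq_single q, sum_eq_single b]
  · simp
  · intro b' _ hb
    simp [hb]
  · simp
  · intro q' _ hq
    simp [hq]
  · simp

theorem u_mul_listMon (l : ZMod P.m) (a : Fin P.θ → ℕ) :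
    ∃ f l', P.canon.u l * listMon P.canon.y a = P.canon.X f * P.canon.u l' := by
  let S : Submonoid P.D :=
    { carrier := {w | ∀ l, ∃ f l', P.canon.u l * w = P.canon.X f * P.canon.u l'}
      one_mem' := fun l => ⟨1, l, by simp⟩
      mul_mem' := by
        intro w w' hw hw' l
        obtain ⟨f, l', h⟩ := hw l
        obtain ⟨f', l'', h'⟩ := hw' l'
        exact ⟨f * f', l'', by rw [← mul_assoc, h, mul_assoc, h', map_mul, mul_assoc]⟩ }
  suffices h : listMon P.canon.y a ∈ S from h l
  refine Submonoid.list_prod_mem _ fun w hw => ?_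
  rw [List.mem_ofFn'] at hw
  obtain ⟨i, rfl⟩ := hw
  refine S.pow_mem (fun l => ?_) _
  refine ⟨(P.ξ i)⁻¹ • (LaurentPolynomial.invert (P.z i) * P.phiL i l), l + P.M i, ?_⟩
  rw [u_mul_y, map_smul, map_mul, smul_mul_assoc, mul_assoc]

theorem listMon_single (i : Fin P.θ) (n : ℕ) :
    listMon P.canon.y (Pi.single i n) = P.canon.y i ^ n := by
  obtain ⟨Y, hY⟩ := exists_mvPolynomial_hom (k := k) P.canon.y P.canon.y_y
  rw [← funext hY, ← map_listMon, listMon_eq_prod, prod_eq_single i]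
  · simp
  · intro l _ hl
    simp [Pi.single_eq_of_ne hl]
  · simp

theorem coord_add_single (n : ZMod P.m) (i : Fin P.θ) : P.coord n + Pi.single i 1 =
    P.coord (n + P.M i) + Pi.single i (if P.coord n i + 1 = P.e i then P.e i else 0) := by
  funext l
  rcases eq_or_ne l i with rfl | h
  · simp only [Pi.add_apply, Pi.single_eq_same, coord_add_M_self]
    split_ifs with h
    · rw [h, zero_add]
    · rfl
  · simp [Pi.single_eq_of_ne h, P.coord_add_M_ne h]

theorem y_mul_basisElt (i : Fin P.θ) (q : P.Idx) :
    ∃ f q', P.canon.y i * P.basisElt q = P.canon.X f * P.basisElt q' := by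
  rcases q with ⟨_ | _, n⟩
  · exact ⟨P.phiL i n, (false, n + P.M i), P.canon.y_u i n⟩
  · have h1 := mul_listMon k P.canon.y_y i (P.coord n)
    rw [coord_add_single, add_comm, listMon_add k P.canon.y_y, listMon_single] at h1
    split_ifs at h1
    · rw [P.canon.y_pow] at h1
      exact ⟨_, (true, n + P.M i), h1⟩
    · exact ⟨1, (true, n + P.M i), by rw [map_one, basisElt, h1, pow_zero]; rfl⟩

theorem u_mul_basisElt (l : ZMod P.m) (q : P.Idx) :
    ∃ f q' b, P.canon.u l * P.basisElt q = P.canon.X f * P.basisElt q' * P.canon.hp b := by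
  rcases q with ⟨_ | _, n⟩
  · refine ⟨P.uuCoeff l n, (true, l + n), 1, ?_⟩
    rw [Model.hp_one]
    exact P.canon.u_u l n
  · obtain ⟨f, l', h⟩ := P.u_mul_listMon l (P.coord n)
    refine ⟨f, (false, l'), 0, ?_⟩
    rw [Model.hp_zero, mul_one]
    exact h

theorem h_mul_basisElt (q : P.Idx) :
    ∃ c : k, P.canon.h * P.basisElt q = c • (P.basisElt q * P.canon.h) := by
  rw [← Model.hp_one]
  rcases q with ⟨_ | _, n⟩
  · refine ⟨(P.chi n)⁻¹, ?_⟩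
    rw [Model.hp_one, basisElt, P.canon.u_h, smul_smul, inv_mul_cancel₀ (P.chi_ne_zero n), one_smul]
  · refine ⟨(P.chi (n * 1))⁻¹, ?_⟩
    rw [basisElt, Model.yMon_mul_hp, smul_smul, inv_mul_cancel₀ (P.chi_ne_zero _), one_smul]

/-- Every element has a normal form: the elements with a normal form contain `1`, and they are stable
under left multiplication by the generators. -/
theorem normalForm_surjective : Function.Surjective P.normalForm := by
  let V : Submodule k P.D :=
    Submodule.span k {a | ∃ f q b, a = P.canon.X f * P.basisElt q * P.canon.hp b}
  have hV : ∀ f q b, P.canon.X f * P.basisElt q * P.canon.hp b ∈ V := fun f q b =>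
    Submodule.subset_span ⟨f, q, b, rfl⟩
  have hgen : ∀ c : P.D, (∀ f q b, c * (P.canon.X f * P.basisElt q * P.canon.hp b) ∈ V) →
      ∀ v ∈ V, c * v ∈ V := by
    intro c hc v hv
    induction hv using Submodule.span_induction with
    | mem x hx =>
      obtain ⟨f, q, b, rfl⟩ := hx
      exact hc f q b
    | zero => rw [mul_zero]; exact V.zero_mem
    | add x y _ _ hx hy => rw [mul_add]; exact V.add_mem hx hy
    | smul r x _ hx => rw [mul_smul_comm]; exact V.smul_mem r hx
  let B : Subalgebra k P.D :=
    { carrier := {a | ∀ v ∈ V, a * v ∈ V}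
      mul_mem' := fun {a b} ha hb v hv => by rw [mul_assoc]; exact ha _ (hb v hv)
      add_mem' := fun {a b} ha hb v hv => by rw [add_mul]; exact V.add_mem (ha v hv) (hb v hv)
      algebraMap_mem' := fun r v hv => by
        rw [← Algebra.smul_def]
        exact V.smul_mem r hv }
  have hB : ∀ a, a ∈ B := by
    refine P.subalgebra_eq_top B (fun n => hgen _ fun f q b => ?_) (hgen _ fun f q b => ?_)
      (fun i => hgen _ fun f q b => ?_) fun l => hgen _ fun f q b => ?_
    · rw [← mul_assoc, ← mul_assoc, ← map_mul]
      exact hV _ _ _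
    · obtain ⟨c, hc⟩ := P.h_mul_basisElt q
      rw [← mul_assoc, ← mul_assoc, ← (P.canon.X_mul_h f).eq, mul_assoc (P.canon.X f), hc,
        mul_smul_comm, smul_mul_assoc, ← mul_assoc, mul_assoc, ← Model.hp_one, ← Model.hp_add]
      exact V.smul_mem c (hV _ _ _)
    · obtain ⟨f', q', h⟩ := P.y_mul_basisElt i q
      rw [← mul_assoc, ← mul_assoc, ← (P.canon.X_mul_y f i).eq, mul_assoc (P.canon.X f), h,
        ← mul_assoc, ← map_mul]
      exact hV _ _ _
    · obtain ⟨f', q', b', h⟩ := P.u_mul_basisElt l q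
      rw [← mul_assoc, ← mul_assoc, Model.u_mul_X, mul_assoc _ (P.canon.u l), h,
        ← mul_assoc, ← mul_assoc, ← map_mul, mul_assoc, ← Model.hp_add]
      exact hV _ _ _
  intro a
  have h1 : (1 : P.D) ∈ V := by
    have := hV 1 (true, 0) 0
    rwa [map_one, basisElt, listMon_coord_zero, Model.hp_zero, mul_one, mul_one] at this
  have h2 : a ∈ V := by simpa using hB a 1 h1
  induction h2 using Submodule.span_induction with
  | mem x hx =>
    obtain ⟨f, q, b, rfl⟩ := hx
    exact ⟨_, P.normalForm_single q b f⟩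
  | zero => exact ⟨0, by simp [normalForm]⟩
  | add x y _ _ hx hy =>
    obtain ⟨F, rfl⟩ := hx
    obtain ⟨G, rfl⟩ := hy
    exact ⟨F + G, P.normalForm_add F G⟩
  | smul r x _ hx =>
    obtain ⟨F, rfl⟩ := hx
    exact ⟨r • F, P.normalForm_smul r F⟩

theorem matHom_injective : Function.Injective P.matHom := by
  refine (injective_iff_map_eq_zero _).2 fun a ha => ?_
  obtain ⟨F, rfl⟩ := P.normalForm_surjective a
  rw [P.eq_zero_of_matHom_normalForm ha]
  simp [normalForm]

theorem normalForm_eq_zero_iff {F : P.Idx → ZMod P.m → k[T;T⁻¹]} : P.normalForm F = 0 ↔ F = 0 :=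
  ⟨fun h => P.eq_zero_of_matHom_normalForm (by rw [h, map_zero]), fun h => by simp [h, normalForm]⟩

/-! ### Matrix units, primeness and the PI-degree -/

theorem wshift_eq_single {I R : Type*} [Fintype I] [DecidableEq I] [CommRing R] (σ : I → I)
    {c : I → R} {p : I} (h : ∀ i, i ≠ p → c i = 0) : wshift σ c = Matrix.single (σ p) p (c p) := by
  refine Matrix.ext fun a b => ?_
  rw [wshift_apply, Matrix.single_apply]
  rcases eq_or_ne b p with rfl | hb
  · simp [eq_comm]
  · rw [h b hb, if_neg (fun h' : σ p = a ∧ p = b => hb h'.2.symm), ite_self]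

theorem wshift_sub_smul {I R : Type*} [Fintype I] [DecidableEq I] [CommRing R] (σ : I → I)
    (c d : I → R) (t : R) : wshift σ c - t • wshift σ d = wshift σ fun i => c i - t * d i := by
  refine Matrix.ext fun a b => ?_
  rw [Matrix.sub_apply, Matrix.smul_apply, wshift_apply, wshift_apply, wshift_apply]
  split_ifs <;> simp

theorem wshift_sum {I R ι : Type*} [Fintype I] [DecidableEq I] [CommRing R] (σ : I → I)
    (s : Finset ι) (c : ι → I → R) :
    ∑ b ∈ s, wshift σ (c b) = wshift σ fun i => ∑ b ∈ s, c b i := by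
  refine Matrix.ext fun a b => ?_
  rw [Matrix.sum_apply]
  simp only [wshift_apply]
  split_ifs <;> simp

theorem T_one_ne_T_neg_one : (LaurentPolynomial.T 1 : k[T;T⁻¹]) ≠ LaurentPolynomial.T (-1) := by
  intro h
  have h1 := one_sub_mul_T_ne_zero (1 : k) (n := 2) (by norm_num)
  apply h1
  have h2 := congrArg (LaurentPolynomial.T 1 * ·) h
  simp only [← LaurentPolynomial.T_add] at h2
  rw [map_one, one_mul, sub_eq_zero]
  simpa using h2.symm

theorem tw_T_one_ne (b : Bool) : tw b (LaurentPolynomial.T 1 : k[T;T⁻¹]) ≠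
    tw (!b) (LaurentPolynomial.T 1) := by
  cases b
  · simpa [tw_true, tw_false] using T_one_ne_T_neg_one.symm
  · simpa [tw_true, tw_false] using T_one_ne_T_neg_one

/-- The image of `D` spans nonzero multiples of all matrix units over the Laurent polynomials. The
idempotents of the group algebra of `h` separate the residues, and since `x` acts by `T` on the
`y_j` and by `T⁻¹` on the `u_j`, multiplication by `x` separates these two kinds of basis vectors. -/
theorem exists_single_mem_span (q p : P.Idx) : ∃ c ≠ 0, Matrix.single q p c ∈
    Submodule.span k[T;T⁻¹] (Set.range (P.matHom : P.D →+* Matrix P.Idx P.Idx k[T;T⁻¹])) := by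
  -- `r` is the index of the basis element that maps the basis vector `p` to a multiple of `q`, and
  -- `E` projects, up to the factor `m`, onto the two basis vectors with residue `p.2`.
  let r : P.Idx := (p.1 == q.1, q.2 - p.2)
  let E : P.D := ∑ b, P.chi (p.2 * b) • P.canon.hp b
  let t : k[T;T⁻¹] := tw (!p.1) (LaurentPolynomial.T 1)
  have hE : P.matHom E = wshift id fun p' : P.Idx => if p'.2 = p.2 then (P.m : k[T;T⁻¹]) else 0 := by
    simp only [E, map_sum, map_smul, matHom_hp, smul_wshift]
    rw [wshift_sum]
    refine wshift_congr (fun _ => rfl) fun p' => ?_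
    have h1 : ∀ b, P.chi (p.2 * b) • algebraMap k k[T;T⁻¹] (P.chi (-(p'.2 * b))) =
        algebraMap k k[T;T⁻¹] (rootPow P.γ (b * (p.2 - p'.2))) := by
      intro b
      rw [Algebra.smul_def, ← map_mul, ← chi_add, ← chi]
      congr 2
      ring
    rw [sum_congr rfl fun b _ => h1 b, ← map_sum, sum_rootPow_mul hP.gamma]
    simp only [sub_eq_zero, eq_comm (a := p'.2)]
    split_ifs <;> simp
  have hx := P.matHom_X (LaurentPolynomial.T 1)
  have hr : ((p.1 == r.1, p.2 + r.2) : P.Idx) = q := by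
    refine Prod.ext ?_ (add_sub_cancel _ _)
    change (p.1 == (p.1 == q.1)) = q.1
    rcases p.1 <;> rcases q.1 <;> rfl
  have hM : P.matHom (P.basisElt r * E * P.canon.X (LaurentPolynomial.T 1)) -
      t • P.matHom (P.basisElt r * E) = Matrix.single q p ((P.m : k[T;T⁻¹]) * P.basisCoeff r p *
        (tw p.1 (LaurentPolynomial.T 1) - t)) := by
    rw [map_mul, map_mul, hx, hE, matHom_basisElt, wshift_mul, wshift_mul, Function.comp_id,
      Function.comp_id, wshift_sub_smul, wshift_eq_single (p := p), hr]
    · congr 1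
      simp only [id, if_true]
      ring
    · intro i hi
      simp only [id]
      split_ifs with h
      · have h2 : i.1 = !p.1 := by
          have h3 : i.1 ≠ p.1 := fun h3 => hi (Prod.ext h3 h)
          revert h3
          rcases i.1 <;> rcases p.1 <;> simp
        rw [h2]
        ring
      · ring
  have hmem : ∀ a, P.matHom a ∈ Submodule.span k[T;T⁻¹]
      (Set.range (P.matHom : P.D →+* Matrix P.Idx P.Idx k[T;T⁻¹])) := fun a =>
    Submodule.subset_span ⟨a, rfl⟩
  refine ⟨_, ?_, hM ▸ Submodule.sub_mem _ (hmem _) (Submodule.smul_mem _ _ (hmem _))⟩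
  refine mul_ne_zero (mul_ne_zero ?_ (P.basisCoeff_ne_zero _ _)) (sub_ne_zero.2 ?_)
  · rw [← map_natCast (algebraMap k k[T;T⁻¹])]
    exact (map_ne_zero_iff _ (FaithfulSMul.algebraMap_injective k k[T;T⁻¹])).2 P.m_ne_zero
  · exact tw_T_one_ne p.1

theorem isPrimeRing : IsPrimeRing P.D :=
  ⟨(P.matHom : P.D →+* Matrix P.Idx P.Idx k[T;T⁻¹]).domain_nontrivial,
    eq_zero_or_eq_zero_of_matrix_embedding _ P.matHom_injective P.exists_single_mem_span⟩

theorem card_idx : Fintype.card P.Idx = 2 * P.m := by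
  rw [Fintype.card_prod, Fintype.card_bool, ZMod.card]

theorem isPIDegree : IsPIDegree P.D (2 * P.m) := by
  constructor
  · let e : P.Idx ≃ Fin (2 * P.m) := Fintype.equivFinOfCardEq P.card_idx
    refine ⟨k[T;T⁻¹], inferInstance, ((Matrix.reindexAlgEquiv k k[T;T⁻¹] e).toAlgHom.comp
      P.matHom : P.D →+* _), ?_⟩
    exact (Matrix.reindexAlgEquiv k k[T;T⁻¹] e).injective.comp P.matHom_injective
  · rintro l ⟨C, _, f, hf⟩
    rw [← card_idx]
    exact card_le_of_matrix_embedding _ P.exists_single_mem_span f hf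

end

end DData

open Finset
open scoped LaurentPolynomial TensorProduct

namespace DData

noncomputable section

variable {k : Type u} [Field k] (P : DData k) [hP : P.IsAdmissible]

/-! ### The one-dimensional representation of order `2m` -/

instance instHopfAlgebraD : HopfAlgebra k P.D := P.hopfStructure.toHopfAlgebra

theorem comul_apply (a : P.D) : Coalgebra.comul (R := k) a = P.comulHom a := rfl

section Winding

variable (ζ : k) (hζ : ζ ^ (2 * P.m) = 1)

theorem winding_X_T (n : ℤ) : leftWinding (P.charModel ζ hζ).lift (P.canon.X (LaurentPolynomial.T n)) =
    P.canon.X (LaurentPolynomial.T n) := by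
  change Algebra.TensorProduct.lid k P.D (Algebra.TensorProduct.map _ (AlgHom.id k P.D)
    (P.comulHom _)) = _
  rw [comulHom_X_T, Algebra.TensorProduct.map_tmul, Algebra.TensorProduct.lid_tmul, charModel_X_T,
    one_smul]
  rfl

theorem winding_h : leftWinding (P.charModel ζ hζ).lift P.canon.h = ζ ^ 2 • P.canon.h := by
  change Algebra.TensorProduct.lid k P.D (Algebra.TensorProduct.map _ (AlgHom.id k P.D)
    (P.comulHom _)) = _
  rw [comulHom_h, Algebra.TensorProduct.map_tmul, Algebra.TensorProduct.lid_tmul, charModel_h]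
  rfl

theorem winding_y (i : Fin P.θ) :
    leftWinding (P.charModel ζ hζ).lift (P.canon.y i) = P.canon.y i := by
  change Algebra.TensorProduct.lid k P.D (Algebra.TensorProduct.map _ (AlgHom.id k P.D)
    (P.comulHom _)) = _
  rw [comulHom_y, map_add, map_add, Algebra.TensorProduct.map_tmul, Algebra.TensorProduct.map_tmul,
    Algebra.TensorProduct.lid_tmul, Algebra.TensorProduct.lid_tmul, charModel_y, zero_smul, zero_add,
    map_one, one_smul]
  rfl

theorem winding_u (j : ZMod P.m) :
    leftWinding (P.charModel ζ hζ).lift (P.canon.u j) = ζ • P.canon.u j := by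
  change Algebra.TensorProduct.lid k P.D (Algebra.TensorProduct.map _ (AlgHom.id k P.D)
    (P.comulHom _)) = _
  rw [comulHom_u, map_sum, map_sum, sum_eq_single 0]
  · rw [map_smul, map_smul, Algebra.TensorProduct.map_tmul, Algebra.TensorProduct.lid_tmul,
      charModel_u, if_pos rfl, zero_mul, P.chi_zero, one_smul, Model.hp_zero, one_mul, sub_zero]
    rfl
  · intro l _ hl
    rw [map_smul, map_smul, Algebra.TensorProduct.map_tmul, Algebra.TensorProduct.lid_tmul,
      charModel_u, if_neg hl, zero_smul, smul_zero]
  · simp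

theorem winding_mul (ζ' : k) (hζ' : ζ' ^ (2 * P.m) = 1) :
    (leftWinding (P.charModel ζ hζ).lift).comp (leftWinding (P.charModel ζ' hζ').lift) =
      leftWinding (P.charModel (ζ * ζ') (by rw [mul_pow, hζ, hζ', one_mul])).lift := by
  refine algHom_ext ?_ ?_ (fun i => ?_) fun j => ?_
  · rw [AlgHom.comp_apply, winding_X_T, winding_X_T, winding_X_T]
  · rw [AlgHom.comp_apply, winding_h, map_smul, winding_h, winding_h, smul_smul, mul_pow,
      mul_comm]
  · rw [AlgHom.comp_apply, winding_y, winding_y, winding_y]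
  · rw [AlgHom.comp_apply, winding_u, map_smul, winding_u, winding_u, smul_smul, mul_comm]

theorem winding_one (h : (1 : k) ^ (2 * P.m) = 1) :
    leftWinding (P.charModel 1 h).lift = AlgHom.id k P.D := by
  refine algHom_ext ?_ ?_ (fun i => ?_) fun j => ?_
  · rw [winding_X_T]; rfl
  · rw [winding_h, one_pow, one_smul]; rfl
  · rw [winding_y]; rfl
  · rw [winding_u, one_smul]; rfl

end Winding

/-- The automorphism `x ↦ x`, `h ↦ ζ ^ 2 h`, `y_i ↦ y_i`, `u_j ↦ ζ u_j`. -/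
def windingEquiv (ζ : rootsOfUnity (2 * P.m) k) : P.D ≃ₐ[k] P.D :=
  have h : ∀ ζ : rootsOfUnity (2 * P.m) k, ((ζ : kˣ) : k) ^ (2 * P.m) = 1 := fun ζ => by
    rw [← Units.val_pow_eq_pow_val, (mem_rootsOfUnity _ _).1 ζ.2, Units.val_one]
  have h1 : ∀ ζ : rootsOfUnity (2 * P.m) k, (leftWinding (P.charModel _ (h ζ)).lift).comp
      (leftWinding (P.charModel _ (h ζ⁻¹)).lift) = AlgHom.id k P.D := fun ζ => by
    rw [winding_mul]
    convert P.winding_one (one_pow _) using 3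
    simp
  AlgEquiv.ofAlgHom (leftWinding (P.charModel _ (h ζ)).lift)
    (leftWinding (P.charModel _ (h ζ⁻¹)).lift) (h1 ζ) (by simpa using h1 ζ⁻¹)

theorem windingEquiv_pow (ζ : rootsOfUnity (2 * P.m) k) (n : ℕ) :
    P.windingEquiv ζ ^ n = P.windingEquiv (ζ ^ n) := by
  have h1 : ∀ ζ ζ', P.windingEquiv ζ * P.windingEquiv ζ' = P.windingEquiv (ζ * ζ') := fun ζ ζ' => by
    refine AlgEquiv.ext fun a => ?_
    exact DFunLike.congr_fun (P.winding_mul _ _ _ _) a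
  induction n with
  | zero =>
    rw [pow_zero, pow_zero]
    refine AlgEquiv.ext fun a => ?_
    exact (DFunLike.congr_fun (P.winding_one (one_pow _)) a).symm
  | succ n ih => rw [pow_succ, ih, h1, pow_succ]

theorem windingEquiv_u (ζ : rootsOfUnity (2 * P.m) k) (j : ZMod P.m) :
    P.windingEquiv ζ (P.canon.u j) = ((ζ : kˣ) : k) • P.canon.u j := P.winding_u _ _ j

theorem canon_u_ne_zero (j : ZMod P.m) : P.canon.u j ≠ 0 := by
  intro h
  have h1 := P.normalForm_single (false, j) 0 1
  rw [map_one, basisElt, h, mul_zero, zero_mul, normalForm_eq_zero_iff] at h1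
  have h2 := congrFun (congrFun h1 (false, j)) 0
  simp at h2

/-- For a primitive `2m`-th root of unity `ζ`, the representation `u_0 ↦ ζ` has order `2m`, because its
winding automorphism multiplies the `u_j` by `ζ`. -/
theorem exists_hasRepOrder [IsAlgClosed k] [CharZero k] :
    ∃ π : P.D →ₐ[k] k, HasRepOrder π (2 * P.m) := by
  have : NeZero (2 * P.m) := ⟨mul_ne_zero two_ne_zero hP.m_pos.ne'⟩
  obtain ⟨ζ, hζ⟩ := HasEnoughRootsOfUnity.exists_primitiveRoot k (2 * P.m)
  let z := hζ.toRootsOfUnity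
  refine ⟨(P.charModel ζ hζ.pow_eq_one).lift, Nat.pos_of_ne_zero (NeZero.ne _), P.windingEquiv z, ?_, ?_⟩
  · exact AlgHom.ext fun a => rfl
  · rw [Nat.card_zpowers, hζ.eq_orderOf]
    refine orderOf_eq_orderOf_iff.2 fun n => ?_
    rw [windingEquiv_pow]
    constructor
    · intro h
      have h1 := P.windingEquiv_u (z ^ n) 0
      rw [h, AlgEquiv.one_apply] at h1
      have h2 : (1 - ζ ^ n) • P.canon.u 0 = 0 := by
        refine (sub_smul (1 : k) (ζ ^ n) (P.canon.u 0)).trans (sub_eq_zero.2 ?_)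
        rw [one_smul]
        simpa [z] using h1
      exact (sub_eq_zero.1 ((smul_eq_zero.1 h2).resolve_right (P.canon_u_ne_zero 0))).symm
    · intro h
      have h1 : z ^ n = 1 := by
        ext
        simpa [z] using h
      rw [h1, ← pow_zero z, ← windingEquiv_pow, pow_zero]

end

end DData

open Finset
open scoped LaurentPolynomial TensorProduct

/-! ### Subcoalgebras -/

section Subcoalgebra

variable {k H : Type u} [Field k] [Ring H] [HopfAlgebra k H]

/-- The map `a ↦ ∑ f(a₂) a₁`. -/
noncomputable def actRight (f : H →ₗ[k] k) : H →ₗ[k] H :=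
  (TensorProduct.rid k H).toLinearMap ∘ₗ f.lTensor H ∘ₗ Coalgebra.comul

/-- The map `a ↦ ∑ f(a₁) a₂`. -/
noncomputable def actLeft (f : H →ₗ[k] k) : H →ₗ[k] H :=
  (TensorProduct.lid k H).toLinearMap ∘ₗ f.rTensor H ∘ₗ Coalgebra.comul

theorem IsSubcoalgebra.comul_mem {C : Submodule k H} (hC : IsSubcoalgebra C) {a : H} (ha : a ∈ C) :
    ∃ t : C ⊗[k] C, TensorProduct.map C.subtype C.subtype t = Coalgebra.comul (R := k) a :=
  hC ⟨a, ha, rfl⟩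

theorem IsSubcoalgebra.actRight_mem {C : Submodule k H} (hC : IsSubcoalgebra C) (f : H →ₗ[k] k)
    {a : H} (ha : a ∈ C) : actRight f a ∈ C := by
  obtain ⟨t, ht⟩ := hC.comul_mem ha
  rw [actRight, LinearMap.comp_apply, LinearMap.comp_apply, ← ht]
  clear ht
  induction t using TensorProduct.induction_on with
  | zero => simp
  | add x y hx hy => rw [map_add, map_add, map_add]; exact C.add_mem hx hy
  | tmul x y => exact C.smul_mem (f y) x.2

theorem IsSubcoalgebra.actLeft_mem {C : Submodule k H} (hC : IsSubcoalgebra C) (f : H →ₗ[k] k)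
    {a : H} (ha : a ∈ C) : actLeft f a ∈ C := by
  obtain ⟨t, ht⟩ := hC.comul_mem ha
  rw [actLeft, LinearMap.comp_apply, LinearMap.comp_apply, ← ht]
  clear ht
  induction t using TensorProduct.induction_on with
  | zero => simp
  | add x y hx hy => rw [map_add, map_add, map_add]; exact C.add_mem hx hy
  | tmul x y => exact C.smul_mem (f x) y.2

/-- `actRight f` is the identity on a subcoalgebra on which `f` is the counit. -/
theorem IsSubcoalgebra.actRight_eq_self {C : Submodule k H} (hC : IsSubcoalgebra C) {f : H →ₗ[k] k}
    (hf : ∀ c ∈ C, f c = Coalgebra.counit (R := k) c) {a : H} (ha : a ∈ C) : actRight f a = a := by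
  obtain ⟨t, ht⟩ := hC.comul_mem ha
  have h1 := congrArg (TensorProduct.rid k H) (Coalgebra.lTensor_counit_comul (R := k) a)
  rw [TensorProduct.rid_tmul, one_smul] at h1
  refine Eq.trans ?_ h1
  rw [actRight, LinearMap.comp_apply, LinearMap.comp_apply, ← ht]
  clear h1 ht
  induction t using TensorProduct.induction_on with
  | zero => simp
  | add x y hx hy => rw [map_add, map_add, map_add, hx, hy, map_add, map_add]
  | tmul x y =>
    have := hf y y.2
    simp [this]

/-- The intersection of two subcoalgebras is a subcoalgebra: there is a projection onto `F` that
maps `C` to `C ⊓ F`. -/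
theorem IsSubcoalgebra.inf {C F : Submodule k H} (hC : IsSubcoalgebra C) (hF : IsSubcoalgebra F) :
    IsSubcoalgebra (C ⊓ F) := by
  -- The kernel of the projection onto `F` is chosen to contain a complement of `C ⊓ F` in `C`.
  obtain ⟨C', hC'⟩ := Submodule.exists_isCompl ((C ⊓ F).comap C.subtype)
  have hd : Disjoint F (C'.map C.subtype) := by
    rw [Submodule.disjoint_def]
    rintro x hxF ⟨c, hc, rfl⟩
    have : c ∈ (C ⊓ F).comap C.subtype ⊓ C' := ⟨⟨c.2, hxF⟩, hc⟩
    rw [hC'.inf_eq_bot] at this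
    rw [(Submodule.mem_bot k).1 this, map_zero]
  obtain ⟨Q, hQ, hFQ⟩ := hd.symm.exists_isCompl
  have hFQ := hFQ.symm
  have h1 : ∀ x ∈ F, F.projection Q hFQ x = x := fun x hx =>
    Submodule.projection_apply_of_mem_left hFQ hx
  have h2 : ∀ c : C, F.projection Q hFQ c ∈ C ⊓ F := by
    intro c
    obtain ⟨i, hi, c', hc', rfl⟩ := Submodule.mem_sup.1 (hC'.sup_eq_top ▸ Submodule.mem_top (x := c))
    rw [Submodule.coe_add, map_add, h1 (i : H) hi.2,
      (Submodule.projection_apply_eq_zero_iff hFQ (x := (c' : H))).2 (hQ ⟨c', hc', rfl⟩), add_zero]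
    exact hi
  rintro _ ⟨a, ha, rfl⟩
  obtain ⟨s, hs⟩ := hC.comul_mem ha.1
  obtain ⟨r, hr⟩ := hF.comul_mem ha.2
  let π : C →ₗ[k] (C ⊓ F : Submodule k H) := ((F.projection Q hFQ).comp C.subtype).codRestrict _ h2
  have h3 : TensorProduct.map (F.projection Q hFQ) (F.projection Q hFQ)
      (Coalgebra.comul (R := k) a) = Coalgebra.comul (R := k) a := by
    have h4 : (F.projection Q hFQ).comp F.subtype = F.subtype :=
      LinearMap.ext fun x => h1 x x.2
    rw [← hr, ← LinearMap.comp_apply, ← TensorProduct.map_comp, h4]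
  refine ⟨TensorProduct.map π π s, ?_⟩
  rw [← h3, ← hs, ← LinearMap.comp_apply, ← LinearMap.comp_apply, ← TensorProduct.map_comp,
    ← TensorProduct.map_comp]
  rfl

variable {ι : Type*} [Fintype ι] [DecidableEq ι]

/-- Matrix units of a coalgebra, if they are linearly independent, span a simple subcoalgebra:
contracting a nonzero element of a subcoalgebra on both sides with the dual basis produces each
matrix unit. -/
theorem isSimpleSubcoalgebra_span [Nonempty ι] {e : ι → ι → H}
    (hli : LinearIndependent k fun p : ι × ι => e p.1 p.2)
    (he : ∀ a b, Coalgebra.comul (R := k) (e a b) = ∑ c, e a c ⊗ₜ[k] e c b) :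
    IsSimpleSubcoalgebra (Submodule.span k (Set.range fun p : ι × ι => e p.1 p.2)) := by
  set C := Submodule.span k (Set.range fun p : ι × ι => e p.1 p.2) with hCdef
  have heC : ∀ a b, e a b ∈ C := fun a b => Submodule.subset_span ⟨(a, b), rfl⟩
  refine ⟨?_, ?_, fun C' hC' hsub => ?_⟩
  · rintro _ ⟨x, hx, rfl⟩
    induction hx using Submodule.span_induction with
    | mem x hx =>
      obtain ⟨p, rfl⟩ := hx
      refine ⟨∑ c, (⟨e p.1 c, heC _ _⟩ : C) ⊗ₜ[k] (⟨e c p.2, heC _ _⟩ : C), ?_⟩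
      rw [map_sum, he]
      rfl
    | zero => rw [map_zero]; exact Submodule.zero_mem _
    | add x y _ _ hx hy => rw [map_add]; exact Submodule.add_mem _ hx hy
    | smul r x _ hx => rw [map_smul]; exact Submodule.smul_mem _ r hx
  · intro h
    obtain ⟨a⟩ := ‹Nonempty ι›
    have := heC a a
    rw [h, Submodule.mem_bot] at this
    exact hli.ne_zero (a, a) this
  · by_cases h0 : C' = ⊥
    · exact Or.inl h0
    right
    obtain ⟨x, hx, hx0⟩ := Submodule.exists_mem_ne_zero_of_ne_bot h0
    obtain ⟨w, hw⟩ := (Submodule.mem_span_range_iff_exists_fun k).1 (hC' hx)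
    obtain ⟨p, hp⟩ : ∃ p, w p ≠ 0 := by
      by_contra! hall
      apply hx0
      rw [← hw]
      simp [hall]
    obtain ⟨dual, hdual⟩ : ∃ D : ι × ι → (H →ₗ[k] k),
        ∀ p a b, D p (e a b) = if (a, b) = p then 1 else 0 := by
      obtain ⟨L, hL⟩ := LinearMap.exists_leftInverse_of_injective
        (Finsupp.linearCombination k (fun p : ι × ι => e p.1 p.2)) (LinearMap.ker_eq_bot.2 hli)
      refine ⟨fun p => (Finsupp.lapply p) ∘ₗ L, fun p a b => ?_⟩
      have := LinearMap.congr_fun hL (Finsupp.single (a, b) 1)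
      rw [LinearMap.comp_apply, Finsupp.linearCombination_single, one_smul] at this
      rw [LinearMap.comp_apply, this, LinearMap.id_apply, Finsupp.lapply_apply,
        Finsupp.single_apply]
    refine le_antisymm hC' (Submodule.span_le.2 ?_)
    rintro _ ⟨⟨c, d⟩, rfl⟩
    have h1 : ∀ (f : H →ₗ[k] k) a b, actLeft f (e a b) = ∑ c, f (e a c) • e c b := fun f a b => by
      simp [actLeft, he]
    have h2 : ∀ (f : H →ₗ[k] k) a b, actRight f (e a b) = ∑ c, f (e c b) • e a c := fun f a b => by
      simp [actRight, he]
    have h3 : actLeft (dual (p.1, c)) x = ∑ b, w (p.1, b) • e c b := by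
      rw [← hw, map_sum, Fintype.sum_prod_type, sum_eq_single p.1]
      · refine sum_congr rfl fun b _ => ?_
        rw [map_smul, h1, sum_eq_single c]
        · rw [hdual, if_pos rfl, one_smul]
        · intro c' _ hc'
          rw [hdual, if_neg fun h => hc' (Prod.ext_iff.1 h).2, zero_smul]
        · simp
      · intro a _ ha
        refine sum_eq_zero fun b _ => ?_
        rw [map_smul, h1, sum_eq_zero, smul_zero]
        intro c' _
        rw [hdual, if_neg fun h => ha (Prod.ext_iff.1 h).1, zero_smul]
      · simp
    have h4 : actRight (dual (d, p.2)) (actLeft (dual (p.1, c)) x) = w p • e c d := by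
      rw [h3, map_sum, sum_eq_single p.2]
      · rw [map_smul, h2, sum_eq_single d]
        · rw [hdual, if_pos rfl, one_smul]
        · intro c' _ hc'
          rw [hdual, if_neg fun h => hc' (Prod.ext_iff.1 h).1, zero_smul]
        · simp
      · intro b _ hb
        rw [map_smul, h2, sum_eq_zero, smul_zero]
        intro c' _
        rw [hdual, if_neg fun h => hb (Prod.ext_iff.1 h).2, zero_smul]
      · simp
    have h5 := hsub.actRight_mem (dual (d, p.2)) (hsub.actLeft_mem (dual (p.1, c)) hx)
    rw [h4] at h5
    exact (C'.smul_mem_iff hp).1 h5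

end Subcoalgebra

open Finset
open scoped LaurentPolynomial TensorProduct

theorem mem_maxGenEigenspace_zero {k V : Type*} [Field k] [AddCommGroup V] [Module k V]
    (f : Module.End k V) (a : V) : a ∈ f.maxGenEigenspace 0 ↔ ∃ N : ℕ, (f ^ N) a = 0 := by
  simp [Module.End.mem_maxGenEigenspace]

namespace DData

noncomputable section

variable {k : Type u} [Field k] (P : DData k) [hP : P.IsAdmissible]

/-! ### The coradical -/

/-- The elements `x ^ n y_p h ^ b` and `x ^ n u_j h ^ b`. -/
def mono (n : ℤ) (q : P.Idx) (b : ZMod P.m) : P.D :=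
  P.canon.X (LaurentPolynomial.T n) * P.basisElt q * P.canon.hp b

theorem X_mul_basisElt_mem {V : Submodule k P.D} {q : P.Idx} {b : ZMod P.m}
    (hV : ∀ n, P.mono n q b ∈ V) (f : k[T;T⁻¹]) : P.canon.X f * P.basisElt q * P.canon.hp b ∈ V := by
  induction f using laurent_induction with
  | add f g hf hg => rw [map_add, add_mul, add_mul]; exact V.add_mem hf hg
  | T c n => rw [map_smul, smul_mul_assoc, smul_mul_assoc]; exact V.smul_mem c (hV n)

theorem mem_of_mono_mem {V : Submodule k P.D} (hV : ∀ n q b, P.mono n q b ∈ V) (a : P.D) : a ∈ V := by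
  obtain ⟨F, rfl⟩ := P.normalForm_surjective a
  exact V.sum_mem fun q _ => V.sum_mem fun b _ => P.X_mul_basisElt_mem (fun n => hV n q b) _

theorem hp_mul_basisElt (l : ZMod P.m) (q : P.Idx) :
    ∃ c : k, P.canon.hp l * P.basisElt q = c • (P.basisElt q * P.canon.hp l) := by
  rcases q with ⟨_ | _, n⟩
  · refine ⟨(P.chi (n * l))⁻¹, ?_⟩
    rw [basisElt, Model.u_mul_hp, smul_smul, inv_mul_cancel₀ (P.chi_ne_zero _), one_smul]
  · refine ⟨(P.chi (n * l))⁻¹, ?_⟩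
    rw [basisElt, Model.yMon_mul_hp, smul_smul, inv_mul_cancel₀ (P.chi_ne_zero _), one_smul]

/-- The span of the elements `x ^ n h ^ b` and `x ^ n u_j h ^ b`. It turns out to contain the
coradical. -/
def lowest : Submodule k P.D :=
  Submodule.span k {a | ∃ n q b, (q.1 = true → q.2 = 0) ∧ a = P.mono n q b}

theorem mem_lowest (f : k[T;T⁻¹]) (l : ZMod P.m) {q : P.Idx} (hq : q.1 = true → q.2 = 0)
    (b : ZMod P.m) : P.canon.X f * (P.canon.hp l * P.basisElt q) * P.canon.hp b ∈ P.lowest := by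
  obtain ⟨c, hc⟩ := P.hp_mul_basisElt l q
  rw [hc, mul_smul_comm, smul_mul_assoc, ← mul_assoc, mul_assoc, ← Model.hp_add]
  refine Submodule.smul_mem _ c (P.X_mul_basisElt_mem (fun n => ?_) f)
  exact Submodule.subset_span ⟨n, q, _, hq, rfl⟩

theorem comul_mono_false (n : ℤ) (j b : ZMod P.m) : P.comulHom (P.mono n (false, j) b) =
    ∑ l, P.chi (l * (j - l)) • (P.mono n (false, l) b ⊗ₜ[k]
      (P.canon.X (LaurentPolynomial.T n) * (P.canon.hp l * P.basisElt (false, j - l)) *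
        P.canon.hp b)) := by
  rw [mono, map_mul, map_mul, comulHom_X_T, comulHom_hp, basisElt, comulHom_u, mul_sum, sum_mul]
  refine sum_congr rfl fun l _ => ?_
  rw [mul_smul_comm, smul_mul_assoc, Algebra.TensorProduct.tmul_mul_tmul,
    Algebra.TensorProduct.tmul_mul_tmul]
  rfl

theorem comul_mono_true (n : ℤ) (p b : ZMod P.m) : P.comulHom (P.mono n (true, p) b) =
    ∑ l, (∏ i, gaussBinom (P.γi i)⁻¹ (P.coord p i) (P.coord l i)) • (P.mono n (true, l) b ⊗ₜ[k]
      (P.canon.X (LaurentPolynomial.T n * ∏ i, P.z i ^ P.coord l i) *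
        (P.canon.hp l * P.basisElt (true, p - l)) * P.canon.hp b)) := by
  have h : P.comulHom (P.basisElt (true, p)) = listMon P.comulY (P.coord p) := Model.lift_listMon _ _
  rw [mono, map_mul, map_mul, comulHom_X_T, comulHom_hp, h, listMon_comulY, mul_sum, sum_mul]
  refine sum_congr rfl fun l _ => ?_
  rw [mul_smul_comm, smul_mul_assoc, XX_tmul, yTensor, Algebra.TensorProduct.tmul_mul_tmul,
    Algebra.TensorProduct.tmul_mul_tmul, Algebra.TensorProduct.tmul_mul_tmul, map_one, one_mul,
    ← mul_assoc, ← map_mul]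
  rfl

theorem isSubcoalgebra_lowest : IsSubcoalgebra P.lowest := by
  rintro _ ⟨a, ha, rfl⟩
  have hmem : ∀ {a b : P.D}, a ∈ P.lowest → b ∈ P.lowest → a ⊗ₜ[k] b ∈
      LinearMap.range (TensorProduct.map P.lowest.subtype P.lowest.subtype) := fun {a b} ha hb =>
    ⟨(⟨a, ha⟩ : P.lowest) ⊗ₜ (⟨b, hb⟩ : P.lowest), rfl⟩
  have hmono : ∀ n q b, (q.1 = true → q.2 = 0) → P.mono n q b ∈ P.lowest := fun n q b hq =>
    Submodule.subset_span ⟨n, q, b, hq, rfl⟩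
  induction ha using Submodule.span_induction with
  | mem a ha =>
    obtain ⟨n, ⟨_ | _, j⟩, b, hq, rfl⟩ := ha
    · rw [comul_apply, comul_mono_false]
      exact Submodule.sum_mem _ fun l _ => Submodule.smul_mem _ _
        (hmem (hmono _ _ _ (by simp)) (P.mem_lowest _ _ (by simp) _))
    · obtain rfl : j = 0 := hq rfl
      rw [comul_apply, mono, basisElt, listMon_coord_zero, mul_one, map_mul, comulHom_X_T,
        comulHom_hp, Algebra.TensorProduct.tmul_mul_tmul]
      have h1 : P.canon.X (LaurentPolynomial.T n) * P.canon.hp b ∈ P.lowest := by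
        have := hmono n (true, 0) b fun _ => rfl
        rwa [mono, basisElt, listMon_coord_zero, mul_one] at this
      exact hmem h1 h1
  | zero => rw [map_zero]; exact Submodule.zero_mem _
  | add x y _ _ hx hy => rw [map_add]; exact Submodule.add_mem _ hx hy
  | smul r x _ hx => rw [map_smul]; exact Submodule.smul_mem _ r hx

theorem actRight_apply (f : P.D →ₗ[k] k) (a : P.D) : actRight f a =
    TensorProduct.rid k P.D (f.lTensor P.D (P.comulHom a)) := rfl

/-- A functional that vanishes on `lowest` acts locally nilpotently, since it lowers the degree of
the monomials in the `y_i`. -/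
theorem exists_actRight_pow_eq_zero {f : P.D →ₗ[k] k} (hf : ∀ a ∈ P.lowest, f a = 0) (a : P.D) :
    ∃ N : ℕ, (actRight f ^ N) a = 0 := by
  -- The elements killed by a power of `actRight f` form a subspace.
  let K : Submodule k P.D := Module.End.maxGenEigenspace (actRight f) 0
  have hK : ∀ a, a ∈ K ↔ ∃ N : ℕ, (actRight f ^ N) a = 0 :=
    mem_maxGenEigenspace_zero _
  have hK' : ∀ a, actRight f a ∈ K → a ∈ K := fun a ha => by
    obtain ⟨N, hN⟩ := (hK _).1 ha
    exact (hK _).2 ⟨N + 1, by rw [pow_succ]; exact hN⟩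
  have h1 : ∀ N n p b, ∑ i, P.coord p i < N → P.mono n (true, p) b ∈ K := by
    intro N
    induction N with
    | zero => intro n p b h; omega
    | succ N ih =>
      intro n p b hp
      refine hK' _ ?_
      rw [actRight_apply, comul_mono_true, map_sum, map_sum]
      refine K.sum_mem fun l _ => ?_
      rw [map_smul, map_smul, LinearMap.lTensor_tmul, TensorProduct.rid_tmul]
      by_cases hlp : l = p
      · rw [hf _ (P.mem_lowest _ _ (fun _ => by rw [hlp, sub_self]) _), zero_smul, smul_zero]
        exact K.zero_mem
      by_cases hle : ∀ i, P.coord l i ≤ P.coord p i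
      · refine K.smul_mem _ (K.smul_mem _ (ih _ _ _ ?_))
        have h2 : ∃ i, P.coord l i < P.coord p i := by
          by_contra! h
          exact hlp (P.coord_injective (funext fun i => le_antisymm (hle i) (h i)))
        obtain ⟨i, hi⟩ := h2
        have := sum_lt_sum (fun i _ => hle i) ⟨i, mem_univ i, hi⟩
        omega
      · push Not at hle
        obtain ⟨i, hi⟩ := hle
        rw [prod_eq_zero (mem_univ i) (gaussBinom_eq_zero _ hi), zero_smul]
        exact K.zero_mem
  refine (hK a).1 (P.mem_of_mono_mem (fun n q b => ?_) a)
  rcases q with ⟨_ | _, p⟩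
  · refine hK' _ ?_
    rw [actRight_apply, comul_mono_false, map_sum, map_sum]
    refine K.sum_mem fun l _ => ?_
    rw [map_smul, map_smul, LinearMap.lTensor_tmul, TensorProduct.rid_tmul,
      hf _ (P.mem_lowest _ _ (by simp) _), zero_smul, smul_zero]
    exact K.zero_mem
  · exact h1 _ n p b (Nat.lt_succ_self _)

/-- If a subcoalgebra `C` meets `lowest` trivially, there is a functional that is the counit on `C` and
vanishes on `lowest`. It acts as the identity on `C` and locally nilpotently, so that `C = 0`. -/
theorem subcoalgebra_inf_lowest_ne_bot {C : Submodule k P.D} (hC : IsSubcoalgebra C) (h0 : C ≠ ⊥) :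
    C ⊓ P.lowest ≠ ⊥ := by
  intro hd
  obtain ⟨Q, hQ, hLQ⟩ := (disjoint_iff.2 hd).exists_isCompl
  let f : P.D →ₗ[k] k := Coalgebra.counit ∘ₗ Q.projection P.lowest hLQ
  have hf : ∀ c ∈ C, f c = Coalgebra.counit (R := k) c := fun c hc => by
    rw [LinearMap.comp_apply, Submodule.projection_apply_of_mem_left hLQ (hQ hc)]
  have hf' : ∀ a ∈ P.lowest, f a = 0 := fun a ha => by
    rw [LinearMap.comp_apply, (Submodule.projection_apply_eq_zero_iff hLQ).2 ha, map_zero]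
  refine h0 (eq_bot_iff.2 fun a ha => ?_)
  obtain ⟨N, hN⟩ := P.exists_actRight_pow_eq_zero hf' a
  have h1 : ∀ N : ℕ, (actRight f ^ N) a = a := by
    intro N
    induction N with
    | zero => rfl
    | succ N ih => rw [pow_succ, Module.End.mul_apply, hC.actRight_eq_self hf ha, ih]
  rw [h1] at hN
  exact hN

theorem coradical_le_lowest : coradical k P.D ≤ P.lowest := by
  refine sSup_le fun C hC => ?_
  have h1 := hC.2.2 (C ⊓ P.lowest) inf_le_left (hC.1.inf P.isSubcoalgebra_lowest)
  exact inf_eq_left.1 (h1.resolve_left (P.subcoalgebra_inf_lowest_ne_bot hC.1 hC.2.1))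

/-- The elements `u_(b - a) h ^ a`, which are the matrix units of a simple subcoalgebra. -/
def unit (a b : ZMod P.m) : P.D := P.canon.u (b - a) * P.canon.hp a

theorem comul_unit (a b : ZMod P.m) :
    P.comulHom (P.unit a b) = ∑ c, P.unit a c ⊗ₜ[k] P.unit c b := by
  rw [unit, map_mul, comulHom_u, comulHom_hp, sum_mul,
    ← Equiv.sum_comp (Equiv.addLeft a) fun c => P.unit a c ⊗ₜ[k] P.unit c b]
  refine sum_congr rfl fun l _ => ?_
  rw [Equiv.coe_addLeft, unit, unit, smul_mul_assoc, Algebra.TensorProduct.tmul_mul_tmul,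
    add_sub_cancel_left, sub_add_eq_sub_sub]
  beta_reduce
  rw [add_comm a, Model.hp_add, ← mul_assoc (P.canon.u _),
    P.canon.u_mul_hp _ l, smul_mul_assoc, TensorProduct.tmul_smul, mul_comm l]

theorem unit_eq_normalForm (a b : ZMod P.m) :
    P.unit a b = P.normalForm (Pi.single (false, b - a) (Pi.single a 1)) := by
  rw [normalForm_single, map_one, one_mul]
  rfl

theorem linearIndependent_unit : LinearIndependent k fun p : ZMod P.m × ZMod P.m => P.unit p.1 p.2 := by
  rw [Fintype.linearIndependent_iff]
  intro w hw p
  let N : (P.Idx → ZMod P.m → k[T;T⁻¹]) →ₗ[k] P.D :=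
    { toFun := P.normalForm
      map_add' := P.normalForm_add
      map_smul' := P.normalForm_smul }
  have h1 : N (∑ p : ZMod P.m × ZMod P.m,
      w p • Pi.single (false, p.2 - p.1) (Pi.single p.1 1)) = 0 := by
    rw [map_sum, ← hw]
    refine sum_congr rfl fun p _ => ?_
    rw [map_smul, unit_eq_normalForm]
    rfl
  have h2 := congrFun (congrFun (P.normalForm_eq_zero_iff.1 h1) (false, p.2 - p.1)) p.1
  rw [Finset.sum_apply, Finset.sum_apply, sum_eq_single p] at h2
  · simpa using h2
  · intro p' _ hp'
    rw [Pi.smul_apply, Pi.smul_apply]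
    by_cases ha : p'.1 = p.1
    · have hb : p.2 - p.1 ≠ p'.2 - p'.1 := by
        intro h
        rw [ha] at h
        exact hp' (Prod.ext ha (sub_left_injective h).symm)
      rw [Pi.single_eq_of_ne, Pi.zero_apply, smul_zero]
      exact fun h => hb (Prod.ext_iff.1 h).2
    · by_cases hb : p.2 - p.1 = p'.2 - p'.1
      · rw [hb, Pi.single_eq_same, Pi.single_eq_of_ne (Ne.symm ha), smul_zero]
      · rw [Pi.single_eq_of_ne, Pi.zero_apply, smul_zero]
        exact fun h => hb (Prod.ext_iff.1 h).2
  · simp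

theorem isSimpleSubcoalgebra_unit : IsSimpleSubcoalgebra
    (Submodule.span k (Set.range fun p : ZMod P.m × ZMod P.m => P.unit p.1 p.2)) :=
  isSimpleSubcoalgebra_span P.linearIndependent_unit P.comul_unit

/-- The simple subcoalgebra spanned by the `u_(b - a) h ^ a` has dimension `m ^ 2`. -/
theorem not_isPointed (hm : 1 < P.m) : ¬ IsPointed k P.D := by
  intro h
  have h1 := h _ P.isSimpleSubcoalgebra_unit
  rw [finrank_span_eq_card P.linearIndependent_unit, Fintype.card_prod, ZMod.card] at h1
  have := Nat.eq_one_of_mul_eq_one_right h1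
  omega

theorem u_mem_coradical (j : ZMod P.m) : P.canon.u j ∈ coradical k P.D := by
  have h1 : P.canon.u j = P.unit 0 j := by rw [unit, sub_zero, Model.hp_zero, mul_one]
  rw [h1]
  exact (le_sSup P.isSimpleSubcoalgebra_unit : _ ≤ coradical k P.D) (Submodule.subset_span ⟨(0, j), rfl⟩)

theorem coeff_eq_zero_of_mem_lowest {F : P.Idx → ZMod P.m → k[T;T⁻¹]} (h : P.normalForm F ∈ P.lowest)
    {p : ZMod P.m} (hp : p ≠ 0) : F (true, p) = 0 := by
  have h1 : ∀ a ∈ P.lowest, ∃ G : P.Idx → ZMod P.m → k[T;T⁻¹], P.normalForm G = a ∧ G (true, p) = 0 := by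
    intro a ha
    induction ha using Submodule.span_induction with
    | mem a ha =>
      obtain ⟨n, q, b, hq, rfl⟩ := ha
      refine ⟨_, P.normalForm_single q b _, Pi.single_eq_of_ne ?_ _⟩
      rintro rfl
      exact hp (hq rfl)
    | zero => exact ⟨0, by simp [normalForm], rfl⟩
    | add x y _ _ hx hy =>
      obtain ⟨F, rfl, hF⟩ := hx
      obtain ⟨G, rfl, hG⟩ := hy
      exact ⟨F + G, P.normalForm_add F G, by rw [Pi.add_apply, hF, hG, add_zero]⟩
    | smul r x _ hx =>
      obtain ⟨F, rfl, hF⟩ := hx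
      exact ⟨r • F, P.normalForm_smul r F, by rw [Pi.smul_apply, hF, smul_zero]⟩
  obtain ⟨G, hG, hG0⟩ := h1 _ h
  have h2 : P.normalForm (F + (-1 : k) • G) = 0 := by
    rw [normalForm_add, normalForm_smul, hG]
    refine (congrArg (P.normalForm F + ·) (neg_one_smul k (P.normalForm F))).trans ?_
    exact add_neg_cancel _
  have h3 := congrFun (P.normalForm_eq_zero_iff.1 h2) (true, p)
  rwa [Pi.add_apply, Pi.smul_apply, hG0, smul_zero, add_zero] at h3

/-- The coradical contains `u_0` and `u_(m_i)`, but not their product, which is a nonzero multiple of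
`y_i h`. -/
theorem not_isHopfSubalgebra_coradical (hm : 1 < P.m) : ¬ IsHopfSubalgebra (coradical k P.D) := by
  intro h
  obtain ⟨i, hi⟩ : ∃ i, P.e i ≠ 1 := by
    by_contra! hall
    have h1 : P.m = ∏ i, P.e i := hP.fraction.prod_eq
    rw [prod_congr rfl fun i _ => hall i, prod_const_one] at h1
    omega
  have hM : (P.M i : ZMod P.m) ≠ 0 := by
    intro h0
    have h1 := P.zcoord_M_self i
    rw [h0, P.zcoord_zero] at h1
    have : Fact (1 < P.e i) := ⟨by have := P.e_pos i; omega⟩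
    exact zero_ne_one h1
  have h1 := P.coradical_le_lowest (h.mul_mem _ (P.u_mem_coradical 0) _ (P.u_mem_coradical (P.M i)))
  rw [P.canon.u_u, zero_add, ← Model.hp_one] at h1
  have h2 := P.normalForm_single (true, (P.M i : ZMod P.m)) 1 (P.uuCoeff 0 (P.M i))
  have h3 : P.normalForm _ ∈ P.lowest := h2 ▸ h1
  have h4 := congrFun (P.coeff_eq_zero_of_mem_lowest h3 hM) 1
  rw [Pi.single_eq_same, Pi.single_eq_same] at h4
  exact P.uuCoeff_ne_zero _ _ h4

end

end DData

open CategoryTheory MonoidalCategory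
open scoped TensorProduct

/-! ### Pivotality from an implementation of the squared antipode -/

namespace HRep

noncomputable section

variable {k H : Type u} [Field k] [Ring H] [HopfAlgebra k H]

instance (X : HRep k H) : Module.Finite k X.V := X.finite

/-- The action of `H` on the dual space `V*`: `h` acts as the transpose of `S(h)`. -/
def dualρ (X : HRep k H) : H →ₐ[k] Module.End k (Module.Dual k X.V) :=
  AlgHom.ofLinearMap
    (Module.Dual.transpose (R := k) ∘ₗ X.ρ.toLinearMap ∘ₗ HopfAlgebra.antipode k)
    (by
      refine LinearMap.ext fun f => LinearMap.ext fun v => ?_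
      change f (X.ρ (HopfAlgebra.antipode k (1 : H)) v) = f v
      rw [HopfAlgebra.antipode_one, map_one]; rfl)
    (fun a b => by
      refine LinearMap.ext fun f => LinearMap.ext fun v => ?_
      change f (X.ρ (HopfAlgebra.antipode k (a * b)) v) =
        f (X.ρ (HopfAlgebra.antipode k b) (X.ρ (HopfAlgebra.antipode k a) v))
      rw [HopfAlgebra.antipode_mul_antidistrib, map_mul]; rfl)

/-- The dual representation. -/
def dual (X : HRep k H) : HRep k H where
  V := ModuleCat.of k (Module.Dual k X.V)
  finite := inferInstanceAs (Module.Finite k (Module.Dual k X.V))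
  ρ := X.dualρ

/-- For `z = Δ(a)` this expresses the equivariance of the evaluation by the antipode axiom. -/
theorem contractLeft_act₂ (X : HRep k H) (z : H ⊗[k] H) (f : Module.Dual k X.V) (v : X.V) :
    contractLeft k X.V (act₂ X.dualρ X.ρ z (f ⊗ₜ v)) =
      f (X.ρ (LinearMap.mul' k H ((HopfAlgebra.antipode k).rTensor H z)) v) := by
  induction z using TensorProduct.induction_on with
  | zero => simp
  | add a b ha hb => simp only [map_add, LinearMap.add_apply, ha, hb]
  | tmul a b =>
    rw [LinearMap.rTensor_tmul, LinearMap.mul'_apply, map_mul]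
    rfl

/-- The evaluation `V* ⊗ V ⟶ k`. -/
def ev (X : HRep k H) : X.dual ⊗ X ⟶ 𝟙_ (HRep k H) where
  hom := ModuleCat.ofHom (contractLeft k X.V)
  comm a := TensorProduct.ext' fun (f : Module.Dual k X.V) v => by
    change contractLeft k X.V (act₂ X.dualρ X.ρ (Coalgebra.comul a) (f ⊗ₜ v)) =
      Coalgebra.counit (R := k) a * f v
    rw [contractLeft_act₂, HopfAlgebra.mul_antipode_rTensor_comul_apply, AlgHom.commutes,
      Module.algebraMap_end_apply, map_smul, smul_eq_mul]

/-- The coevaluation corresponds to the identity of `V`. -/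
theorem dualTensorHom_coevaluation (X : HRep k H) :
    dualTensorHom k X.V X.V (TensorProduct.comm k X.V (Module.Dual k X.V)
      (coevaluation k X.V 1)) = LinearMap.id := by
  refine LinearMap.ext fun v => ?_
  rw [coevaluation_apply_one, map_sum, map_sum, LinearMap.sum_apply]
  simpa using (Module.Basis.ofVectorSpace k X.V).sum_repr v

theorem dualTensorHom_act₂ (X : HRep k H) (z : H ⊗[k] H) :
    dualTensorHom k X.V X.V (TensorProduct.comm k X.V (Module.Dual k X.V)
      (act₂ X.ρ X.dualρ z (coevaluation k X.V 1))) =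
      X.ρ (LinearMap.mul' k H ((HopfAlgebra.antipode k).lTensor H z)) := by
  have h2 : ∀ (a b : H) (w : X.V ⊗[k] Module.Dual k X.V),
      dualTensorHom k X.V X.V (TensorProduct.comm k X.V (Module.Dual k X.V)
        (act₂ X.ρ X.dualρ (a ⊗ₜ b) w)) = X.ρ a ∘ₗ dualTensorHom k X.V X.V
          (TensorProduct.comm k X.V (Module.Dual k X.V) w) ∘ₗ X.ρ (HopfAlgebra.antipode k b) := by
    intro a b w
    induction w using TensorProduct.induction_on with
    | zero => simp
    | add v w hv hw => simp only [map_add, LinearMap.add_comp, LinearMap.comp_add, hv, hw]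
    | tmul v f =>
      refine LinearMap.ext fun x => ?_
      change f (X.ρ (HopfAlgebra.antipode k b) x) • X.ρ a v =
        X.ρ a (f (X.ρ (HopfAlgebra.antipode k b) x) • v)
      rw [map_smul]
  induction z using TensorProduct.induction_on with
  | zero => simp
  | add a b ha hb => simp only [map_add, LinearMap.add_apply, ha, hb]
  | tmul a b =>
    rw [LinearMap.lTensor_tmul, LinearMap.mul'_apply, map_mul, h2, dualTensorHom_coevaluation,
      LinearMap.id_comp]
    rfl

/-- The coevaluation `k ⟶ V ⊗ V*`. -/
def coev (X : HRep k H) : 𝟙_ (HRep k H) ⟶ X ⊗ X.dual where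
  hom := ModuleCat.ofHom (coevaluation k X.V)
  comm a := LinearMap.ext_ring <| by
    change coevaluation k X.V (Coalgebra.counit (R := k) a * 1) =
      act₂ X.ρ X.dualρ (Coalgebra.comul a) (coevaluation k X.V 1)
    apply (TensorProduct.comm k X.V (Module.Dual k X.V)).injective
    apply (dualTensorHomEquiv k X.V X.V).injective
    change dualTensorHom k X.V X.V (TensorProduct.comm k X.V (Module.Dual k X.V) _) =
      dualTensorHom k X.V X.V (TensorProduct.comm k X.V (Module.Dual k X.V) _)
    rw [dualTensorHom_act₂, HopfAlgebra.mul_antipode_lTensor_comul_apply, AlgHom.commutes,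
      ← smul_eq_mul, map_smul, map_smul, map_smul, dualTensorHom_coevaluation]
    exact (Algebra.algebraMap_eq_smul_one _).symm

instance exactPairingDual (X : HRep k H) : ExactPairing X X.dual where
  coevaluation' := X.coev
  evaluation' := X.ev
  coevaluation_evaluation' := Hom.ext <| ModuleCat.hom_ext <|
    contractLeft_assoc_coevaluation k X.V
  evaluation_coevaluation' := Hom.ext <| ModuleCat.hom_ext <|
    contractLeft_assoc_coevaluation' k X.V

instance hasRightDual (X : HRep k H) : HasRightDual X := ⟨X.dual⟩

instance rightRigid : RightRigidCategory (HRep k H) where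

/-- The linear map underlying a morphism of representations. -/
def lin {X Y : HRep k H} (f : X ⟶ Y) : X.V →ₗ[k] Y.V := (Hom.hom f).hom

theorem hom_ext_lin {X Y : HRep k H} {f g : X ⟶ Y} (h : ∀ v, lin f v = lin g v) : f = g :=
  Hom.ext (ModuleCat.hom_ext (LinearMap.ext h))

/-- The bilinear form `Y × X → k` of an exact pairing. -/
def pair {X Y : HRep k H} (p : ExactPairing X Y) : Y.V →ₗ[k] X.V →ₗ[k] k :=
  TensorProduct.curry (lin (ε_ X Y) : Y.V ⊗[k] X.V →ₗ[k] k)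

/-- A pure tensor in the tensor product of two representations. -/
def tm {X Y : HRep k H} (x : X.V) (y : Y.V) : (X ⊗ Y).V := (x ⊗ₜ[k] y : X.V ⊗[k] Y.V)

theorem hom_ext_tm {X Y Z : HRep k H} {f g : X ⊗ Y ⟶ Z}
    (h : ∀ x y, lin f (tm x y) = lin g (tm x y)) : f = g :=
  Hom.ext (ModuleCat.hom_ext (TensorProduct.ext' (M := X.V) (N := Y.V) h))

theorem induction_tm {X Y : HRep k H} {p : (X ⊗ Y).V → Prop} (z : (X ⊗ Y).V)
    (hz : p 0) (ha : ∀ a b, p a → p b → p (a + b)) (ht : ∀ x y, p (tm x y)) : p z :=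
  TensorProduct.induction_on (motive := p) z hz ht ha

/-- The mate of `f` is its adjoint with respect to the pairings. -/
theorem pair_mate {X Y X' Y' : HRep k H} (p : ExactPairing X X') (q : ExactPairing Y Y')
    (f : X ⟶ Y) (η : Y'.V) (x : X.V) :
    pair p (lin (@rightAdjointMate _ _ _ X Y ⟨X'⟩ ⟨Y'⟩ f) η) x = pair q η (lin f x) := by
  have h := @rightAdjointMate_comp_evaluation _ _ _ X Y ⟨X'⟩ ⟨Y'⟩ f
  exact LinearMap.congr_fun (congrArg lin h) (η ⊗ₜ[k] x)

/-- The pairing of `Y* ⊗ X*` with `X ⊗ Y` is the product of the pairings. -/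
theorem pair_tensor {X Y X' Y' : HRep k H} (p : ExactPairing X X') (q : ExactPairing Y Y')
    (η : Y'.V) (ξ : X'.V) (x : X.V) (y : Y.V) :
    pair (@ExactPairing.tensor _ _ _ X Y X' Y' p q) (tm η ξ) (tm x y) =
      pair p ξ x * pair q η y := by
  have h : ε_ (X ⊗ Y) (Y' ⊗ X') = (α_ _ _ _).hom ≫
      Y' ◁ ((α_ _ _ _).inv ≫ ε_ X X' ▷ Y ≫ (λ_ _).hom) ≫ ε_ Y Y' := by
    rw [ExactPairing.tensor_evaluation]
    monoidal
  refine (LinearMap.congr_fun (congrArg lin h) (tm (tm η ξ) (tm x y))).trans ?_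
  change pair q η (pair p ξ x • y) = _
  rw [map_smul, smul_eq_mul]

end

end HRep

/-- A grouplike element `ω` of a Hopf algebra, with inverse `ω⁻¹`, such that
`S²(a) = ω a ω⁻¹` for all `a`. -/
structure PivotalElement (k H : Type u) [Field k] [Ring H] [HopfAlgebra k H] where
  val : H
  inv : H
  val_mul_inv : val * inv = 1
  inv_mul_val : inv * val = 1
  comul_val : Coalgebra.comul (R := k) val = val ⊗ₜ[k] val
  antipode_antipode : ∀ a : H,
    HopfAlgebra.antipode k (HopfAlgebra.antipode k a) = val * a * inv

namespace PivotalElement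

noncomputable section

open HRep

variable {k H : Type u} [Field k] [Ring H] [HopfAlgebra k H] (ω : PivotalElement k H)

/-- The action of a pivotal element on a representation. -/
def actEquiv (X : HRep k H) : X.V ≃ₗ[k] X.V :=
  LinearEquiv.ofLinearMap (X.ρ ω.val) (X.ρ ω.inv)
    (by change X.ρ ω.val * X.ρ ω.inv = 1; rw [← map_mul, ω.val_mul_inv, map_one])
    (by change X.ρ ω.inv * X.ρ ω.val = 1; rw [← map_mul, ω.inv_mul_val, map_one])

/-- The isomorphism `V ≅ V**`, `v ↦ (f ↦ f(ωv))`. -/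
def toDoubleDual (X : HRep k H) : X ≅ X.dual.dual :=
  mkIso (X := X) (Y := X.dual.dual)
    ((ω.actEquiv X).trans (Module.evalEquiv k X.V)).toModuleIso fun a =>
      LinearMap.ext fun v => LinearMap.ext fun (f : Module.Dual k X.V) => by
    change f (X.ρ ω.val (X.ρ a v)) =
      f (X.ρ (HopfAlgebra.antipode k (HopfAlgebra.antipode k a)) (X.ρ ω.val v))
    rw [ω.antipode_antipode, ← Module.End.mul_apply, ← Module.End.mul_apply, ← map_mul, ← map_mul,
      mul_assoc _ ω.inv, ω.inv_mul_val, mul_one]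

/-- Right duals are also left duals, by way of the isomorphism with the double dual. -/
@[reducible]
def rigid : RigidCategory (HRep k H) where
  leftDual X :=
    { leftDual := X.dual
      exact := exactPairingCongrRight (ω.toDoubleDual X) }

theorem toDoubleDual_naturality {X Y : HRep k H} (f : X ⟶ Y) :
    f ≫ (ω.toDoubleDual Y).hom =
      (ω.toDoubleDual X).hom ≫ rightAdjointMate (rightAdjointMate f) := by
  refine hom_ext_lin fun x => LinearMap.ext fun (η : Module.Dual k Y.V) => ?_
  refine .trans ?_ (pair_mate Y.dual.exactPairingDual X.dual.exactPairingDual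
    (rightAdjointMate f) (lin (ω.toDoubleDual X).hom x) η).symm
  refine .trans ?_ (pair_mate X.exactPairingDual Y.exactPairingDual f η (X.ρ ω.val x)).symm
  exact congrArg η (LinearMap.congr_fun (f.comm ω.val) x).symm

theorem pair_tensor_toDoubleDual {X Y : HRep k H} (x : X.V) (y : Y.V) (z : (Y.dual ⊗ X.dual).V) :
    pair (@ExactPairing.tensor _ _ _ Y.dual X.dual Y.dual.dual X.dual.dual _ _)
      (tm (lin (ω.toDoubleDual X).hom x) (lin (ω.toDoubleDual Y).hom y)) z =
    pair (@ExactPairing.tensor _ _ _ X Y X.dual Y.dual _ _) z (tm (X.ρ ω.val x) (Y.ρ ω.val y)) := by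
  induction z using induction_tm with
  | hz => rw [map_zero, map_zero, LinearMap.zero_apply]
  | ha a b ha hb => rw [map_add, map_add, LinearMap.add_apply, ha, hb]
  | ht η ξ =>
    rw [pair_tensor, pair_tensor]
    exact mul_comm _ _

theorem toDoubleDual_tensor (X Y : HRep k H) :
    (ω.toDoubleDual (X ⊗ Y)).hom =
      ((ω.toDoubleDual X).hom ⊗ₘ (ω.toDoubleDual Y).hom) ≫ doubleDualTensor X Y := by
  refine hom_ext_tm fun x y => LinearMap.ext fun (ζ : Module.Dual k (X ⊗ Y).V) => ?_
  have h1 : (X ⊗ Y).ρ ω.val (tm x y) = tm (X.ρ ω.val x) (Y.ρ ω.val y) := by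
    change act₂ X.ρ Y.ρ (Coalgebra.comul ω.val) (x ⊗ₜ[k] y) = _
    rw [ω.comul_val]
    rfl
  refine .trans (congrArg ζ h1) ?_
  -- The right adjoint mates are evaluated from the outside to the inside.
  refine .trans ?_ (pair_mate (X ⊗ Y).dual.exactPairingDual
    (Y.dual ⊗ X.dual).exactPairingDual (rightDualTensorIso X Y).hom _ ζ).symm
  refine .trans ?_ (pair_mate (Y.dual ⊗ X.dual).exactPairingDual ExactPairing.tensor
    (𝟙 _) (tm (lin (ω.toDoubleDual X).hom x) (lin (ω.toDoubleDual Y).hom y)) _).symm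
  refine .trans ?_ (ω.pair_tensor_toDoubleDual x y _).symm
  exact (pair_mate ExactPairing.tensor (X ⊗ Y).exactPairingDual (𝟙 _) ζ _).symm

/-- A Hopf algebra with a grouplike element that implements `S²` is pivotal. -/
theorem isPivotalHopf (ω : PivotalElement k H) : IsPivotalHopf k H :=
  ⟨ω.rigid, ⟨{
    iso := ω.toDoubleDual
    naturality := ω.toDoubleDual_naturality
    tensor := ω.toDoubleDual_tensor }⟩⟩

end

end PivotalElement

namespace DData

noncomputable section

variable {k : Type u} [Field k] (P : DData k) [hP : P.IsAdmissible]

/-- The grouplike element of `D` that implements `S²`. -/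
def pivotalElement : PivotalElement k P.D where
  val := P.omega
  inv := P.omegaInv
  val_mul_inv := P.omega_mul_inv
  inv_mul_val := P.omega_inv_mul
  comul_val := by
    rw [comul_apply, omega, map_mul, comulHom_X_T, comulHom_hp,
      Algebra.TensorProduct.tmul_mul_tmul]
  antipode_antipode := P.anti_anti

end

end DData

theorem proposition4p8 {k : Type u} [Field k] [IsAlgClosed k] [CharZero k] (P : DData k)
    (hm : 0 < P.m) (hd : 0 < P.d) (hM : IsFraction P.m P.M)
    (h₁ : 2 ∣ ∑ i, (P.M i - 1) * (P.e i - 1))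
    (h₂ : 2 ∣ ∑ i, (P.e i - 1) * P.M i * P.d)
    (hγ : IsPrimitiveRoot P.γ P.m)
    (hξ : ∀ i, P.ξ i ^ 2 = P.γ ^ P.M i ∧ IsPrimitiveRoot (P.ξ i) (2 * P.e i)) :
    ∃ s : HopfStructure k P.D, P.IsStandard s ∧
      letI : HopfAlgebra k P.D := s.toHopfAlgebra
      (IsPrimeRing P.D ∧ IsPIDegree P.D (2 * P.m)) ∧
      (∃ π : P.D →ₐ[k] k, HasRepOrder π (2 * P.m)) ∧
      (1 < P.m → ¬ IsPointed k P.D ∧ ¬ IsHopfSubalgebra (coradical k P.D)) ∧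
      IsPivotalHopf k P.D := by
  have : P.IsAdmissible :=
    { m_pos := hm
      d_pos := hd
      fraction := hM
      two_dvd := by rwa [DData.N, Finset.sum_mul]
      gamma := hγ
      xi_sq := fun i => (hξ i).1
      xi := fun i => (hξ i).2 }
  exact ⟨P.hopfStructure, P.isStandard_hopfStructure, ⟨P.isPrimeRing, P.isPIDegree⟩,
    P.exists_hasRepOrder, fun hm' => ⟨P.not_isPointed hm', P.not_isHopfSubalgebra_coradical hm'⟩,
    P.pivotalElement.isPivotalHopf⟩
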